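/- Let $m\ge 1$ be a square-free integer such that $K=\mathbb{Q}(\sqrt{-m})$ has class number $1$, let $\mathcal{O}_K=\mathbb{Z}[\omega]$ with $\omega=\sqrt{-m}$ if $m\equiv 1,2 \pmod 4$ and $\omega=(1+\sqrt{-m})/2$ if $m\equiv 3\pmod 4$, let $\ell\ge 1$ be an integer and let $\mathcal{P}$ be a finite set of primes. *Quadratic spaces.* Put $S=\begin{pmatrix}2&0\\0&2m\end{pmatrix}$ if $m\equiv1,2\pmod 4$ and $S=\begin{pmatrix}2&1\\1&(m+1)/2\end{pmatrix}$ if $m\equiv 3\pmod 4$, let $q$ be the level of $S$, $D_\ell=-\ell q$, $S_0=\begin{pmatrix}&&1\\&-S&\\1&&\end{pmatrix}$, $V_0=\mathbb{Q}^4$, $\phi_0(x,y)=\tfrac12x^tS_0y$, $\Lambda=\mathbb{Z}^4$. The map $(x,y,z,w)\mapsto\begin{pmatrix}x&y+\omega z\\y+\overline{\omega}z&w\end{pmatrix}$ identifies $(V_0,\phi_0)$ with the space of Hermitian $2\times2$ matrices over $K$ with the form $\det$. Let $\xi=(1,0,0,\ell)$, $W=\xi^\perp\subset V_0$, and let $H(\xi)=\mathrm{SO}(W)$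 be the stabiliser of $\xi$ in $\mathrm{SO}(V_0)$. Let $\Lambda[\ell,2^{-1}\mathbb{Z}]=\{x\in V_0:\phi_0(x,x)=\ell,\ \phi_0(x,\Lambda)=2^{-1}\mathbb{Z}\}$, $\widehat\Gamma=\{g\in \mathrm{SO}(V_0): g\Lambda=\Lambda,\ g\in 1+M_4(\mathbb{Z})S_0\}$, and let $\widehat\Gamma^+$ be its intersection with the identity component of $\mathrm{SO}(V_0\otimes\mathbb{R})$. Let $\xi_1,\dots,\xi_{h_1}$ be representatives of $\Lambda[\ell,2^{-1}\mathbb{Z}]/\widehat\Gamma$ in the cone $\{y: y_1>0,\ \phi_0(y,y)>0\}$. *Zeta functions.* Let $n(\xi_i;d)$ be the number of $s\in\mathbb{Z}^2/dS\mathbb{Z}^2$ with $D_\ell\equiv\frac12qS^{-1}[s]\pmod{qd}$ and $\big((\tfrac12qS^{-1}[s]-D_\ell)/(qd),\,S^{-1}s,\,d\big)^t\in\widehat\Gamma^+\xi_i$. Put $\zeta_{\xi_i,\mathcal{P}}(s)=\sum_{(N,\mathcal{P})=1}n(\xi_i;N)N^{-s}$ and $\widehat\zeta_{\xi_i,\mathcal{P}}(s)=\zeta_{K,\mathcal{P}}(s)\,\zeta_{\xi_i,\mathcal{P}}(s)$,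 where $\zeta_{K,\mathcal{P}}$ is the Dedekind zeta function of $K$ without the Euler factors above $\mathcal{P}$. *Clifford groups.* For a quadratic space $V$ let $G^+(V)=\{\alpha\in A^+(V)^\times:\alpha V\alpha^{-1}=V\}$ be its even Clifford group, $\tau(\alpha)x=\alpha x\alpha^{-1}$, $\nu(\alpha)=\alpha\alpha^*$. Put $C_p=\{g\in\mathrm{SO}(V_0)_p:g\Lambda_p=\Lambda_p\}$, $C=\mathrm{SO}(V_0)_\infty\prod_pC_p$, $J_p=\{\gamma\in G^+(V_0)_p:\tau(\gamma)\in C_p,\ \nu(\gamma)\in\mathbb{Z}_p^\times\}$, $J=G^+(V_0)_\infty\prod_pJ_p$, $\mathcal{J}=G^+(W)_{\mathbb{A}}\cap J$, and let $\mathcal{D}=\{x\in H(\xi)_{\mathbb{A}}: x(\Lambda\cap W)=\Lambda\cap W\}$. Let $\mathcal{Y}$ be the set of $y\in G^+(W)_{\mathbb{A}}$ with $y_p\in A^+(\Lambda\cap W)_p$ for $p\notin\mathcal{P}$ and $y_p\in\mathcal{J}_p$ for $p\in\mathcal{P}$. For $a\in G^+(W)_{\mathbb{A}}$ put $$\mathcal{Y}_a=\{y\in\mathcal{Y}:\tau(y)\in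 H(\xi)_{\mathbb{Q}}\,\tau(a)\,(H(\xi)_{\mathbb{A}}\cap C)\},\qquad \mathcal{Y}'_a=\{y\in\mathcal{Y}:\tau(y)\in H(\xi)_{\mathbb{Q}}\,\tau(a)\,\mathcal{D}\}.$$ Let $\zeta_i\in G^+(W)_{\mathbb{A}}$ correspond to $\xi_i$, that is, $\zeta_i\in\alpha_iJ$ for some $\alpha_i\in G^+(V_0)_{\mathbb{Q}}$ with $\xi_i\in\widehat\Gamma\,\tau(\alpha_i)^{-1}\xi$. *Quaternion algebra.* Let $B=K+\epsilon K$ with $\epsilon^2=-\ell$, $\epsilon a=\overline a\epsilon$ for $a\in K$, let $\mathfrak{o}=\mathcal{O}_K+\epsilon\mathcal{O}_K$, $X=B_\infty^\times\prod_p\mathfrak{o}_p^\times$, $N_B(X)=\{\alpha\in B_{\mathbb{A}}^\times:\alpha\mathfrak{o}\alpha^{-1}=\mathfrak{o}\}$. Let $\Xi:G^+(W)\to B^\times$ be the isomorphism which sends the product of two Hermitian matrices $h,k\in W$ to $h\,k^\iota$ ($\iota$ the adjugate), where $B\subset M_2(K)$ via $a\mapsto\mathrm{diag}(a,\overline a)$,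 $\epsilon\mapsto\begin{pmatrix}0&1\\-\ell&0\end{pmatrix}$. Put $u_i=\Xi(\zeta_i)$. Let $\rho: B^\times\backslash B_{\mathbb{A}}^\times/X\to B^\times\backslash B_{\mathbb{A}}^\times/N_B(X)$ be the natural map from the right class set of $\mathfrak{o}$ to its type set (it sends the class of a right ideal to the type of its left order). **Proposition.** Let $\mathrm{Re}(s)>2$. All series below converge absolutely. (i) For every $w$ in the type set of $\mathfrak{o}$ and every $a\in G^+(W)_{\mathbb{A}}$ with $\rho(\Xi(a))=w$, $$\sum_{i:\ \rho(u_i)=w}\widehat\zeta_{\xi_i,\mathcal{P}}(s)=\sum_{y\in\mathcal{Y}'_{a}/\mathcal{J}}N(\nu(y)\mathbb{Z})^{-s},$$ and this equals the adelic partial zeta series $\sum_{y}N(\mathrm{nrd}(y)\mathbb{Z})^{-s}$ of $B$, where $y$ runs over the cosets $yX$ of those $y\in B_{\mathbb{A}}^\times$ with $\rho(y)=w$, $y_p\in\mathfrak{o}_p$ for $p\notin\mathcal{P}$ and $y_p\in\mathfrak{o}_p^\times$ for $p\in\mathcal{P}$. (ii) For every $a\in G^+(W)_{\mathbb{A}}$,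 $$\sum_{i:\ \tau(\zeta_i)\in H(\xi)_{\mathbb{Q}}\tau(a)(H(\xi)_{\mathbb{A}}\cap C)}\widehat\zeta_{\xi_i,\mathcal{P}}(s)=\sum_{y\in\mathcal{Y}_{a}/\mathcal{J}}N(\nu(y)\mathbb{Z})^{-s}.$$ -/

import Mathlib

open scoped RestrictedProduct

noncomputable section

namespace HermZeta

instance instFactPrimes (p : Nat.Primes) : Fact (p : ℕ).Prime := ⟨p.2⟩

/-! ### The imaginary quadratic field `K = ℚ(√-m)` and its base changes

The generator `ω` is `√-m` if `m ≡ 1, 2 (mod 4)` and `(1 + √-m)/2` if `m ≡ 3 (mod 4)`;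
it satisfies `ω² = cA m + cB m · ω`. -/

/-- The constant coefficient in `ω² = cA m + cB m · ω`. -/
def cA (m : ℕ) : ℤ := if m % 4 = 3 then -(((m : ℤ) + 1) / 4) else -(m : ℤ)

/-- The linear coefficient in `ω² = cA m + cB m · ω`. -/
def cB (m : ℕ) : ℤ := if m % 4 = 3 then 1 else 0

/-- `K ⊗ R = R + R ω` for a commutative ring `R`; `star` is the conjugation.
The element `x + y ω` is `⟨x, y⟩`. -/
abbrev KAlg (m : ℕ) (R : Type) [CommRing R] : Type :=
  QuadraticAlgebra R (cA m : R) (cB m : R)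

instance instFactK (m : ℕ) [NeZero m] :
    Fact (∀ r : ℚ, r ^ 2 ≠ ((cA m : ℤ) : ℚ) + ((cB m : ℤ) : ℚ) * r) := ⟨by
  intro r h
  have hm : (0 : ℚ) < m := by exact_mod_cast Nat.pos_of_ne_zero (NeZero.ne m)
  unfold cA cB at h
  split_ifs at h with h3
  · obtain ⟨k, hk⟩ : ∃ k : ℤ, (m : ℤ) + 1 = 4 * k := ⟨((m : ℤ) + 1) / 4, by omega⟩
    have hk' : (m : ℚ) + 1 = 4 * k := by exact_mod_cast hk
    have h4 : ((m : ℤ) + 1) / 4 = k := by omega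
    rw [h4] at h
    push_cast at h
    nlinarith [sq_nonneg (2 * r - 1)]
  · push_cast at h
    nlinarith [sq_nonneg r]⟩

instance instNumberFieldK (m : ℕ) [NeZero m] : NumberField (KAlg m ℚ) where
  to_charZero := inferInstance
  to_finiteDimensional := by
    have h : Module.Finite ℚ (KAlg m ℚ) := inferInstance
    convert h

/-! ### The lattice `(ℤ², S)`, the quadratic space `(V₀, φ₀)`, and `L₀ = ℤ⁴` -/

/-- The matrix `S`. -/
def Smat (m : ℕ) : Matrix (Fin 2) (Fin 2) ℤ :=
  if m % 4 = 3 then !![2, 1; 1, ((m : ℤ) + 1) / 2] else !![2, 0; 0, 2 * (m : ℤ)]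

/-- The matrix `S₀`, with antidiagonal blocks `1, -S, 1`. -/
def S0mat (m : ℕ) : Matrix (Fin 4) (Fin 4) ℤ :=
  !![0, 0, 0, 1;
     0, -Smat m 0 0, -Smat m 0 1, 0;
     0, -Smat m 1 0, -Smat m 1 1, 0;
     1, 0, 0, 0]

/-- `S₀` with coefficients in `R`. -/
def S0R (m : ℕ) (R : Type) [CommRing R] : Matrix (Fin 4) (Fin 4) R :=
  (S0mat m).map (Int.cast : ℤ → R)

/-- The form `φ(x, y) = -xᵗ S y / 2` on `ℚ²`. -/
def phi (m : ℕ) : LinearMap.BilinForm ℚ (Fin 2 → ℚ) :=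
  Matrix.toBilin' ((-1 / 2 : ℚ) • (Smat m).map (Int.cast : ℤ → ℚ))

/-- The form `φ₀(x, y) = xᵗ S₀ y / 2` on `V₀ ⊗ R = R⁴`. -/
def phi0 (m : ℕ) (R : Type) [Field R] : LinearMap.BilinForm R (Fin 4 → R) :=
  Matrix.toBilin' ((1 / 2 : R) • S0R m R)

/-- The quadratic form `φ₀[x] = φ₀(x, x)`. -/
def Q0 (m : ℕ) (R : Type) [Field R] : QuadraticForm R (Fin 4 → R) :=
  LinearMap.BilinMap.toQuadraticMap (phi0 m R)

/-- The level `q` of `ℤ²` with respect to `φ`: the least positive integer such that `q φ[x]` is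
an integer for all `x` in the dual lattice `{x | 2 φ(x, y) ∈ ℤ for all y ∈ ℤ²}`. -/
def level (m : ℕ) : ℕ :=
  sInf {q : ℕ | 0 < q ∧ ∀ x : Fin 2 → ℚ,
    (∀ y : Fin 2 → ℤ, ∃ k : ℤ, 2 * phi m x (fun j => (y j : ℚ)) = k) →
      ∃ k : ℤ, (q : ℚ) * phi m x x = k}

/-- The vector `ξ = (1, 0, 0, ℓ)`, that is, the Hermitian matrix `diag(1, ℓ)`. -/
def xi0 (ℓ : ℕ) (R : Type) [CommRing R] : Fin 4 → R := ![1, 0, 0, (ℓ : R)]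

/-- The three-dimensional space `W = {x | φ₀(x, ξ) = 0}`. -/
def W (m ℓ : ℕ) (R : Type) [Field R] : Submodule R (Fin 4 → R) :=
  LinearMap.ker (phi0 m R (xi0 ℓ R))

/-- The set `L₀[ℓ, 2⁻¹ℤ] = {x ∈ V₀ | φ₀[x] = ℓ, φ₀(x, L₀) = 2⁻¹ℤ}`. -/
def solSet (m ℓ : ℕ) : Set (Fin 4 → ℚ) :=
  {x | phi0 m ℚ x x = ℓ ∧
    Set.range (fun y : Fin 4 → ℤ => phi0 m ℚ x (fun j => (y j : ℚ))) =
      Set.range (fun k : ℤ => (k : ℚ) / 2)}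

/-- `SO(V₀ ⊗ R)`. -/
def SO0 (m : ℕ) (R : Type) [Field R] : Subgroup (Matrix.SpecialLinearGroup (Fin 4) R) where
  carrier := {g | g.1.transpose * S0R m R * g.1 = S0R m R}
  one_mem' := by simp
  mul_mem' := by
    intro a b ha hb
    simp only [Set.mem_ofPred_eq, Matrix.SpecialLinearGroup.coe_mul, Matrix.transpose_mul] at *
    calc b.1.transpose * a.1.transpose * S0R m R * (a.1 * b.1)
        = b.1.transpose * (a.1.transpose * S0R m R * a.1) * b.1 := by
          simp only [Matrix.mul_assoc]
      _ = S0R m R := by rw [ha, hb]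
  inv_mem' := by
    intro a ha
    simp only [Set.mem_ofPred_eq] at *
    have h1 : a.1 * (a⁻¹).1 = 1 := by
      rw [← Matrix.SpecialLinearGroup.coe_mul, mul_inv_cancel, Matrix.SpecialLinearGroup.coe_one]
    have h2 : (a⁻¹).1.transpose * a.1.transpose = 1 := by
      rw [← Matrix.transpose_mul, h1, Matrix.transpose_one]
    calc (a⁻¹).1.transpose * S0R m R * (a⁻¹).1
        = (a⁻¹).1.transpose * (a.1.transpose * S0R m R * a.1) * (a⁻¹).1 := by rw [ha]
      _ = ((a⁻¹).1.transpose * a.1.transpose) * S0R m R * (a.1 * (a⁻¹).1) := by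
          simp only [Matrix.mul_assoc]
      _ = S0R m R := by rw [h1, h2, Matrix.one_mul, Matrix.mul_one]

/-- Membership in the discriminant kernel `Γ̂(L₀)`: `g ∈ SO(V₀)` stabilises `L₀ = ℤ⁴` and lies in
`1 + M₄(ℤ) S₀`. (An element of `SL₄(ℚ)` stabilises `ℤ⁴` iff it has integral entries, which is
implied by the last condition.) -/
def InGammaHat (m : ℕ) (g : Matrix.SpecialLinearGroup (Fin 4) ℚ) : Prop :=
  g ∈ SO0 m ℚ ∧ ∃ N : Matrix (Fin 4) (Fin 4) ℤ,
    g.1 = 1 + (N * S0mat m).map (Int.cast : ℤ → ℚ)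

/-- Membership in `Γ̂⁺(L₀)`: moreover `g` lies in the identity component of `SO(V₀ ⊗ ℝ)`. -/
def InGammaHatPlus (m : ℕ) (g : Matrix.SpecialLinearGroup (Fin 4) ℚ) : Prop :=
  InGammaHat m g ∧
    g.1.map (Rat.cast : ℚ → ℝ) ∈
      connectedComponentIn
        {h : Matrix (Fin 4) (Fin 4) ℝ |
          h.transpose * S0R m ℝ * h = S0R m ℝ ∧ h.det = 1} 1

/-- The family `ξ_1, …, ξ_{h₁}` is a system of representatives of `L₀[ℓ, 2⁻¹ℤ] / Γ̂(L₀)` contained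
in the cone `{y | y₁ > 0, φ₀[y] > 0}`. -/
def IsRepSystem (m ℓ : ℕ) {h₁ : ℕ} (ξ : Fin h₁ → Fin 4 → ℚ) : Prop :=
  (∀ i, ξ i ∈ solSet m ℓ ∧ 0 < ξ i 0 ∧ 0 < phi0 m ℚ (ξ i) (ξ i)) ∧
    ∀ x ∈ solSet m ℓ, ∃! i, ∃ g, InGammaHat m g ∧ x = g.1.mulVec (ξ i)

/-! ### The zeta functions `ζ_{ξ, 𝒫}`, `ζ_{K, 𝒫}` and their product -/

/-- The sublattice `d S ℤ²` of `ℤ²`. -/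
def dSLattice (m d : ℕ) : AddSubgroup (Fin 2 → ℤ) :=
  (((d : ℤ) • Smat m).mulVecLin).range.toAddSubgroup

/-- `S⁻¹ s` -/
def SinvVec (m : ℕ) (s : Fin 2 → ℤ) : Fin 2 → ℚ :=
  (((Smat m).map (Int.cast : ℤ → ℚ))⁻¹).mulVec (fun j => (s j : ℚ))

/-- `S⁻¹[s] = sᵗ S⁻¹ s` -/
def SinvForm (m : ℕ) (s : Fin 2 → ℤ) : ℚ :=
  (fun j => (s j : ℚ)) ⬝ᵥ SinvVec m s

/-- The number `n(ξ; d)` of classes `s ∈ ℤ² / d S ℤ²` such that, with `D = -ℓ q`, the congruence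
`D ≡ ½ q S⁻¹[s] (mod q d)` holds (with quotient `k`) and `(k, S⁻¹ s, d) = γ ξ` for a
`γ ∈ Γ̂⁺(L₀)`. -/
def nRep (m ℓ : ℕ) (ξ : Fin 4 → ℚ) (d : ℕ) : ℕ :=
  Nat.card {c : (Fin 2 → ℤ) ⧸ dSLattice m d //
    ∃ s : Fin 2 → ℤ, (QuotientAddGroup.mk s : (Fin 2 → ℤ) ⧸ dSLattice m d) = c ∧
      ∃ k : ℤ,
        (1 / 2 : ℚ) * level m * SinvForm m s - (-(ℓ : ℚ) * level m) = (level m : ℚ) * d * k ∧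
        ∃ g, InGammaHatPlus m g ∧
          ![(k : ℚ), SinvVec m s 0, SinvVec m s 1, (d : ℚ)] = g.1.mulVec ξ}

open Classical in
/-- The coefficients of `ζ_{ξ, 𝒫}`: those `n(ξ; N)` with `N` prime to `𝒫`. -/
def coeffXi (m ℓ : ℕ) (P : Finset ℕ) (ξ : Fin 4 → ℚ) (N : ℕ) : ℂ :=
  if ∀ p ∈ P, N.Coprime p then (nRep m ℓ ξ N : ℂ) else 0

open Classical in
/-- The coefficients of `ζ_{K, 𝒫}`, the Dedekind zeta function of `K` with the Euler factors above
the primes in `𝒫` removed: the numbers of integral ideals of norm `N`, with `N` prime to `𝒫`. -/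
def coeffK (m : ℕ) [NeZero m] (P : Finset ℕ) (N : ℕ) : ℂ :=
  if ∀ p ∈ P, N.Coprime p then
    (Nat.card {I : Ideal (NumberField.RingOfIntegers (KAlg m ℚ)) // Ideal.absNorm I = N} : ℂ)
  else 0

/-- `ζ̂_{ξ, 𝒫}(s) = ζ_{K, 𝒫}(s) ζ_{ξ, 𝒫}(s)` -/
def zetaHat (m ℓ : ℕ) [NeZero m] (P : Finset ℕ) (ξ : Fin 4 → ℚ) (s : ℂ) : ℂ :=
  LSeries (coeffK m P) s * LSeries (coeffXi m ℓ P ξ) s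

/-! ### Clifford algebras and even Clifford groups -/

/-- The Clifford algebra `A(V₀ ⊗ R)`. -/
abbrev Cl (m : ℕ) (R : Type) [Field R] : Type := CliffordAlgebra (Q0 m R)

/-- The inclusion `V₀ ⊗ R → A(V₀ ⊗ R)`. -/
abbrev io (m : ℕ) (R : Type) [Field R] : (Fin 4 → R) →ₗ[R] Cl m R := CliffordAlgebra.ι (Q0 m R)

/-- `A⁺(V)` for a subspace `V` of `V₀ ⊗ R`, inside `A(V₀ ⊗ R)`: the elements of the subalgebra
`A(V)` generated by `V` which are fixed by the canonical automorphism `x ↦ x'`. -/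
def evenSub (m : ℕ) (R : Type) [Field R] (V : Submodule R (Fin 4 → R)) :
    Subalgebra R (Cl m R) :=
  Algebra.adjoin R (io m R '' V) ⊓
    AlgHom.equalizer (CliffordAlgebra.involute (Q := Q0 m R)) (AlgHom.id R (Cl m R))

/-- The even Clifford group `G⁺(V) = {α ∈ A⁺(V)^× | α V α⁻¹ = V}`. -/
def Gplus (m : ℕ) (R : Type) [Field R] (V : Submodule R (Fin 4 → R)) : Subgroup (Cl m R)ˣ where
  carrier := {α | (α : Cl m R) ∈ evenSub m R V ∧ ((α⁻¹ : (Cl m R)ˣ) : Cl m R) ∈ evenSub m R V ∧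
    ∀ z : Cl m R, (α : Cl m R) * z * ((α⁻¹ : (Cl m R)ˣ) : Cl m R) ∈ io m R '' V ↔ z ∈ io m R '' V}
  one_mem' := by
    refine ⟨?_, ?_, ?_⟩
    · simp
    · simp
    · intro z; simp
  mul_mem' := by
    rintro a b ⟨ha, ha', hav⟩ ⟨hb, hb', hbv⟩
    refine ⟨?_, ?_, ?_⟩
    · rw [Units.val_mul]; exact (evenSub m R V).mul_mem ha hb
    · rw [mul_inv_rev, Units.val_mul]; exact (evenSub m R V).mul_mem hb' ha'
    · intro z
      rw [← hbv z, ← hav ((b : Cl m R) * z * ((b⁻¹ : (Cl m R)ˣ) : Cl m R))]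
      simp only [mul_inv_rev, Units.val_mul, mul_assoc]
  inv_mem' := by
    rintro a ⟨ha, ha', hav⟩
    refine ⟨ha', by simpa using ha, ?_⟩
    intro z
    rw [← hav]
    simp [mul_assoc]

/-- `g = τ(α)`, that is, `α x α⁻¹ = g x` for all `x ∈ V₀ ⊗ R`. -/
def IsTau (m : ℕ) (R : Type) [Field R] (α : (Cl m R)ˣ)
    (g : Matrix.SpecialLinearGroup (Fin 4) R) : Prop :=
  ∀ x : Fin 4 → R,
    (α : Cl m R) * io m R x * ((α⁻¹ : (Cl m R)ˣ) : Cl m R) = io m R (g.1.mulVec x)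

open Classical in
/-- `ν(α) = α α^*`, as an element of `R` (`α ↦ α^*` is the canonical involution, the identity
on `V₀ ⊗ R`). -/
def nu (m : ℕ) (R : Type) [Field R] (α : Cl m R) : R :=
  if h : ∃ r : R, algebraMap R (Cl m R) r = α * CliffordAlgebra.reverse α then h.choose else 0

/-- The base change map `A(V₀) → A(V₀ ⊗ R)`. -/
def clMap (m : ℕ) (R : Type) [Field R] [CharZero R] : Cl m ℚ →ₐ[ℚ] Cl m R :=
  CliffordAlgebra.lift (Q0 m ℚ)
    ⟨{ toFun := fun x => io m R (fun j => (x j : R))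
       map_add' := by
         intro x y
         rw [← map_add]
         congr 1
         ext j
         simp
       map_smul' := by
         intro c x
         have h : (fun j => (((c • x) j : ℚ) : R)) = (c : R) • (fun j => (x j : R)) := by
           ext j
           simp
         rw [h, map_smul, RingHom.id_apply, ← algebraMap_smul R c]
         simp }, by
      intro x
      change io m R (fun j => (x j : R)) * io m R (fun j => (x j : R)) = _
      rw [CliffordAlgebra.ι_sq_scalar, IsScalarTower.algebraMap_apply ℚ R (Cl m R)]
      congr 1
      simp only [Q0, phi0, LinearMap.BilinMap.toQuadraticMap_apply, Matrix.toBilin'_apply', S0R,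
        Matrix.mulVec, dotProduct, Fin.sum_univ_four, Matrix.smul_apply, Matrix.map_apply]
      simp⟩

/-! ### Local groups -/

/-- `Λ_p = ℤ_p⁴` -/
def latP (p : ℕ) [Fact p.Prime] : Set (Fin 4 → ℚ_[p]) := {x | ∀ i, ‖x i‖ ≤ 1}

/-- `H(ξ) = SO(W)`, embedded into `SO(V₀ ⊗ R)` as the stabiliser of `ξ`. -/
def H (m ℓ : ℕ) (R : Type) [Field R] : Subgroup (Matrix.SpecialLinearGroup (Fin 4) R) where
  carrier := {g | g ∈ SO0 m R ∧ g.1.mulVec (xi0 ℓ R) = xi0 ℓ R}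
  one_mem' := ⟨(SO0 m R).one_mem, by simp⟩
  mul_mem' := by
    rintro a b ⟨ha, ha'⟩ ⟨hb, hb'⟩
    refine ⟨(SO0 m R).mul_mem ha hb, ?_⟩
    rw [Matrix.SpecialLinearGroup.coe_mul, ← Matrix.mulVec_mulVec, hb', ha']
  inv_mem' := by
    rintro a ⟨ha, ha'⟩
    refine ⟨(SO0 m R).inv_mem ha, ?_⟩
    have h1 : (a⁻¹).1 * a.1 = 1 := by
      rw [← Matrix.SpecialLinearGroup.coe_mul, inv_mul_cancel, Matrix.SpecialLinearGroup.coe_one]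
    conv_lhs => rw [← ha']
    rw [Matrix.mulVec_mulVec, h1, Matrix.one_mulVec]

lemma mulVec_inv_mulVec {R : Type} [Field R] (g : Matrix.SpecialLinearGroup (Fin 4) R)
    (x : Fin 4 → R) : g.1.mulVec ((g⁻¹).1.mulVec x) = x := by
  have h1 : g.1 * (g⁻¹).1 = 1 := by
    rw [← Matrix.SpecialLinearGroup.coe_mul, mul_inv_cancel, Matrix.SpecialLinearGroup.coe_one]
  rw [Matrix.mulVec_mulVec, h1, Matrix.one_mulVec]

/-- `C_p = {g ∈ SO(V₀)_p | g Λ_p = Λ_p}` -/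
def C (m : ℕ) (p : ℕ) [Fact p.Prime] : Subgroup (Matrix.SpecialLinearGroup (Fin 4) ℚ_[p]) where
  carrier := {g | g ∈ SO0 m ℚ_[p] ∧ ∀ x, g.1.mulVec x ∈ latP p ↔ x ∈ latP p}
  one_mem' := ⟨(SO0 m _).one_mem, by simp⟩
  mul_mem' := by
    rintro a b ⟨ha, ha'⟩ ⟨hb, hb'⟩
    refine ⟨(SO0 m _).mul_mem ha hb, fun x => ?_⟩
    rw [Matrix.SpecialLinearGroup.coe_mul, ← Matrix.mulVec_mulVec, ha', hb']
  inv_mem' := by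
    rintro a ⟨ha, ha'⟩
    refine ⟨(SO0 m _).inv_mem ha, fun x => ?_⟩
    rw [← ha', mulVec_inv_mulVec]

/-- `D_p = {g ∈ H(ξ)_p | g (Λ ∩ W)_p = (Λ ∩ W)_p}` -/
def D (m ℓ : ℕ) (p : ℕ) [Fact p.Prime] :
    Subgroup (Matrix.SpecialLinearGroup (Fin 4) ℚ_[p]) where
  carrier := {g | g ∈ H m ℓ ℚ_[p] ∧
    ∀ x, g.1.mulVec x ∈ latP p ∩ W m ℓ ℚ_[p] ↔ x ∈ latP p ∩ W m ℓ ℚ_[p]}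
  one_mem' := ⟨(H m ℓ _).one_mem, by simp⟩
  mul_mem' := by
    rintro a b ⟨ha, ha'⟩ ⟨hb, hb'⟩
    refine ⟨(H m ℓ _).mul_mem ha hb, fun x => ?_⟩
    rw [Matrix.SpecialLinearGroup.coe_mul, ← Matrix.mulVec_mulVec, ha', hb']
  inv_mem' := by
    rintro a ⟨ha, ha'⟩
    refine ⟨(H m ℓ _).inv_mem ha, fun x => ?_⟩
    rw [← ha', mulVec_inv_mulVec]

/-- `J_p = {γ ∈ G⁺(V₀)_p | τ(γ) ∈ C_p, ν(γ) ∈ ℤ_p^×}` -/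
def J (m : ℕ) (p : ℕ) [Fact p.Prime] : Subgroup (Cl m ℚ_[p])ˣ where
  carrier := {γ | γ ∈ Gplus m ℚ_[p] ⊤ ∧ (∃ g ∈ C m p, IsTau m ℚ_[p] γ g) ∧
    ∃ r : ℚ_[p], ‖r‖ = 1 ∧
      algebraMap ℚ_[p] (Cl m ℚ_[p]) r = (γ : Cl m ℚ_[p]) * CliffordAlgebra.reverse (γ : Cl m ℚ_[p])}
  one_mem' := ⟨(Gplus m _ ⊤).one_mem, ⟨1, (C m p).one_mem, fun x => by simp⟩, 1, by simp, by simp⟩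
  mul_mem' := by
    rintro a b ⟨ha, ⟨g, hg, hag⟩, r, hr, har⟩ ⟨hb, ⟨g', hg', hbg⟩, r', hr', hbr⟩
    refine ⟨(Gplus m _ ⊤).mul_mem ha hb, ⟨g * g', (C m p).mul_mem hg hg', fun x => ?_⟩,
      r * r', by rw [norm_mul, hr, hr', one_mul], ?_⟩
    · rw [Matrix.SpecialLinearGroup.coe_mul, ← Matrix.mulVec_mulVec, ← hag, ← hbg]
      simp only [mul_inv_rev, Units.val_mul, mul_assoc]
    · rw [Units.val_mul, CliffordAlgebra.reverse.map_mul]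
      calc algebraMap ℚ_[p] (Cl m ℚ_[p]) (r * r')
          = algebraMap ℚ_[p] (Cl m ℚ_[p]) r' * algebraMap ℚ_[p] (Cl m ℚ_[p]) r := by
            rw [map_mul, Algebra.commutes]
        _ = (algebraMap ℚ_[p] (Cl m ℚ_[p]) r' * (a : Cl m ℚ_[p])) *
              CliffordAlgebra.reverse (a : Cl m ℚ_[p]) := by rw [har, mul_assoc]
        _ = ((a : Cl m ℚ_[p]) * algebraMap ℚ_[p] (Cl m ℚ_[p]) r') *
              CliffordAlgebra.reverse (a : Cl m ℚ_[p]) := by rw [Algebra.commutes]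
        _ = _ := by rw [hbr]; simp only [mul_assoc]
  inv_mem' := by
    rintro a ⟨ha, ⟨g, hg, hag⟩, r, hr, har⟩
    refine ⟨(Gplus m _ ⊤).inv_mem ha, ⟨g⁻¹, (C m p).inv_mem hg, fun x => ?_⟩,
      r⁻¹, by rw [norm_inv, hr, inv_one], ?_⟩
    · have h := hag ((g⁻¹).1.mulVec x)
      rw [mulVec_inv_mulVec] at h
      rw [← h]
      simp [mul_assoc]
    · have hr0 : r ≠ 0 := by
        rintro rfl
        simp at hr
      have hra : CliffordAlgebra.reverse (a : Cl m ℚ_[p]) *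
          CliffordAlgebra.reverse ((a⁻¹ : (Cl m ℚ_[p])ˣ) : Cl m ℚ_[p]) = 1 := by
        rw [← CliffordAlgebra.reverse.map_mul, Units.inv_mul, CliffordAlgebra.reverse.map_one]
      have h1 : CliffordAlgebra.reverse (a : Cl m ℚ_[p]) =
          ((a⁻¹ : (Cl m ℚ_[p])ˣ) : Cl m ℚ_[p]) * algebraMap ℚ_[p] (Cl m ℚ_[p]) r := by
        rw [har, ← mul_assoc, Units.inv_mul, one_mul]
      rw [h1, ← Algebra.commutes, mul_assoc] at hra
      have h2 : algebraMap ℚ_[p] (Cl m ℚ_[p]) r⁻¹ * algebraMap ℚ_[p] (Cl m ℚ_[p]) r = 1 := by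
        rw [← map_mul, inv_mul_cancel₀ hr0, map_one]
      calc algebraMap ℚ_[p] (Cl m ℚ_[p]) r⁻¹
          = algebraMap ℚ_[p] (Cl m ℚ_[p]) r⁻¹ * (algebraMap ℚ_[p] (Cl m ℚ_[p]) r *
              (((a⁻¹ : (Cl m ℚ_[p])ˣ) : Cl m ℚ_[p]) *
                CliffordAlgebra.reverse ((a⁻¹ : (Cl m ℚ_[p])ˣ) : Cl m ℚ_[p]))) := by
            rw [hra, mul_one]
        _ = _ := by rw [← mul_assoc, h2, one_mul]

/-- `G⁺(W ⊗ R)` -/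
abbrev GW (m ℓ : ℕ) (R : Type) [Field R] : Subgroup (Cl m R)ˣ := Gplus m R (W m ℓ R)

/-- `S_p = A⁺((Λ ∩ W)_p)`: the even elements of the subring of the Clifford algebra generated by
`ℤ_p` and the lattice `(Λ ∩ W)_p = Λ_p ∩ W_p`. -/
def Sloc (m ℓ : ℕ) (p : ℕ) [Fact p.Prime] : Set (Cl m ℚ_[p]) :=
  {α | α ∈ Subring.closure
      (io m ℚ_[p] '' (latP p ∩ W m ℓ ℚ_[p]) ∪ algebraMap ℚ_[p] (Cl m ℚ_[p]) '' {r | ‖r‖ ≤ 1}) ∧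
    CliffordAlgebra.involute α = α}

/-! ### Adelic groups attached to `W` -/

/-- `G⁺(W)_𝔸`, as the product of the archimedean component and the restricted product of the
`G⁺(W)_p` with respect to `G⁺(W)_p ∩ J_p`. -/
abbrev GWA (m ℓ : ℕ) : Type :=
  GW m ℓ ℝ × Πʳ p : Nat.Primes, [GW m ℓ ℚ_[p], (J m p).subgroupOf (GW m ℓ ℚ_[p])]

/-- `H(ξ)_𝔸` -/
abbrev HA (m ℓ : ℕ) : Type :=
  H m ℓ ℝ × Πʳ p : Nat.Primes, [H m ℓ ℚ_[p], (C m p).subgroupOf (H m ℓ ℚ_[p])]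

/-- `𝒥 = G⁺(W)_𝔸 ∩ J` -/
def calJ (m ℓ : ℕ) : Subgroup (GWA m ℓ) where
  carrier := {y | ∀ p : Nat.Primes, ((y.2 p : GW m ℓ ℚ_[p]) : (Cl m ℚ_[p])ˣ) ∈ J m p}
  one_mem' := fun p => (J m p).one_mem
  mul_mem' := fun ha hb p => (J m p).mul_mem (ha p) (hb p)
  inv_mem' := fun ha p => (J m p).inv_mem (ha p)

/-- `H(ξ)_𝔸 ∩ C` -/
def HC (m ℓ : ℕ) : Subgroup (HA m ℓ) where
  carrier := {g | ∀ p : Nat.Primes, (g.2 p : Matrix.SpecialLinearGroup (Fin 4) ℚ_[p]) ∈ C m p}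
  one_mem' := fun p => (C m p).one_mem
  mul_mem' := fun ha hb p => (C m p).mul_mem (ha p) (hb p)
  inv_mem' := fun ha p => (C m p).inv_mem (ha p)

/-- The stabiliser `D = {g ∈ H(ξ)_𝔸 | g (Λ ∩ W) = Λ ∩ W}` -/
def HD (m ℓ : ℕ) : Subgroup (HA m ℓ) where
  carrier := {g | ∀ p : Nat.Primes, (g.2 p : Matrix.SpecialLinearGroup (Fin 4) ℚ_[p]) ∈ D m ℓ p}
  one_mem' := fun p => (D m ℓ p).one_mem
  mul_mem' := fun ha hb p => (D m ℓ p).mul_mem (ha p) (hb p)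
  inv_mem' := fun ha p => (D m ℓ p).inv_mem (ha p)

/-- `H(ξ)_ℚ`, embedded diagonally in `H(ξ)_𝔸`. -/
def HQ (m ℓ : ℕ) : Subgroup (HA m ℓ) where
  carrier := {g | ∃ h ∈ H m ℓ ℚ,
    (g.1 : Matrix.SpecialLinearGroup (Fin 4) ℝ) =
      Matrix.SpecialLinearGroup.map (algebraMap ℚ ℝ) h ∧
    ∀ p : Nat.Primes, (g.2 p : Matrix.SpecialLinearGroup (Fin 4) ℚ_[p]) =
      Matrix.SpecialLinearGroup.map (algebraMap ℚ ℚ_[p]) h}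
  one_mem' := ⟨1, (H m ℓ ℚ).one_mem, by simp, fun p => by simp⟩
  mul_mem' := by
    rintro a b ⟨h, hh, h1, h2⟩ ⟨h', hh', h1', h2'⟩
    refine ⟨h * h', (H m ℓ ℚ).mul_mem hh hh', ?_, fun p => ?_⟩
    · rw [map_mul, ← h1, ← h1']; rfl
    · rw [map_mul, ← h2, ← h2']; rfl
  inv_mem' := by
    rintro a ⟨h, hh, h1, h2⟩
    refine ⟨h⁻¹, (H m ℓ ℚ).inv_mem hh, ?_, fun p => ?_⟩
    · rw [map_inv, ← h1]; rfl
    · rw [map_inv, ← h2]; rfl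

/-- `g = τ(y)` for `y ∈ G⁺(W)_𝔸` and `g ∈ H(ξ)_𝔸`. -/
def IsTauA (m ℓ : ℕ) (y : GWA m ℓ) (g : HA m ℓ) : Prop :=
  IsTau m ℝ y.1 g.1 ∧ ∀ p : Nat.Primes, IsTau m ℚ_[p] (y.2 p).1 (g.2 p).1

/-- For a subgroup `E` of `H(ξ)_𝔸`: `τ(y) ∈ H(ξ)_ℚ τ(a) E`. -/
def TauEquiv (m ℓ : ℕ) (E : Subgroup (HA m ℓ)) (a y : GWA m ℓ) : Prop :=
  ∃ g k : HA m ℓ, IsTauA m ℓ y g ∧ IsTauA m ℓ a k ∧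
    g ∈ DoubleCoset.doubleCoset k (HQ m ℓ : Set (HA m ℓ)) (E : Set (HA m ℓ))

/-- The correspondence `κ`: the class of `ε ∈ G⁺(W)_𝔸` is mapped to `Γ̂(L₀) τ(α)⁻¹ ξ`, where
`α ∈ G⁺(V₀)_ℚ` is such that `ε ∈ α J`; here `x` belongs to that orbit. -/
def IsKappa (m ℓ : ℕ) (ε : GWA m ℓ) (x : Fin 4 → ℚ) : Prop :=
  ∃ α ∈ Gplus m ℚ ⊤,
    (∀ p : Nat.Primes,
      (Units.map (clMap m ℚ_[p] : Cl m ℚ →* Cl m ℚ_[p]) α)⁻¹ *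
        ((ε.2 p : GW m ℓ ℚ_[p]) : (Cl m ℚ_[p])ˣ) ∈ J m p) ∧
    ∃ g ∈ SO0 m ℚ, IsTau m ℚ α g ∧
      ∃ γ, InGammaHat m γ ∧ x = γ.1.mulVec ((g⁻¹).1.mulVec (xi0 ℓ ℚ))

/-- The set `𝒴` of all `y ∈ G⁺(W)_𝔸` with `y_p ∈ S_p` for `p ∉ 𝒫` and `y_p ∈ 𝒥_p` for
`p ∈ 𝒫`. -/
def Yset (m ℓ : ℕ) (P : Finset ℕ) : Set (GWA m ℓ) :=
  {y | ∀ p : Nat.Primes,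
    ((p : ℕ) ∉ P → (((y.2 p : GW m ℓ ℚ_[p]) : (Cl m ℚ_[p])ˣ) : Cl m ℚ_[p]) ∈ Sloc m ℓ p) ∧
    ((p : ℕ) ∈ P → ((y.2 p : GW m ℓ ℚ_[p]) : (Cl m ℚ_[p])ˣ) ∈ J m p)}

/-- `{y ∈ 𝒴 | τ(y) ∈ H(ξ)_ℚ τ(a) E}` -/
def Ya (m ℓ : ℕ) (P : Finset ℕ) (E : Subgroup (HA m ℓ)) (a : GWA m ℓ) : Set (GWA m ℓ) :=
  {y | y ∈ Yset m ℓ P ∧ TauEquiv m ℓ E a y}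

/-- `N(ν(y)ℤ) = ∏_p |ν(y_p)|_p⁻¹`, the norm of the fractional ideal `ν(y)ℤ` of `ℚ`. -/
def normNu (m ℓ : ℕ) (y : GWA m ℓ) : ℝ :=
  ∏ᶠ p : Nat.Primes,
    ‖nu m ℚ_[p] (((y.2 p : GW m ℓ ℚ_[p]) : (Cl m ℚ_[p])ˣ) : Cl m ℚ_[p])‖⁻¹

/-- The term `N(ν(y)ℤ)^{-s}`, on the classes `y𝒥`. -/
def termY (m ℓ : ℕ) (s : ℂ) (c : GWA m ℓ ⧸ calJ m ℓ) : ℂ :=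
  ((normNu m ℓ c.out : ℝ) : ℂ) ^ (-s)

/-- `Z/𝒥` for a set `Z` of adeles. -/
def modJ (m ℓ : ℕ) (Z : Set (GWA m ℓ)) : Set (GWA m ℓ ⧸ calJ m ℓ) :=
  (fun y => (QuotientGroup.mk y : GWA m ℓ ⧸ calJ m ℓ)) '' Z

/-! ### The quaternion algebra `B = K + εK` and the order `𝔬 = 𝒪_K + ε𝒪_K` -/

/-- `B ⊗ R`, with `i = ω`, `j = ε`, `ε² = -ℓ`, `ε a = ā ε`. The element `⟨x, y, z, w⟩` is
`(x + y ω) + (z + w ω) ε`; it lies in `𝔬` iff its coordinates are integral, as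
`ε𝒪_K = 𝒪_K ε`. -/
abbrev BAlg (m ℓ : ℕ) (R : Type) [CommRing R] : Type :=
  QuaternionAlgebra R (cA m : R) (cB m : R) (-(ℓ : R))

/-- The order `𝔬_p = 𝔬 ⊗ ℤ_p` in `B_p`. -/
def oLoc (m ℓ : ℕ) (p : ℕ) [Fact p.Prime] : Subring (BAlg m ℓ ℚ_[p]) where
  carrier := {x | x.re ∈ PadicInt.subring p ∧ x.imI ∈ PadicInt.subring p ∧
    x.imJ ∈ PadicInt.subring p ∧ x.imK ∈ PadicInt.subring p}
  one_mem' := by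
    refine ⟨?_, ?_, ?_, ?_⟩ <;> simp
  zero_mem' := by
    refine ⟨?_, ?_, ?_, ?_⟩ <;> simp
  add_mem' := by
    rintro a b ⟨h1, h2, h3, h4⟩ ⟨k1, k2, k3, k4⟩
    exact ⟨add_mem h1 k1, add_mem h2 k2, add_mem h3 k3, add_mem h4 k4⟩
  neg_mem' := by
    rintro a ⟨h1, h2, h3, h4⟩
    exact ⟨neg_mem h1, neg_mem h2, neg_mem h3, neg_mem h4⟩
  mul_mem' := by
    rintro a b ⟨h1, h2, h3, h4⟩ ⟨k1, k2, k3, k4⟩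
    have hA : ((cA m : ℤ) : ℚ_[p]) ∈ PadicInt.subring p := intCast_mem _ _
    have hB : ((cB m : ℤ) : ℚ_[p]) ∈ PadicInt.subring p := intCast_mem _ _
    have hL : (-(ℓ : ℚ_[p])) ∈ PadicInt.subring p := neg_mem (natCast_mem _ _)
    refine ⟨?_, ?_, ?_, ?_⟩
    · rw [QuaternionAlgebra.re_mul]
      apply_rules [add_mem, sub_mem, mul_mem]
    · rw [QuaternionAlgebra.imI_mul]
      apply_rules [add_mem, sub_mem, mul_mem]
    · rw [QuaternionAlgebra.imJ_mul]
      apply_rules [add_mem, sub_mem, mul_mem]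
    · rw [QuaternionAlgebra.imK_mul]
      apply_rules [add_mem, sub_mem, mul_mem]

/-- `𝔬_p^×` -/
def oUnits (m ℓ : ℕ) (p : ℕ) [Fact p.Prime] : Subgroup (BAlg m ℓ ℚ_[p])ˣ :=
  (oLoc m ℓ p).toSubmonoid.units

/-- `B_𝔸^×` -/
abbrev BA (m ℓ : ℕ) : Type :=
  (BAlg m ℓ ℝ)ˣ × Πʳ p : Nat.Primes, [(BAlg m ℓ ℚ_[p])ˣ, oUnits m ℓ p]

/-- The base change map `B → B ⊗ R`. -/
def bMap (m ℓ : ℕ) (R : Type) [Field R] [CharZero R] : BAlg m ℓ ℚ →+* BAlg m ℓ R where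
  toFun x := ⟨(x.re : R), (x.imI : R), (x.imJ : R), (x.imK : R)⟩
  map_one' := by ext <;> simp
  map_zero' := by ext <;> simp
  map_add' := by intro x y; ext <;> simp
  map_mul' := by intro x y; ext <;> simp

/-- `B^×`, embedded diagonally in `B_𝔸^×`. -/
def BQ (m ℓ : ℕ) : Subgroup (BA m ℓ) where
  carrier := {x | ∃ β : (BAlg m ℓ ℚ)ˣ,
    x.1 = Units.map (bMap m ℓ ℝ : BAlg m ℓ ℚ →* BAlg m ℓ ℝ) β ∧
    ∀ p : Nat.Primes, x.2 p = Units.map (bMap m ℓ ℚ_[p] : BAlg m ℓ ℚ →* BAlg m ℓ ℚ_[p]) β}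
  one_mem' := ⟨1, by simp, fun p => by simp⟩
  mul_mem' := by
    rintro a b ⟨h, h1, h2⟩ ⟨h', h1', h2'⟩
    refine ⟨h * h', ?_, fun p => ?_⟩
    · rw [map_mul, ← h1, ← h1']; rfl
    · rw [map_mul, ← h2, ← h2']; rfl
  inv_mem' := by
    rintro a ⟨h, h1, h2⟩
    refine ⟨h⁻¹, ?_, fun p => ?_⟩
    · rw [map_inv, ← h1]; rfl
    · rw [map_inv, ← h2]; rfl

/-- `X = B_∞^× ∏_p 𝔬_p^×` -/
def X (m ℓ : ℕ) : Subgroup (BA m ℓ) where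
  carrier := {x | ∀ p : Nat.Primes, x.2 p ∈ oUnits m ℓ p}
  one_mem' := fun p => (oUnits m ℓ p).one_mem
  mul_mem' := fun ha hb p => (oUnits m ℓ p).mul_mem (ha p) (hb p)
  inv_mem' := fun ha p => (oUnits m ℓ p).inv_mem (ha p)

/-- `N_B(X) = {α ∈ B_𝔸^× | α 𝔬 α⁻¹ = 𝔬}` -/
def NB (m ℓ : ℕ) : Subgroup (BA m ℓ) where
  carrier := {x | ∀ (p : Nat.Primes) (z : BAlg m ℓ ℚ_[p]),
    (x.2 p : BAlg m ℓ ℚ_[p]) * z * (((x.2 p)⁻¹ : (BAlg m ℓ ℚ_[p])ˣ) : BAlg m ℓ ℚ_[p]) ∈ oLoc m ℓ p ↔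
      z ∈ oLoc m ℓ p}
  one_mem' := fun p z => by simp
  mul_mem' := by
    intro a b ha hb p z
    rw [← hb p z, ← ha p ((b.2 p : BAlg m ℓ ℚ_[p]) * z *
      (((b.2 p)⁻¹ : (BAlg m ℓ ℚ_[p])ˣ) : BAlg m ℓ ℚ_[p]))]
    simp [mul_assoc]
  inv_mem' := by
    intro a ha p z
    rw [← ha p]
    simp [mul_assoc]

/-- The type set of `𝔬`, as `B^× \ B_𝔸^× / N_B(X)`. -/
abbrev TypeSet (m ℓ : ℕ) : Type :=
  DoubleCoset.Quotient (BQ m ℓ : Set (BA m ℓ)) (NB m ℓ : Set (BA m ℓ))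

/-- The map `ρ`, sending the right ideal class `[u𝔬]` to the type of its left order `u𝔬u⁻¹`;
on `B^× \ B_𝔸^× / X` it is induced by the identity of `B_𝔸^×`. -/
def rho (m ℓ : ℕ) (u : BA m ℓ) : TypeSet m ℓ :=
  DoubleCoset.mk _ _ u

/-! ### The identification `Ξ` of `G⁺(W)` with `B^×` -/

/-- The Hermitian matrix over `K ⊗ R` with coordinates `(x, y, z, w)`, that is, the inverse of the
isometry `f_ω : U → V₀`. -/
def hermL (m : ℕ) (R : Type) [Field R] :
    (Fin 4 → R) →ₗ[R] Matrix (Fin 2) (Fin 2) (KAlg m R) where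
  toFun x := !![⟨x 0, 0⟩, ⟨x 1, x 2⟩; star ⟨x 1, x 2⟩, ⟨x 3, 0⟩]
  map_add' := by
    intro x y
    ext i j <;> fin_cases i <;> fin_cases j <;> simp <;> ring
  map_smul' := by
    intro c x
    ext i j <;> fin_cases i <;> fin_cases j <;> simp <;> ring

/-- `h ↦ [[0, h], [h^ι, 0]]`, where `h^ι` is the adjugate of the Hermitian matrix `h`. -/
def hermBlock (m : ℕ) (R : Type) [Field R] :
    (Fin 4 → R) →ₗ[R] Matrix (Fin 2 ⊕ Fin 2) (Fin 2 ⊕ Fin 2) (KAlg m R) where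
  toFun x := Matrix.fromBlocks 0 (hermL m R x) (hermL m R x).adjugate 0
  map_add' := by
    intro x y
    rw [map_add, Matrix.fromBlocks_add]
    simp [Matrix.adjugate_fin_two]
    constructor
    all_goals ring
  map_smul' := by
    intro c x
    rw [map_smul, RingHom.id_apply, Matrix.fromBlocks_smul]
    simp [Matrix.adjugate_fin_two]

lemma det_hermL (m : ℕ) (R : Type) [Field R] [CharZero R] (x : Fin 4 → R) :
    (hermL m R x).det = algebraMap R (KAlg m R) (Q0 m R x) := by
  have h2 : (2 : R) ≠ 0 := two_ne_zero
  rw [Matrix.det_fin_two]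
  simp only [hermL, Q0, phi0, LinearMap.BilinMap.toQuadraticMap_apply, Matrix.toBilin'_apply', S0R,
    Matrix.mulVec, dotProduct, Fin.sum_univ_four, Matrix.smul_apply, Matrix.map_apply, S0mat, Smat,
    LinearMap.coe_mk, AddHom.coe_mk]
  by_cases h3 : m % 4 = 3
  · obtain ⟨k, hk⟩ : ∃ k : ℤ, (m : ℤ) + 1 = 4 * k := ⟨((m : ℤ) + 1) / 4, by omega⟩
    have h4 : cA m = -k := by simp only [cA, h3, if_true]; omega
    have h5 : ((m : ℤ) + 1) / 2 = 2 * k := by omega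
    have h6 : cB m = 1 := by simp [cB, h3]
    simp only [h3, if_true, h5]
    ext
    · simp [h4, h6]
      field_simp
      ring
    · simp [h4, h6]
      try ring
  · have h4 : cA m = -(m : ℤ) := by simp [cA, h3]
    have h6 : cB m = 0 := by simp [cB, h3]
    simp only [h3, if_false]
    ext
    · simp [h4, h6]
      field_simp
      ring
    · simp [h4, h6]
      try ring

/-- The representation of `A(V₀ ⊗ R)` extending `h ↦ [[0, h], [h^ι, 0]]`. -/
def clRep (m : ℕ) (R : Type) [Field R] [CharZero R] :
    Cl m R →ₐ[R] Matrix (Fin 2 ⊕ Fin 2) (Fin 2 ⊕ Fin 2) (KAlg m R) :=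
  CliffordAlgebra.lift (Q0 m R) ⟨hermBlock m R, by
    intro x
    change Matrix.fromBlocks 0 (hermL m R x) (hermL m R x).adjugate 0 *
      Matrix.fromBlocks 0 (hermL m R x) (hermL m R x).adjugate 0 = _
    rw [Matrix.fromBlocks_multiply, Matrix.mul_adjugate, Matrix.adjugate_mul, det_hermL,
      Algebra.algebraMap_eq_smul_one, Algebra.algebraMap_eq_smul_one,
      ← Matrix.fromBlocks_one, Matrix.fromBlocks_smul]
    simp⟩

/-- The isomorphism `Ξ` of `G⁺(V₀ ⊗ R)` with the group of all `g ∈ GL₂(K ⊗ R)` with `det g ∈ R^×`: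
the upper left block of `clRep`, so that the product of two Hermitian matrices `h, k` in the
Clifford algebra is mapped to `h k^ι`. -/
def Xi (m : ℕ) (R : Type) [Field R] [CharZero R] (α : Cl m R) :
    Matrix (Fin 2) (Fin 2) (KAlg m R) :=
  (clRep m R α).toBlocks₁₁

/-- The embedding of `B ⊗ R` in `M₂(K ⊗ R)` given by `a ↦ diag(a, ā)` for `a ∈ K` and
`ε ↦ [[0, 1], [-ℓ, 0]]`; its image is `Ξ(A⁺(W))`. -/
def bMat (m ℓ : ℕ) (R : Type) [Field R] (x : BAlg m ℓ R) :
    Matrix (Fin 2) (Fin 2) (KAlg m R) :=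
  !![⟨x.re, x.imI⟩, ⟨x.imJ, x.imK⟩;
     (-(ℓ : KAlg m R)) * star ⟨x.imJ, x.imK⟩, star ⟨x.re, x.imI⟩]

/-- `u = Ξ(y)` for `y ∈ G⁺(W)_𝔸` and `u ∈ B_𝔸^×`. -/
def IsXi (m ℓ : ℕ) (y : GWA m ℓ) (u : BA m ℓ) : Prop :=
  Xi m ℝ ((y.1 : (Cl m ℝ)ˣ) : Cl m ℝ) = bMat m ℓ ℝ u.1 ∧
    ∀ p : Nat.Primes,
      Xi m ℚ_[p] (((y.2 p : GW m ℓ ℚ_[p]) : (Cl m ℚ_[p])ˣ) : Cl m ℚ_[p]) = bMat m ℓ ℚ_[p] (u.2 p)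

/-! ### The partial zeta series in terms of `B` -/

/-- The reduced norm `nrd(x) = x x̄`. -/
def nrd (m ℓ : ℕ) (R : Type) [Field R] (x : BAlg m ℓ R) : R := (x * star x).re

/-- The set of all `y ∈ B_𝔸^×` with `ρ(y) = w`, with `y_p ∈ 𝔬_p` for `p ∉ 𝒫` and
`y_p ∈ 𝔬_p^×` for `p ∈ 𝒫`. -/
def YB (m ℓ : ℕ) (P : Finset ℕ) (w : TypeSet m ℓ) : Set (BA m ℓ) :=
  {y | rho m ℓ y = w ∧ ∀ p : Nat.Primes,
    ((p : ℕ) ∉ P → (y.2 p : BAlg m ℓ ℚ_[p]) ∈ oLoc m ℓ p) ∧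
    ((p : ℕ) ∈ P → y.2 p ∈ oUnits m ℓ p)}

/-- The term `N(nrd(y)ℤ)^{-s}`, on the classes `yX`. -/
def termB (m ℓ : ℕ) (s : ℂ) (c : BA m ℓ ⧸ X m ℓ) : ℂ :=
  ((∏ᶠ p : Nat.Primes,
    ‖nrd m ℓ ℚ_[p] (((c.out : BA m ℓ).2 p : (BAlg m ℓ ℚ_[p])ˣ) : BAlg m ℓ ℚ_[p])‖⁻¹ : ℝ) : ℂ) ^ (-s)

/-- `Z/X` for a set `Z` of elements of `B_𝔸^×`. -/
def modX (m ℓ : ℕ) (Z : Set (BA m ℓ)) : Set (BA m ℓ ⧸ X m ℓ) :=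
  (fun y => (QuotientGroup.mk y : BA m ℓ ⧸ X m ℓ)) '' Z

end HermZeta

end

/-!
The partial zeta series of the quaternion algebra `B` are computed by decomposing an integral
adelic quaternion into a scalar in `𝒪_K` and a primitive part which is described by a vector of
norm `ℓ` in `V₀`.

*From `G⁺(W)` to `B`.* The matrix model of the Clifford algebra is faithful, so `Ξ` identifies
`G⁺(W)` with `B^×`, and `τ(g)` is the map `h ↦ g h g^* / det g` on Hermitian matrices. At a prime
`p` the group `𝒥_p` corresponds to `𝔬_p^×` (`PsiU_mem_J_iff`; this uses that `m` is squarefree),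
the lattice `A⁺(Λ ∩ W)_p` to `𝔬_p` (`Psi_mem_Sloc_iff`), and the stabiliser of `(Λ ∩ W)_p` to the
normaliser of `𝔬_p` (`tauB_mem_D_iff`). As every element of `H(ξ)_ℚ` is `τ(u)` for some `u ∈ B^×`
(`exists_tauB_of_mem_H`), two elements have the same type if and only if they lie in the same double
coset modulo `H(ξ)_ℚ` and `𝒟` (`rho_eq_iff_tauEquiv`). So both parts of the theorem are instances
of one summation formula, `hasSum_modJ_Ya`, for a subgroup `E` of `H(ξ)_𝔸` which contains
`H(ξ)_𝔸 ∩ C`.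

*Vectors and quaternions.* To a vector `v = (k, β, n)` of norm `ℓ` with `n > 0`, primitive in the
dual lattice, is attached the matrix `A_v = [[0, 1], [-n, β]]`, for which `τ(A_v) v = ξ`. At each
prime the set `A_v GL₂(𝒪_p)` contains exactly one coset `u 𝔬_p^×` of quaternions (`exists_LRel`,
`LRel.inv_mul_mem`). The quaternion `u` has reduced norm `n` up to units and a unimodular first row;
conversely, every unimodular integral adelic quaternion arises in this way (`exists_primVec`), and
it determines `n`, and `β` modulo `n𝒪_K` (`GRel.eq_mod`). Since `𝒪_K` is a principal ideal domain,
every integral adelic quaternion is `t u` with `t ∈ 𝒪_K` and `u` unimodular (`exists_unimod`), where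
the ideal `(t)` is unique. Translations of `β` by `n𝒪_K` lie in `Γ̂`, so `u` determines the index
`i` for which `v` lies in `Γ̂ ξ_i`, and the residue classes of `β` are those counted by `n(ξ_i; n)`
(`exists_primVec_of_mem_NSet`, `betaClass_mem_NSet`). Here `Γ̂` may be replaced by `Γ̂⁺`
because an element `h ↦ g h g^* / det g` of `Γ̂` which maps a vector of the positive cone into the
cone has `det g > 0`, and then it is joined to the identity by a path (`InGammaHat.plus`). Finally
`τ(t u)` lies in the double coset of `τ(ζ_i)` modulo `H(ξ)_ℚ` and `H(ξ)_𝔸 ∩ C`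
(`tauEquiv_of_isKappa`).

*Summation.* Hence the integral cosets `yX` correspond to triples consisting of an ideal of `𝒪_K`,
an index `i` and a class counted by `n(ξ_i; n)`, the norm being `N(t) n` (`exists_parametrization`).
The sum over the triples with fixed `i` is the product of the Dirichlet series `ζ_{K, 𝒫}` and
`ζ_{ξ_i, 𝒫}` (`hasSum_zetaHat`). The second converges absolutely for `Re s > 2`, because
`∑_{d ≤ x} n(ξ_i; d)` is at most the number of pairs of a point `0 ≤ a, b < x` and a divisor of
`N(a + b ω) + ℓ`, which is `O(x^(2 + ε))` by the divisor bound (`lSeriesSummable_coeffXi`).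
-/

noncomputable section

namespace HermZeta

set_option linter.unusedSectionVars false

/-! ### Hermitian matrices and the matrix model of the Clifford algebra -/

lemma Smat_eq (m : ℕ) : Smat m = !![2, cB m; cB m, -2 * cA m] := by
  unfold Smat cA cB
  split_ifs with h
  · ext i j
    fin_cases i <;> fin_cases j <;> simp
    omega
  · ext i j
    fin_cases i <;> fin_cases j <;> simp

lemma S0R_eq (m : ℕ) (R : Type) [CommRing R] :
    S0R m R = !![0, 0, 0, 1; 0, -2, -(cB m : R), 0; 0, -(cB m : R), 2 * (cA m : R), 0;
      1, 0, 0, 0] := by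
  ext i j
  fin_cases i <;> fin_cases j <;> simp [S0R, S0mat, Smat_eq]

section field
variable {m : ℕ} {R : Type} [Field R] [CharZero R]

lemma phi0_apply (x y : Fin 4 → R) :
    phi0 m R x y = (1 / 2) * (x 0 * y 3 + x 3 * y 0) -
      (x 1 * y 1 + (1 / 2) * cB m * (x 1 * y 2 + x 2 * y 1) - cA m * x 2 * y 2) := by
  simp only [phi0, Matrix.toBilin'_apply', S0R_eq, Matrix.mulVec, dotProduct, Fin.sum_univ_four,
    Matrix.smul_apply, smul_eq_mul]
  have h2 : (2 : R) ≠ 0 := two_ne_zero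
  simp
  field_simp
  ring

lemma Q0_apply (x : Fin 4 → R) :
    Q0 m R x = x 0 * x 3 - (x 1 ^ 2 + cB m * x 1 * x 2 - cA m * x 2 ^ 2) := by
  have h2 : (2 : R) ≠ 0 := two_ne_zero
  simp only [Q0, LinearMap.BilinMap.toQuadraticMap_apply, phi0_apply]
  field_simp
  ring

lemma phi0_self (x : Fin 4 → R) : phi0 m R x x = Q0 m R x := rfl

lemma mem_W {ℓ : ℕ} {x : Fin 4 → R} : x ∈ W m ℓ R ↔ x 3 = -(ℓ * x 0) := by
  have h2 : (2 : R) ≠ 0 := two_ne_zero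
  simp only [W, LinearMap.mem_ker, phi0_apply, xi0]
  simp
  constructor
  · intro h
    linear_combination h
  · intro h
    rw [h]; ring

end field

section mats
variable {m : ℕ} {R : Type} [Field R]

/-- The multiplicative map `g ↦ (g^ι)^*` on `M₂(K ⊗ R)`, the conjugate transpose of the adjugate. -/
def theta (X : Matrix (Fin 2) (Fin 2) (KAlg m R)) : Matrix (Fin 2) (Fin 2) (KAlg m R) :=
  !![star (X 1 1), -star (X 1 0); -star (X 0 1), star (X 0 0)]

lemma theta_mul (X Y : Matrix (Fin 2) (Fin 2) (KAlg m R)) :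
    theta (X * Y) = theta X * theta Y := by
  ext i j : 1
  fin_cases i <;> fin_cases j <;>
    simp [theta, Matrix.mul_apply, Fin.sum_univ_two] <;> ring

lemma theta_add (X Y : Matrix (Fin 2) (Fin 2) (KAlg m R)) :
    theta (X + Y) = theta X + theta Y := by
  ext i j : 1
  fin_cases i <;> fin_cases j <;> simp [theta, add_comm]

lemma theta_neg (X : Matrix (Fin 2) (Fin 2) (KAlg m R)) : theta (-X) = -theta X := by
  ext i j : 1
  fin_cases i <;> fin_cases j <;> simp [theta]

@[simp] lemma theta_zero : theta (0 : Matrix (Fin 2) (Fin 2) (KAlg m R)) = 0 := by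
  ext i j : 1
  fin_cases i <;> fin_cases j <;> simp [theta]

@[simp] lemma theta_one : theta (1 : Matrix (Fin 2) (Fin 2) (KAlg m R)) = 1 := by
  ext i j : 1
  fin_cases i <;> fin_cases j <;> simp [theta]

lemma theta_theta (X : Matrix (Fin 2) (Fin 2) (KAlg m R)) : theta (theta X) = X := by
  ext i j : 1
  fin_cases i <;> fin_cases j <;> simp [theta]

lemma theta_eq (X : Matrix (Fin 2) (Fin 2) (KAlg m R)) :
    theta X = X.adjugate.conjTranspose := by
  ext i j : 1
  fin_cases i <;> fin_cases j <;> simp [theta, Matrix.adjugate_fin_two]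

lemma theta_algebraMap (r : R) :
    theta (algebraMap R (Matrix (Fin 2) (Fin 2) (KAlg m R)) r) = algebraMap R _ r := by
  ext i j : 1
  fin_cases i <;> fin_cases j <;>
    simp [theta, Matrix.algebraMap_matrix_apply] <;> (ext <;> simp)

lemma theta_smul (r : R) (X : Matrix (Fin 2) (Fin 2) (KAlg m R)) :
    theta (r • X) = r • theta X := by
  rw [Algebra.smul_def, theta_mul, theta_algebraMap, ← Algebra.smul_def]

lemma hermL_apply (x : Fin 4 → R) :
    hermL m R x = !![⟨x 0, 0⟩, ⟨x 1, x 2⟩; star ⟨x 1, x 2⟩, ⟨x 3, 0⟩] := rfl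

lemma star_mk0 (r : R) : star (⟨r, 0⟩ : KAlg m R) = ⟨r, 0⟩ := by
  ext <;> simp

/-- So `[[0, h], [h^ι, 0]]` has the shape `[[g, h], [θ h, θ g]]`. -/
lemma theta_hermL (x : Fin 4 → R) : theta (hermL m R x) = (hermL m R x).adjugate := by
  ext i j : 1
  fin_cases i <;> fin_cases j <;>
    simp [theta, hermL_apply, Matrix.adjugate_fin_two, star_mk0, -QuadraticAlgebra.star_mk]

lemma conjTranspose_hermL (x : Fin 4 → R) :
    (hermL m R x).conjTranspose = hermL m R x := by
  ext i j : 1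
  fin_cases i <;> fin_cases j <;>
    simp [hermL_apply, star_mk0, -QuadraticAlgebra.star_mk]

lemma hermL_injective : Function.Injective (hermL m R) := by
  intro x y h
  have h00 := congr_fun (congr_fun h 0) 0
  have h01 := congr_fun (congr_fun h 0) 1
  have h11 := congr_fun (congr_fun h 1) 1
  simp [hermL_apply] at h00 h01 h11
  ext i
  fin_cases i <;> simp_all

/-- The coordinates of a Hermitian matrix. -/
def hermCoord (X : Matrix (Fin 2) (Fin 2) (KAlg m R)) : Fin 4 → R :=
  ![(X 0 0).re, (X 0 1).re, (X 0 1).im, (X 1 1).re]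

lemma hermL_hermCoord [CharZero R] {X : Matrix (Fin 2) (Fin 2) (KAlg m R)}
    (hX : X.conjTranspose = X)
    (h0 : (X 0 0).im = 0) (h1 : (X 1 1).im = 0) : hermL m R (hermCoord X) = X := by
  have h10 := congr_fun (congr_fun hX 1) 0
  simp only [Matrix.conjTranspose_apply] at h10
  ext i j : 1
  fin_cases i <;> fin_cases j
  · ext <;> simp [hermL_apply, hermCoord, h0]
  · ext <;> simp [hermL_apply, hermCoord]
  · simp only [hermL_apply, hermCoord]
    simp
    rw [← h10]
  · ext <;> simp [hermL_apply, hermCoord, h1]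

lemma im_eq_zero_of_star_eq [CharZero R] {z : KAlg m R} (h : star z = z) : z.im = 0 := by
  have := congr_arg QuadraticAlgebra.im h
  simp at this
  have h2 : (2 : R) * z.im = 0 := by linear_combination -this
  simpa using h2

lemma hermL_hermCoord' [CharZero R] {X : Matrix (Fin 2) (Fin 2) (KAlg m R)}
    (hX : X.conjTranspose = X) : hermL m R (hermCoord X) = X := by
  refine hermL_hermCoord hX (im_eq_zero_of_star_eq ?_) (im_eq_zero_of_star_eq ?_)
  · have := congr_fun (congr_fun hX 0) 0
    simpa using this
  · have := congr_fun (congr_fun hX 1) 1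
    simpa using this

/-- The map `h ↦ g h g^*` on Hermitian matrices, as a matrix in the coordinates of `V₀`. -/
def actMat (g : Matrix (Fin 2) (Fin 2) (KAlg m R)) : Matrix (Fin 4) (Fin 4) R :=
  Matrix.of fun i j => hermCoord (g * hermL m R (Pi.single j 1) * g.conjTranspose) i

/-- The defining property of `actMat`. -/
lemma hermL_actMat [CharZero R] (g : Matrix (Fin 2) (Fin 2) (KAlg m R)) (x : Fin 4 → R) :
    hermL m R ((actMat g).mulVec x) = g * hermL m R x * g.conjTranspose := by
  have key : (actMat g).mulVec x = ∑ j, x j •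
      hermCoord (g * hermL m R (Pi.single j 1) * g.conjTranspose) := by
    ext i
    simp [actMat, Matrix.mulVec, dotProduct, mul_comm]
  rw [key, map_sum]
  have h1 : ∀ j : Fin 4, hermL m R (x j • hermCoord
      (g * hermL m R (Pi.single j 1) * g.conjTranspose)) =
      g * hermL m R (x j • Pi.single j 1) * g.conjTranspose := by
    intro j
    rw [map_smul, map_smul, hermL_hermCoord']
    · simp
    · rw [Matrix.conjTranspose_mul, Matrix.conjTranspose_mul, Matrix.conjTranspose_conjTranspose,
        conjTranspose_hermL, Matrix.mul_assoc]
  simp_rw [h1]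
  rw [← Finset.sum_mul, ← Finset.mul_sum, ← map_sum]
  congr 3
  ext i
  simp [Pi.single_apply]

end mats

section rep
variable {m : ℕ} {R : Type} [Field R] [CharZero R]

lemma clRep_io (x : Fin 4 → R) :
    clRep m R (io m R x) = Matrix.fromBlocks 0 (hermL m R x) (theta (hermL m R x)) 0 := by
  rw [clRep, CliffordAlgebra.lift_ι_apply, theta_hermL]
  rfl

/-- `A(V₀)` is represented by the matrices `[[g, h], [θ h, θ g]]`; the canonical involution acts by
`(g, h) ↦ (g^ι, h^*)` and the canonical automorphism by `(g, h) ↦ (g, -h)`. -/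
lemma clRep_shape (x : Cl m R) : ∃ g h : Matrix (Fin 2) (Fin 2) (KAlg m R),
    clRep m R x = Matrix.fromBlocks g h (theta h) (theta g) ∧
    clRep m R (CliffordAlgebra.reverse x) =
      Matrix.fromBlocks g.adjugate h.conjTranspose (theta h.conjTranspose) (theta g.adjugate) ∧
    clRep m R (CliffordAlgebra.involute x) =
      Matrix.fromBlocks g (-h) (theta (-h)) (theta g) := by
  have adj : ∀ X Y : Matrix (Fin 2) (Fin 2) (KAlg m R),
      (X * theta Y).adjugate = Y.conjTranspose * theta X.conjTranspose := by
    intro X Y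
    ext i j : 1
    fin_cases i <;> fin_cases j <;>
      simp [theta, Matrix.adjugate_fin_two, Matrix.mul_apply, Fin.sum_univ_two] <;> ring
  have adj' : ∀ X Y : Matrix (Fin 2) (Fin 2) (KAlg m R),
      (X * theta Y).conjTranspose = Y.adjugate * X.conjTranspose := by
    intro X Y
    ext i j : 1
    fin_cases i <;> fin_cases j <;>
      simp [theta, Matrix.adjugate_fin_two, Matrix.mul_apply, Fin.sum_univ_two] <;> ring
  have adj'' : ∀ X Y : Matrix (Fin 2) (Fin 2) (KAlg m R),
      (X * Y).conjTranspose = Y.conjTranspose * theta X.adjugate := by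
    intro X Y
    ext i j : 1
    fin_cases i <;> fin_cases j <;>
      simp [theta, Matrix.adjugate_fin_two, Matrix.mul_apply, Fin.sum_univ_two] <;> ring
  have adjadd : ∀ X Y : Matrix (Fin 2) (Fin 2) (KAlg m R),
      (X + Y).adjugate = X.adjugate + Y.adjugate := by
    intro X Y
    ext i j : 1
    fin_cases i <;> fin_cases j <;> simp [Matrix.adjugate_fin_two, add_comm]
  induction x using CliffordAlgebra.induction with
  | algebraMap r =>
    refine ⟨algebraMap R _ r, 0, ?_, ?_, ?_⟩
    · rw [AlgHom.commutes, theta_algebraMap]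
      simp [Algebra.algebraMap_eq_smul_one, ← Matrix.fromBlocks_one, Matrix.fromBlocks_smul]
    · have : (algebraMap R (Matrix (Fin 2) (Fin 2) (KAlg m R)) r).adjugate = algebraMap R _ r := by
        ext i j : 1
        fin_cases i <;> fin_cases j <;>
          simp [Matrix.adjugate_fin_two, Matrix.algebraMap_matrix_apply]
      rw [CliffordAlgebra.reverse.commutes, AlgHom.commutes, this, theta_algebraMap]
      simp [Algebra.algebraMap_eq_smul_one, ← Matrix.fromBlocks_one, Matrix.fromBlocks_smul]
    · rw [AlgHom.commutes, AlgHom.commutes, theta_algebraMap]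
      simp [Algebra.algebraMap_eq_smul_one, ← Matrix.fromBlocks_one, Matrix.fromBlocks_smul]
  | ι x =>
    refine ⟨0, hermL m R x, ?_, ?_, ?_⟩
    · rw [clRep_io, theta_zero]
    · rw [CliffordAlgebra.reverse_ι, clRep_io, conjTranspose_hermL]
      simp
    · rw [CliffordAlgebra.involute_ι, map_neg, clRep_io, theta_neg, Matrix.fromBlocks_neg]
      simp
  | mul a b ha hb =>
    obtain ⟨g, h, h1, h2, h3⟩ := ha
    obtain ⟨g', h', h1', h2', h3'⟩ := hb
    refine ⟨g * g' + h * theta h', g * h' + h * theta g', ?_, ?_, ?_⟩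
    · rw [map_mul, h1, h1', Matrix.fromBlocks_multiply]
      simp only [theta_add, theta_mul, theta_theta]
      congr 1 <;> abel
    · rw [CliffordAlgebra.reverse.map_mul, map_mul, h2, h2', Matrix.fromBlocks_multiply]
      simp only [theta_add, theta_mul, theta_theta, adjadd, adj, adj', adj'',
        Matrix.conjTranspose_add, Matrix.adjugate_mul_distrib]
      congr 1 <;> abel
    · rw [map_mul, map_mul, h3, h3', Matrix.fromBlocks_multiply]
      simp only [theta_add, theta_mul, theta_theta, theta_neg, Matrix.mul_neg, Matrix.neg_mul,
        neg_neg, neg_add]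
      congr 1 <;> abel
  | add a b ha hb =>
    obtain ⟨g, h, h1, h2, h3⟩ := ha
    obtain ⟨g', h', h1', h2', h3'⟩ := hb
    refine ⟨g + g', h + h', ?_, ?_, ?_⟩
    · rw [map_add, h1, h1', Matrix.fromBlocks_add, theta_add, theta_add]
    · rw [map_add, map_add, h2, h2', Matrix.fromBlocks_add, adjadd, Matrix.conjTranspose_add,
        theta_add, theta_add]
    · rw [map_add, map_add, h3, h3', Matrix.fromBlocks_add, neg_add, theta_add, theta_add]

end rep

/-! ### The quaternion algebra inside the Clifford algebra -/

section psi
variable {m : ℕ} {R : Type} [Field R] [CharZero R]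

lemma io_mul_self (x : Fin 4 → R) : io m R x * io m R x = algebraMap R _ (Q0 m R x) :=
  CliffordAlgebra.ι_sq_scalar _ x

lemma io_mul_io_add (x y : Fin 4 → R) :
    io m R x * io m R y + io m R y * io m R x = algebraMap R _ (2 * phi0 m R x y) := by
  have h2 : (2 : R) ≠ 0 := two_ne_zero
  rw [CliffordAlgebra.ι_mul_ι_add_swap]
  congr 1
  simp only [QuadraticMap.polar, Q0_apply, phi0_apply, Pi.add_apply]
  field_simp
  ring

lemma io_mul_io_swap (x y : Fin 4 → R) :
    io m R x * io m R y = (2 * phi0 m R x y) • 1 - io m R y * io m R x := by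
  rw [← Algebra.algebraMap_eq_smul_one, ← io_mul_io_add]
  abel

/-- The vector `e₀ = (1, 0, 0, -ℓ)` of `Λ ∩ W`. -/
def e0 (ℓ : ℕ) (R : Type) [Field R] : Fin 4 → R := ![1, 0, 0, -(ℓ : R)]
/-- The vector `e₁ = (0, 1, 0, 0)` of `Λ ∩ W`, with `φ₀[e₁] = -1`. -/
def e1 (R : Type) [Field R] : Fin 4 → R := ![0, 1, 0, 0]
/-- The vector `e₂ = (0, 0, 1, 0)` of `Λ ∩ W`. -/
def e2 (R : Type) [Field R] : Fin 4 → R := ![0, 0, 1, 0]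

lemma e1_sq : io m R (e1 R) * io m R (e1 R) = -1 := by
  rw [io_mul_self, Q0_apply]
  simp [e1]

lemma xi0_sq (ℓ : ℕ) : io m R (xi0 ℓ R) * io m R (xi0 ℓ R) = (ℓ : R) • 1 := by
  rw [io_mul_self, Q0_apply, Algebra.algebraMap_eq_smul_one]
  simp [xi0]

lemma e2_e1 : io m R (e2 R) * io m R (e1 R) =
    (-(cB m : R)) • 1 - io m R (e1 R) * io m R (e2 R) := by
  rw [io_mul_io_swap, phi0_apply]
  congr 2
  simp [e1, e2]

lemma e0_e1 (ℓ : ℕ) : io m R (e0 ℓ R) * io m R (e1 R) = - (io m R (e1 R) * io m R (e0 ℓ R)) := by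
  rw [io_mul_io_swap, phi0_apply]
  simp [e1, e0]

lemma e0_e2 (ℓ : ℕ) : io m R (e0 ℓ R) * io m R (e2 R) = - (io m R (e2 R) * io m R (e0 ℓ R)) := by
  rw [io_mul_io_swap, phi0_apply]
  simp [e2, e0]

lemma e0_sq (ℓ : ℕ) : io m R (e0 ℓ R) * io m R (e0 ℓ R) = (-(ℓ : R)) • 1 := by
  rw [io_mul_self, Q0_apply, Algebra.algebraMap_eq_smul_one]
  simp [e0]

lemma e2_sq : io m R (e2 R) * io m R (e2 R) = (cA m : R) • 1 := by
  rw [io_mul_self, Q0_apply, Algebra.algebraMap_eq_smul_one]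
  simp [e2]

/-- The images `-e₂e₁`, `-e₀e₁`, `-e₀e₂` of `ω`, `ε`, `ωε` in the Clifford algebra. -/
def psiBasis (m ℓ : ℕ) (R : Type) [Field R] [CharZero R] :
    QuaternionAlgebra.Basis (Cl m R) (cA m : R) (cB m : R) (-(ℓ : R)) where
  i := -(io m R (e2 R) * io m R (e1 R))
  j := -(io m R (e0 ℓ R) * io m R (e1 R))
  k := -(io m R (e0 ℓ R) * io m R (e2 R))
  i_mul_i := by
    have h : io m R (e2 R) * io m R (e1 R) * (io m R (e2 R) * io m R (e1 R)) =
        io m R (e2 R) * (io m R (e1 R) * io m R (e2 R)) * io m R (e1 R) := by noncomm_ring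
    have h' : io m R (e1 R) * io m R (e2 R) =
        (-(cB m : R)) • 1 - io m R (e2 R) * io m R (e1 R) := by rw [e2_e1]; abel
    rw [neg_mul_neg, h, h']
    have h3 : io m R (e2 R) * ((-(cB m : R)) • 1 - io m R (e2 R) * io m R (e1 R)) * io m R (e1 R)
        = (-(cB m : R)) • (io m R (e2 R) * io m R (e1 R)) -
          (io m R (e2 R) * io m R (e2 R)) * (io m R (e1 R) * io m R (e1 R)) := by
      simp only [mul_sub, sub_mul, mul_assoc, mul_smul_comm, smul_mul_assoc, one_mul]
    rw [h3, e2_sq, e1_sq]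
    simp
    abel
  j_mul_j := by
    have h : io m R (e0 ℓ R) * io m R (e1 R) * (io m R (e0 ℓ R) * io m R (e1 R)) =
        io m R (e0 ℓ R) * (io m R (e1 R) * io m R (e0 ℓ R)) * io m R (e1 R) := by noncomm_ring
    have h' : io m R (e1 R) * io m R (e0 ℓ R) = - (io m R (e0 ℓ R) * io m R (e1 R)) := by
      rw [e0_e1]; simp
    rw [neg_mul_neg, h, h']
    have h3 : io m R (e0 ℓ R) * (- (io m R (e0 ℓ R) * io m R (e1 R))) * io m R (e1 R)
        = - ((io m R (e0 ℓ R) * io m R (e0 ℓ R)) * (io m R (e1 R) * io m R (e1 R))) := by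
      noncomm_ring
    rw [h3, e0_sq, e1_sq]
    simp
  i_mul_j := by
    have h : io m R (e2 R) * io m R (e1 R) * (io m R (e0 ℓ R) * io m R (e1 R)) =
        io m R (e2 R) * (io m R (e1 R) * io m R (e0 ℓ R)) * io m R (e1 R) := by noncomm_ring
    have h' : io m R (e1 R) * io m R (e0 ℓ R) = - (io m R (e0 ℓ R) * io m R (e1 R)) := by
      rw [e0_e1]; simp
    rw [neg_mul_neg, h, h']
    have h3 : io m R (e2 R) * (- (io m R (e0 ℓ R) * io m R (e1 R))) * io m R (e1 R)
        = - ((io m R (e2 R) * io m R (e0 ℓ R)) * (io m R (e1 R) * io m R (e1 R))) := by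
      noncomm_ring
    rw [h3, e1_sq, e0_e2]
    simp
  j_mul_i := by
    have h : io m R (e0 ℓ R) * io m R (e1 R) * (io m R (e2 R) * io m R (e1 R)) =
        io m R (e0 ℓ R) * (io m R (e1 R) * io m R (e2 R)) * io m R (e1 R) := by noncomm_ring
    have h' : io m R (e1 R) * io m R (e2 R) =
        (-(cB m : R)) • 1 - io m R (e2 R) * io m R (e1 R) := by rw [e2_e1]; abel
    rw [neg_mul_neg, h, h']
    have h3 : io m R (e0 ℓ R) * ((-(cB m : R)) • 1 - io m R (e2 R) * io m R (e1 R)) * io m R (e1 R)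
        = (-(cB m : R)) • (io m R (e0 ℓ R) * io m R (e1 R)) -
          (io m R (e0 ℓ R) * io m R (e2 R)) * (io m R (e1 R) * io m R (e1 R)) := by
      simp only [mul_sub, sub_mul, mul_assoc, mul_smul_comm, smul_mul_assoc, one_mul]
    rw [h3, e1_sq]
    simp

/-- The isomorphism `B ⊗ R ≅ A⁺(W ⊗ R)`, as an algebra map into `A(V₀ ⊗ R)`. -/
def Psi (m ℓ : ℕ) (R : Type) [Field R] [CharZero R] : BAlg m ℓ R →ₐ[R] Cl m R :=
  (psiBasis m ℓ R).liftHom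

variable {ℓ : ℕ}

lemma Psi_apply (b : BAlg m ℓ R) : Psi m ℓ R b =
    algebraMap R _ b.re + b.imI • -(io m R (e2 R) * io m R (e1 R)) +
    b.imJ • -(io m R (e0 ℓ R) * io m R (e1 R)) + b.imK • -(io m R (e0 ℓ R) * io m R (e2 R)) := rfl

/-- Conjugation of `B` by `e₁`: `a + bε ↦ ā - b̄ε`. -/
def sig (b : BAlg m ℓ R) : BAlg m ℓ R :=
  ⟨b.re + cB m * b.imI, -b.imI, -(b.imJ + cB m * b.imK), b.imK⟩

lemma e1_mul_Psi (b : BAlg m ℓ R) :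
    io m R (e1 R) * Psi m ℓ R b = Psi m ℓ R (sig b) * io m R (e1 R) := by
  have a1 : io m R (e1 R) * (io m R (e2 R) * io m R (e1 R)) =
      (-(cB m : R)) • io m R (e1 R) - io m R (e2 R) * (io m R (e1 R) * io m R (e1 R)) := by
    rw [← mul_assoc, ← mul_assoc]
    have h' : io m R (e1 R) * io m R (e2 R) =
        (-(cB m : R)) • 1 - io m R (e2 R) * io m R (e1 R) := by rw [e2_e1]; abel
    rw [h', sub_mul, smul_mul_assoc, one_mul]
  have a2 : io m R (e1 R) * (io m R (e0 ℓ R) * io m R (e1 R)) =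
      - (io m R (e0 ℓ R) * (io m R (e1 R) * io m R (e1 R))) := by
    rw [← mul_assoc, ← mul_assoc, e0_e1]; simp
  have a3 : io m R (e1 R) * (io m R (e0 ℓ R) * io m R (e2 R)) =
      (cB m : R) • io m R (e0 ℓ R) + io m R (e0 ℓ R) * io m R (e2 R) * io m R (e1 R) := by
    rw [mul_assoc, e2_e1, mul_sub, ← mul_assoc, ← mul_assoc, e0_e1]
    simp
  simp only [Psi_apply, sig, mul_add, add_mul, Algebra.algebraMap_eq_smul_one, mul_smul_comm,
    smul_mul_assoc, mul_neg, neg_mul, a1, a2, a3, mul_one, one_mul, mul_assoc, e1_sq]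
  module

lemma xi0_anticomm {x : Fin 4 → R} (hx : x ∈ W m ℓ R) :
    io m R (xi0 ℓ R) * io m R x = - (io m R x * io m R (xi0 ℓ R)) := by
  rw [io_mul_io_swap]
  have : phi0 m R (xi0 ℓ R) x = 0 := hx
  simp [this]

lemma e0_mem : e0 ℓ R ∈ W m ℓ R := by rw [mem_W]; simp [e0]
lemma e1_mem : e1 R ∈ W m ℓ R := by rw [mem_W]; simp [e1]
lemma e2_mem : e2 R ∈ W m ℓ R := by rw [mem_W]; simp [e2]

lemma xi0_mul_Psi (b : BAlg m ℓ R) :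
    io m R (xi0 ℓ R) * Psi m ℓ R b = Psi m ℓ R b * io m R (xi0 ℓ R) := by
  have a : ∀ x y : Fin 4 → R, x ∈ W m ℓ R → y ∈ W m ℓ R →
      io m R (xi0 ℓ R) * (io m R x * io m R y) = io m R x * io m R y * io m R (xi0 ℓ R) := by
    intro x y hx hy
    rw [← mul_assoc, xi0_anticomm hx, neg_mul, mul_assoc, xi0_anticomm hy, mul_neg, neg_neg,
      mul_assoc]
  simp only [Psi_apply, mul_add, add_mul, Algebra.algebraMap_eq_smul_one, mul_smul_comm,
    smul_mul_assoc, mul_neg, neg_mul, mul_one, one_mul, a _ _ e0_mem e1_mem, a _ _ e0_mem e2_mem,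
    a _ _ e2_mem e1_mem]

/-- The element of `B` with `x = Ψ(wB x) e₁`, for `x ∈ W`. -/
def wB (m ℓ : ℕ) (x : Fin 4 → R) : BAlg m ℓ R := ⟨x 1, x 2, x 0, 0⟩

lemma io_eq_Psi {x : Fin 4 → R} (hx : x ∈ W m ℓ R) :
    io m R x = Psi m ℓ R (wB m ℓ x) * io m R (e1 R) := by
  have h : x = x 0 • e0 ℓ R + x 1 • e1 R + x 2 • e2 R := by
    rw [mem_W] at hx
    ext i
    fin_cases i <;> simp [e0, e1, e2, hx]
    ring
  conv_lhs => rw [h]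
  simp only [Psi_apply, wB, map_add, map_smul, add_mul, Algebra.algebraMap_eq_smul_one,
    smul_mul_assoc, one_mul, neg_mul, mul_assoc, e1_sq]
  simp
  abel

lemma bMat_mul (a b : BAlg m ℓ R) : bMat m ℓ R (a * b) = bMat m ℓ R a * bMat m ℓ R b := by
  ext i j : 1
  fin_cases i <;> fin_cases j <;> simp [bMat, Matrix.mul_apply, Fin.sum_univ_two] <;>
    (ext <;> simp <;> ring)

lemma bMat_one : bMat m ℓ R 1 = 1 := by
  ext i j : 1
  fin_cases i <;> fin_cases j <;> simp [bMat] <;>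
    (ext <;> simp [QuadraticAlgebra.re_one, QuadraticAlgebra.im_one])

lemma bMat_injective : Function.Injective (bMat m ℓ R) := by
  intro a b h
  have h00 := congr_fun (congr_fun h 0) 0
  have h01 := congr_fun (congr_fun h 0) 1
  simp [bMat] at h00 h01
  ext <;> simp [*]

lemma clRep_Psi (b : BAlg m ℓ R) :
    clRep m R (Psi m ℓ R b) = Matrix.fromBlocks (bMat m ℓ R b) 0 0 (theta (bMat m ℓ R b)) := by
  have hp : ∀ x y : Fin 4 → R, clRep m R (io m R x * io m R y) =
      Matrix.fromBlocks (hermL m R x * theta (hermL m R y)) 0 0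
        (theta (hermL m R x * theta (hermL m R y))) := by
    intro x y
    rw [map_mul, clRep_io, clRep_io, Matrix.fromBlocks_multiply, theta_mul, theta_theta]
    simp
  have key : bMat m ℓ R b = algebraMap R _ b.re +
      b.imI • -(hermL m R (e2 R) * theta (hermL m R (e1 R))) +
      b.imJ • -(hermL m R (e0 ℓ R) * theta (hermL m R (e1 R))) +
      b.imK • -(hermL m R (e0 ℓ R) * theta (hermL m R (e2 R))) := by
    ext i j : 1
    fin_cases i <;> fin_cases j <;>
      simp [bMat, hermL_apply, theta, e0, e1, e2, Matrix.algebraMap_matrix_apply] <;>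
      (ext <;> simp <;> ring)
  rw [key, Psi_apply]
  simp only [map_add, map_smul, map_neg, hp, theta_add, theta_smul, theta_neg, theta_algebraMap,
    AlgHom.commutes]
  simp [Matrix.fromBlocks_add, Matrix.fromBlocks_smul, Matrix.fromBlocks_neg,
    Algebra.algebraMap_eq_smul_one, ← Matrix.fromBlocks_one]

lemma Xi_Psi (b : BAlg m ℓ R) : Xi m R (Psi m ℓ R b) = bMat m ℓ R b := by
  rw [Xi, clRep_Psi, Matrix.toBlocks_fromBlocks₁₁]

lemma Psi_injective : Function.Injective (Psi m ℓ R) := by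
  intro a b h
  apply bMat_injective
  rw [← Xi_Psi, h, Xi_Psi]

end psi

/-! ### The matrix model is faithful -/

section span
variable {m ℓ : ℕ} {R : Type} [Field R] [CharZero R]

/-- `A(V₀) = A(W) ⊕ A(W) ξ` and `A(W) = A⁺(W) ⊕ A⁺(W) e₁`. -/
lemma exists_Psi_decomp (hℓ : 0 < ℓ) (x : Cl m R) : ∃ b₁ b₂ b₃ b₄ : BAlg m ℓ R,
    x = Psi m ℓ R b₁ + Psi m ℓ R b₂ * io m R (e1 R) + Psi m ℓ R b₃ * io m R (xi0 ℓ R) +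
      Psi m ℓ R b₄ * (io m R (e1 R) * io m R (xi0 ℓ R)) := by
  have hℓR : (ℓ : R) ≠ 0 := by exact_mod_cast hℓ.ne'
  induction x using CliffordAlgebra.left_induction with
  | algebraMap r =>
    exact ⟨algebraMap R _ r, 0, 0, 0, by
      simp only [map_zero, zero_mul, add_zero, AlgHom.commutes]⟩
  | add x y hx hy =>
    obtain ⟨b₁, b₂, b₃, b₄, rfl⟩ := hx
    obtain ⟨c₁, c₂, c₃, c₄, rfl⟩ := hy
    refine ⟨b₁ + c₁, b₂ + c₂, b₃ + c₃, b₄ + c₄, ?_⟩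
    simp only [map_add, add_mul]
    abel
  | ι_mul x v hx =>
    obtain ⟨b₁, b₂, b₃, b₄, rfl⟩ := hx
    set c : R := (v 3 + ℓ * v 0) / (2 * ℓ) with hc
    have hw : v - c • xi0 ℓ R ∈ W m ℓ R := by
      rw [mem_W]
      simp [xi0, hc]
      field_simp
      ring
    have hv : io m R v = Psi m ℓ R (wB m ℓ (v - c • xi0 ℓ R)) * io m R (e1 R) +
        c • io m R (xi0 ℓ R) := by
      rw [← io_eq_Psi hw, map_sub, map_smul]
      abel
    set w := wB m ℓ (v - c • xi0 ℓ R)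
    have h1 : ∀ b : BAlg m ℓ R, ∀ z : Cl m R, io m R (e1 R) * (Psi m ℓ R b * z) =
        Psi m ℓ R (sig b) * (io m R (e1 R) * z) := by
      intro b z
      rw [← mul_assoc, e1_mul_Psi, mul_assoc]
    have h2 : ∀ b : BAlg m ℓ R, ∀ z : Cl m R, io m R (xi0 ℓ R) * (Psi m ℓ R b * z) =
        Psi m ℓ R b * (io m R (xi0 ℓ R) * z) := by
      intro b z
      rw [← mul_assoc, xi0_mul_Psi, mul_assoc]
    have h3 : ∀ z : Cl m R, io m R (e1 R) * (io m R (e1 R) * z) = - z := by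
      intro z
      rw [← mul_assoc, e1_sq, neg_one_mul]
    have h4 : ∀ z : Cl m R, io m R (xi0 ℓ R) * (io m R (e1 R) * z) =
        - (io m R (e1 R) * (io m R (xi0 ℓ R) * z)) := by
      intro z
      rw [← mul_assoc, xi0_anticomm e1_mem, neg_mul, mul_assoc]
    change ∃ b₁' b₂' b₃' b₄' : BAlg m ℓ R, io m R v * _ = _
    refine ⟨w * (-sig b₂) + (c * ℓ) • b₃, w * sig b₁ - (c * ℓ) • b₄, -(w * sig b₄) + c • b₁,
      w * sig b₃ - c • b₂, ?_⟩
    rw [hv]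
    simp only [mul_add, add_mul, mul_assoc, h1, h2, h3, h4, e1_mul_Psi, xi0_mul_Psi, e1_sq, xi0_sq,
      smul_mul_assoc, map_add, map_sub, map_mul, map_smul, map_neg, sub_mul, mul_neg, neg_mul,
      mul_smul_comm, mul_one, xi0_anticomm (ℓ := ℓ) (m := m) e1_mem]
    module

/-- The matrix model is faithful; the decomposition of `exists_Psi_decomp` is needed only for
`ℓ = 1`. -/
lemma clRep_injective (m : ℕ) (R : Type) [Field R] [CharZero R] :
    Function.Injective (clRep m R) := by
  rw [injective_iff_map_eq_zero]
  intro x hx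
  obtain ⟨b₁, b₂, b₃, b₄, rfl⟩ := exists_Psi_decomp (ℓ := 1) one_pos x
  simp only [map_add, map_mul, clRep_Psi, clRep_io, Matrix.fromBlocks_multiply,
    Matrix.fromBlocks_add] at hx
  rw [← Matrix.fromBlocks_zero, Matrix.fromBlocks_inj] at hx
  obtain ⟨h1, h2, -, -⟩ := hx
  have d : ∀ a b : BAlg m 1 R, bMat m 1 R a + bMat m 1 R b * !![0, 1; 1, 0] = 0 →
      a = 0 ∧ b = 0 := by
    intro a b h
    have h00 := congr_fun (congr_fun h 0) 0
    have h01 := congr_fun (congr_fun h 0) 1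
    have h10 := congr_fun (congr_fun h 1) 0
    have h11 := congr_fun (congr_fun h 1) 1
    simp [bMat, QuadraticAlgebra.ext_iff] at h00 h01 h10 h11
    have two : ∀ z : R, 2 * z = 0 → z = 0 := fun z hz => by simpa using hz
    have a1 : a.imI = 0 := two _ (by linear_combination h00.2 - h11.2)
    have b1 : b.imK = 0 := by linear_combination h00.2 - a1
    have a2 : a.re = 0 := two _ (by
      linear_combination h00.1 + h11.1 - (cB m : R) * a1 + (cB m : R) * b1)
    have b2 : b.imJ = 0 := by linear_combination h00.1 - a2
    have a3 : a.imK = 0 := two _ (by linear_combination h01.2 + h10.2)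
    have b3 : b.imI = 0 := by linear_combination h01.2 - a3
    have a4 : a.imJ = 0 := two _ (by
      linear_combination h01.1 - h10.1 - (cB m : R) * a3 + (cB m : R) * b3)
    have b4 : b.re = 0 := by linear_combination h01.1 - a4
    exact ⟨by ext <;> simp [*], by ext <;> simp [*]⟩
  have hX : hermL m R (e1 R) * theta (hermL m R (xi0 1 R)) = !![0, 1; 1, 0] := by
    ext i j : 1
    fin_cases i <;> fin_cases j <;>
      simp [hermL_apply, theta, e1, xi0] <;>
      (ext <;> simp [QuadraticAlgebra.re_one, QuadraticAlgebra.im_one])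
  have h1' := d b₁ b₄ (by simpa [hX] using h1)
  have he : hermL m R (e1 R) = !![0, 1; 1, 0] := by
    ext i j : 1
    fin_cases i <;> fin_cases j <;>
      simp [hermL_apply, e1] <;>
      (ext <;> simp [QuadraticAlgebra.re_one, QuadraticAlgebra.im_one])
  have hxi : hermL m R (xi0 1 R) = 1 := by
    ext i j : 1
    fin_cases i <;> fin_cases j <;>
      simp [hermL_apply, xi0] <;>
      (ext <;> simp [QuadraticAlgebra.re_one, QuadraticAlgebra.im_one])
  have h2' := d b₃ b₂ (by
    rw [he, hxi] at h2
    simpa [add_comm] using h2)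
  simp [h1', h2']

lemma io_injective (m : ℕ) (R : Type) [Field R] [CharZero R] :
    Function.Injective (io m R) := by
  intro x y h
  have := congr_arg (clRep m R) h
  rw [clRep_io, clRep_io, Matrix.fromBlocks_inj] at this
  exact hermL_injective this.2.1

lemma algebraMap_cl_injective (m : ℕ) (R : Type) [Field R] [CharZero R] :
    Function.Injective (algebraMap R (Cl m R)) := by
  have : Nontrivial (Cl m R) := ⟨io m R (e1 R), 0, fun h => by
    have := io_injective m R (h.trans (map_zero _).symm)
    simpa [e1] using congr_fun this 1⟩
  exact (algebraMap R (Cl m R)).injective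

/-- `x` is the element of `A⁺(V₀)` represented by `g`. -/
def IsRep (m : ℕ) (R : Type) [Field R] [CharZero R] (x : Cl m R)
    (g : Matrix (Fin 2) (Fin 2) (KAlg m R)) : Prop :=
  clRep m R x = Matrix.fromBlocks g 0 0 (theta g)

lemma IsRep.Xi_eq {x : Cl m R} {g : Matrix (Fin 2) (Fin 2) (KAlg m R)} (h : IsRep m R x g) :
    Xi m R x = g := by
  rw [Xi, h, Matrix.toBlocks_fromBlocks₁₁]

lemma isRep_Psi (b : BAlg m ℓ R) : IsRep m R (Psi m ℓ R b) (bMat m ℓ R b) := clRep_Psi b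

lemma isRep_one : IsRep m R 1 1 := by
  rw [IsRep, map_one, theta_one, Matrix.fromBlocks_one]

lemma IsRep.mul {x y : Cl m R} {g h : Matrix (Fin 2) (Fin 2) (KAlg m R)} (hx : IsRep m R x g)
    (hy : IsRep m R y h) : IsRep m R (x * y) (g * h) := by
  rw [IsRep, map_mul, hx, hy, Matrix.fromBlocks_multiply, theta_mul]
  simp

lemma IsRep.eq {x y : Cl m R} {g : Matrix (Fin 2) (Fin 2) (KAlg m R)} (hx : IsRep m R x g)
    (hy : IsRep m R y g) : x = y :=
  clRep_injective m R (Eq.trans hx (Eq.symm hy))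

lemma IsRep.involute {x : Cl m R} {g : Matrix (Fin 2) (Fin 2) (KAlg m R)} (h : IsRep m R x g) :
    CliffordAlgebra.involute x = x := by
  apply clRep_injective m R
  obtain ⟨g', k, h1, -, h3⟩ := clRep_shape x
  rw [h3, h1]
  rw [IsRep, h1, Matrix.fromBlocks_inj] at h
  rw [h.2.1, neg_zero]

lemma IsRep.reverse {x : Cl m R} {g : Matrix (Fin 2) (Fin 2) (KAlg m R)} (h : IsRep m R x g) :
    IsRep m R (CliffordAlgebra.reverse x) g.adjugate := by
  obtain ⟨g', k, h1, h2, -⟩ := clRep_shape x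
  rw [IsRep, h1, Matrix.fromBlocks_inj] at h
  rw [IsRep, h2, h.1, h.2.1]
  simp

lemma isRep_algebraMap (r : R) : IsRep m R (algebraMap R _ r) (algebraMap R _ r) := by
  rw [IsRep, AlgHom.commutes, theta_algebraMap]
  simp [Algebra.algebraMap_eq_smul_one, ← Matrix.fromBlocks_one, Matrix.fromBlocks_smul]

lemma algebraMap_mat (r : R) : algebraMap R (Matrix (Fin 2) (Fin 2) (KAlg m R)) r =
    (algebraMap R (KAlg m R) r) • 1 := by
  rw [Algebra.algebraMap_eq_smul_one, Algebra.algebraMap_eq_smul_one, smul_assoc, one_smul]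

lemma IsRep.mul_reverse {x : Cl m R} {g : Matrix (Fin 2) (Fin 2) (KAlg m R)} {r : R}
    (h : IsRep m R x g) (hr : g.det = algebraMap R _ r) :
    algebraMap R (Cl m R) r = x * CliffordAlgebra.reverse x := by
  refine (isRep_algebraMap r).eq ?_
  have := h.mul h.reverse
  rwa [Matrix.mul_adjugate, hr, ← algebraMap_mat] at this

lemma IsRep.nu {x : Cl m R} {g : Matrix (Fin 2) (Fin 2) (KAlg m R)} {r : R}
    (h : IsRep m R x g) (hr : g.det = algebraMap R _ r) : nu m R x = r := by
  have hex : ∃ r : R, algebraMap R (Cl m R) r = x * CliffordAlgebra.reverse x :=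
    ⟨r, h.mul_reverse hr⟩
  unfold HermZeta.nu
  rw [dif_pos hex]
  exact algebraMap_cl_injective m R (hex.choose_spec.trans (h.mul_reverse hr).symm)

/-- Every `2 × 2` matrix represents an even element, because `M₂(K ⊗ R) = B + B e₁ξ`. -/
lemma exists_isRep (g : Matrix (Fin 2) (Fin 2) (KAlg m R)) : ∃ x : Cl m R, IsRep m R x g := by
  have hp : IsRep m R (io m R (e1 R) * io m R (xi0 1 R)) !![0, 1; 1, 0] := by
    rw [IsRep, map_mul, clRep_io, clRep_io, Matrix.fromBlocks_multiply]
    congr 1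
    · ext i j : 1
      fin_cases i <;> fin_cases j <;>
        simp [hermL_apply, theta, e1, xi0] <;>
        (ext <;> simp [QuadraticAlgebra.re_one, QuadraticAlgebra.im_one])
    · simp
    · simp
    · ext i j : 1
      fin_cases i <;> fin_cases j <;>
        simp [hermL_apply, theta, e1, xi0] <;>
        (ext <;> simp [QuadraticAlgebra.re_one, QuadraticAlgebra.im_one])
  set p := g 0 0
  set q := g 0 1
  set r := star (g 1 0)
  set s := star (g 1 1)
  let b₁ : BAlg m 1 R := ⟨(p + s).re / 2, (p + s).im / 2, (q - r).re / 2, (q - r).im / 2⟩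
  let b₄ : BAlg m 1 R := ⟨(q + r).re / 2, (q + r).im / 2, (p - s).re / 2, (p - s).im / 2⟩
  refine ⟨Psi m 1 R b₁ + Psi m 1 R b₄ * (io m R (e1 R) * io m R (xi0 1 R)), ?_⟩
  have hg : g = bMat m 1 R b₁ + bMat m 1 R b₄ * !![0, 1; 1, 0] := by
    have h2 : (2 : R) ≠ 0 := two_ne_zero
    ext i j : 1
    fin_cases i <;> fin_cases j <;>
      simp [bMat, b₁, b₄, p, q, r, s] <;>
      (ext <;> simp <;> field_simp <;> ring)
  rw [hg, IsRep, map_add, clRep_Psi, (isRep_Psi b₄).mul hp, Matrix.fromBlocks_add, theta_add]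
  simp

lemma IsRep.inv {α : (Cl m R)ˣ} {g g' : Matrix (Fin 2) (Fin 2) (KAlg m R)}
    (h : IsRep m R (α : Cl m R) g) (hg : g * g' = 1) :
    IsRep m R ((α⁻¹ : (Cl m R)ˣ) : Cl m R) g' := by
  obtain ⟨x, hx⟩ := exists_isRep g'
  have : (α : Cl m R) * x = 1 := (h.mul hx).eq (hg ▸ isRep_one)
  have hx' : x = ((α⁻¹ : (Cl m R)ˣ) : Cl m R) := by
    rw [← mul_one ((α⁻¹ : (Cl m R)ˣ) : Cl m R), ← this, Units.inv_mul_cancel_left]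
  rwa [← hx']

end span

section disc
variable (m : ℕ) [NeZero m]

lemma disc_lt (m : ℕ) [NeZero m] : cB m ^ 2 + 4 * cA m < 0 := by
  have hm : 0 < m := Nat.pos_of_ne_zero (NeZero.ne m)
  unfold cA cB
  split_ifs with h <;> omega

end disc

/-! ### The action of matrices on the quadratic space -/

section tau
variable {m ℓ : ℕ} [NeZero m] {R : Type} [Field R] [CharZero R]

lemma disc_ne : ((cB m : R) ^ 2 + 4 * (cA m : R)) ≠ 0 := by
  have := (disc_lt m).ne
  exact_mod_cast this

/-- Over `K ⊗ K ≅ K × K` the map `h ↦ g h g^*` becomes `X ↦ g X ḡᵗ`, whose matrix is the Kronecker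
product of `g` and `ḡ`. -/
lemma det_actMat (g : Matrix (Fin 2) (Fin 2) (KAlg m R)) :
    algebraMap R (KAlg m R) (actMat g).det = g.det ^ 2 * star g.det ^ 2 := by
  let e : Fin 4 ≃ Fin 2 × Fin 2 := (finProdFinEquiv (m := 2) (n := 2)).symm
  -- `P` is the base change from the coordinates of `V₀` to the matrix entries, and `(det P)² ∈ R`
  let P : Matrix (Fin 4) (Fin 4) (KAlg m R) :=
    Matrix.of fun i j => hermL m R (Pi.single j 1) (e i).1 (e i).2
  let G : Matrix (Fin 4) (Fin 4) (KAlg m R) :=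
    (Matrix.kroneckerMap (· * ·) g (g.map star)).submatrix e e
  have hG : G.det = g.det ^ 2 * star g.det ^ 2 := by
    have hs : (g.map star).det = star g.det := by
      simp [Matrix.det_fin_two]
    have := Matrix.det_kronecker g (g.map star)
    simp only [Fintype.card_fin, hs] at this
    rw [← this]
    exact Matrix.det_submatrix_equiv_self e _
  have hP : P.det = ⟨cB m, -2⟩ := by
    have he : ∀ i : Fin 4, e i = ![(0, 0), (0, 1), (1, 0), (1, 1)] i := by decide
    have hPe : P = !![1, 0, 0, 0; 0, 1, ⟨0, 1⟩, 0; 0, 1, star ⟨0, 1⟩, 0; 0, 0, 0, 1] := by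
      ext i j : 1
      fin_cases i <;> fin_cases j <;>
        simp [P, he, hermL_apply] <;>
        (ext <;> simp [QuadraticAlgebra.re_one, QuadraticAlgebra.im_one])
    rw [hPe, Matrix.det_succ_row_zero]
    simp [Fin.sum_univ_succ, Matrix.det_fin_three]
    norm_num
  have key : P * (actMat g).map (algebraMap R (KAlg m R)) = G * P := by
    ext i j : 1
    have h1 : (P * (actMat g).map (algebraMap R (KAlg m R))) i j =
        hermL m R ((actMat g).mulVec (Pi.single j 1)) (e i).1 (e i).2 := by
      have h2 : (actMat g).mulVec (Pi.single j 1) =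
          ∑ k, (actMat g k j) • (Pi.single k 1 : Fin 4 → R) := by
        ext k
        simp [Pi.single_apply]
      rw [h2, map_sum, Matrix.sum_apply, Matrix.mul_apply]
      refine Finset.sum_congr rfl fun k _ => ?_
      rw [map_smul, Matrix.smul_apply, Algebra.smul_def, mul_comm]
      rfl
    rw [h1, hermL_actMat]
    have h3 : (G * P) i j = ∑ x : Fin 2 × Fin 2, g (e i).1 x.1 * star (g (e i).2 x.2) *
        hermL m R (Pi.single j 1) x.1 x.2 := by
      rw [Matrix.mul_apply, ← e.sum_comp]
      rfl
    rw [h3, Fintype.sum_prod_type]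
    simp [Matrix.mul_apply, Fin.sum_univ_two]
    ring
  have hdet := congr_arg Matrix.det key
  have hmap : ((actMat g).map (algebraMap R (KAlg m R))).det =
      algebraMap R (KAlg m R) (actMat g).det := by
    rw [RingHom.map_det]; rfl
  rw [Matrix.det_mul, Matrix.det_mul, hmap, hG, hP] at hdet
  have hD : (⟨cB m, -2⟩ : KAlg m R) * ⟨cB m, -2⟩ =
      algebraMap R _ ((cB m : R) ^ 2 + 4 * (cA m : R)) := by
    rw [QuadraticAlgebra.algebraMap_eq, QuadraticAlgebra.mk_mul_mk]
    congr 1 <;> ring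
  have h5 : ((cB m : R) ^ 2 + 4 * (cA m : R)) • (algebraMap R (KAlg m R) (actMat g).det) =
      ((cB m : R) ^ 2 + 4 * (cA m : R)) • (g.det ^ 2 * star g.det ^ 2) := by
    rw [Algebra.smul_def, Algebra.smul_def, ← hD, mul_assoc, mul_assoc, hdet]
    ring
  exact smul_right_injective _ disc_ne h5

lemma actMat_Q0 (g : Matrix (Fin 2) (Fin 2) (KAlg m R)) {r : R} (h : g.det = algebraMap R _ r)
    (x : Fin 4 → R) : Q0 m R ((actMat g).mulVec x) = r ^ 2 * Q0 m R x := by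
  apply QuadraticAlgebra.algebraMap_injective (a := (cA m : R)) (b := (cB m : R))
  rw [← det_hermL, hermL_actMat, Matrix.det_mul, Matrix.det_mul, Matrix.det_conjTranspose, h,
    map_mul, ← det_hermL]
  have : star (algebraMap R (KAlg m R) r) = algebraMap R _ r := star_mk0 r
  rw [this, map_pow]
  ring

lemma mem_SO0_of_Q0 {γ : Matrix.SpecialLinearGroup (Fin 4) R}
    (h : ∀ x, Q0 m R (γ.1.mulVec x) = Q0 m R x) : γ ∈ SO0 m R := by
  have h2 : (2 : R) ≠ 0 := two_ne_zero
  have hb : ∀ x y, phi0 m R (γ.1.mulVec x) (γ.1.mulVec y) = phi0 m R x y := by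
    intro x y
    have e : ∀ a b : Fin 4 → R, 2 * phi0 m R a b = Q0 m R (a + b) - Q0 m R a - Q0 m R b := by
      intro a b
      simp only [Q0_apply, phi0_apply, Pi.add_apply]
      field_simp
      ring
    have : 2 * phi0 m R (γ.1.mulVec x) (γ.1.mulVec y) = 2 * phi0 m R x y := by
      rw [e, e, ← Matrix.mulVec_add, h, h, h]
    exact mul_left_cancel₀ h2 this
  change γ.1.transpose * S0R m R * γ.1 = S0R m R
  have hS : ∀ x y : Fin 4 → R, x ⬝ᵥ (S0R m R).mulVec y = 2 * phi0 m R x y := by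
    intro x y
    rw [phi0, Matrix.toBilin'_apply', Matrix.smul_mulVec, dotProduct_smul]
    simp
  apply Matrix.toBilin'.injective
  ext i j
  simp only [LinearMap.comp_apply, LinearMap.coe_single, Matrix.toBilin'_apply']
  rw [← Matrix.mulVec_mulVec, ← Matrix.mulVec_mulVec, Matrix.dotProduct_mulVec,
    Matrix.vecMul_transpose, hS, hS, hb]

lemma SO0_phi0 {γ : Matrix.SpecialLinearGroup (Fin 4) R} (h : γ ∈ SO0 m R) (x y : Fin 4 → R) :
    phi0 m R (γ.1.mulVec x) (γ.1.mulVec y) = phi0 m R x y := by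
  have h' : γ.1.transpose * S0R m R * γ.1 = S0R m R := h
  have hS : ∀ x y : Fin 4 → R, phi0 m R x y = (1 / 2) * (x ⬝ᵥ (S0R m R).mulVec y) := by
    intro x y
    rw [phi0, Matrix.toBilin'_apply', Matrix.smul_mulVec, dotProduct_smul, smul_eq_mul]
  rw [hS, hS, ← Matrix.vecMul_transpose, ← Matrix.dotProduct_mulVec, Matrix.mulVec_mulVec,
    Matrix.mulVec_mulVec, h']

lemma SO0_Q0 {γ : Matrix.SpecialLinearGroup (Fin 4) R} (h : γ ∈ SO0 m R) (x : Fin 4 → R) :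
    Q0 m R (γ.1.mulVec x) = Q0 m R x := by
  rw [← phi0_self, SO0_phi0 h, phi0_self]

/-- The element `h ↦ g h g^* / det g` of `SO(V₀)`. -/
def tauSL (g : Matrix (Fin 2) (Fin 2) (KAlg m R)) {r : R} (hr : r ≠ 0)
    (h : g.det = algebraMap R _ r) : Matrix.SpecialLinearGroup (Fin 4) R :=
  ⟨r⁻¹ • actMat g, by
    have h1 := det_actMat g
    have hst : star (algebraMap R (KAlg m R) r) = algebraMap R _ r := star_mk0 r
    rw [h, hst, ← map_pow, ← map_mul] at h1
    rw [Matrix.det_smul, QuadraticAlgebra.algebraMap_injective h1, Fintype.card_fin]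
    field_simp⟩

variable {g : Matrix (Fin 2) (Fin 2) (KAlg m R)} {r : R} (hr : r ≠ 0)
  (h : g.det = algebraMap R _ r)

lemma tauSL_mulVec (x : Fin 4 → R) : (tauSL g hr h).1.mulVec x = r⁻¹ • (actMat g).mulVec x := by
  rw [tauSL, Matrix.smul_mulVec]

lemma hermL_tauSL (x : Fin 4 → R) :
    hermL m R ((tauSL g hr h).1.mulVec x) = r⁻¹ • (g * hermL m R x * g.conjTranspose) := by
  rw [tauSL_mulVec, map_smul, hermL_actMat]

lemma tauSL_mem_SO0 : tauSL g hr h ∈ SO0 m R := by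
  apply mem_SO0_of_Q0
  intro x
  rw [tauSL_mulVec, QuadraticMap.map_smul, actMat_Q0 g h]
  simp only [smul_eq_mul]
  field_simp

lemma IsRep.isTau {α : (Cl m R)ˣ} (hα : IsRep m R (α : Cl m R) g) :
    IsTau m R α (tauSL g hr h) := by
  intro x
  have : (α : Cl m R) * io m R x = io m R ((tauSL g hr h).1.mulVec x) * α := by
    apply clRep_injective m R
    rw [map_mul, map_mul, hα, clRep_io, clRep_io, Matrix.fromBlocks_multiply,
      Matrix.fromBlocks_multiply, hermL_tauSL, theta_smul, theta_mul, theta_mul]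
    have h1 : g.conjTranspose * theta g = algebraMap R _ r := by
      rw [theta_eq, ← Matrix.conjTranspose_mul, Matrix.adjugate_mul, h,
        Matrix.conjTranspose_smul, Matrix.conjTranspose_one, algebraMap_mat]
      congr 1
      exact star_mk0 r
    have h2 : theta g.conjTranspose * g = algebraMap R _ r := by
      have : theta g.conjTranspose = g.adjugate := by
        ext i j : 1
        fin_cases i <;> fin_cases j <;> simp [theta, Matrix.adjugate_fin_two]
      rw [this, Matrix.adjugate_mul, h, algebraMap_mat]
    congr 1
    · simp
    · simp only [Matrix.zero_mul, zero_add, add_zero, Matrix.smul_mul, Matrix.mul_assoc, h1]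
      simp [Algebra.algebraMap_eq_smul_one, smul_smul, inv_mul_cancel₀ hr]
    · simp only [Matrix.zero_mul, zero_add, add_zero, Matrix.smul_mul, Matrix.mul_assoc, h2]
      simp [Algebra.algebraMap_eq_smul_one, smul_smul, inv_mul_cancel₀ hr]
    · simp
  rw [this, Units.mul_inv_cancel_right]

end tau

/-! ### The group `G⁺(W)` and the quaternion algebra -/

section gw
variable {m ℓ : ℕ} {R : Type} [Field R] [CharZero R]

lemma IsTau.unique {α : (Cl m R)ˣ} {g g' : Matrix.SpecialLinearGroup (Fin 4) R}
    (h : IsTau m R α g) (h' : IsTau m R α g') : g = g' := by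
  apply Subtype.ext
  apply Matrix.ext_of_mulVec_single
  intro i
  exact io_injective m R ((h _).symm.trans (h' _))

lemma IsTau.mul {α β : (Cl m R)ˣ} {g g' : Matrix.SpecialLinearGroup (Fin 4) R}
    (h : IsTau m R α g) (h' : IsTau m R β g') : IsTau m R (α * β) (g * g') := by
  intro x
  rw [Matrix.SpecialLinearGroup.coe_mul, ← Matrix.mulVec_mulVec, ← h, ← h']
  simp only [mul_inv_rev, Units.val_mul, mul_assoc]

lemma IsTau.inv {α : (Cl m R)ˣ} {g : Matrix.SpecialLinearGroup (Fin 4) R}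
    (h : IsTau m R α g) : IsTau m R α⁻¹ g⁻¹ := by
  intro x
  have := h ((g⁻¹).1.mulVec x)
  rw [mulVec_inv_mulVec] at this
  rw [← this]
  simp [mul_assoc]

/-- An even unit whose conjugation stabilises `V` lies in `G⁺(V)`. -/
lemma mem_Gplus_of_isTau {V : Submodule R (Fin 4 → R)} {α : (Cl m R)ˣ}
    {g : Matrix.SpecialLinearGroup (Fin 4) R} (h1 : (α : Cl m R) ∈ evenSub m R V)
    (h2 : ((α⁻¹ : (Cl m R)ˣ) : Cl m R) ∈ evenSub m R V) (h : IsTau m R α g)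
    (hV : ∀ x, g.1.mulVec x ∈ V ↔ x ∈ V) : α ∈ Gplus m R V := by
  refine ⟨h1, h2, fun z => ⟨?_, ?_⟩⟩
  · rintro ⟨x, hx, hxz⟩
    have hh := h.inv x
    rw [hxz, inv_inv] at hh
    refine ⟨(g⁻¹).1.mulVec x, ?_, ?_⟩
    · change (g⁻¹).1.mulVec x ∈ V
      rwa [← hV, mulVec_inv_mulVec]
    · rw [← hh]
      simp [mul_assoc]
  · rintro ⟨x, hx, rfl⟩
    exact ⟨_, (hV x).2 hx, (h x).symm⟩

lemma mem_evenSub_top {x : Cl m R} (h : CliffordAlgebra.involute x = x) :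
    x ∈ evenSub m R ⊤ := by
  refine ⟨?_, h⟩
  have : (io m R '' ((⊤ : Submodule R (Fin 4 → R)) : Set (Fin 4 → R))) = Set.range (io m R) := by
    simp
  rw [this]
  change x ∈ Algebra.adjoin R (Set.range (CliffordAlgebra.ι (Q0 m R)))
  rw [CliffordAlgebra.adjoin_range_ι]
  trivial

lemma inv_mul_smul_adjugate {g : Matrix (Fin 2) (Fin 2) (KAlg m R)} {r : R} (hr : r ≠ 0)
    (h : g.det = algebraMap R _ r) : g * (r⁻¹ • g.adjugate) = 1 := by
  rw [mul_smul_comm, Matrix.mul_adjugate, h, algebraMap_smul, smul_smul, inv_mul_cancel₀ hr,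
    one_smul]

lemma IsRep.mem_Gplus_top [NeZero m] {α : (Cl m R)ˣ} {g : Matrix (Fin 2) (Fin 2) (KAlg m R)} {r : R}
    (hα : IsRep m R (α : Cl m R) g) (hr : r ≠ 0) (h : g.det = algebraMap R _ r) :
    α ∈ Gplus m R ⊤ :=
  mem_Gplus_of_isTau (mem_evenSub_top hα.involute)
    (mem_evenSub_top (hα.inv (inv_mul_smul_adjugate hr h)).involute) (hα.isTau hr h) (by simp)

lemma det_bMat (b : BAlg m ℓ R) : (bMat m ℓ R b).det = algebraMap R _ (nrd m ℓ R b) := by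
  rw [Matrix.det_fin_two]
  ext <;> simp [bMat, nrd] <;> ring

lemma nrd_mul (a b : BAlg m ℓ R) : nrd m ℓ R (a * b) = nrd m ℓ R a * nrd m ℓ R b := by
  apply QuadraticAlgebra.algebraMap_injective (a := (cA m : R)) (b := (cB m : R))
  rw [map_mul, ← det_bMat, ← det_bMat, ← det_bMat, bMat_mul, Matrix.det_mul]

lemma nrd_one : nrd m ℓ R 1 = 1 := by
  apply QuadraticAlgebra.algebraMap_injective (a := (cA m : R)) (b := (cB m : R))
  rw [← det_bMat, bMat_one, Matrix.det_one, map_one]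

lemma nrd_unit_ne_zero (u : (BAlg m ℓ R)ˣ) : nrd m ℓ R (u : BAlg m ℓ R) ≠ 0 := by
  intro h
  have := nrd_mul (u : BAlg m ℓ R) ((u⁻¹ : (BAlg m ℓ R)ˣ) : BAlg m ℓ R)
  rw [Units.mul_inv, nrd_one, h, zero_mul] at this
  exact one_ne_zero this

/-- `τ(u) ∈ H(ξ)` for `u ∈ B^×`. -/
def tauB [NeZero m] (u : (BAlg m ℓ R)ˣ) : Matrix.SpecialLinearGroup (Fin 4) R :=
  tauSL (bMat m ℓ R (u : BAlg m ℓ R)) (nrd_unit_ne_zero u) (det_bMat _)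

lemma tauB_mem_H [NeZero m] (u : (BAlg m ℓ R)ˣ) : tauB u ∈ H m ℓ R := by
  refine ⟨tauSL_mem_SO0 _ _, ?_⟩
  apply hermL_injective (m := m)
  rw [tauB, hermL_tauSL]
  have : bMat m ℓ R (u : BAlg m ℓ R) * hermL m R (xi0 ℓ R) *
      (bMat m ℓ R (u : BAlg m ℓ R)).conjTranspose =
      nrd m ℓ R (u : BAlg m ℓ R) • hermL m R (xi0 ℓ R) := by
    ext i j : 1
    fin_cases i <;> fin_cases j <;>
      simp [bMat, hermL_apply, xi0, nrd, Matrix.mul_apply, Fin.sum_univ_two] <;>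
      (ext <;> simp <;> ring)
  rw [this, smul_smul, inv_mul_cancel₀ (nrd_unit_ne_zero u), one_smul]

/-- `H(ξ)` preserves `W = ξ^⊥`. -/
lemma H_mem_W_iff [NeZero m] {g : Matrix.SpecialLinearGroup (Fin 4) R} (hg : g ∈ H m ℓ R)
    (x : Fin 4 → R) :
    g.1.mulVec x ∈ W m ℓ R ↔ x ∈ W m ℓ R := by
  have := SO0_phi0 hg.1 (xi0 ℓ R) x
  rw [hg.2] at this
  simp only [W, LinearMap.mem_ker, this]

lemma io_mem_adjoin {V : Submodule R (Fin 4 → R)} {x : Fin 4 → R} (hx : x ∈ V) :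
    io m R x ∈ Algebra.adjoin R (io m R '' (V : Set (Fin 4 → R))) :=
  Algebra.subset_adjoin ⟨x, hx, rfl⟩

lemma Psi_mem_evenSub (b : BAlg m ℓ R) : Psi m ℓ R b ∈ evenSub m R (W m ℓ R) := by
  refine ⟨?_, (isRep_Psi b).involute⟩
  change _ ∈ Algebra.adjoin R _
  rw [Psi_apply]
  have h0 := io_mem_adjoin (m := m) (e0_mem (m := m) (ℓ := ℓ) (R := R))
  have h1 := io_mem_adjoin (m := m) (e1_mem (m := m) (ℓ := ℓ) (R := R))
  have h2 := io_mem_adjoin (m := m) (e2_mem (m := m) (ℓ := ℓ) (R := R))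
  refine add_mem (add_mem (add_mem (Subalgebra.algebraMap_mem _ _) ?_) ?_) ?_ <;>
    refine Subalgebra.smul_mem _ (neg_mem (mul_mem ?_ ?_)) _ <;> assumption

/-- `Ψ` on unit groups. -/
def PsiU (m ℓ : ℕ) (R : Type) [Field R] [CharZero R] : (BAlg m ℓ R)ˣ →* (Cl m R)ˣ :=
  Units.map (Psi m ℓ R : BAlg m ℓ R →* Cl m R)

lemma PsiU_coe (u : (BAlg m ℓ R)ˣ) : ((PsiU m ℓ R u : (Cl m R)ˣ) : Cl m R) = Psi m ℓ R u := rfl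

lemma isRep_PsiU (u : (BAlg m ℓ R)ˣ) :
    IsRep m R (PsiU m ℓ R u : Cl m R) (bMat m ℓ R (u : BAlg m ℓ R)) := isRep_Psi _

lemma PsiU_injective : Function.Injective (PsiU m ℓ R) := by
  intro u v h
  apply Units.ext
  exact Psi_injective (congr_arg (fun a : (Cl m R)ˣ => (a : Cl m R)) h)

lemma isTau_PsiU [NeZero m] (u : (BAlg m ℓ R)ˣ) : IsTau m R (PsiU m ℓ R u) (tauB u) :=
  (isRep_PsiU u).isTau _ _

lemma PsiU_mem_GW [NeZero m] (u : (BAlg m ℓ R)ˣ) : PsiU m ℓ R u ∈ GW m ℓ R := by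
  refine mem_Gplus_of_isTau (Psi_mem_evenSub _) ?_ (isTau_PsiU u) (H_mem_W_iff (tauB_mem_H u))
  rw [← map_inv, PsiU_coe]
  exact Psi_mem_evenSub _

/-- The subring `Ψ(𝒪) + Ψ(𝒪) e₁` for a subring `𝒪` of `B` stable under conjugation by `e₁`. -/
def psiSubring (O : Subring (BAlg m ℓ R)) (hO : ∀ b ∈ O, sig b ∈ O) : Subring (Cl m R) where
  carrier := {x | ∃ b ∈ O, ∃ c ∈ O, x = Psi m ℓ R b + Psi m ℓ R c * io m R (e1 R)}
  zero_mem' := ⟨0, O.zero_mem, 0, O.zero_mem, by simp⟩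
  one_mem' := ⟨1, O.one_mem, 0, O.zero_mem, by simp⟩
  add_mem' := by
    rintro _ _ ⟨b, hb, c, hc, rfl⟩ ⟨b', hb', c', hc', rfl⟩
    refine ⟨_, O.add_mem hb hb', _, O.add_mem hc hc', ?_⟩
    simp only [map_add, add_mul]
    abel
  neg_mem' := by
    rintro _ ⟨b, hb, c, hc, rfl⟩
    refine ⟨_, O.neg_mem hb, _, O.neg_mem hc, ?_⟩
    simp only [map_neg, neg_mul]
    abel
  mul_mem' := by
    rintro _ _ ⟨b, hb, c, hc, rfl⟩ ⟨b', hb', c', hc', rfl⟩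
    refine ⟨b * b' - c * sig c', O.sub_mem (O.mul_mem hb hb') (O.mul_mem hc (hO _ hc')),
      b * c' + c * sig b', O.add_mem (O.mul_mem hb hc') (O.mul_mem hc (hO _ hb')), ?_⟩
    have h1 : io m R (e1 R) * (Psi m ℓ R c' * io m R (e1 R)) = -Psi m ℓ R (sig c') := by
      rw [← mul_assoc, e1_mul_Psi, mul_assoc, e1_sq, mul_neg_one]
    simp only [mul_add, add_mul, mul_assoc, h1, e1_mul_Psi, map_sub, map_add, map_mul, mul_neg]
    abel

lemma psi_even {b c : BAlg m ℓ R}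
    (h : CliffordAlgebra.involute (Psi m ℓ R b + Psi m ℓ R c * io m R (e1 R)) =
      Psi m ℓ R b + Psi m ℓ R c * io m R (e1 R)) : c = 0 := by
  rw [map_add, map_mul, (isRep_Psi b).involute, (isRep_Psi c).involute,
    CliffordAlgebra.involute_ι] at h
  have h2 : (2 : R) • (Psi m ℓ R c * io m R (e1 R)) = 0 := by
    rw [two_smul, ← add_right_inj (Psi m ℓ R b), ← add_assoc, ← h]
    simp
  have h3 : Psi m ℓ R c * io m R (e1 R) = 0 := by simpa using h2
  have h4 : Psi m ℓ R c = 0 := by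
    have := congr_arg (· * io m R (e1 R)) h3
    simpa only [mul_assoc, e1_sq, mul_neg_one, zero_mul, neg_eq_zero] using this
  exact Psi_injective (h4.trans (map_zero _).symm)

/-- The even part of the algebra generated by `W` is the image of `B`. -/
lemma exists_Psi_of_mem_evenSub {x : Cl m R} (hx : x ∈ evenSub m R (W m ℓ R)) :
    ∃ b, x = Psi m ℓ R b := by
  obtain ⟨h1, h2⟩ := hx
  have h3 : x ∈ psiSubring (⊤ : Subring (BAlg m ℓ R)) (fun _ _ => trivial) := by
    change x ∈ Algebra.adjoin R _ at h1
    clear h2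
    induction h1 using Algebra.adjoin_induction with
    | mem x hx =>
      obtain ⟨v, hv, rfl⟩ := hx
      exact ⟨0, trivial, wB m ℓ v, trivial, by rw [io_eq_Psi hv]; simp⟩
    | algebraMap r => exact ⟨algebraMap R _ r, trivial, 0, trivial, by
        simp only [map_zero, zero_mul, add_zero, AlgHom.commutes]⟩
    | add x y _ _ hx hy => exact add_mem hx hy
    | mul x y _ _ hx hy => exact mul_mem hx hy
  obtain ⟨b, -, c, -, rfl⟩ := h3
  have hc := psi_even h2
  exact ⟨b, by simp [hc]⟩

lemma exists_PsiU_of_mem_GW {α : (Cl m R)ˣ} (h : α ∈ GW m ℓ R) : ∃ u, PsiU m ℓ R u = α := by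
  obtain ⟨h1, h2, -⟩ := h
  obtain ⟨b, hb⟩ := exists_Psi_of_mem_evenSub h1
  obtain ⟨c, hc⟩ := exists_Psi_of_mem_evenSub h2
  refine ⟨⟨b, c, ?_, ?_⟩, Units.ext hb.symm⟩
  · apply Psi_injective
    rw [map_mul, ← hb, ← hc, Units.mul_inv, map_one]
  · apply Psi_injective
    rw [map_mul, ← hb, ← hc, Units.inv_mul, map_one]

/-- The isomorphism `B^× ≅ G⁺(W)`, the inverse of `Ξ`. -/
def gwEquiv (m ℓ : ℕ) [NeZero m] (R : Type) [Field R] [CharZero R] :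
    (BAlg m ℓ R)ˣ ≃* GW m ℓ R :=
  MulEquiv.ofBijective ((PsiU m ℓ R).codRestrict (GW m ℓ R) PsiU_mem_GW) (by
    refine ⟨fun u v h => PsiU_injective (congr_arg Subtype.val h), fun α => ?_⟩
    obtain ⟨u, hu⟩ := exists_PsiU_of_mem_GW α.2
    exact ⟨u, Subtype.ext hu⟩)

lemma gwEquiv_coe [NeZero m] (u : (BAlg m ℓ R)ˣ) :
    ((gwEquiv m ℓ R u : GW m ℓ R) : (Cl m R)ˣ) = PsiU m ℓ R u := rfl

end gw

/-! ### Integrality at a prime -/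

section padic
variable {p : ℕ} [Fact p.Prime]

/-- A squarefree integer cannot cancel the denominator of a square. -/
lemma norm_le_one_of_squarefree_mul_sq {m : ℕ} (hm : Squarefree m) {b : ℚ_[p]}
    (h : ‖(m : ℚ_[p]) * b ^ 2‖ ≤ 1) : ‖b‖ ≤ 1 := by
  by_contra! hb
  have hp : (1 : ℝ) < p := by exact_mod_cast (Fact.out : p.Prime).one_lt
  have hb' : (p : ℝ) ≤ ‖b‖ := by
    have := Padic.norm_eq_zpow_neg_valuation (p := p) (x := b) (by rintro rfl; simp at hb; linarith)
    rw [this] at hb ⊢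
    have h0 : 0 < -b.valuation := by
      by_contra! h0
      have := zpow_le_one_of_nonpos₀ hp.le h0
      linarith
    calc (p : ℝ) = (p : ℝ) ^ (1 : ℤ) := by simp
      _ ≤ _ := zpow_le_zpow_right₀ hp.le h0
  have hm' : (p : ℝ)⁻¹ ≤ ‖(m : ℚ_[p])‖ := by
    by_contra! hlt
    have h2 : ‖((m : ℤ) : ℚ_[p])‖ ≤ (p : ℝ) ^ (-(2 : ℕ) : ℤ) := by
      by_contra! h3
      have h4 : ‖((m : ℤ) : ℚ_[p])‖ < (p : ℝ) ^ (-(1 : ℤ)) := by simpa using hlt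
      have h5 := (Padic.norm_le_pow_iff_norm_lt_pow_add_one ((m : ℤ) : ℚ_[p]) (-2)).2
        (by simpa using h4)
      have h6 : (p : ℝ) ^ (-(2 : ℕ) : ℤ) = (p : ℝ) ^ (-2 : ℤ) := by norm_num
      rw [h6] at h3
      linarith
    rw [Padic.norm_int_le_pow_iff_dvd] at h2
    have h3 : p * p ∣ m := by
      have : (p : ℤ) ^ 2 ∣ (m : ℤ) := by exact_mod_cast h2
      rw [← sq]
      exact_mod_cast this
    exact (Fact.out : p.Prime).not_isUnit (hm p h3)
  rw [norm_mul, norm_pow] at h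
  have : (p : ℝ) ≤ ‖(m : ℚ_[p])‖ * ‖b‖ ^ 2 := by
    calc (p : ℝ) = (p : ℝ)⁻¹ * (p : ℝ) ^ 2 := by field_simp
      _ ≤ _ := by gcongr
  linarith

lemma norm_le_one_of_mul_add {a b : ℚ_[p]} (hb : ‖b‖ ≤ 1) (h : ‖a * (a + b)‖ ≤ 1) : ‖a‖ ≤ 1 := by
  by_contra! ha
  have h1 : ‖a + b‖ = ‖a‖ := by
    rw [Padic.add_eq_max_of_ne (by linarith : ‖b‖ < ‖a‖).ne']
    exact max_eq_left (by linarith)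
  rw [norm_mul, h1] at h
  nlinarith

/-- `x² + m y² ≡ 0 (mod 4)` forces `x` and `y` to be even if `m ≡ 1, 2 (mod 4)`. -/
lemma two_adic_aux {m : ℕ} (h : m % 4 = 1 ∨ m % 4 = 2) {x y c : ℤ_[2]}
    (hx : x ^ 2 + m * y ^ 2 = 4 * c) : (∃ x', x = 2 * x') ∧ ∃ y', y = 2 * y' := by
  have key := congr_arg (PadicInt.toZModPow 2) hx
  have h4 : (PadicInt.toZModPow (p := 2) 2) 4 = 0 := by
    have : (4 : ℤ_[2]) = ((4 : ℕ) : ℤ_[2]) := by norm_num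
    rw [this, map_natCast]
    rfl
  rw [map_add, map_mul, map_mul, map_pow, map_pow, h4, zero_mul, map_natCast] at key
  have hmc : ((m : ℕ) : ZMod (2 ^ 2)) = 1 ∨ ((m : ℕ) : ZMod (2 ^ 2)) = 2 := by
    rcases h with h | h
    · left
      have := (ZMod.natCast_eq_natCast_iff m 1 4).2 h
      simpa using this
    · right
      have := (ZMod.natCast_eq_natCast_iff m 2 4).2 h
      simpa using this
  have fin : ∀ M X Y : ZMod (2 ^ 2), (M = 1 ∨ M = 2) → X ^ 2 + M * Y ^ 2 = 0 →
      2 * X = 0 ∧ 2 * Y = 0 := by decide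
  obtain ⟨hX, hY⟩ := fin _ _ _ hmc key
  have lift : ∀ z : ℤ_[2], 2 * (PadicInt.toZModPow 2 z) = 0 → ∃ z', z = 2 * z' := by
    intro z hz
    have h2 : (PadicInt.toZModPow (p := 2) 2) (2 * z) = 0 := by
      rw [map_mul]
      have : (2 : ℤ_[2]) = ((2 : ℕ) : ℤ_[2]) := by norm_num
      rw [this, map_natCast]
      exact hz
    rw [← RingHom.mem_ker, PadicInt.ker_toZModPow, Ideal.mem_span_singleton] at h2
    obtain ⟨w, hw⟩ := h2
    refine ⟨w, mul_left_cancel₀ (two_ne_zero' ℤ_[2]) ?_⟩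
    rw [hw]
    push_cast
    ring
  exact ⟨lift _ hX, lift _ hY⟩

/-- `𝒪_K ⊗ ℤ_p`. -/
def OKp (m p : ℕ) [Fact p.Prime] : Subring (KAlg m ℚ_[p]) where
  carrier := {x | ‖x.re‖ ≤ 1 ∧ ‖x.im‖ ≤ 1}
  one_mem' := by simp [QuadraticAlgebra.re_one, QuadraticAlgebra.im_one]
  zero_mem' := by simp
  add_mem' := by
    rintro a b ⟨h1, h2⟩ ⟨k1, k2⟩
    exact ⟨(PadicInt.subring p).add_mem h1 k1, (PadicInt.subring p).add_mem h2 k2⟩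
  neg_mem' := by
    rintro a ⟨h1, h2⟩
    exact ⟨(PadicInt.subring p).neg_mem h1, (PadicInt.subring p).neg_mem h2⟩
  mul_mem' := by
    rintro a b ⟨h1, h2⟩ ⟨k1, k2⟩
    have hA : ((cA m : ℤ) : ℚ_[p]) ∈ PadicInt.subring p := intCast_mem _ _
    have hB : ((cB m : ℤ) : ℚ_[p]) ∈ PadicInt.subring p := intCast_mem _ _
    change _ ∈ PadicInt.subring p at h1 h2 k1 k2
    refine ⟨?_, ?_⟩
    · change _ ∈ PadicInt.subring p
      rw [QuadraticAlgebra.re_mul]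
      apply_rules [add_mem, sub_mem, mul_mem]
    · change _ ∈ PadicInt.subring p
      rw [QuadraticAlgebra.im_mul]
      apply_rules [add_mem, sub_mem, mul_mem]

variable {m : ℕ}

lemma mem_OKp {x : KAlg m ℚ_[p]} : x ∈ OKp m p ↔ ‖x.re‖ ≤ 1 ∧ ‖x.im‖ ≤ 1 := Iff.rfl

lemma star_mem_OKp {x : KAlg m ℚ_[p]} (h : x ∈ OKp m p) : star x ∈ OKp m p := by
  have hB : ((cB m : ℤ) : ℚ_[p]) ∈ PadicInt.subring p := intCast_mem _ _
  refine ⟨?_, ?_⟩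
  · rw [QuadraticAlgebra.re_star]
    exact (PadicInt.subring p).add_mem h.1 ((PadicInt.subring p).mul_mem hB h.2)
  · rw [QuadraticAlgebra.im_star, norm_neg]
    exact h.2

/-- For squarefree `m` an element of `K_p` with integral trace and norm lies in `𝒪_K ⊗ ℤ_p`. -/
lemma mem_OKp_of_trace_norm (hm : Squarefree m) {x : KAlg m ℚ_[p]}
    (ht : ‖2 * x.re + cB m * x.im‖ ≤ 1) (hn : ‖QuadraticAlgebra.norm x‖ ≤ 1) : x ∈ OKp m p := by
  have sub : ∀ {x y : ℚ_[p]}, ‖x‖ ≤ 1 → ‖y‖ ≤ 1 → ‖x - y‖ ≤ 1 := (PadicInt.subring p).sub_mem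
  have mul : ∀ {x y : ℚ_[p]}, ‖x‖ ≤ 1 → ‖y‖ ≤ 1 → ‖x * y‖ ≤ 1 := (PadicInt.subring p).mul_mem
  rw [QuadraticAlgebra.norm_def] at hn
  set a := x.re with ha
  set b := x.im with hb
  have h4 : ((4 : ℕ) : ℚ_[p]) ∈ PadicInt.subring p := natCast_mem _ _
  -- `4 N(x) - Tr(x)²` is `m b²`, respectively `m (2b)²`
  have key := sub (mul h4 hn) (mul ht ht)
  by_cases h3 : m % 4 = 3
  · obtain ⟨k, hk⟩ : ∃ k : ℤ, (m : ℤ) + 1 = 4 * k := ⟨((m : ℤ) + 1) / 4, by omega⟩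
    have hA : cA m = -k := by simp only [cA, h3, if_true]; omega
    have hB : cB m = 1 := by simp [cB, h3]
    have hk' : (m : ℚ_[p]) + 1 = 4 * k := by exact_mod_cast hk
    rw [hA, hB] at hn key
    have hbi : ‖b‖ ≤ 1 := by
      apply norm_le_one_of_squarefree_mul_sq hm
      have : (m : ℚ_[p]) * b ^ 2 = ((4 : ℕ) : ℚ_[p]) *
          (a * a + ((1 : ℤ) : ℚ_[p]) * a * b - ((-k : ℤ) : ℚ_[p]) * b * b) -
          (2 * a + ((1 : ℤ) : ℚ_[p]) * b) * (2 * a + ((1 : ℤ) : ℚ_[p]) * b) := by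
        push_cast
        linear_combination b ^ 2 * hk'
      rw [this]
      exact key
    refine ⟨norm_le_one_of_mul_add hbi ?_, hbi⟩
    have hki : ((k : ℤ) : ℚ_[p]) ∈ PadicInt.subring p := intCast_mem _ _
    have := sub hn (mul hki (mul hbi hbi))
    have e : a * (a + b) = (a * a + ((1 : ℤ) : ℚ_[p]) * a * b - ((-k : ℤ) : ℚ_[p]) * b * b) -
        k * (b * b) := by push_cast; ring
    rw [e]
    exact this
  · have hA : cA m = -(m : ℤ) := by simp [cA, h3]
    have hB : cB m = 0 := by simp [cB, h3]
    rw [hA, hB] at hn key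
    rw [hB] at ht
    have ht' : ‖2 * a‖ ≤ 1 := by simpa using ht
    have hbi : ‖2 * b‖ ≤ 1 := by
      apply norm_le_one_of_squarefree_mul_sq hm
      have : (m : ℚ_[p]) * (2 * b) ^ 2 = ((4 : ℕ) : ℚ_[p]) *
          (a * a + ((0 : ℤ) : ℚ_[p]) * a * b - ((-(m : ℤ) : ℤ) : ℚ_[p]) * b * b) -
          (2 * a + ((0 : ℤ) : ℚ_[p]) * b) * (2 * a + ((0 : ℤ) : ℚ_[p]) * b) := by
        push_cast
        ring
      rw [this]
      exact key
    -- for `m ≡ 1, 2 (mod 4)` only `2a` and `2b` are integral so far, which leaves the prime 2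
    by_cases hp : p = 2
    · subst hp
      have hm4 : m % 4 = 1 ∨ m % 4 = 2 := by
        have : m % 4 ≠ 0 := by
          intro h0
          have h22 : 2 * 2 ∣ m := by omega
          have := hm 2 h22
          simp at this
        omega
      have hn' : ‖a ^ 2 + m * b ^ 2‖ ≤ 1 := by
        have e : a ^ 2 + m * b ^ 2 =
          a * a + ((0 : ℤ) : ℚ_[2]) * a * b - ((-(m : ℤ) : ℤ) : ℚ_[2]) * b * b := by
          push_cast; ring
        rw [e]; exact hn
      obtain ⟨α, hα⟩ : ∃ α : ℤ_[2], (α : ℚ_[2]) = 2 * a := ⟨⟨2 * a, ht'⟩, rfl⟩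
      obtain ⟨β, hβ⟩ : ∃ β : ℤ_[2], (β : ℚ_[2]) = 2 * b := ⟨⟨2 * b, hbi⟩, rfl⟩
      obtain ⟨γ, hγ⟩ : ∃ γ : ℤ_[2], (γ : ℚ_[2]) = a ^ 2 + m * b ^ 2 := ⟨⟨_, hn'⟩, rfl⟩
      have h22 : ((2 : ℤ_[2]) : ℚ_[2]) = 2 := rfl
      have h44 : ((4 : ℤ_[2]) : ℚ_[2]) = 4 := rfl
      obtain ⟨⟨x', hx'⟩, y', hy'⟩ := two_adic_aux hm4 (x := α) (y := β) (c := γ) (by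
          apply Subtype.ext
          rw [PadicInt.coe_add, PadicInt.coe_mul, PadicInt.coe_pow, PadicInt.coe_natCast,
            PadicInt.coe_mul, PadicInt.coe_pow, h44, hα, hβ, hγ]
          ring)
      have hx2 := congr_arg (Subtype.val : ℤ_[2] → ℚ_[2]) hx'
      have hy2 := congr_arg (Subtype.val : ℤ_[2] → ℚ_[2]) hy'
      rw [PadicInt.coe_mul, h22, hα] at hx2
      rw [PadicInt.coe_mul, h22, hβ] at hy2
      have ha2 : a = x'.1 := mul_left_cancel₀ (two_ne_zero' ℚ_[2]) hx2
      have hb2 : b = y'.1 := mul_left_cancel₀ (two_ne_zero' ℚ_[2]) hy2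
      exact ⟨(congr_arg norm ha2).trans_le x'.2, (congr_arg norm hb2).trans_le y'.2⟩
    · have h2 : ‖(2 : ℚ_[p])‖ = 1 := by
        have : ‖((2 : ℕ) : ℚ_[p])‖ = 1 := by
          rw [Padic.norm_natCast_eq_one_iff]
          exact (Nat.coprime_primes (Fact.out : p.Prime) Nat.prime_two).2 hp
        simpa using this
      rw [norm_mul, h2, one_mul] at ht' hbi
      exact ⟨ht', hbi⟩

/-- `𝒪_K ⊗ ℤ_p` contains the square roots of its elements, since it is integrally closed. -/
lemma mem_OKp_of_sq (hm : Squarefree m) {x : KAlg m ℚ_[p]} (h : x * x ∈ OKp m p) :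
    x ∈ OKp m p := by
  have add : ∀ {x y : ℚ_[p]}, ‖x‖ ≤ 1 → ‖y‖ ≤ 1 → ‖x + y‖ ≤ 1 := (PadicInt.subring p).add_mem
  have mul : ∀ {x y : ℚ_[p]}, ‖x‖ ≤ 1 → ‖y‖ ≤ 1 → ‖x * y‖ ≤ 1 := (PadicInt.subring p).mul_mem
  have norm_int : ∀ y ∈ OKp m p, ‖QuadraticAlgebra.norm y‖ ≤ 1 := by
    intro y hy
    have := (OKp m p).mul_mem hy (star_mem_OKp hy)
    rw [← QuadraticAlgebra.algebraMap_norm_eq_mul_star] at this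
    exact this.1
  have sqle : ∀ z : ℚ_[p], ‖z * z‖ ≤ 1 → ‖z‖ ≤ 1 := by
    intro z hz
    rw [norm_mul] at hz
    nlinarith [norm_nonneg z]
  have h2 : ((2 : ℕ) : ℚ_[p]) ∈ PadicInt.subring p := natCast_mem _ _
  have hB : ((cB m : ℤ) : ℚ_[p]) ∈ PadicInt.subring p := intCast_mem _ _
  have hn : ‖QuadraticAlgebra.norm x‖ ≤ 1 := by
    apply sqle
    rw [← map_mul]
    exact norm_int _ h
  refine mem_OKp_of_trace_norm hm (sqle _ ?_) hn
  have e := add (add (mul h2 h.1) (mul hB h.2)) (mul h2 hn)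
  have : (2 * x.re + cB m * x.im) * (2 * x.re + cB m * x.im) =
      ((2 : ℕ) : ℚ_[p]) * (x * x).re + cB m * (x * x).im +
        ((2 : ℕ) : ℚ_[p]) * QuadraticAlgebra.norm x := by
    rw [QuadraticAlgebra.norm_def, QuadraticAlgebra.re_mul, QuadraticAlgebra.im_mul]
    push_cast
    ring
  rw [this]
  exact e

end padic

/-! ### The local groups -/

section local_groups
variable {m ℓ : ℕ} [NeZero m] {p : ℕ} [Fact p.Prime]

/-- The matrix has entries in `𝒪_K ⊗ ℤ_p`. -/
def MatInt (g : Matrix (Fin 2) (Fin 2) (KAlg m ℚ_[p])) : Prop := ∀ i j, g i j ∈ OKp m p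

lemma MatInt.mul {g h : Matrix (Fin 2) (Fin 2) (KAlg m ℚ_[p])} (hg : MatInt g) (hh : MatInt h) :
    MatInt (g * h) := by
  intro i j
  rw [Matrix.mul_apply]
  exact sum_mem fun k _ => mul_mem (hg i k) (hh k j)

lemma MatInt.conjTranspose {g : Matrix (Fin 2) (Fin 2) (KAlg m ℚ_[p])} (hg : MatInt g) :
    MatInt g.conjTranspose := fun i j => star_mem_OKp (hg j i)

lemma MatInt.adjugate {g : Matrix (Fin 2) (Fin 2) (KAlg m ℚ_[p])} (hg : MatInt g) :
    MatInt g.adjugate := by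
  intro i j
  rw [Matrix.adjugate_fin_two]
  fin_cases i <;> fin_cases j <;> simp only [Fin.zero_eta, Fin.mk_one, Matrix.of_apply,
    Matrix.cons_val', Matrix.cons_val_zero, Matrix.cons_val_one, Matrix.cons_val_fin_one] <;>
    first | exact hg _ _ | exact neg_mem (hg _ _)

lemma MatInt.theta {g : Matrix (Fin 2) (Fin 2) (KAlg m ℚ_[p])} (hg : MatInt g) :
    MatInt (theta g) := by
  rw [theta_eq]
  exact hg.adjugate.conjTranspose

lemma mk_mem_OKp {a b : ℚ_[p]} (ha : ‖a‖ ≤ 1) (hb : ‖b‖ ≤ 1) :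
    (⟨a, b⟩ : KAlg m ℚ_[p]) ∈ OKp m p := ⟨ha, hb⟩

lemma algebraMap_mem_OKp {a : ℚ_[p]} (ha : ‖a‖ ≤ 1) :
    algebraMap ℚ_[p] (KAlg m ℚ_[p]) a ∈ OKp m p := ⟨ha, by simp⟩

lemma MatInt.smul {g : Matrix (Fin 2) (Fin 2) (KAlg m ℚ_[p])} (hg : MatInt g) {r : ℚ_[p]}
    (hr : ‖r‖ ≤ 1) : MatInt (r • g) := by
  intro i j
  rw [Matrix.smul_apply, Algebra.smul_def]
  exact mul_mem (algebraMap_mem_OKp hr) (hg i j)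

lemma matInt_hermL {x : Fin 4 → ℚ_[p]} (hx : x ∈ latP p) : MatInt (hermL m ℚ_[p] x) := by
  intro i j
  rw [hermL_apply]
  fin_cases i <;> fin_cases j
  · exact mk_mem_OKp (hx 0) (by simp)
  · exact mk_mem_OKp (hx 1) (hx 2)
  · exact star_mem_OKp (mk_mem_OKp (hx 1) (hx 2))
  · exact mk_mem_OKp (hx 3) (by simp)

lemma hermCoord_mem_latP {g : Matrix (Fin 2) (Fin 2) (KAlg m ℚ_[p])} (hg : MatInt g) :
    hermCoord g ∈ latP p := by
  intro i
  fin_cases i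
  · exact (hg 0 0).1
  · exact (hg 0 1).1
  · exact (hg 0 1).2
  · exact (hg 1 1).1

lemma mulVec_mem_latP {A : Matrix (Fin 4) (Fin 4) ℚ_[p]} (h : ∀ i j, ‖A i j‖ ≤ 1)
    {x : Fin 4 → ℚ_[p]} (hx : x ∈ latP p) : A.mulVec x ∈ latP p := by
  intro i
  change (∑ j, A i j * x j) ∈ PadicInt.subring p
  exact sum_mem fun j _ => mul_mem (h i j) (hx j)

/-- A matrix in `SL₄` with integral entries stabilises `Λ_p`. -/
lemma mulVec_mem_latP_iff {γ : Matrix.SpecialLinearGroup (Fin 4) ℚ_[p]}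
    (h : ∀ i j, ‖γ.1 i j‖ ≤ 1) (x : Fin 4 → ℚ_[p]) : γ.1.mulVec x ∈ latP p ↔ x ∈ latP p := by
  refine ⟨fun hx => ?_, mulVec_mem_latP h⟩
  have hinv : ∀ i j, ‖(γ⁻¹).1 i j‖ ≤ 1 := by
    intro i j
    let A : Matrix (Fin 4) (Fin 4) (PadicInt.subring p) := Matrix.of fun i j => ⟨γ.1 i j, h i j⟩
    have hA : (PadicInt.subring p).subtype.mapMatrix A = γ.1 := by
      ext i j; rfl
    rw [Matrix.SpecialLinearGroup.coe_inv, ← hA, ← RingHom.map_adjugate]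
    exact (A.adjugate i j).2
  have := mulVec_mem_latP hinv hx
  have e := mulVec_inv_mulVec γ⁻¹ x
  rw [inv_inv] at e
  rwa [e] at this

lemma single_mem_latP (j : Fin 4) : (Pi.single j 1 : Fin 4 → ℚ_[p]) ∈ latP p := by
  intro i
  rw [Pi.single_apply]
  split_ifs <;> simp

lemma tauSL_mem_C {g : Matrix (Fin 2) (Fin 2) (KAlg m ℚ_[p])} {r : ℚ_[p]} (hr : r ≠ 0)
    (h : g.det = algebraMap _ _ r) (hg : MatInt g) (hr1 : ‖r‖ = 1) : tauSL g hr h ∈ C m p := by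
  refine ⟨tauSL_mem_SO0 hr h, mulVec_mem_latP_iff fun i j => ?_⟩
  have h1 := hermCoord_mem_latP
    ((hg.mul (matInt_hermL (single_mem_latP j))).mul hg.conjTranspose) i
  change ‖r⁻¹ * actMat g i j‖ ≤ 1
  rw [norm_mul, norm_inv, hr1, inv_one, one_mul]
  exact h1

lemma IsRep.mem_J {α : (Cl m ℚ_[p])ˣ} {g : Matrix (Fin 2) (Fin 2) (KAlg m ℚ_[p])} {r : ℚ_[p]}
    (hα : IsRep m ℚ_[p] (α : Cl m ℚ_[p]) g) (h : g.det = algebraMap _ _ r) (hg : MatInt g)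
    (hr1 : ‖r‖ = 1) : α ∈ J m p := by
  have hr : r ≠ 0 := by
    rintro rfl
    simp at hr1
  exact ⟨hα.mem_Gplus_top hr h, ⟨_, tauSL_mem_C hr h hg hr1, hα.isTau hr h⟩, r, hr1,
    hα.mul_reverse h⟩

lemma isRep_io_mul_io {R : Type} [Field R] [CharZero R] (x y : Fin 4 → R) :
    IsRep m R (io m R x * io m R y) (hermL m R x * theta (hermL m R y)) := by
  rw [IsRep, map_mul, clRep_io, clRep_io, Matrix.fromBlocks_multiply, theta_mul, theta_theta]
  simp

lemma IsRep.conj_herm {R : Type} [Field R] [CharZero R] {α : (Cl m R)ˣ}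
    {g g' : Matrix (Fin 2) (Fin 2) (KAlg m R)} {γ : Matrix.SpecialLinearGroup (Fin 4) R}
    (hα : IsRep m R (α : Cl m R) g) (hg : g * g' = 1) (hγ : IsTau m R α γ) (x y : Fin 4 → R) :
    g * (hermL m R x * theta (hermL m R y)) * g' =
      hermL m R (γ.1.mulVec x) * theta (hermL m R (γ.1.mulVec y)) := by
  have h1 := (hα.mul (isRep_io_mul_io x y)).mul (hα.inv hg)
  have h2 := isRep_io_mul_io (m := m) (γ.1.mulVec x) (γ.1.mulVec y)
  rw [← h1.Xi_eq, ← h2.Xi_eq, ← hγ, ← hγ]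
  congr 1
  simp only [mul_assoc, Units.inv_mul_cancel_left]

/-- If `τ(g)` stabilises `Λ_p` and `det g` is a unit, the products of pairs of entries of `g`
are integral, since `Λ_p Λ_p^ι` contains the matrix units; so `g` is integral. -/
lemma IsRep.matInt_of_mem_J (hm : Squarefree m) {α : (Cl m ℚ_[p])ˣ}
    {g : Matrix (Fin 2) (Fin 2) (KAlg m ℚ_[p])}
    (hα : IsRep m ℚ_[p] (α : Cl m ℚ_[p]) g) (hJ : α ∈ J m p) :
    MatInt g ∧ ∃ r : ℚ_[p], ‖r‖ = 1 ∧ g.det = algebraMap _ _ r := by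
  obtain ⟨-, ⟨γ, hγC, hγ⟩, r, hr1, hr⟩ := hJ
  have hdet : g.det = algebraMap _ _ r := by
    have h1 := hα.mul hα.reverse
    rw [← hr] at h1
    have h2 := h1.Xi_eq.symm.trans (isRep_algebraMap r).Xi_eq
    rw [Matrix.mul_adjugate, algebraMap_mat] at h2
    simpa using congr_fun (congr_fun h2 0) 0
  have hr0 : r ≠ 0 := by
    rintro rfl
    simp at hr1
  refine ⟨?_, r, hr1, hdet⟩
  have hg := inv_mul_smul_adjugate hr0 hdet
  have key : ∀ x y : Fin 4 → ℚ_[p], x ∈ latP p → y ∈ latP p →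
      MatInt (g * (hermL m ℚ_[p] x * HermZeta.theta (hermL m ℚ_[p] y)) * g.adjugate) := by
    intro x y hx hy
    have h1 := hα.conj_herm hg hγ x y
    have h2 : MatInt (g * (hermL m ℚ_[p] x * HermZeta.theta (hermL m ℚ_[p] y)) *
        (r⁻¹ • g.adjugate)) := by
      rw [h1]
      exact (matInt_hermL ((hγC.2 x).2 hx)).mul (matInt_hermL ((hγC.2 y).2 hy)).theta
    have h3 := h2.smul hr1.le
    rwa [mul_smul_comm, smul_smul, mul_inv_cancel₀ hr0, one_smul] at h3
  have he : e1 ℚ_[p] ∈ latP p := by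
    intro i
    fin_cases i <;> simp [e1]
  have k0 := key _ _ (single_mem_latP 0) he
  have k3 := key _ _ (single_mem_latP 3) he
  -- the products `h k^ι` of these vectors of `Λ_p` are the off-diagonal matrix units, up to sign
  have m0 : hermL m ℚ_[p] (Pi.single 0 1) * HermZeta.theta (hermL m ℚ_[p] (e1 ℚ_[p])) =
      !![0, -1; 0, 0] := by
    ext i j : 1
    fin_cases i <;> fin_cases j <;>
      simp [hermL_apply, HermZeta.theta, e1] <;>
      (ext <;> simp [QuadraticAlgebra.re_one, QuadraticAlgebra.im_one])
  have m3 : hermL m ℚ_[p] (Pi.single 3 1) * HermZeta.theta (hermL m ℚ_[p] (e1 ℚ_[p])) =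
      !![0, 0; -1, 0] := by
    ext i j : 1
    fin_cases i <;> fin_cases j <;>
      simp [hermL_apply, HermZeta.theta, e1] <;>
      (ext <;> simp [QuadraticAlgebra.re_one, QuadraticAlgebra.im_one])
  rw [m0, Matrix.adjugate_fin_two] at k0
  rw [m3, Matrix.adjugate_fin_two] at k3
  -- conjugating them gives the squares of the entries of `g`
  have a00 := k0 0 1
  have a01 := k3 0 1
  have a10 := k0 1 0
  have a11 := k3 1 0
  simp [Matrix.mul_apply, Fin.sum_univ_two] at a00 a01 a10 a11
  intro i j
  fin_cases i <;> fin_cases j <;> apply mem_OKp_of_sq hm <;> assumption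

lemma matInt_bMat_iff {b : BAlg m ℓ ℚ_[p]} : MatInt (bMat m ℓ ℚ_[p] b) ↔ b ∈ oLoc m ℓ p := by
  constructor
  · intro h
    exact ⟨(h 0 0).1, (h 0 0).2, (h 0 1).1, (h 0 1).2⟩
  · rintro ⟨h1, h2, h3, h4⟩ i j
    fin_cases i <;> fin_cases j
    · exact mk_mem_OKp h1 h2
    · exact mk_mem_OKp h3 h4
    · exact mul_mem (neg_mem (natCast_mem _ _)) (star_mem_OKp (mk_mem_OKp h3 h4))
    · exact star_mem_OKp (mk_mem_OKp h1 h2)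

lemma nrd_norm_le_one {b : BAlg m ℓ ℚ_[p]} (h : b ∈ oLoc m ℓ p) : ‖nrd m ℓ ℚ_[p] b‖ ≤ 1 := by
  have h1 := matInt_bMat_iff.2 h
  have h2 : (bMat m ℓ ℚ_[p] b).det ∈ OKp m p := by
    rw [Matrix.det_fin_two]
    exact sub_mem (mul_mem (h1 _ _) (h1 _ _)) (mul_mem (h1 _ _) (h1 _ _))
  rw [det_bMat] at h2
  exact h2.1

lemma mem_oUnits_iff {u : (BAlg m ℓ ℚ_[p])ˣ} : u ∈ oUnits m ℓ p ↔
    (u : BAlg m ℓ ℚ_[p]) ∈ oLoc m ℓ p ∧ ‖nrd m ℓ ℚ_[p] (u : BAlg m ℓ ℚ_[p])‖ = 1 := by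
  rw [oUnits, Submonoid.mem_units_iff]
  constructor
  · rintro ⟨h1, h2⟩
    refine ⟨h1, le_antisymm (nrd_norm_le_one h1) ?_⟩
    have h3 := nrd_norm_le_one (m := m) (ℓ := ℓ) h2
    have h4 := nrd_mul (u : BAlg m ℓ ℚ_[p]) ((u⁻¹ : (BAlg m ℓ ℚ_[p])ˣ) : BAlg m ℓ ℚ_[p])
    rw [Units.mul_inv, nrd_one] at h4
    have h5 := congr_arg norm h4
    rw [norm_one, norm_mul] at h5
    nlinarith [norm_nonneg (nrd m ℓ ℚ_[p] (u : BAlg m ℓ ℚ_[p]))]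
  · rintro ⟨h1, h2⟩
    refine ⟨h1, ?_⟩
    change _ ∈ oLoc m ℓ p
    rw [← matInt_bMat_iff] at h1 ⊢
    have hr := nrd_unit_ne_zero u
    have h3 := inv_mul_smul_adjugate hr (det_bMat (u : BAlg m ℓ ℚ_[p]))
    have h4 : bMat m ℓ ℚ_[p] ((u⁻¹ : (BAlg m ℓ ℚ_[p])ˣ) : BAlg m ℓ ℚ_[p]) =
        (nrd m ℓ ℚ_[p] (u : BAlg m ℓ ℚ_[p]))⁻¹ • (bMat m ℓ ℚ_[p] u).adjugate := by
      rw [← mul_one (bMat m ℓ ℚ_[p] ((u⁻¹ : (BAlg m ℓ ℚ_[p])ˣ) : BAlg m ℓ ℚ_[p])), ← h3,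
        ← mul_assoc, ← bMat_mul, Units.inv_mul, bMat_one, one_mul]
    rw [h4]
    exact h1.adjugate.smul (by rw [norm_inv, h2, inv_one])

lemma PsiU_mem_J_iff (hm : Squarefree m) {u : (BAlg m ℓ ℚ_[p])ˣ} :
    PsiU m ℓ ℚ_[p] u ∈ J m p ↔ u ∈ oUnits m ℓ p := by
  rw [mem_oUnits_iff, ← matInt_bMat_iff]
  constructor
  · intro h
    obtain ⟨h1, r, hr, h2⟩ := (isRep_PsiU u).matInt_of_mem_J hm h
    rw [det_bMat] at h2
    rw [QuadraticAlgebra.algebraMap_injective h2]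
    exact ⟨h1, hr⟩
  · rintro ⟨h1, h2⟩
    exact (isRep_PsiU u).mem_J (det_bMat _) h1 h2

lemma sig_mem_oLoc (b : BAlg m ℓ ℚ_[p]) (h : b ∈ oLoc m ℓ p) : sig b ∈ oLoc m ℓ p := by
  obtain ⟨h1, h2, h3, h4⟩ := h
  have hB : ((cB m : ℤ) : ℚ_[p]) ∈ PadicInt.subring p := intCast_mem _ _
  exact ⟨add_mem h1 (mul_mem hB h2), neg_mem h2, neg_mem (add_mem h3 (mul_mem hB h4)), h4⟩

lemma e0_mem_latP : e0 ℓ ℚ_[p] ∈ latP p := by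
  have : ‖(ℓ : ℚ_[p])‖ ≤ 1 := by exact_mod_cast Padic.norm_int_le_one (ℓ : ℤ)
  intro i
  fin_cases i <;> simp [e0, this]

lemma e1_mem_latP : e1 ℚ_[p] ∈ latP p := by
  intro i
  fin_cases i <;> simp [e1]

lemma e2_mem_latP : e2 ℚ_[p] ∈ latP p := by
  intro i
  fin_cases i <;> simp [e2]

/-- `A⁺(Λ ∩ W)_p` is the image of `𝔬_p`. -/
lemma Psi_mem_Sloc_iff {b : BAlg m ℓ ℚ_[p]} : Psi m ℓ ℚ_[p] b ∈ Sloc m ℓ p ↔ b ∈ oLoc m ℓ p := by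
  constructor
  · rintro ⟨h1, h2⟩
    have h3 : Subring.closure
        (io m ℚ_[p] '' (latP p ∩ W m ℓ ℚ_[p]) ∪ algebraMap ℚ_[p] (Cl m ℚ_[p]) '' {r | ‖r‖ ≤ 1}) ≤
        psiSubring (oLoc m ℓ p) sig_mem_oLoc := by
      rw [Subring.closure_le]
      rintro _ (⟨x, ⟨hx, hxW⟩, rfl⟩ | ⟨r, hr, rfl⟩)
      · exact ⟨0, zero_mem _, wB m ℓ x, ⟨hx 1, hx 2, hx 0, zero_mem (PadicInt.subring p)⟩,
          by rw [io_eq_Psi hxW]; simp⟩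
      · refine ⟨algebraMap _ _ r, ⟨?_, ?_, ?_, ?_⟩, 0, zero_mem _, ?_⟩
        · exact hr
        · exact zero_mem (PadicInt.subring p)
        · exact zero_mem (PadicInt.subring p)
        · exact zero_mem (PadicInt.subring p)
        · simp only [map_zero, zero_mul, add_zero, AlgHom.commutes]
    obtain ⟨b', hb', c, -, hbc⟩ := h3 h1
    rw [hbc] at h2
    have hc := psi_even h2
    rw [hc, map_zero, zero_mul, add_zero] at hbc
    rwa [Psi_injective hbc]
  · rintro ⟨h1, h2, h3, h4⟩
    refine ⟨?_, (isRep_Psi b).involute⟩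
    rw [Psi_apply]
    simp only [Algebra.smul_def]
    have hs : ∀ r : ℚ_[p], ‖r‖ ≤ 1 → algebraMap ℚ_[p] (Cl m ℚ_[p]) r ∈ Subring.closure
        (io m ℚ_[p] '' (latP p ∩ W m ℓ ℚ_[p]) ∪ algebraMap ℚ_[p] (Cl m ℚ_[p]) '' {r | ‖r‖ ≤ 1}) :=
      fun r hr => Subring.subset_closure (Or.inr ⟨r, hr, rfl⟩)
    have hv : ∀ x : Fin 4 → ℚ_[p], x ∈ latP p → x ∈ W m ℓ ℚ_[p] → io m ℚ_[p] x ∈ Subring.closure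
        (io m ℚ_[p] '' (latP p ∩ W m ℓ ℚ_[p]) ∪ algebraMap ℚ_[p] (Cl m ℚ_[p]) '' {r | ‖r‖ ≤ 1}) :=
      fun x hx hw => Subring.subset_closure (Or.inl ⟨x, ⟨hx, hw⟩, rfl⟩)
    have v0 := hv _ e0_mem_latP (e0_mem (ℓ := ℓ))
    have v1 := hv _ e1_mem_latP (e1_mem (ℓ := ℓ))
    have v2 := hv _ e2_mem_latP (e2_mem (ℓ := ℓ))
    exact add_mem (add_mem (add_mem (hs _ h1) (mul_mem (hs _ h2) (neg_mem (mul_mem v2 v1))))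
      (mul_mem (hs _ h3) (neg_mem (mul_mem v0 v1)))) (mul_mem (hs _ h4) (neg_mem (mul_mem v0 v2)))

lemma tauB_mul {R : Type} [Field R] [CharZero R] (u v : (BAlg m ℓ R)ˣ) :
    tauB (u * v) = tauB u * tauB v := by
  have := (isTau_PsiU u).mul (isTau_PsiU v)
  rw [← map_mul] at this
  exact (isTau_PsiU _).unique this

lemma tauB_inv {R : Type} [Field R] [CharZero R] (u : (BAlg m ℓ R)ˣ) :
    tauB u⁻¹ = (tauB u)⁻¹ := by
  have := (isTau_PsiU u).inv
  rw [← map_inv] at this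
  exact (isTau_PsiU _).unique this

/-- The element of `B` with `x y = Ψ(wwB x y)` for `x, y ∈ W`. -/
def wwB {R : Type} [Field R] (m ℓ : ℕ) (x y : Fin 4 → R) : BAlg m ℓ R :=
  -(wB m ℓ x * sig (wB m ℓ y))

lemma Psi_wwB {R : Type} [Field R] [CharZero R] {x y : Fin 4 → R} (hx : x ∈ W m ℓ R)
    (hy : y ∈ W m ℓ R) : Psi m ℓ R (wwB m ℓ x y) = io m R x * io m R y := by
  rw [io_eq_Psi hx, io_eq_Psi hy, wwB, map_neg, map_mul, mul_assoc, ← mul_assoc (io m R (e1 R)),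
    e1_mul_Psi, mul_assoc, e1_sq]
  simp

lemma conj_wwB {R : Type} [Field R] [CharZero R] (u : (BAlg m ℓ R)ˣ) {x y : Fin 4 → R}
    (hx : x ∈ W m ℓ R) (hy : y ∈ W m ℓ R) :
    (u : BAlg m ℓ R) * wwB m ℓ x y * ((u⁻¹ : (BAlg m ℓ R)ˣ) : BAlg m ℓ R) =
      wwB m ℓ ((tauB u).1.mulVec x) ((tauB u).1.mulVec y) := by
  apply Psi_injective
  have hH := H_mem_W_iff (tauB_mem_H u)
  rw [Psi_wwB ((hH x).2 hx) ((hH y).2 hy), ← isTau_PsiU, ← isTau_PsiU, map_mul, map_mul,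
    Psi_wwB hx hy, ← map_inv]
  change Psi m ℓ R u * (io m R x * io m R y) * Psi m ℓ R ((u⁻¹ : (BAlg m ℓ R)ˣ) : BAlg m ℓ R) =
    Psi m ℓ R u * io m R x * Psi m ℓ R ((u⁻¹ : (BAlg m ℓ R)ˣ) : BAlg m ℓ R) *
    (Psi m ℓ R u * io m R y * Psi m ℓ R ((u⁻¹ : (BAlg m ℓ R)ˣ) : BAlg m ℓ R))
  have h1 : Psi m ℓ R ((u⁻¹ : (BAlg m ℓ R)ˣ) : BAlg m ℓ R) * Psi m ℓ R u = 1 := by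
    rw [← map_mul, Units.inv_mul, map_one]
  calc _ = Psi m ℓ R u * io m R x * (Psi m ℓ R ((u⁻¹ : (BAlg m ℓ R)ˣ) : BAlg m ℓ R) *
        Psi m ℓ R u) * (io m R y * Psi m ℓ R ((u⁻¹ : (BAlg m ℓ R)ˣ) : BAlg m ℓ R)) := by
        rw [h1]; simp only [mul_assoc, mul_one]
    _ = _ := by simp only [mul_assoc]

/-- The pairing of `W` with `B`, proportional to `(h, z) ↦ tr(h ξ^ι z)`, for which `Λ ∩ W` is the
dual of `𝔬`. -/
def pairW {R : Type} [Field R] (x : Fin 4 → R) (z : BAlg m ℓ R) : R :=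
  x 0 * z.imI + x 1 * z.imK - x 2 * z.imJ

/-- The factor `⟨-cB m, 2⟩` is `2ω - cB m`, a square root of the discriminant. -/
lemma trace_pairW {R : Type} [Field R] [CharZero R] {x : Fin 4 → R} (hx : x ∈ W m ℓ R)
    (z : BAlg m ℓ R) :
    (hermL m R x * theta (hermL m R (xi0 ℓ R)) * bMat m ℓ R z).trace =
      (ℓ * pairW x z) • (⟨-cB m, 2⟩ : KAlg m R) := by
  rw [mem_W] at hx
  simp [Matrix.trace_fin_two, hermL_apply, theta, xi0, bMat, hx, pairW]
  ext <;> simp <;> ring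

/-- The pairing is invariant, because `τ(u)` fixes `ξ`. -/
lemma pairW_conj (hℓ : 0 < ℓ) {R : Type} [Field R] [CharZero R] (u : (BAlg m ℓ R)ˣ)
    {x : Fin 4 → R} (hx : x ∈ W m ℓ R) (z : BAlg m ℓ R) :
    pairW ((tauB u).1.mulVec x)
      ((u : BAlg m ℓ R) * z * ((u⁻¹ : (BAlg m ℓ R)ˣ) : BAlg m ℓ R)) = pairW x z := by
  have hgi : bMat m ℓ R u * bMat m ℓ R ((u⁻¹ : (BAlg m ℓ R)ˣ) : BAlg m ℓ R) = 1 := by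
    rw [← bMat_mul, Units.mul_inv, bMat_one]
  have hgi' : bMat m ℓ R ((u⁻¹ : (BAlg m ℓ R)ˣ) : BAlg m ℓ R) * bMat m ℓ R u = 1 := by
    rw [← bMat_mul, Units.inv_mul, bMat_one]
  have h1 := (isRep_PsiU u).conj_herm hgi (isTau_PsiU u) x (xi0 ℓ R)
  rw [(tauB_mem_H u).2] at h1
  have h2 := trace_pairW ((H_mem_W_iff (tauB_mem_H u) x).2 hx)
    ((u : BAlg m ℓ R) * z * ((u⁻¹ : (BAlg m ℓ R)ˣ) : BAlg m ℓ R))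
  have h3 := trace_pairW hx z
  rw [← h1, bMat_mul, bMat_mul] at h2
  set g := bMat m ℓ R u
  set g' := bMat m ℓ R ((u⁻¹ : (BAlg m ℓ R)ˣ) : BAlg m ℓ R)
  set T := hermL m R x * theta (hermL m R (xi0 ℓ R))
  have h4 : (g * T * g' * (g * bMat m ℓ R z * g')).trace = (T * bMat m ℓ R z).trace := by
    have : g * T * g' * (g * bMat m ℓ R z * g') = g * (T * (g' * g) * bMat m ℓ R z * g') := by
      simp only [Matrix.mul_assoc]
    rw [this, hgi', Matrix.mul_one, Matrix.trace_mul_comm, Matrix.mul_assoc, hgi', Matrix.mul_one]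
  rw [h4, h3] at h2
  have h5 := congr_arg QuadraticAlgebra.im h2
  simp only [QuadraticAlgebra.im_smul, smul_eq_mul] at h5
  have hℓR : (ℓ : R) ≠ 0 := by exact_mod_cast hℓ.ne'
  exact (mul_left_cancel₀ hℓR (mul_right_cancel₀ two_ne_zero h5)).symm

/-- `𝔬_p` is spanned over `ℤ_p` by `1` and the products of two vectors of `Λ ∩ W`, and conjugation
by `u` acts on these products through `τ(u)`. -/
lemma conj_mem_oLoc_of_tauB_mem_D {u : (BAlg m ℓ ℚ_[p])ˣ} (h : tauB u ∈ D m ℓ p)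
    {z : BAlg m ℓ ℚ_[p]} (hz : z ∈ oLoc m ℓ p) :
    (u : BAlg m ℓ ℚ_[p]) * z * ((u⁻¹ : (BAlg m ℓ ℚ_[p])ˣ) : BAlg m ℓ ℚ_[p]) ∈ oLoc m ℓ p := by
  have hww : ∀ x y : Fin 4 → ℚ_[p], x ∈ latP p → x ∈ W m ℓ ℚ_[p] → y ∈ latP p →
      y ∈ W m ℓ ℚ_[p] → (u : BAlg m ℓ ℚ_[p]) * wwB m ℓ x y *
        ((u⁻¹ : (BAlg m ℓ ℚ_[p])ˣ) : BAlg m ℓ ℚ_[p]) ∈ oLoc m ℓ p := by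
    intro x y hx hxW hy hyW
    rw [conj_wwB u hxW hyW]
    have hx' := ((h.2 x).2 ⟨hx, hxW⟩).1
    have hy' := ((h.2 y).2 ⟨hy, hyW⟩).1
    have w : ∀ v : Fin 4 → ℚ_[p], v ∈ latP p → wB m ℓ v ∈ oLoc m ℓ p := fun v hv =>
      ⟨hv 1, hv 2, hv 0, zero_mem (PadicInt.subring p)⟩
    exact neg_mem (mul_mem (w _ hx') (sig_mem_oLoc _ (w _ hy')))
  have w21 := hww _ _ e2_mem_latP (e2_mem (ℓ := ℓ)) e1_mem_latP (e1_mem (ℓ := ℓ))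
  have w01 := hww _ _ e0_mem_latP (e0_mem (ℓ := ℓ)) e1_mem_latP (e1_mem (ℓ := ℓ))
  have w02 := hww _ _ e0_mem_latP (e0_mem (ℓ := ℓ)) e2_mem_latP (e2_mem (ℓ := ℓ))
  have ez : z = algebraMap _ _ z.re - algebraMap _ _ z.imI * wwB m ℓ (e2 ℚ_[p]) (e1 ℚ_[p]) -
      algebraMap _ _ z.imJ * wwB m ℓ (e0 ℓ ℚ_[p]) (e1 ℚ_[p]) -
      algebraMap _ _ z.imK * wwB m ℓ (e0 ℓ ℚ_[p]) (e2 ℚ_[p]) := by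
    ext <;> simp [wwB, wB, sig, e0, e1, e2]
  obtain ⟨h1, h2, h3, h4⟩ := hz
  have hs : ∀ r : ℚ_[p], r ∈ PadicInt.subring p →
      algebraMap ℚ_[p] (BAlg m ℓ ℚ_[p]) r ∈ oLoc m ℓ p := fun r hr =>
    ⟨hr, zero_mem (PadicInt.subring p), zero_mem (PadicInt.subring p),
      zero_mem (PadicInt.subring p)⟩
  have comm : ∀ (r : ℚ_[p]) (w : BAlg m ℓ ℚ_[p]), (u : BAlg m ℓ ℚ_[p]) * (algebraMap _ _ r * w) *
      ((u⁻¹ : (BAlg m ℓ ℚ_[p])ˣ) : BAlg m ℓ ℚ_[p]) = algebraMap _ _ r *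
      (u * w * ((u⁻¹ : (BAlg m ℓ ℚ_[p])ˣ) : BAlg m ℓ ℚ_[p])) := by
    intro r w
    rw [← mul_assoc, ← Algebra.commutes r (u : BAlg m ℓ ℚ_[p])]
    simp only [mul_assoc]
  have comm1 : ∀ (r : ℚ_[p]), (u : BAlg m ℓ ℚ_[p]) * (algebraMap _ _ r) *
      ((u⁻¹ : (BAlg m ℓ ℚ_[p])ˣ) : BAlg m ℓ ℚ_[p]) = algebraMap _ _ r := by
    intro r
    rw [← Algebra.commutes, mul_assoc, Units.mul_inv, mul_one]
  rw [ez]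
  simp only [mul_sub, sub_mul, comm, comm1]
  exact sub_mem (sub_mem (sub_mem (hs _ h1) (mul_mem (hs _ h2) w21)) (mul_mem (hs _ h3) w01))
    (mul_mem (hs _ h4) w02)

/-- `Λ ∩ W` is the dual of `𝔬` for the invariant pairing `pairW`. -/
lemma tauB_mulVec_mem_of_conj (hℓ : 0 < ℓ) {u : (BAlg m ℓ ℚ_[p])ˣ}
    (h : ∀ z ∈ oLoc m ℓ p, ((u⁻¹ : (BAlg m ℓ ℚ_[p])ˣ) : BAlg m ℓ ℚ_[p]) * z *
      (u : BAlg m ℓ ℚ_[p]) ∈ oLoc m ℓ p)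
    {x : Fin 4 → ℚ_[p]} (hx : x ∈ latP p ∩ W m ℓ ℚ_[p]) :
    (tauB u).1.mulVec x ∈ latP p ∩ W m ℓ ℚ_[p] := by
  have hW : (tauB u).1.mulVec x ∈ W m ℓ ℚ_[p] := (H_mem_W_iff (tauB_mem_H u) x).2 hx.2
  refine ⟨?_, hW⟩
  have key : ∀ z ∈ oLoc m ℓ p, ‖pairW ((tauB u).1.mulVec x) z‖ ≤ 1 := by
    intro z hz
    have h1 := pairW_conj hℓ u hx.2 (((u⁻¹ : (BAlg m ℓ ℚ_[p])ˣ) : BAlg m ℓ ℚ_[p]) * z *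
      (u : BAlg m ℓ ℚ_[p]))
    have h2 : (u : BAlg m ℓ ℚ_[p]) * (((u⁻¹ : (BAlg m ℓ ℚ_[p])ˣ) : BAlg m ℓ ℚ_[p]) * z *
      (u : BAlg m ℓ ℚ_[p])) * ((u⁻¹ : (BAlg m ℓ ℚ_[p])ˣ) : BAlg m ℓ ℚ_[p]) = z := by
      simp [mul_assoc]
    rw [h2] at h1
    rw [h1]
    obtain ⟨-, h3, h4, h5⟩ := h z hz
    exact (PadicInt.subring p).sub_mem ((PadicInt.subring p).add_mem
      ((PadicInt.subring p).mul_mem (hx.1 0) h3) ((PadicInt.subring p).mul_mem (hx.1 1) h5))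
      ((PadicInt.subring p).mul_mem (hx.1 2) h4)
  have z0 := zero_mem (PadicInt.subring p)
  have z1 := one_mem (PadicInt.subring p)
  have k0 := key ⟨0, 1, 0, 0⟩ ⟨z0, z1, z0, z0⟩
  have k1 := key ⟨0, 0, 0, 1⟩ ⟨z0, z0, z0, z1⟩
  have k2 := key ⟨0, 0, 1, 0⟩ ⟨z0, z0, z1, z0⟩
  simp [pairW] at k0 k1 k2
  rw [mem_W] at hW
  intro i
  fin_cases i
  · exact k0
  · exact k1
  · exact k2
  · change ‖(tauB u).1.mulVec x 3‖ ≤ 1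
    rw [hW]
    exact neg_mem (mul_mem (natCast_mem (PadicInt.subring p) ℓ) k0)

/-- `τ(u)` stabilises `(Λ ∩ W)_p` if and only if `u` normalises `𝔬_p`. -/
lemma tauB_mem_D_iff (hℓ : 0 < ℓ) {u : (BAlg m ℓ ℚ_[p])ˣ} : tauB u ∈ D m ℓ p ↔
    ∀ z : BAlg m ℓ ℚ_[p], (u : BAlg m ℓ ℚ_[p]) * z *
      ((u⁻¹ : (BAlg m ℓ ℚ_[p])ˣ) : BAlg m ℓ ℚ_[p]) ∈ oLoc m ℓ p ↔ z ∈ oLoc m ℓ p := by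
  constructor
  · intro h z
    refine ⟨fun hz => ?_, conj_mem_oLoc_of_tauB_mem_D h⟩
    have h' : tauB u⁻¹ ∈ D m ℓ p := by
      rw [tauB_inv]
      exact inv_mem h
    have := conj_mem_oLoc_of_tauB_mem_D h' hz
    simpa [mul_assoc] using this
  · intro h
    refine ⟨tauB_mem_H u, fun x => ⟨fun hx => ?_, ?_⟩⟩
    · have := tauB_mulVec_mem_of_conj hℓ (u := u⁻¹) (by
        intro z hz
        rw [inv_inv]
        exact (h z).2 hz) hx
      rw [tauB_inv] at this
      have e := mulVec_inv_mulVec (tauB u)⁻¹ x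
      rw [inv_inv] at e
      rwa [e] at this
    · refine tauB_mulVec_mem_of_conj hℓ fun z hz => ?_
      rw [← h]
      simpa [mul_assoc] using hz

end local_groups

/-! ### Adelic groups -/

section basechange
variable {m ℓ : ℕ} {R : Type} [Field R] [CharZero R]

/-- The base change map `K → K ⊗ R`. -/
def kMap (m : ℕ) (R : Type) [Field R] [CharZero R] : KAlg m ℚ →+* KAlg m R where
  toFun x := ⟨(x.re : R), (x.im : R)⟩
  map_one' := by ext <;> simp [QuadraticAlgebra.re_one, QuadraticAlgebra.im_one]
  map_zero' := by ext <;> simp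
  map_add' := by intro x y; ext <;> simp
  map_mul' := by intro x y; ext <;> simp

@[simp] lemma kMap_re (x : KAlg m ℚ) : (kMap m R x).re = (x.re : R) := rfl
@[simp] lemma kMap_im (x : KAlg m ℚ) : (kMap m R x).im = (x.im : R) := rfl

lemma kMap_star (x : KAlg m ℚ) : kMap m R (star x) = star (kMap m R x) := by
  ext <;> simp

lemma kMap_algebraMap (r : ℚ) :
    kMap m R (algebraMap ℚ (KAlg m ℚ) r) = algebraMap R (KAlg m R) (r : R) := by
  rw [QuadraticAlgebra.algebraMap_eq, QuadraticAlgebra.algebraMap_eq]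
  ext <;> simp

lemma hermL_map (x : Fin 4 → ℚ) :
    (hermL m ℚ x).map (kMap m R) = hermL m R (fun j => (x j : R)) := by
  ext i j : 1
  fin_cases i <;> fin_cases j <;> simp [hermL_apply] <;> (ext <;> simp)

lemma actMat_map (g : Matrix (Fin 2) (Fin 2) (KAlg m ℚ)) :
    actMat (g.map (kMap m R)) = (actMat g).map (Rat.cast : ℚ → R) := by
  ext i j
  have h1 : hermL m R (Pi.single j 1) = (hermL m ℚ (Pi.single j 1)).map (kMap m R) := by
    rw [hermL_map]
    congr 1
    ext k
    simp only [Pi.single_apply]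
    split_ifs <;> simp
  have h2 : (g.map (kMap m R)).conjTranspose = g.conjTranspose.map (kMap m R) := by
    ext i j : 1
    simp [kMap_star]
  simp only [actMat, Matrix.of_apply, Matrix.map_apply]
  rw [h1, h2, ← Matrix.map_mul, ← Matrix.map_mul]
  fin_cases i <;> simp [hermCoord]

lemma det_map_kMap (g : Matrix (Fin 2) (Fin 2) (KAlg m ℚ)) {r : ℚ} (h : g.det = algebraMap ℚ _ r) :
    (g.map (kMap m R)).det = algebraMap R _ (r : R) := by
  rw [← kMap_algebraMap, ← h, RingHom.map_det]
  rfl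

lemma tauSL_map [NeZero m] {g : Matrix (Fin 2) (Fin 2) (KAlg m ℚ)} {r : ℚ} (hr : r ≠ 0)
    (h : g.det = algebraMap ℚ _ r) (hr' : (r : R) ≠ 0) :
    tauSL (g.map (kMap m R)) hr' (det_map_kMap g h) =
      Matrix.SpecialLinearGroup.map (algebraMap ℚ R) (tauSL g hr h) := by
  apply Subtype.ext
  change (r : R)⁻¹ • actMat (g.map (kMap m R)) = (r⁻¹ • actMat g).map (algebraMap ℚ R)
  rw [actMat_map]
  ext i j
  simp

lemma bMat_bMap (b : BAlg m ℓ ℚ) : bMat m ℓ R (bMap m ℓ R b) = (bMat m ℓ ℚ b).map (kMap m R) := by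
  ext i j : 1
  fin_cases i <;> fin_cases j <;> simp [bMat, bMap] <;> (ext <;> simp)

lemma tauB_map [NeZero m] (u : (BAlg m ℓ ℚ)ˣ) :
    tauB (Units.map (bMap m ℓ R : BAlg m ℓ ℚ →* BAlg m ℓ R) u) =
      Matrix.SpecialLinearGroup.map (algebraMap ℚ R) (tauB u) := by
  have hr : ((nrd m ℓ ℚ (u : BAlg m ℓ ℚ) : ℚ) : R) ≠ 0 := by
    exact_mod_cast nrd_unit_ne_zero u
  rw [tauB, tauB, ← tauSL_map (R := R) (nrd_unit_ne_zero u) (det_bMat _) hr]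
  congr 1
  · exact bMat_bMap _
  · apply QuadraticAlgebra.algebraMap_injective (a := (cA m : R)) (b := (cB m : R))
    rw [← det_bMat, ← det_map_kMap _ (det_bMat _), ← bMat_bMap]
    rfl

lemma IsTau.clMap {α : (Cl m ℚ)ˣ} {g : Matrix.SpecialLinearGroup (Fin 4) ℚ} (h : IsTau m ℚ α g) :
    IsTau m R (Units.map (clMap m R : Cl m ℚ →* Cl m R) α)
      (Matrix.SpecialLinearGroup.map (algebraMap ℚ R) g) := by
  have hio : ∀ x, HermZeta.clMap m R (io m ℚ x) = io m R (fun j => (x j : R)) := by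
    intro x
    rw [HermZeta.clMap, CliffordAlgebra.lift_ι_apply]
    rfl
  set G := Matrix.SpecialLinearGroup.map (algebraMap ℚ R) g
  set A := Units.map (HermZeta.clMap m R : Cl m ℚ →* Cl m R) α
  have hs : ∀ j : Fin 4, (A : Cl m R) * io m R (Pi.single j 1) * ((A⁻¹ : (Cl m R)ˣ) : Cl m R) =
      io m R (G.1.mulVec (Pi.single j 1)) := by
    intro j
    have h1 := congr_arg (HermZeta.clMap m R) (h (Pi.single j 1))
    rw [map_mul, map_mul, hio, hio] at h1
    have e1 : (fun k => (((Pi.single j 1 : Fin 4 → ℚ) k : ℚ) : R)) = Pi.single j 1 := by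
      ext k
      simp only [Pi.single_apply]
      split_ifs <;> simp
    have e2 : (fun k => ((g.1.mulVec (Pi.single j 1) k : ℚ) : R)) = G.1.mulVec (Pi.single j 1) := by
      ext k
      simp [G]
    rw [e1, e2] at h1
    rw [← h1]
    rfl
  intro x
  have hx : x = ∑ j, x j • (Pi.single j 1 : Fin 4 → R) := by
    ext k
    simp [Pi.single_apply]
  have h2 : G.1.mulVec x = ∑ j, x j • G.1.mulVec (Pi.single j 1) := by
    ext k
    simp [Matrix.mulVec, dotProduct, mul_comm]
  rw [h2]
  nth_rewrite 1 [hx]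
  simp only [map_sum, map_smul, Finset.mul_sum, Finset.sum_mul, mul_smul_comm, smul_mul_assoc, hs]

end basechange

lemma eventually_not_dvd {n : ℕ} (hn : n ≠ 0) :
    ∀ᶠ p : Nat.Primes in Filter.cofinite, ¬ (p : ℕ) ∣ n := by
  rw [Filter.eventually_cofinite]
  simp only [not_not]
  refine Set.Finite.of_finite_image (f := fun p : Nat.Primes => (p : ℕ)) ?_
    Subtype.val_injective.injOn
  refine (Nat.divisors n).finite_toSet.subset ?_
  rintro _ ⟨p, hp, rfl⟩
  simpa [hn] using hp

lemma eventually_norm_le_one (q : ℚ) :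
    ∀ᶠ p : Nat.Primes in Filter.cofinite, ‖(q : ℚ_[p])‖ ≤ 1 := by
  filter_upwards [eventually_not_dvd q.den_ne_zero] with p hp
  exact Padic.norm_rat_le_one hp

section adeles
variable {m ℓ : ℕ} [NeZero m]

lemma eventually_mem_oLoc (b : BAlg m ℓ ℚ) :
    ∀ᶠ p : Nat.Primes in Filter.cofinite, bMap m ℓ ℚ_[p] b ∈ oLoc m ℓ p := by
  filter_upwards [eventually_norm_le_one b.re, eventually_norm_le_one b.imI,
    eventually_norm_le_one b.imJ, eventually_norm_le_one b.imK] with p h1 h2 h3 h4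
  exact ⟨h1, h2, h3, h4⟩

/-- The diagonal embedding `B^× → B_𝔸^×`. -/
def diagB (u : (BAlg m ℓ ℚ)ˣ) : BA m ℓ :=
  (Units.map (bMap m ℓ ℝ : BAlg m ℓ ℚ →* BAlg m ℓ ℝ) u,
    ⟨fun p => Units.map (bMap m ℓ ℚ_[p] : BAlg m ℓ ℚ →* BAlg m ℓ ℚ_[p]) u, by
      filter_upwards [eventually_mem_oLoc (u : BAlg m ℓ ℚ),
        eventually_mem_oLoc ((u⁻¹ : (BAlg m ℓ ℚ)ˣ) : BAlg m ℓ ℚ)] with p h1 h2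
      change _ ∈ oUnits m ℓ p
      rw [oUnits, Submonoid.mem_units_iff, ← map_inv]
      exact ⟨h1, h2⟩⟩)

lemma diagB_mem_BQ (u : (BAlg m ℓ ℚ)ˣ) : diagB u ∈ BQ m ℓ := ⟨u, rfl, fun _ => rfl⟩

lemma BA_ext {x y : BA m ℓ} (h1 : x.1 = y.1) (h2 : ∀ p, x.2 p = y.2 p) : x = y :=
  Prod.ext h1 (RestrictedProduct.ext _ _ h2)

lemma HA_ext {x y : HA m ℓ} (h1 : x.1 = y.1) (h2 : ∀ p, x.2 p = y.2 p) : x = y :=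
  Prod.ext h1 (RestrictedProduct.ext _ _ h2)

lemma GWA_ext {x y : GWA m ℓ} (h1 : x.1 = y.1) (h2 : ∀ p, x.2 p = y.2 p) : x = y :=
  Prod.ext h1 (RestrictedProduct.ext _ _ h2)

lemma mem_BQ_iff {x : BA m ℓ} : x ∈ BQ m ℓ ↔ ∃ u, x = diagB u := by
  constructor
  · rintro ⟨u, h1, h2⟩
    exact ⟨u, BA_ext h1 h2⟩
  · rintro ⟨u, rfl⟩
    exact diagB_mem_BQ u

lemma gwEquiv_mem_J_iff (hm : Squarefree m) (p : ℕ) [Fact p.Prime] (u : (BAlg m ℓ ℚ_[p])ˣ) :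
    ((gwEquiv m ℓ ℚ_[p] u : GW m ℓ ℚ_[p]) : (Cl m ℚ_[p])ˣ) ∈ J m p ↔ u ∈ oUnits m ℓ p := by
  rw [gwEquiv_coe, PsiU_mem_J_iff hm]

/-- The isomorphism `B_𝔸^× ≅ G⁺(W)_𝔸`, the inverse of `Ξ`. -/
def psiA (hm : Squarefree m) : BA m ℓ ≃* GWA m ℓ where
  toFun x := (gwEquiv m ℓ ℝ x.1, ⟨fun p => gwEquiv m ℓ ℚ_[p] (x.2 p), by
    filter_upwards [x.2.2] with p hp
    exact (gwEquiv_mem_J_iff hm p _).2 hp⟩)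
  invFun y := ((gwEquiv m ℓ ℝ).symm y.1, ⟨fun p => (gwEquiv m ℓ ℚ_[p]).symm (y.2 p), by
    filter_upwards [y.2.2] with p hp
    refine (gwEquiv_mem_J_iff hm p _).1 ?_
    rw [MulEquiv.apply_symm_apply]
    exact hp⟩)
  left_inv x := BA_ext (MulEquiv.symm_apply_apply _ _) fun p => MulEquiv.symm_apply_apply _ _
  right_inv x := GWA_ext (MulEquiv.apply_symm_apply _ _) fun p => MulEquiv.apply_symm_apply _ _
  map_mul' x y := GWA_ext (map_mul (gwEquiv m ℓ ℝ) x.1 y.1)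
    fun p => map_mul (gwEquiv m ℓ ℚ_[p]) (x.2 p) (y.2 p)

variable (hm : Squarefree m)

lemma psiA_fst (x : BA m ℓ) : ((psiA hm x).1 : (Cl m ℝ)ˣ) = PsiU m ℓ ℝ x.1 := rfl
lemma psiA_snd (x : BA m ℓ) (p : Nat.Primes) :
    ((psiA hm x).2 p : (Cl m ℚ_[p])ˣ) = PsiU m ℓ ℚ_[p] (x.2 p) := rfl

/-- The relation `Ξ(y) = u` is the graph of the inverse of `psiA`. -/
lemma isXi_iff {y : GWA m ℓ} {u : BA m ℓ} : IsXi m ℓ y u ↔ psiA hm u = y := by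
  obtain ⟨v, rfl⟩ := (psiA hm).surjective y
  rw [(psiA hm).apply_eq_iff_eq]
  constructor
  · rintro ⟨h1, h2⟩
    refine BA_ext ?_ fun p => ?_
    · rw [psiA_fst, PsiU_coe, Xi_Psi] at h1
      exact Units.ext (bMat_injective h1.symm)
    · have := h2 p
      rw [psiA_snd, PsiU_coe, Xi_Psi] at this
      exact Units.ext (bMat_injective this.symm)
  · rintro rfl
    refine ⟨?_, fun p => ?_⟩
    · rw [psiA_fst, PsiU_coe, Xi_Psi]
    · rw [psiA_snd, PsiU_coe, Xi_Psi]

/-- `Ξ` maps `𝒥` onto `X`. -/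
lemma psiA_mem_calJ_iff {u : BA m ℓ} : psiA hm u ∈ calJ m ℓ ↔ u ∈ X m ℓ :=
  forall_congr' fun p => gwEquiv_mem_J_iff hm p (u.2 p)

lemma tauB_mem_C_of_mem_oUnits (hm : Squarefree m) {p : ℕ} [Fact p.Prime] {u : (BAlg m ℓ ℚ_[p])ˣ}
    (h : u ∈ oUnits m ℓ p) : tauB u ∈ C m p := by
  obtain ⟨-, ⟨g, hg, hτ⟩, -⟩ := (PsiU_mem_J_iff hm).2 h
  rwa [(isTau_PsiU u).unique hτ]

/-- `τ(u) ∈ H(ξ)_𝔸` for `u ∈ B_𝔸^×`. -/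
def tauA (hm : Squarefree m) (u : BA m ℓ) : HA m ℓ :=
  (⟨tauB u.1, tauB_mem_H _⟩, ⟨fun p => ⟨tauB (u.2 p), tauB_mem_H _⟩, by
    filter_upwards [u.2.2] with p hp
    exact tauB_mem_C_of_mem_oUnits hm hp⟩)

lemma tauA_mul (u v : BA m ℓ) : tauA hm (u * v) = tauA hm u * tauA hm v :=
  HA_ext (Subtype.ext (tauB_mul _ _)) fun _ => Subtype.ext (tauB_mul _ _)

lemma isTauA_psiA_iff {u : BA m ℓ} {g : HA m ℓ} : IsTauA m ℓ (psiA hm u) g ↔ g = tauA hm u := by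
  constructor
  · rintro ⟨h1, h2⟩
    refine HA_ext (Subtype.ext ?_) fun p => Subtype.ext ?_
    · exact h1.unique (isTau_PsiU u.1)
    · exact (h2 p).unique (isTau_PsiU (u.2 p))
  · rintro rfl
    exact ⟨isTau_PsiU u.1, fun p => isTau_PsiU (u.2 p)⟩

lemma tauEquiv_psiA_iff {E : Subgroup (HA m ℓ)} {a y : BA m ℓ} :
    TauEquiv m ℓ E (psiA hm a) (psiA hm y) ↔
      ∃ h ∈ HQ m ℓ, ∃ e ∈ E, tauA hm y = h * tauA hm a * e := by
  constructor
  · rintro ⟨g, k, hg, hk, hgk⟩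
    rw [isTauA_psiA_iff] at hg hk
    subst hg hk
    rw [DoubleCoset.mem_doubleCoset] at hgk
    exact hgk
  · rintro ⟨h, hh, e, he, heq⟩
    refine ⟨_, _, (isTauA_psiA_iff hm).2 rfl, (isTauA_psiA_iff hm).2 rfl, ?_⟩
    rw [DoubleCoset.mem_doubleCoset]
    exact ⟨h, hh, e, he, heq⟩

lemma TauEquiv.symm {E : Subgroup (HA m ℓ)} {a y : GWA m ℓ} (h : TauEquiv m ℓ E a y) :
    TauEquiv m ℓ E y a := by
  obtain ⟨g, k, hg, hk, hgk⟩ := h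
  refine ⟨k, g, hk, hg, ?_⟩
  rw [DoubleCoset.mem_doubleCoset] at hgk ⊢
  obtain ⟨x, hx, e, he, rfl⟩ := hgk
  exact ⟨x⁻¹, inv_mem hx, e⁻¹, inv_mem he, by group⟩

lemma TauEquiv.trans (hm : Squarefree m) {E : Subgroup (HA m ℓ)} {a y z : GWA m ℓ}
    (h : TauEquiv m ℓ E a y)
    (h' : TauEquiv m ℓ E y z) : TauEquiv m ℓ E a z := by
  obtain ⟨a, rfl⟩ := (psiA hm).surjective a
  obtain ⟨y, rfl⟩ := (psiA hm).surjective y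
  obtain ⟨z, rfl⟩ := (psiA hm).surjective z
  rw [tauEquiv_psiA_iff] at *
  obtain ⟨x, hx, e, he, h1⟩ := h
  obtain ⟨x', hx', e', he', h2⟩ := h'
  exact ⟨x' * x, mul_mem hx' hx, e * e', mul_mem he he', by rw [h2, h1]; group⟩

lemma TauEquiv.mono {E E' : Subgroup (HA m ℓ)} (hE : E ≤ E') {a y : GWA m ℓ}
    (h : TauEquiv m ℓ E a y) : TauEquiv m ℓ E' a y := by
  obtain ⟨g, k, hg, hk, hgk⟩ := h
  refine ⟨g, k, hg, hk, ?_⟩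
  rw [DoubleCoset.mem_doubleCoset] at hgk ⊢
  obtain ⟨x, hx, e, he, h⟩ := hgk
  exact ⟨x, hx, e, hE he, h⟩

lemma HC_le_HD : HC m ℓ ≤ HD m ℓ := by
  intro g hg p
  refine ⟨(g.2 p).2, fun x => ?_⟩
  exact and_congr ((hg p).2 x) (H_mem_W_iff (g.2 p).2 x)

/-- `τ⁻¹(𝒟)` is the normaliser of `𝔬`. -/
lemma tauA_mem_HD_iff (hℓ : 0 < ℓ) {u : BA m ℓ} : tauA hm u ∈ HD m ℓ ↔ u ∈ NB m ℓ :=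
  forall_congr' fun _ => tauB_mem_D_iff hℓ

lemma tauA_diagB_mem (u : (BAlg m ℓ ℚ)ˣ) : tauA hm (diagB u) ∈ HQ m ℓ :=
  ⟨tauB u, tauB_mem_H u, tauB_map u, fun _ => tauB_map u⟩

/-- Two elements of `B_𝔸^×` have the same type if and only if their images under `τ` lie in the
same double coset modulo `H(ξ)_ℚ` and the stabiliser of `Λ ∩ W`. -/
lemma rho_eq_iff_tauEquiv (hℓ : 0 < ℓ) (hQ : ∀ h ∈ H m ℓ ℚ, ∃ u : (BAlg m ℓ ℚ)ˣ, tauB u = h)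
    {a y : BA m ℓ} :
    rho m ℓ a = rho m ℓ y ↔ TauEquiv m ℓ (HD m ℓ) (psiA hm a) (psiA hm y) := by
  rw [tauEquiv_psiA_iff, rho, rho, DoubleCoset.eq]
  constructor
  · rintro ⟨b, hb, n, hn, rfl⟩
    obtain ⟨u, rfl⟩ := mem_BQ_iff.1 hb
    exact ⟨_, tauA_diagB_mem hm u, _, (tauA_mem_HD_iff hm hℓ).2 hn, by rw [tauA_mul, tauA_mul]⟩
  · rintro ⟨h, ⟨h', hh', e1, e2⟩, d, hd, heq⟩
    obtain ⟨u, rfl⟩ := hQ h' hh'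
    have hh : h = tauA hm (diagB u) := by
      refine HA_ext (Subtype.ext ?_) fun p => Subtype.ext ?_
      · rw [e1, ← tauB_map]; rfl
      · rw [e2, ← tauB_map]; rfl
    refine ⟨diagB u, diagB_mem_BQ u, (diagB u * a)⁻¹ * y, ?_, by group⟩
    change _ ∈ NB m ℓ
    rw [← tauA_mem_HD_iff hm hℓ]
    have : tauA hm (diagB u * a) * tauA hm ((diagB u * a)⁻¹ * y) = tauA hm (diagB u * a) * d := by
      rw [← tauA_mul, mul_inv_cancel_left, heq, hh, tauA_mul]
    rw [mul_left_cancel this]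
    exact hd

end adeles

/-! ### Surjectivity of `τ` on rational points -/

section surj
variable {m ℓ : ℕ} {R : Type} [Field R] [CharZero R]

lemma mul_star_K (z : KAlg m R) :
    z * star z = algebraMap R _ (QuadraticAlgebra.norm z) := by
  rw [QuadraticAlgebra.algebraMap_norm_eq_mul_star]

lemma conj_hermL (a b c d : KAlg m R) (x : Fin 4 → R) :
    !![a, b; c, d] * hermL m R x * (!![a, b; c, d] : Matrix _ _ (KAlg m R)).conjTranspose =
      !![(a * ⟨x 0, 0⟩ + b * star ⟨x 1, x 2⟩) * star a + (a * ⟨x 1, x 2⟩ + b * ⟨x 3, 0⟩) * star b,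
        (a * ⟨x 0, 0⟩ + b * star ⟨x 1, x 2⟩) * star c + (a * ⟨x 1, x 2⟩ + b * ⟨x 3, 0⟩) * star d;
        (c * ⟨x 0, 0⟩ + d * star ⟨x 1, x 2⟩) * star a + (c * ⟨x 1, x 2⟩ + d * ⟨x 3, 0⟩) * star b,
        (c * ⟨x 0, 0⟩ + d * star ⟨x 1, x 2⟩) * star c +
          (c * ⟨x 1, x 2⟩ + d * ⟨x 3, 0⟩) * star d] := by
  have h : (!![a, b; c, d] : Matrix _ _ (KAlg m R)).conjTranspose =
      !![star a, star c; star b, star d] := by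
    ext i j : 1
    fin_cases i <;> fin_cases j <;> rfl
  rw [h, hermL_apply, Matrix.mul_fin_two, Matrix.mul_fin_two]

/-- `γ ∈ SL₄` is the map `h ↦ g h g^* / r`, where `g ∈ GL₂(K ⊗ R)` has determinant `r ∈ R^×`. -/
def IsTauBy (m : ℕ) (R : Type) [Field R] (γ : Matrix.SpecialLinearGroup (Fin 4) R)
    (g : Matrix (Fin 2) (Fin 2) (KAlg m R)) (r : R) : Prop :=
  r ≠ 0 ∧ g.det = algebraMap R _ r ∧
    ∀ x, r • hermL m R (γ.1.mulVec x) = g * hermL m R x * g.conjTranspose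

lemma isTauBy_tauSL [NeZero m] {g : Matrix (Fin 2) (Fin 2) (KAlg m R)} {r : R} (hr : r ≠ 0)
    (h : g.det = algebraMap R _ r) : IsTauBy m R (tauSL g hr h) g r :=
  ⟨hr, h, fun x => by rw [hermL_tauSL hr h, smul_inv_smul₀ hr]⟩

lemma IsTauBy.mul {γ γ' : Matrix.SpecialLinearGroup (Fin 4) R}
    {g g' : Matrix (Fin 2) (Fin 2) (KAlg m R)} {r r' : R} (h : IsTauBy m R γ g r)
    (h' : IsTauBy m R γ' g' r') : IsTauBy m R (γ * γ') (g * g') (r * r') := by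
  obtain ⟨hr, hg, hx⟩ := h
  obtain ⟨hr', hg', hx'⟩ := h'
  refine ⟨mul_ne_zero hr hr', by rw [Matrix.det_mul, hg, hg', map_mul], fun x => ?_⟩
  rw [Matrix.SpecialLinearGroup.coe_mul, ← Matrix.mulVec_mulVec, mul_comm, mul_smul, hx,
    Matrix.conjTranspose_mul, ← Matrix.smul_mul, ← Matrix.mul_smul, hx']
  simp only [Matrix.mul_assoc]

lemma IsTauBy.eq_tauSL [NeZero m] {γ : Matrix.SpecialLinearGroup (Fin 4) R}
    {g : Matrix (Fin 2) (Fin 2) (KAlg m R)} {r : R} (h : IsTauBy m R γ g r) :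
    γ = tauSL g h.1 h.2.1 := by
  refine Subtype.ext (Matrix.ext_of_mulVec_single fun j => ?_)
  apply hermL_injective (m := m)
  rw [hermL_tauSL h.1 h.2.1, ← h.2.2, inv_smul_smul₀ h.1]

/-- An isometry which fixes both isotropic vectors of a hyperbolic plane rotates `K ⊗ R` by an
element `a` of norm 1. -/
lemma isTauBy_of_fix_two [NeZero m] {γ : Matrix.SpecialLinearGroup (Fin 4) R} (h : γ ∈ SO0 m R)
    (hR : ∀ z : KAlg m R, QuadraticAlgebra.norm z = 0 → z = 0)
    (h0 : γ.1.mulVec ![1, 0, 0, 0] = ![1, 0, 0, 0])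
    (h3 : γ.1.mulVec ![0, 0, 0, 1] = ![0, 0, 0, 1]) : ∃ g r, IsTauBy m R γ g r := by
  have c0 : ∀ i, γ.1 i 0 = (![1, 0, 0, 0] : Fin 4 → R) i := fun i => by
    rw [← h0]; simp [Matrix.mulVec, dotProduct, Fin.sum_univ_four]
  have c3 : ∀ i, γ.1 i 3 = (![0, 0, 0, 1] : Fin 4 → R) i := fun i => by
    rw [← h3]; simp [Matrix.mulVec, dotProduct, Fin.sum_univ_four]
  have c1 : γ.1.mulVec ![0, 1, 0, 0] = fun i => γ.1 i 1 := by
    ext i; simp [Matrix.mulVec, dotProduct, Fin.sum_univ_four]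
  have c2 : γ.1.mulVec ![0, 0, 1, 0] = fun i => γ.1 i 2 := by
    ext i; simp [Matrix.mulVec, dotProduct, Fin.sum_univ_four]
  have p01 := SO0_phi0 h ![1, 0, 0, 0] ![0, 1, 0, 0]
  have p02 := SO0_phi0 h ![1, 0, 0, 0] ![0, 0, 1, 0]
  have p31 := SO0_phi0 h ![0, 0, 0, 1] ![0, 1, 0, 0]
  have p32 := SO0_phi0 h ![0, 0, 0, 1] ![0, 0, 1, 0]
  have p11 := SO0_phi0 h ![0, 1, 0, 0] ![0, 1, 0, 0]
  have p12 := SO0_phi0 h ![0, 1, 0, 0] ![0, 0, 1, 0]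
  rw [h0, c1, phi0_apply, phi0_apply] at p01
  rw [h0, c2, phi0_apply, phi0_apply] at p02
  rw [h3, c1, phi0_apply, phi0_apply] at p31
  rw [h3, c2, phi0_apply, phi0_apply] at p32
  rw [c1, phi0_apply, phi0_apply] at p11
  rw [c1, c2, phi0_apply, phi0_apply] at p12
  simp at p01 p02 p31 p32 p11 p12
  have hdet := γ.2
  rw [Matrix.det_succ_row_zero] at hdet
  simp [Fin.sum_univ_succ, Matrix.det_fin_three, Matrix.submatrix_apply, Fin.succAbove, c0, c3,
    p01, p02] at hdet
  -- the isometry maps `1 ∈ K ⊗ R` to `a`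
  set a : KAlg m R := ⟨γ.1 1 1, γ.1 2 1⟩ with ha
  have hN : γ.1 1 1 ^ 2 + cB m * γ.1 1 1 * γ.1 2 1 - cA m * γ.1 2 1 ^ 2 = 1 := by
    rw [p31, p01] at p11
    linear_combination -p11
  have hNa : a * star a = 1 := by
    rw [mul_star_K, QuadraticAlgebra.norm_def, ← map_one (algebraMap R (KAlg m R))]
    congr 1
    simp only [ha]
    linear_combination hN
  -- the second column is `a ω`
  have hb1 : γ.1 1 2 = cA m * γ.1 2 1 := by
    rw [p31, p01, p32, p02] at p12
    linear_combination -(cB m * γ.1 1 1 / 2 - cA m * γ.1 2 1) * hdet - γ.1 1 1 * p12 - γ.1 1 2 * hN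
  have hb2 : γ.1 2 2 = γ.1 1 1 + cB m * γ.1 2 1 := by
    rw [p31, p01, p32, p02] at p12
    linear_combination (γ.1 1 1 + cB m / 2 * γ.1 2 1) * hdet - γ.1 2 1 * p12 - γ.1 2 2 * hN
  -- Hilbert 90: `a = s / s̄`
  obtain ⟨s, hs, has⟩ : ∃ s : KAlg m R, s ≠ 0 ∧ a * star s = s := by
    by_cases h1 : 1 + a = 0
    · refine ⟨⟨-cB m, 2⟩, fun h => ?_, ?_⟩
      · simpa using congr_arg QuadraticAlgebra.im h
      · rw [eq_neg_of_add_eq_zero_right h1]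
        ext <;> simp <;> ring
    · exact ⟨1 + a, h1, by rw [star_add, star_one, mul_add, hNa]; ring⟩
  refine ⟨!![s, 0; 0, star s], QuadraticAlgebra.norm s, fun h => hs (hR s h), ?_, fun x => ?_⟩
  · rw [← mul_star_K]; simp [Matrix.det_fin_two]
  have hγ : γ.1.mulVec x = ![x 0, γ.1 1 1 * x 1 + γ.1 1 2 * x 2, γ.1 2 1 * x 1 + γ.1 2 2 * x 2,
      x 3] := by
    ext i
    fin_cases i <;> simp [Matrix.mulVec, dotProduct, Fin.sum_univ_four, c0, c3, p01, p02, p31, p32]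
  have hmid : (⟨γ.1 1 1 * x 1 + γ.1 1 2 * x 2, γ.1 2 1 * x 1 + γ.1 2 2 * x 2⟩ : KAlg m R) =
      a * ⟨x 1, x 2⟩ := by
    ext <;> simp [ha, hb1, hb2] <;> ring
  have hmid' := congr_arg star hmid
  rw [star_mul] at hmid'
  rw [← algebraMap_smul (KAlg m R), ← mul_star_K, hγ, conj_hermL, hermL_apply]
  have has' := congr_arg star has
  rw [star_mul, star_star] at has'
  ext i j : 1
  fin_cases i <;> fin_cases j <;> simp
  · ring
  · rw [hmid]; linear_combination (s * ⟨x 1, x 2⟩) * has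
  · simp at hmid'
    rw [hmid']
    linear_combination (star s * ⟨x 1 + cB m * x 2, -x 2⟩) * has'
  · ring

lemma inv_mulVec_eq {σ : Matrix.SpecialLinearGroup (Fin 4) R} {x y : Fin 4 → R}
    (h : σ.1.mulVec x = y) : σ⁻¹.1.mulVec y = x := by
  have := mulVec_inv_mulVec σ⁻¹ x
  rwa [inv_inv, h] at this

/-- A unipotent matrix reduces the claim to isometries which fix both isotropic vectors. -/
lemma isTauBy_of_fix_one [NeZero m] {γ : Matrix.SpecialLinearGroup (Fin 4) R} (h : γ ∈ SO0 m R)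
    (hR : ∀ z : KAlg m R, QuadraticAlgebra.norm z = 0 → z = 0)
    (h0 : γ.1.mulVec ![1, 0, 0, 0] = ![1, 0, 0, 0]) : ∃ g r, IsTauBy m R γ g r := by
  set v := γ.1.mulVec ![0, 0, 0, 1] with hv
  have p := SO0_phi0 h ![1, 0, 0, 0] ![0, 0, 0, 1]
  have q := SO0_Q0 h ![0, 0, 0, 1]
  rw [h0, ← hv, phi0_apply, phi0_apply] at p
  rw [← hv, Q0_apply, Q0_apply] at q
  simp at p q
  -- the unipotent `g` fixes `(1, 0, 0, 0)` and maps `(0, 0, 0, 1)` to `v`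
  set g : Matrix (Fin 2) (Fin 2) (KAlg m R) := !![1, ⟨v 1, v 2⟩; 0, 1] with hg
  have hdet : g.det = algebraMap R _ 1 := by simp [hg, Matrix.det_fin_two]
  have f0 : (tauSL g one_ne_zero hdet).1.mulVec ![1, 0, 0, 0] = ![1, 0, 0, 0] := by
    apply hermL_injective (m := m)
    rw [hermL_tauSL, hg, conj_hermL, hermL_apply]
    ext i j : 1
    fin_cases i <;> fin_cases j <;> simp <;> (ext <;> simp)
  have f3 : (tauSL g one_ne_zero hdet).1.mulVec ![0, 0, 0, 1] = v := by
    apply hermL_injective (m := m)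
    rw [hermL_tauSL, hg, conj_hermL, hermL_apply]
    ext i j : 1
    fin_cases i <;> fin_cases j <;> simp [p] <;> (ext <;> simp)
    · linear_combination -q + v 0 * p
    · ring
  have hmem : (tauSL g one_ne_zero hdet)⁻¹ * γ ∈ SO0 m R :=
    mul_mem (inv_mem (tauSL_mem_SO0 _ _)) h
  obtain ⟨g', r', h'⟩ := isTauBy_of_fix_two hmem hR
    (by rw [Matrix.SpecialLinearGroup.coe_mul, ← Matrix.mulVec_mulVec, h0]; exact inv_mulVec_eq f0)
    (by rw [Matrix.SpecialLinearGroup.coe_mul, ← Matrix.mulVec_mulVec, ← hv]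
        exact inv_mulVec_eq f3)
  have := (isTauBy_tauSL one_ne_zero hdet).mul h'
  rw [mul_inv_cancel_left] at this
  exact ⟨_, _, this⟩

/-- If the norm form is anisotropic then every element of `SO(V₀)` is a map
`h ↦ g h g^* / det g`. -/
lemma exists_isTauBy [NeZero m] {γ : Matrix.SpecialLinearGroup (Fin 4) R} (h : γ ∈ SO0 m R)
    (hR : ∀ z : KAlg m R, QuadraticAlgebra.norm z = 0 → z = 0) : ∃ g r, IsTauBy m R γ g r := by
  set v := γ.1.mulVec ![1, 0, 0, 0] with hv
  have q := SO0_Q0 h ![1, 0, 0, 0]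
  rw [← hv, Q0_apply, Q0_apply] at q
  simp at q
  -- some `τ(g)` maps `(1, 0, 0, 0)` to the isotropic vector `v`, with `r = v 0` or `r = v 3`; if
  -- `v 0 = 0` then `v` is a multiple of `(0, 0, 0, 1)` because the norm form is anisotropic
  obtain ⟨g, r, hr, hdet, hgv⟩ : ∃ (g : Matrix (Fin 2) (Fin 2) (KAlg m R)) (r : R), r ≠ 0 ∧
      g.det = algebraMap R _ r ∧
      g * hermL m R ![1, 0, 0, 0] * g.conjTranspose = r • hermL m R v := by
    by_cases hv0 : v 0 = 0
    · have h12 := hR ⟨v 1, v 2⟩ (by rw [QuadraticAlgebra.norm_def]; rw [hv0] at q;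
                                    simp only; linear_combination -q)
      have h1 : v 1 = 0 := congr_arg QuadraticAlgebra.re h12
      have h2 : v 2 = 0 := congr_arg QuadraticAlgebra.im h12
      have hv3 : v 3 ≠ 0 := by
        intro hv3
        have hz : v = 0 := by ext i; fin_cases i <;> assumption
        have : (![1, 0, 0, 0] : Fin 4 → R) = 0 := by
          rw [← inv_mulVec_eq hv.symm, hz, Matrix.mulVec_zero]
        simpa using congr_fun this 0
      refine ⟨!![0, -1; algebraMap R _ (v 3), 0], v 3, hv3, by simp [Matrix.det_fin_two], ?_⟩
      rw [conj_hermL, hermL_apply]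
      ext i j : 1
      fin_cases i <;> fin_cases j <;>
        simp [hv0, h1, h2, QuadraticAlgebra.algebraMap_eq]
    · refine ⟨!![algebraMap R _ (v 0), 0; star ⟨v 1, v 2⟩, 1], v 0, hv0,
        by simp [Matrix.det_fin_two], ?_⟩
      rw [conj_hermL, hermL_apply]
      ext i j : 1
      fin_cases i <;> fin_cases j <;>
        simp [QuadraticAlgebra.algebraMap_eq]
      all_goals ext <;> simp
      all_goals first | ring1 | linear_combination -q
  have f0 : (tauSL g hr hdet).1.mulVec ![1, 0, 0, 0] = v := by
    apply hermL_injective (m := m)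
    rw [hermL_tauSL, hgv, inv_smul_smul₀ hr]
  obtain ⟨g', r', h'⟩ := isTauBy_of_fix_one
    (mul_mem (inv_mem (tauSL_mem_SO0 hr hdet)) h) hR
    (by rw [Matrix.SpecialLinearGroup.coe_mul, ← Matrix.mulVec_mulVec, ← hv]
        exact inv_mulVec_eq f0)
  have := (isTauBy_tauSL hr hdet).mul h'
  rw [mul_inv_cancel_left] at this
  exact ⟨_, _, this⟩

/-- An element `g` for which `τ(g)` fixes `ξ` lies in the image of `B^×`. -/
lemma IsTauBy.exists_tauB [NeZero m] {γ : Matrix.SpecialLinearGroup (Fin 4) R}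
    {g : Matrix (Fin 2) (Fin 2) (KAlg m R)} {r : R} (h : IsTauBy m R γ g r)
    (hξ : γ.1.mulVec (xi0 ℓ R) = xi0 ℓ R) : ∃ u : (BAlg m ℓ R)ˣ, tauB u = γ := by
  obtain ⟨hr, hg, hx⟩ := id h
  have h1 := hx (xi0 ℓ R)
  rw [hξ] at h1
  -- `g ξ g^* = r ξ` means `g^ι ξ = ξ g^*`, which is the condition for `g` to lie in `B ⊂ M₂(K)`
  have h2 : g.adjugate * (r • hermL m R (xi0 ℓ R)) =
      r • (hermL m R (xi0 ℓ R) * g.conjTranspose) := by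
    rw [h1, Matrix.mul_assoc, ← Matrix.mul_assoc g.adjugate, Matrix.adjugate_mul, hg,
      Matrix.smul_mul, Matrix.one_mul, algebraMap_smul]
  rw [Matrix.mul_smul] at h2
  have h3 := smul_right_injective _ hr h2
  have e00 := congr_fun (congr_fun h3 0) 0
  have e10 := congr_fun (congr_fun h3 1) 0
  simp [hermL_apply, xi0, Matrix.mul_apply, Matrix.adjugate_fin_two] at e00 e10
  have z0 : (⟨0, 0⟩ : KAlg m R) = 0 := rfl
  have z1 : (⟨1, 0⟩ : KAlg m R) = 1 := rfl
  have zl : (⟨ℓ, 0⟩ : KAlg m R) = (ℓ : KAlg m R) := by ext <;> simp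
  simp only [z0, z1, zl, mul_one, mul_zero, neg_zero, add_zero, one_mul, zero_mul, zero_add]
    at e00 e10
  set b : BAlg m ℓ R := ⟨(g 0 0).re, (g 0 0).im, (g 0 1).re, (g 0 1).im⟩ with hb
  have hbg : bMat m ℓ R b = g := by
    ext i j : 1
    fin_cases i <;> fin_cases j
    · rfl
    · rfl
    · change -(ℓ : KAlg m R) * star (g 0 1) = g 1 0
      linear_combination e10
    · exact e00.symm
  have hn : nrd m ℓ R b = r := by
    apply QuadraticAlgebra.algebraMap_injective (a := (cA m : R)) (b := (cB m : R))
    rw [← det_bMat, hbg, hg]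
  have hbs : b * star b = algebraMap R _ r := by
    rw [← hn, QuaternionAlgebra.mul_star_eq_coe]; rfl
  have hsb : star b * b = algebraMap R _ r := by
    have h4 : star b * b = b * star b := by
      rw [QuaternionAlgebra.star_mul_eq_coe, QuaternionAlgebra.mul_star_eq_coe]
      congr 1
      simp
      ring
    rw [h4, hbs]
  refine ⟨⟨b, r⁻¹ • star b, ?_, ?_⟩, ?_⟩
  · rw [mul_smul_comm, hbs, Algebra.algebraMap_eq_smul_one, inv_smul_smul₀ hr]
  · rw [smul_mul_assoc, hsb, Algebra.algebraMap_eq_smul_one, inv_smul_smul₀ hr]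
  · have h5 : IsTauBy m R γ (bMat m ℓ R b) (nrd m ℓ R b) := by rwa [hbg, hn]
    exact h5.eq_tauSL.symm

end surj

/-! ### The identity component of `SO(V₀ ⊗ ℝ)` -/

section cone
variable {m ℓ : ℕ} [NeZero m]

lemma norm_nonneg_K (z : KAlg m ℚ) : 0 ≤ QuadraticAlgebra.norm z := by
  have h : ((cB m : ℚ)) ^ 2 + 4 * cA m < 0 := by exact_mod_cast disc_lt m
  rw [QuadraticAlgebra.norm_def]
  nlinarith [sq_nonneg (2 * z.re + cB m * z.im), sq_nonneg z.im,
    mul_nonneg (neg_nonneg.2 h.le) (sq_nonneg z.im)]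

lemma eq_zero_of_norm_real {z : KAlg m ℝ} (h0 : QuadraticAlgebra.norm z = 0) : z = 0 := by
  have h : ((cB m : ℝ)) ^ 2 + 4 * cA m < 0 := by exact_mod_cast disc_lt m
  rw [QuadraticAlgebra.norm_def] at h0
  have h1 : (2 * z.re + cB m * z.im) ^ 2 + (-((cB m : ℝ) ^ 2 + 4 * cA m)) * z.im ^ 2 = 0 := by
    linear_combination 4 * h0
  have h2 : 0 ≤ (-((cB m : ℝ) ^ 2 + 4 * cA m)) * z.im ^ 2 := mul_nonneg (by linarith) (sq_nonneg _)
  have h3 : z.im = 0 := by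
    have : (-((cB m : ℝ) ^ 2 + 4 * cA m)) * z.im ^ 2 = 0 := by
      nlinarith [sq_nonneg (2 * z.re + cB m * z.im)]
    rcases mul_eq_zero.1 this with h4 | h4
    · linarith
    · exact pow_eq_zero_iff two_ne_zero |>.1 h4
  have h4 : z.re = 0 := by
    rw [h3] at h0
    nlinarith
  ext <;> assumption

lemma norm_nonneg_real (z : KAlg m ℝ) : 0 ≤ QuadraticAlgebra.norm z := by
  have h : ((cB m : ℝ)) ^ 2 + 4 * cA m < 0 := by exact_mod_cast disc_lt m
  rw [QuadraticAlgebra.norm_def]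
  nlinarith [sq_nonneg (2 * z.re + cB m * z.im), sq_nonneg z.im,
    mul_nonneg (neg_nonneg.2 h.le) (sq_nonneg z.im)]

lemma eq_zero_of_norm {z : KAlg m ℚ} (h0 : QuadraticAlgebra.norm z = 0) : z = 0 :=
  QuadraticAlgebra.norm_eq_zero_iff_eq_zero.1 h0

/-- The first coordinate of `τ(g) v`, up to a factor, as a combination of norms. -/
lemma IsTauBy.entry {R : Type} [Field R] [CharZero R] {γ : Matrix.SpecialLinearGroup (Fin 4) R}
    {g : Matrix (Fin 2) (Fin 2) (KAlg m R)} {r : R} (h : IsTauBy m R γ g r) (v : Fin 4 → R) :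
    r * γ.1.mulVec v 0 * v 0 =
      QuadraticAlgebra.norm (algebraMap R _ (v 0) * g 0 0 + star ⟨v 1, v 2⟩ * g 0 1) +
        Q0 m R v * QuadraticAlgebra.norm (g 0 1) := by
  have h1 := congr_fun (congr_fun (h.2.2 v) 0) 0
  rw [Matrix.eta_fin_two g, conj_hermL, hermL_apply] at h1
  simp only [Matrix.smul_apply, Matrix.of_apply, Matrix.cons_val_zero] at h1
  rw [← algebraMap_smul (KAlg m R), smul_eq_mul, ← QuadraticAlgebra.algebraMap_eq,
    ← QuadraticAlgebra.algebraMap_eq, ← QuadraticAlgebra.algebraMap_eq] at h1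
  have h2 := det_hermL m R v
  rw [hermL_apply, Matrix.det_fin_two_of, ← QuadraticAlgebra.algebraMap_eq,
    ← QuadraticAlgebra.algebraMap_eq] at h2
  apply QuadraticAlgebra.algebraMap_injective (a := (cA m : R)) (b := (cB m : R))
  rw [map_mul, map_mul, map_add, map_mul, ← mul_star_K, ← mul_star_K, ← h2, h1]
  simp only [star_add, star_mul, star_star]
  have : star (algebraMap R (KAlg m R) (v 0)) = algebraMap R (KAlg m R) (v 0) := star_mk0 _
  rw [this]
  ring

/-- If `τ(g)` maps one vector of the positive cone to another then `det g > 0`. -/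
lemma IsTauBy.pos {γ : Matrix.SpecialLinearGroup (Fin 4) ℚ}
    {g : Matrix (Fin 2) (Fin 2) (KAlg m ℚ)} {r : ℚ} (h : IsTauBy m ℚ γ g r) {v : Fin 4 → ℚ}
    (hv : 0 < v 0) (hQ : 0 < Q0 m ℚ v) (hγ : 0 < γ.1.mulVec v 0) : 0 < r := by
  have h1 := h.entry v
  have h2 : 0 ≤ r * (γ.1.mulVec v 0 * v 0) := by
    rw [← mul_assoc, h1]
    exact add_nonneg (norm_nonneg_K _) (mul_nonneg hQ.le (norm_nonneg_K _))
  exact lt_of_le_of_ne (nonneg_of_mul_nonneg_left h2 (mul_pos hγ hv)) (Ne.symm h.1)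

/-- Coordinatewise continuity of a function with values in `K ⊗ ℝ`. -/
def KCont {T : Type} [TopologicalSpace T] (f : T → KAlg m ℝ) : Prop :=
  Continuous (fun t => (f t).re) ∧ Continuous (fun t => (f t).im)

section KCont
variable {T : Type} [TopologicalSpace T] {f g : T → KAlg m ℝ}

lemma KCont.add (hf : KCont f) (hg : KCont g) : KCont fun t => f t + g t :=
  ⟨hf.1.add hg.1, hf.2.add hg.2⟩

lemma KCont.sub (hf : KCont f) (hg : KCont g) : KCont fun t => f t - g t :=
  ⟨hf.1.sub hg.1, hf.2.sub hg.2⟩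

lemma KCont.mul (hf : KCont f) (hg : KCont g) : KCont fun t => f t * g t := by
  obtain ⟨h1, h2⟩ := hf
  obtain ⟨h3, h4⟩ := hg
  constructor
  · simp only [QuadraticAlgebra.re_mul]; fun_prop
  · simp only [QuadraticAlgebra.im_mul]; fun_prop

lemma KCont.star (hf : KCont f) : KCont fun t => star (f t) := by
  obtain ⟨h1, h2⟩ := hf
  constructor
  · simp only [QuadraticAlgebra.re_star]; fun_prop
  · simp only [QuadraticAlgebra.im_star]; fun_prop

lemma KCont.const (c : KAlg m ℝ) : KCont fun _ : T => c := ⟨continuous_const, continuous_const⟩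

lemma KCont.norm (hf : KCont f) : Continuous fun t => QuadraticAlgebra.norm (f t) := by
  obtain ⟨h1, h2⟩ := hf
  simp only [QuadraticAlgebra.norm_def]
  fun_prop

lemma KCont.mulMat {F G : T → Matrix (Fin 2) (Fin 2) (KAlg m ℝ)}
    (hF : ∀ i j, KCont fun t => F t i j) (hG : ∀ i j, KCont fun t => G t i j) :
    ∀ i j, KCont fun t => (F t * G t) i j := by
  intro i j
  simp only [Matrix.mul_apply, Fin.sum_univ_two]
  exact ((hF i 0).mul (hG 0 j)).add ((hF i 1).mul (hG 1 j))

lemma KCont.actMat {F : T → Matrix (Fin 2) (Fin 2) (KAlg m ℝ)}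
    (hF : ∀ i j, KCont fun t => F t i j) : Continuous fun t => HermZeta.actMat (F t) := by
  refine continuous_matrix fun i j => ?_
  have h : ∀ i' j', KCont fun t =>
      (F t * hermL m ℝ (Pi.single j 1) * (F t).conjTranspose) i' j' :=
    KCont.mulMat (KCont.mulMat hF fun i j => KCont.const _) fun i j => (hF j i).star
  fin_cases i
  · exact (h 0 0).1
  · exact (h 0 1).1
  · exact (h 0 1).2
  · exact (h 1 1).1

end KCont

lemma actMat_one {R : Type} [Field R] [CharZero R] :
    actMat (1 : Matrix (Fin 2) (Fin 2) (KAlg m R)) = 1 := by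
  refine Matrix.ext_of_mulVec_single fun j => hermL_injective (m := m) ?_
  rw [hermL_actMat, Matrix.conjTranspose_one, Matrix.mul_one, Matrix.one_mul, Matrix.one_mulVec]

/-- If `det g > 0` then `τ(g)` lies in the identity component of `SO(V₀ ⊗ ℝ)`: for `z` in the
complement of a finite set of `K ⊗ ℝ ≅ ℂ`, the matrix `1 + z (g - 1)` is invertible. -/
lemma tauSL_mem_connectedComponentIn {g : Matrix (Fin 2) (Fin 2) (KAlg m ℝ)} {r : ℝ} (hr : 0 < r)
    (hg : g.det = algebraMap ℝ _ r) :
    (tauSL g hr.ne' hg).1 ∈ connectedComponentIn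
      {h : Matrix (Fin 4) (Fin 4) ℝ | h.transpose * S0R m ℝ * h = S0R m ℝ ∧ h.det = 1} 1 := by
  -- `F z = τ(G z)`, normalised by a square root so that it makes sense when `det G z` is not real;
  -- `F` joins `F 0 = 1` to `F 1 = τ(g)`
  set G : ℝ × ℝ → Matrix (Fin 2) (Fin 2) (KAlg m ℝ) :=
    fun z => 1 + (⟨z.1, z.2⟩ : KAlg m ℝ) • (g - 1) with hG
  have hGc : ∀ i j, KCont fun z => G z i j := by
    intro i j
    simp only [hG, Matrix.add_apply, Matrix.smul_apply, smul_eq_mul]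
    exact (KCont.const _).add (KCont.mul ⟨continuous_fst, continuous_snd⟩ (KCont.const _))
  set d : ℝ × ℝ → ℝ := fun z => QuadraticAlgebra.norm (G z).det with hd
  have hdc : Continuous d := by
    refine KCont.norm ?_
    simp only [Matrix.det_fin_two]
    exact ((hGc 0 0).mul (hGc 1 1)).sub ((hGc 0 1).mul (hGc 1 0))
  set F : ℝ × ℝ → Matrix (Fin 4) (Fin 4) ℝ := fun z => (Real.sqrt (d z))⁻¹ • actMat (G z) with hF
  have hU : IsPathConnected {z | d z = 0}ᶜ := by
    -- a plane minus a countable set is path connected, and `det G z` is a nonzero polynomial in `z`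
    refine Set.Countable.isPathConnected_compl_of_one_lt_rank ?_ (Set.Finite.countable ?_)
    · rw [← Module.finrank_eq_rank, Module.finrank_prod, Module.finrank_self]
      exact_mod_cast Nat.one_lt_two
    have : Fact (∀ x : ℝ, x ^ 2 ≠ (cA m : ℝ) + (cB m : ℝ) * x) := ⟨fun x hx => by
      have h : ((cB m : ℝ)) ^ 2 + 4 * cA m < 0 := by exact_mod_cast disc_lt m
      nlinarith [sq_nonneg (2 * x - cB m)]⟩
    have : IsDomain (KAlg m ℝ) := inferInstance
    set q : Polynomial (KAlg m ℝ) := Polynomial.C (g - 1).det * Polynomial.X ^ 2 +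
      Polynomial.C (g - 1).trace * Polynomial.X + 1 with hq
    have hq0 : q ≠ 0 := by
      intro h
      have := congr_arg (Polynomial.eval 0) h
      simp [hq] at this
    refine Set.Finite.subset (Set.Finite.preimage (f := fun z : ℝ × ℝ => (⟨z.1, z.2⟩ : KAlg m ℝ))
      ?_ (Polynomial.finite_setOfPred_isRoot hq0)) ?_
    · intro x _ y _ hxy
      exact Prod.ext (congr_arg QuadraticAlgebra.re hxy) (congr_arg QuadraticAlgebra.im hxy)
    · intro z hz
      have := eq_zero_of_norm_real hz
      simp only [Set.mem_preimage, Set.mem_ofPred_eq, Polynomial.IsRoot.def]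
      rw [← this]
      simp [hq, hG, Matrix.det_fin_two, Matrix.trace_fin_two]
      ring
  have hcont : ContinuousOn F {z | d z = 0}ᶜ := by
    refine ContinuousOn.fun_smul ?_ (KCont.actMat hGc).continuousOn
    refine (Real.continuous_sqrt.comp hdc).continuousOn.inv₀ fun z hz => ?_
    exact (Real.sqrt_pos.2 (lt_of_le_of_ne (norm_nonneg_real _) (Ne.symm hz))).ne'
  have hS : F '' {z | d z = 0}ᶜ ⊆
      {h : Matrix (Fin 4) (Fin 4) ℝ | h.transpose * S0R m ℝ * h = S0R m ℝ ∧ h.det = 1} := by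
    rintro _ ⟨z, hz, rfl⟩
    have hpos : 0 < d z := lt_of_le_of_ne (norm_nonneg_real _) (Ne.symm hz)
    have hact : (actMat (G z)).det = d z ^ 2 := by
      apply QuadraticAlgebra.algebraMap_injective (a := (cA m : ℝ)) (b := (cB m : ℝ))
      rw [det_actMat, map_pow, ← mul_star_K, mul_pow]
    have hdet : (F z).det = 1 := by
      rw [hF]
      simp only [Matrix.det_smul, Fintype.card_fin]
      have hs := Real.sq_sqrt hpos.le
      rw [hact, inv_pow, show Real.sqrt (d z) ^ 4 = (Real.sqrt (d z) ^ 2) ^ 2 by ring, hs]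
      exact inv_mul_cancel₀ (pow_ne_zero _ hpos.ne')
    have : (⟨F z, hdet⟩ : Matrix.SpecialLinearGroup (Fin 4) ℝ) ∈ SO0 m ℝ := by
      refine mem_SO0_of_Q0 fun x => ?_
      change Q0 m ℝ (((Real.sqrt (d z))⁻¹ • actMat (G z)).mulVec x) = _
      rw [Matrix.smul_mulVec, QuadraticMap.map_smul, smul_eq_mul]
      have h1 : Q0 m ℝ ((actMat (G z)).mulVec x) = d z * Q0 m ℝ x := by
        apply QuadraticAlgebra.algebraMap_injective (a := (cA m : ℝ)) (b := (cB m : ℝ))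
        rw [← det_hermL, hermL_actMat, Matrix.det_mul, Matrix.det_mul, det_hermL,
          Matrix.det_conjTranspose, map_mul, ← mul_star_K]
        ring
      rw [h1, ← mul_assoc, ← mul_inv, Real.mul_self_sqrt hpos.le, inv_mul_cancel₀ hpos.ne', one_mul]
    exact ⟨this, hdet⟩
  have h0 : F (0, 0) = 1 := by
    have h1 : G (0, 0) = 1 := by
      have : (⟨0, 0⟩ : KAlg m ℝ) = 0 := rfl
      simp [hG, this]
    simp [hF, hd, h1, actMat_one]
  have h1 : F (1, 0) = (tauSL g hr.ne' hg).1 := by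
    have h1 : G (1, 0) = g := by
      have : (⟨1, 0⟩ : KAlg m ℝ) = 1 := rfl
      simp [hG, this]
    have h2 : d (1, 0) = r ^ 2 := by
      simp [hd, h1, hg]
    simp only [hF, h1, h2, Real.sqrt_sq hr.le]
    rfl
  have hm0 : ((0, 0) : ℝ × ℝ) ∈ {z | d z = 0}ᶜ := by
    have h1 : G (0, 0) = 1 := by
      have : (⟨0, 0⟩ : KAlg m ℝ) = 0 := rfl
      simp [hG, this]
    simp [hd, h1]
  have hm1 : ((1, 0) : ℝ × ℝ) ∈ {z | d z = 0}ᶜ := by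
    have h1 : G (1, 0) = g := by
      have : (⟨1, 0⟩ : KAlg m ℝ) = 1 := rfl
      simp [hG, this]
    simp [hd, h1, hg, hr.ne']
  exact (hU.isConnected.isPreconnected.image F hcont).subset_connectedComponentIn
    (Set.mem_image_of_mem F hm0 |> fun h => h0 ▸ h) hS (h1 ▸ Set.mem_image_of_mem F hm1)

/-- An element of `Γ̂` which maps a vector of the positive cone into that cone lies in `Γ̂⁺`. -/
lemma InGammaHat.plus {γ : Matrix.SpecialLinearGroup (Fin 4) ℚ} (h : InGammaHat m γ)
    {v : Fin 4 → ℚ} (hv : 0 < v 0) (hQ : 0 < Q0 m ℚ v) (hγ : 0 < γ.1.mulVec v 0) :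
    InGammaHatPlus m γ := by
  obtain ⟨g, r, hgr⟩ := exists_isTauBy h.1 fun _ hz => eq_zero_of_norm hz
  have hr := hgr.pos hv hQ hγ
  have hr' : (0 : ℝ) < r := by exact_mod_cast hr
  refine ⟨h, ?_⟩
  have h1 := tauSL_mem_connectedComponentIn hr' (det_map_kMap g hgr.2.1)
  rw [tauSL_map hgr.1 hgr.2.1, ← hgr.eq_tauSL] at h1
  exact h1

lemma exists_tauB_of_mem_H (h : Matrix.SpecialLinearGroup (Fin 4) ℚ)
    (hh : h ∈ H m ℓ ℚ) : ∃ u : (BAlg m ℓ ℚ)ˣ, tauB u = h := by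
  obtain ⟨g, r, hgr⟩ := exists_isTauBy hh.1 fun _ hz => eq_zero_of_norm hz
  exact hgr.exists_tauB hh.2

end cone

/-! ### The discriminant kernel and the vectors of norm `ℓ` -/

/-- A rational number which is integral at all primes is an integer. -/
lemma exists_int_of_norm_le_one {q : ℚ} (h : ∀ p : Nat.Primes, ‖(q : ℚ_[p])‖ ≤ 1) :
    ∃ z : ℤ, q = z := by
  refine ⟨q.num, ?_⟩
  have hd : q.den = 1 := by
    by_contra hne
    obtain ⟨p, hp, hpd⟩ := Nat.exists_prime_and_dvd hne
    have : Fact p.Prime := ⟨hp⟩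
    have h1 : ((q.num : ℤ) : ℚ_[p]) = (q : ℚ_[p]) * ((q.den : ℕ) : ℚ_[p]) := by
      have h2 := congr_arg (Rat.cast : ℚ → ℚ_[p]) (Rat.mul_den_eq_num q)
      push_cast at h2
      exact h2.symm
    have h2 : ‖((q.num : ℤ) : ℚ_[p])‖ < 1 := by
      rw [h1, norm_mul]
      exact mul_lt_one_of_nonneg_of_lt_one_right (h ⟨p, hp⟩) (norm_nonneg _)
        (Padic.norm_natCast_lt_one_iff.2 hpd)
    rw [Padic.norm_intCast_lt_one_iff, Int.natCast_dvd] at h2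
    exact hp.one_lt.ne' (Nat.dvd_one.1 (q.reduced ▸ Nat.dvd_gcd h2 hpd))
  rw [← Rat.num_div_den q, hd]
  simp

section integral
variable {m ℓ : ℕ}

/-- The quadratic form `φ₀` on `ℤ⁴`. -/
def QZ (m : ℕ) (w : Fin 4 → ℤ) : ℤ :=
  w 0 * w 3 - (w 1 ^ 2 + cB m * w 1 * w 2 - cA m * w 2 ^ 2)

/-- The bilinear form `2 φ₀` on `ℤ⁴`. -/
def BZ (m : ℕ) (w y : Fin 4 → ℤ) : ℤ :=
  w 0 * y 3 + w 3 * y 0 -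
    (2 * w 1 * y 1 + cB m * (w 1 * y 2 + w 2 * y 1) - 2 * cA m * w 2 * y 2)

variable {R : Type} [Field R] [CharZero R]

lemma Q0_intCast (w : Fin 4 → ℤ) : Q0 m R (fun j => (w j : R)) = QZ m w := by
  rw [Q0_apply, QZ]; push_cast; ring

lemma phi0_intCast (w y : Fin 4 → ℤ) :
    phi0 m R (fun j => (w j : R)) (fun j => (y j : R)) = (BZ m w y : R) / 2 := by
  rw [phi0_apply, BZ]; push_cast; ring

lemma BZ_smul (w y : Fin 4 → ℤ) (c : ℤ) : BZ m w (c • y) = c * BZ m w y := by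
  simp only [BZ, Pi.smul_apply, smul_eq_mul]; ring

variable [NeZero m]

/-- The elements of `L₀[ℓ, 2⁻¹ℤ]` are the integral vectors of norm `ℓ` which are primitive in the
dual lattice. -/
lemma mem_solSet_iff (hm : Squarefree m) {x : Fin 4 → ℚ} : x ∈ solSet m ℓ ↔
    ∃ w : Fin 4 → ℤ, x = (fun j => (w j : ℚ)) ∧ QZ m w = ℓ ∧ ∃ y, BZ m w y = 1 := by
  constructor
  · rintro ⟨hQ, hr⟩
    rw [phi0_self] at hQ
    have hval : ∀ y : Fin 4 → ℤ, ∃ k : ℤ, 2 * phi0 m ℚ x (fun j => (y j : ℚ)) = k := by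
      intro y
      have : phi0 m ℚ x (fun j => (y j : ℚ)) ∈ Set.range (fun k : ℤ => (k : ℚ) / 2) :=
        hr ▸ ⟨y, rfl⟩
      obtain ⟨k, hk⟩ := this
      exact ⟨k, by rw [← hk]; ring⟩
    obtain ⟨n, hn⟩ := hval ![1, 0, 0, 0]
    obtain ⟨k, hk⟩ := hval ![0, 0, 0, 1]
    obtain ⟨t, ht⟩ := hval ![0, 1, 0, 0]
    rw [phi0_apply] at hn hk ht
    simp at hn hk ht
    rw [Q0_apply] at hQ
    -- `(x 1) + (x 2) ω` has integral trace and norm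
    have hint : ∀ p : Nat.Primes, (⟨x 1, x 2⟩ : KAlg m ℚ_[p]) ∈ OKp m p := by
      intro p
      apply mem_OKp_of_trace_norm hm
      · have h1 : (2 * (x 1 : ℚ_[p]) + cB m * (x 2 : ℚ_[p])) = ((-t : ℤ) : ℚ_[p]) := by
          have : 2 * x 1 + cB m * x 2 = ((-t : ℤ) : ℚ) := by push_cast; linarith
          exact_mod_cast congr_arg (Rat.cast : ℚ → ℚ_[p]) this
        simp only
        rw [h1]
        exact Padic.norm_int_le_one _
      · have h1 : QuadraticAlgebra.norm (⟨x 1, x 2⟩ : KAlg m ℚ_[p]) =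
            ((k * n - ℓ : ℤ) : ℚ_[p]) := by
          rw [QuadraticAlgebra.norm_def]
          have : x 1 * x 1 + cB m * x 1 * x 2 - cA m * x 2 * x 2 = ((k * n - ℓ : ℤ) : ℚ) := by
            push_cast; rw [← hn, ← hk]; linarith
          have h2 := congr_arg (Rat.cast : ℚ → ℚ_[p]) this
          push_cast at h2 ⊢
          exact h2
        rw [h1]
        exact Padic.norm_int_le_one _
    obtain ⟨b1, hb1⟩ := exists_int_of_norm_le_one fun p => (mem_OKp.1 (hint p)).1
    obtain ⟨b2, hb2⟩ := exists_int_of_norm_le_one fun p => (mem_OKp.1 (hint p)).2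
    have hx : x = fun j => ((![k, b1, b2, n] : Fin 4 → ℤ) j : ℚ) := by
      ext j
      fin_cases j
      · exact hk
      · exact hb1
      · exact hb2
      · exact hn
    refine ⟨![k, b1, b2, n], hx, ?_, ?_⟩
    · have := Q0_intCast (R := ℚ) (m := m) ![k, b1, b2, n]
      rw [← hx, Q0_apply, hQ] at this
      exact_mod_cast this.symm
    · have : (1 / 2 : ℚ) ∈ Set.range (fun y : Fin 4 → ℤ => phi0 m ℚ x (fun j => (y j : ℚ))) := by
        rw [hr]; exact ⟨1, by simp⟩
      obtain ⟨y, hy⟩ := this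
      refine ⟨y, ?_⟩
      simp only at hy
      rw [hx, phi0_intCast] at hy
      have h2 : (BZ m ![k, b1, b2, n] y : ℚ) = 1 := by linarith
      exact_mod_cast h2
  · rintro ⟨w, rfl, hQ, y, hy⟩
    refine ⟨by rw [phi0_self, Q0_intCast, hQ]; simp, ?_⟩
    ext r
    constructor
    · rintro ⟨z, rfl⟩
      exact ⟨BZ m w z, (phi0_intCast w z).symm⟩
    · rintro ⟨k, rfl⟩
      refine ⟨k • y, ?_⟩
      simp only
      rw [phi0_intCast, BZ_smul, hy, mul_one]

lemma InGammaHat.exists_int {g : Matrix.SpecialLinearGroup (Fin 4) ℚ} (h : InGammaHat m g) :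
    ∃ M : Matrix.SpecialLinearGroup (Fin 4) ℤ, g = M.map (Int.castRingHom ℚ) := by
  obtain ⟨-, N, hN⟩ := h
  have h1 : g.1 = (1 + N * S0mat m).map (Int.cast : ℤ → ℚ) := by
    rw [hN, Matrix.map_add _ Int.cast_add, Matrix.map_one _ Int.cast_zero Int.cast_one]
  have hdet : (1 + N * S0mat m).det = 1 := by
    have := g.2
    rw [h1] at this
    have h2 := Int.cast_det (R := ℚ) (1 + N * S0mat m)
    rw [this] at h2
    exact_mod_cast h2
  exact ⟨⟨1 + N * S0mat m, hdet⟩, Subtype.ext h1⟩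

lemma InGammaHat.mul {g h : Matrix.SpecialLinearGroup (Fin 4) ℚ} (hg : InGammaHat m g)
    (hh : InGammaHat m h) : InGammaHat m (g * h) := by
  obtain ⟨h1, N, hN⟩ := hg
  obtain ⟨h2, N', hN'⟩ := hh
  refine ⟨mul_mem h1 h2, N + N' + N * S0mat m * N', ?_⟩
  rw [Matrix.SpecialLinearGroup.coe_mul, hN, hN']
  have e : (N + N' + N * S0mat m * N') * S0mat m =
      N * S0mat m + N' * S0mat m + (N * S0mat m) * (N' * S0mat m) := by
    simp only [Matrix.add_mul, Matrix.mul_assoc]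
  rw [e, Matrix.map_add _ Int.cast_add, Matrix.map_add _ Int.cast_add,
    show ((N * S0mat m) * (N' * S0mat m)).map (Int.cast : ℤ → ℚ) =
      (N * S0mat m).map (Int.cast : ℤ → ℚ) * (N' * S0mat m).map (Int.cast : ℤ → ℚ) from
      Matrix.map_mul (f := Int.castRingHom ℚ)]
  rw [add_mul, mul_add, mul_add, one_mul, one_mul, mul_one]
  abel

lemma InGammaHat.mem_solSet (hm : Squarefree m) {g : Matrix.SpecialLinearGroup (Fin 4) ℚ}
    (h : InGammaHat m g) {x : Fin 4 → ℚ} (hx : x ∈ solSet m ℓ) : g.1.mulVec x ∈ solSet m ℓ := by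
  obtain ⟨M, rfl⟩ := h.exists_int
  have hcast : ∀ w : Fin 4 → ℤ, (M.map (Int.castRingHom ℚ)).1.mulVec (fun j => (w j : ℚ)) =
      fun j => ((M.1.mulVec w j : ℤ) : ℚ) := by
    intro w
    ext j
    simp [Matrix.mulVec, dotProduct]
  rw [mem_solSet_iff hm] at hx ⊢
  obtain ⟨w, rfl, hQ, y, hy⟩ := hx
  refine ⟨M.1.mulVec w, hcast w, ?_, M.1.mulVec y, ?_⟩
  · have := SO0_Q0 h.1 (fun j => (w j : ℚ))
    rw [hcast, Q0_intCast, Q0_intCast, hQ] at this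
    exact_mod_cast this
  · have := SO0_phi0 h.1 (fun j => (w j : ℚ)) (fun j => (y j : ℚ))
    rw [hcast, hcast, phi0_intCast, phi0_intCast, hy] at this
    have h2 : ((BZ m (M.1.mulVec w) (M.1.mulVec y) : ℤ) : ℚ) = 1 := by
      push_cast at this ⊢; linarith
    exact_mod_cast h2

lemma SO0_map {g : Matrix.SpecialLinearGroup (Fin 4) ℚ} (h : g ∈ SO0 m ℚ) :
    Matrix.SpecialLinearGroup.map (algebraMap ℚ R) g ∈ SO0 m R := by
  have hS : (S0R m ℚ).map (algebraMap ℚ R) = S0R m R := by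
    ext i j; simp [S0R]
  change (g.1.map (algebraMap ℚ R)).transpose * S0R m R * g.1.map (algebraMap ℚ R) = S0R m R
  rw [← hS, ← Matrix.transpose_map, ← Matrix.map_mul, ← Matrix.map_mul]
  exact congr_arg (fun A => Matrix.map A (algebraMap ℚ R)) h

/-- `Γ̂` stabilises all `Λ_p`. -/
lemma InGammaHat.mem_C {g : Matrix.SpecialLinearGroup (Fin 4) ℚ} (h : InGammaHat m g)
    (p : ℕ) [Fact p.Prime] : Matrix.SpecialLinearGroup.map (algebraMap ℚ ℚ_[p]) g ∈ C m p := by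
  refine ⟨SO0_map h.1, mulVec_mem_latP_iff fun i j => ?_⟩
  obtain ⟨M, rfl⟩ := h.exists_int
  have : ((M.map (Int.castRingHom ℚ)).map (algebraMap ℚ ℚ_[p])).1 i j =
      ((M.1 i j : ℤ) : ℚ_[p]) := by
    simp
  rw [this]
  exact Padic.norm_int_le_one _

/-- The translations `h ↦ [[1, γ], [0, 1]] h [[1, γ], [0, 1]]^*` with `γ ∈ 𝒪_K` lie in `Γ̂`. -/
lemma exists_inGammaHat_translation {w w' : Fin 4 → ℤ} {c d : ℤ} (h3 : w' 3 = w 3) (hw3 : w 3 ≠ 0)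
    (h1 : w' 1 = w 1 + w 3 * c) (h2 : w' 2 = w 2 + w 3 * d) (hQ : QZ m w' = QZ m w) :
    ∃ g, InGammaHat m g ∧ (fun j => (w' j : ℚ)) = g.1.mulVec (fun j => (w j : ℚ)) := by
  set nγ : ℤ := c ^ 2 + cB m * c * d - cA m * d ^ 2 with hn
  set N : Matrix (Fin 4) (Fin 4) ℤ := !![nγ, -c, -d, 0; c, 0, 0, 0; d, 0, 0, 0; 0, 0, 0, 0] with hN
  have hM : 1 + N * S0mat m = !![1, 2 * c + cB m * d, cB m * c - 2 * cA m * d, nγ; 0, 1, 0, c;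
      0, 0, 1, d; 0, 0, 0, 1] := by
    rw [S0mat, Smat_eq, hN]
    ext i j
    fin_cases i <;> fin_cases j <;> simp <;> ring
  have hdet : ((1 + N * S0mat m).map (Int.cast : ℤ → ℚ)).det = 1 := by
    have h := Int.cast_det (R := ℚ) (1 + N * S0mat m)
    rw [← h, hM, Matrix.det_of_isUpperTriangular]
    · simp [Fin.prod_univ_four]
    · intro i j hij
      fin_cases i <;> fin_cases j <;> simp at hij ⊢
  have hmul : ∀ x : Fin 4 → ℚ, ((1 + N * S0mat m).map (Int.cast : ℤ → ℚ)).mulVec x =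
      ![x 0 + (2 * c + cB m * d) * x 1 + (cB m * c - 2 * cA m * d) * x 2 + nγ * x 3,
        x 1 + c * x 3, x 2 + d * x 3, x 3] := by
    intro x
    rw [hM]
    ext i
    fin_cases i <;> simp [Matrix.mulVec, dotProduct, Fin.sum_univ_four]
  refine ⟨⟨_, hdet⟩, ⟨mem_SO0_of_Q0 fun x => ?_, N, ?_⟩, ?_⟩
  · change Q0 m ℚ (((1 + N * S0mat m).map (Int.cast : ℤ → ℚ)).mulVec x) = _
    rw [hmul, Q0_apply, Q0_apply]
    simp [hn]
    ring
  · change (1 + N * S0mat m).map (Int.cast : ℤ → ℚ) = _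
    rw [Matrix.map_add _ Int.cast_add, Matrix.map_one _ Int.cast_zero Int.cast_one]
  · change _ = ((1 + N * S0mat m).map (Int.cast : ℤ → ℚ)).mulVec _
    rw [hmul]
    -- the first coordinate is determined by the others
    have h0 : w' 0 = w 0 + (2 * c + cB m * d) * w 1 + (cB m * c - 2 * cA m * d) * w 2 +
        nγ * w 3 := by
      apply mul_right_cancel₀ hw3
      rw [QZ, QZ, h1, h2, h3] at hQ
      rw [hn]
      linear_combination hQ
    ext j
    fin_cases j
    · simp [h0]
    · simp [h1]; ring
    · simp [h2]; ring
    · simp [h3]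

/-- The matrix `A_v = [[0, 1], [-n, β]]` attached to `v = (k, β, n)`. -/
def Av (v : Fin 4 → R) : Matrix (Fin 2) (Fin 2) (KAlg m R) :=
  !![0, 1; -algebraMap R _ (v 3), ⟨v 1, v 2⟩]

lemma det_Av (v : Fin 4 → R) : (Av v : Matrix (Fin 2) (Fin 2) (KAlg m R)).det =
    algebraMap R _ (v 3) := by
  simp [Av, Matrix.det_fin_two]

/-- `τ(A_v)` maps the vector `v` of norm `ℓ` to `ξ`. -/
lemma tauSL_Av {v : Fin 4 → R} (hv : Q0 m R v = ℓ) (h3 : v 3 ≠ 0) :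
    (tauSL (Av v : Matrix (Fin 2) (Fin 2) (KAlg m R)) h3 (det_Av v)).1.mulVec v = xi0 ℓ R := by
  apply hermL_injective (m := m)
  rw [hermL_tauSL, inv_smul_eq_iff₀ h3, Av, conj_hermL, hermL_apply]
  rw [Q0_apply] at hv
  ext i j : 1
  fin_cases i <;> fin_cases j <;> simp [xi0, QuadraticAlgebra.algebraMap_eq]
  all_goals ext <;> simp
  all_goals first | ring1 | linear_combination (v 3) * hv

lemma tauSL_mul {g g' : Matrix (Fin 2) (Fin 2) (KAlg m R)} {r r' s : R} (hr : r ≠ 0)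
    (h : g.det = algebraMap R _ r) (hr' : r' ≠ 0) (h' : g'.det = algebraMap R _ r') (hs : s ≠ 0)
    {g'' : Matrix (Fin 2) (Fin 2) (KAlg m R)} (h'' : g''.det = algebraMap R _ s)
    (hg : g'' = g * g') : tauSL g'' hs h'' = tauSL g hr h * tauSL g' hr' h' := by
  have h1 := ((isTauBy_tauSL hr h).mul (isTauBy_tauSL hr' h')).eq_tauSL
  rw [h1]
  have hrs : s = r * r' := by
    apply QuadraticAlgebra.algebraMap_injective (a := (cA m : R)) (b := (cB m : R))
    rw [← h'', hg, Matrix.det_mul, h, h', map_mul]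
  subst hrs hg
  rfl

lemma Av_map (v : Fin 4 → ℚ) :
    (Av v : Matrix (Fin 2) (Fin 2) (KAlg m ℚ)).map (kMap m R) = Av (fun j => (v j : R)) := by
  ext i j : 1
  fin_cases i <;> fin_cases j <;> simp [Av]
  all_goals ext <;> simp [kMap, QuadraticAlgebra.algebraMap_eq]

/-- If locally everywhere `Ξ(y) = b A_v j` with `j ∈ GL₂(𝒪_p)`, where `v` lies in the `Γ̂`-orbit
corresponding to `ε`, then `τ(y) ∈ H(ξ)_ℚ τ(ε) (H(ξ)_𝔸 ∩ C)`. -/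
lemma tauEquiv_of_isKappa (hm : Squarefree m) {v x : Fin 4 → ℚ} (hQ : Q0 m ℚ v = ℓ) (h3 : v 3 ≠ 0)
    {γ : Matrix.SpecialLinearGroup (Fin 4) ℚ} (hγ : InGammaHat m γ) (hv : v = γ.1.mulVec x)
    {ε : GWA m ℓ} (hε : IsKappa m ℓ ε x) {u : BA m ℓ} (b : (BAlg m ℓ ℚ)ˣ)
    (hu : ∀ p : Nat.Primes, ∃ (j : Matrix (Fin 2) (Fin 2) (KAlg m ℚ_[p])) (r : ℚ_[p]), MatInt j ∧
      j.det = algebraMap _ _ r ∧ ‖r‖ = 1 ∧ bMat m ℓ ℚ_[p] (u.2 p) =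
        bMat m ℓ ℚ_[p] (bMap m ℓ ℚ_[p] b) * Av (fun j => (v j : ℚ_[p])) * j) :
    TauEquiv m ℓ (HC m ℓ) ε (psiA hm u) := by
  obtain ⟨e, rfl⟩ := (psiA hm).surjective ε
  rw [tauEquiv_psiA_iff]
  obtain ⟨α, -, hJ, g, hg, hα, γ', hγ', hx⟩ := hε
  set σ := tauB b * tauSL (m := m) (Av v) h3 (det_Av v) with hσ
  have hσ0 : σ ∈ SO0 m ℚ := mul_mem (tauB_mem_H b).1 (tauSL_mem_SO0 _ _)
  have hσv : σ.1.mulVec v = xi0 ℓ ℚ := by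
    rw [hσ, Matrix.SpecialLinearGroup.coe_mul, ← Matrix.mulVec_mulVec, tauSL_Av hQ]
    exact (tauB_mem_H b).2
  -- `σ` maps `v` to `ξ`, and `g` maps a vector of the `Γ̂`-orbit of `x` to `ξ`
  set h := σ * (γ * γ') * g⁻¹ with hh
  have hH : h ∈ H m ℓ ℚ := by
    refine ⟨mul_mem (mul_mem hσ0 (mul_mem hγ.1 hγ'.1)) (inv_mem hg), ?_⟩
    rw [hh]
    simp only [Matrix.SpecialLinearGroup.coe_mul, ← Matrix.mulVec_mulVec]
    rw [← hx, ← hv, hσv]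
  obtain ⟨β, hβ⟩ := exists_tauB_of_mem_H h hH
  refine ⟨_, tauA_diagB_mem hm β, (tauA hm (diagB β) * tauA hm e)⁻¹ * tauA hm u, fun p => ?_,
    by group⟩
  change (tauB (Units.map (bMap m ℓ ℚ_[p] : BAlg m ℓ ℚ →* BAlg m ℓ ℚ_[p]) β) *
    tauB (e.2 p))⁻¹ * tauB (u.2 p) ∈ C m p
  set φ := Matrix.SpecialLinearGroup.map (n := Fin 4) (algebraMap ℚ ℚ_[p])
  obtain ⟨-, ⟨c, hc, hcτ⟩, -⟩ := hJ p
  have hc' : c = (φ g)⁻¹ * tauB (e.2 p) :=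
    hcτ.unique ((hα.clMap (R := ℚ_[p])).inv.mul (isTau_PsiU (e.2 p)))
  obtain ⟨j, r, hj, hdet, hr, hb⟩ := hu p
  have hr0 : r ≠ 0 := by rintro rfl; simp at hr
  have hrv : ((v 3 : ℚ) : ℚ_[p]) ≠ 0 := by exact_mod_cast h3
  have hu' : tauB (u.2 p) = φ σ * tauSL j hr0 hdet := by
    have h4 : tauSL (m := m) (Av (fun j => (v j : ℚ_[p])) :
        Matrix (Fin 2) (Fin 2) (KAlg m ℚ_[p])) hrv (det_Av _) =
        φ (tauSL (m := m) (Av v) h3 (det_Av v)) := by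
      rw [← tauSL_map h3 (det_Av v) hrv]
      congr 1
      exact (Av_map v).symm
    rw [hσ, map_mul, ← h4, ← tauB_map, mul_assoc,
      ← tauSL_mul (g'' := Av (fun j => (v j : ℚ_[p])) * j) (s := (v 3 : ℚ_[p]) * r) hrv
        (det_Av _) hr0 hdet (mul_ne_zero hrv hr0)
        (by rw [Matrix.det_mul, det_Av, hdet, map_mul]) rfl]
    refine tauSL_mul _ _ _ _ _ _ ?_
    rw [hb, Matrix.mul_assoc]
    rfl
  have hγC := (hγ.mul hγ').mem_C p
  -- the rational factors cancel, and what is left stabilises `Λ_p`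
  have hfin : (tauB (Units.map (bMap m ℓ ℚ_[p] : BAlg m ℓ ℚ →* BAlg m ℓ ℚ_[p]) β) *
      tauB (e.2 p))⁻¹ * tauB (u.2 p) = c⁻¹ * (φ (γ * γ'))⁻¹ * tauSL j hr0 hdet := by
    rw [tauB_map, hβ, hu', hc', hh]
    simp only [φ, map_mul, map_inv]
    group
  rw [hfin]
  exact mul_mem (mul_mem (inv_mem hc) (inv_mem hγC)) (tauSL_mem_C hr0 hdet hj hr)

end integral

/-! ### Local correspondence between vectors of norm `ℓ` and primitive quaternions -/

section units
variable {m ℓ : ℕ} {R : Type} [Field R] [CharZero R]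

lemma exists_unit_of_nrd {b : BAlg m ℓ R} (h : nrd m ℓ R b ≠ 0) :
    ∃ u : (BAlg m ℓ R)ˣ, (u : BAlg m ℓ R) = b := by
  have hbs : b * star b = algebraMap R _ (nrd m ℓ R b) := by
    rw [QuaternionAlgebra.mul_star_eq_coe]; rfl
  have hsb : star b * b = algebraMap R _ (nrd m ℓ R b) := by
    rw [← hbs, QuaternionAlgebra.star_mul_eq_coe, QuaternionAlgebra.mul_star_eq_coe]
    congr 1
    simp
    ring
  refine ⟨⟨b, (nrd m ℓ R b)⁻¹ • star b, ?_, ?_⟩, rfl⟩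
  · rw [mul_smul_comm, hbs, Algebra.algebraMap_eq_smul_one, inv_smul_smul₀ h]
  · rw [smul_mul_assoc, hsb, Algebra.algebraMap_eq_smul_one, inv_smul_smul₀ h]

lemma mul_left_cancel_of_det {A X Y : Matrix (Fin 2) (Fin 2) (KAlg m R)} {r : R} (hr : r ≠ 0)
    (hA : A.det = algebraMap R _ r) (h : A * X = A * Y) : X = Y := by
  have h1 : (r⁻¹ • A.adjugate) * A = 1 := mul_eq_one_comm.1 (inv_mul_smul_adjugate hr hA)
  rw [← Matrix.one_mul X, ← Matrix.one_mul Y, ← h1, Matrix.mul_assoc, Matrix.mul_assoc, h]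

end units

section local_rel
variable {m ℓ : ℕ} [NeZero m] {p : ℕ} [Fact p.Prime]

/-- The relation `u ∈ A_v GL₂(𝒪_p)` between a vector `v = (k, β, n)` and a quaternion `u`. -/
def LRel (v : Fin 4 → ℚ_[p]) (u : (BAlg m ℓ ℚ_[p])ˣ) : Prop :=
  ‖nrd m ℓ ℚ_[p] (u : BAlg m ℓ ℚ_[p])‖ = ‖v 3‖ ∧
    ∃ j, MatInt j ∧ bMat m ℓ ℚ_[p] (u : BAlg m ℓ ℚ_[p]) = Av v * j

/-- The first row `(a, b)` of the matrix of `u` generates the unit ideal of `𝒪_p`. -/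
def Unimod (u : (BAlg m ℓ ℚ_[p])ˣ) : Prop :=
  ∃ r ∈ OKp m p, ∃ s ∈ OKp m p, r * bMat m ℓ ℚ_[p] (u : BAlg m ℓ ℚ_[p]) 0 0 +
    s * bMat m ℓ ℚ_[p] (u : BAlg m ℓ ℚ_[p]) 0 1 = 1

variable {v v' : Fin 4 → ℚ_[p]} {u u' : (BAlg m ℓ ℚ_[p])ˣ}

lemma bMat_row_one (b : BAlg m ℓ ℚ_[p]) :
    bMat m ℓ ℚ_[p] b 1 0 = -(ℓ : KAlg m ℚ_[p]) * star (bMat m ℓ ℚ_[p] b 0 1) ∧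
      bMat m ℓ ℚ_[p] b 1 1 = star (bMat m ℓ ℚ_[p] b 0 0) := ⟨rfl, rfl⟩

lemma LRel.exists_det (h : LRel v u) (h3 : v 3 ≠ 0) :
    ∃ (j : Matrix (Fin 2) (Fin 2) (KAlg m ℚ_[p])) (r : ℚ_[p]), MatInt j ∧
      j.det = algebraMap _ _ r ∧ ‖r‖ = 1 ∧
      bMat m ℓ ℚ_[p] (u : BAlg m ℓ ℚ_[p]) = Av v * j := by
  obtain ⟨hn, j, hj, hb⟩ := h
  refine ⟨j, nrd m ℓ ℚ_[p] (u : BAlg m ℓ ℚ_[p]) / v 3, hj, ?_, ?_, hb⟩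
  · have h1 := congr_arg Matrix.det hb
    rw [Matrix.det_mul, det_bMat, det_Av] at h1
    rw [div_eq_inv_mul, map_mul, h1, ← mul_assoc, ← map_mul, inv_mul_cancel₀ h3, map_one, one_mul]
  · rw [norm_div, hn, div_self (norm_ne_zero_iff.2 h3)]

/-- The quaternion is determined by the vector up to units. -/
lemma LRel.inv_mul_mem (h : LRel v u) (h' : LRel v u') (h3 : v 3 ≠ 0) :
    u⁻¹ * u' ∈ oUnits m ℓ p := by
  obtain ⟨j, r, hj, hdet, hr, hb⟩ := h.exists_det h3
  obtain ⟨j', r', hj', hdet', hr', hb'⟩ := h'.exists_det h3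
  have hr0 : r ≠ 0 := by rintro rfl; simp at hr
  have huu : (u : BAlg m ℓ ℚ_[p]) * ((u⁻¹ * u' : (BAlg m ℓ ℚ_[p])ˣ) : BAlg m ℓ ℚ_[p]) = u' := by
    simp
  have h1 : j * bMat m ℓ ℚ_[p] ((u⁻¹ * u' : (BAlg m ℓ ℚ_[p])ˣ) : BAlg m ℓ ℚ_[p]) = j' := by
    refine mul_left_cancel_of_det h3 (det_Av v) ?_
    rw [← Matrix.mul_assoc, ← hb, ← bMat_mul, huu, hb']
  have h2 : bMat m ℓ ℚ_[p] ((u⁻¹ * u' : (BAlg m ℓ ℚ_[p])ˣ) : BAlg m ℓ ℚ_[p]) =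
      (r⁻¹ • j.adjugate) * j' := by
    rw [← h1, ← Matrix.mul_assoc, mul_eq_one_comm.1 (inv_mul_smul_adjugate hr0 hdet),
      Matrix.one_mul]
  rw [mem_oUnits_iff, ← matInt_bMat_iff, h2]
  refine ⟨(hj.adjugate.smul (by rw [norm_inv, hr, inv_one])).mul hj', ?_⟩
  have h4 := congr_arg norm (congr_arg (nrd m ℓ ℚ_[p]) huu)
  rw [nrd_mul, norm_mul, h.1, h'.1] at h4
  exact mul_left_cancel₀ (norm_ne_zero_iff.2 h3) (h4.trans (mul_one _).symm)

lemma LRel.mul (h : LRel v u) {x : (BAlg m ℓ ℚ_[p])ˣ} (hx : x ∈ oUnits m ℓ p) :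
    LRel v (u * x) := by
  obtain ⟨hn, j, hj, hb⟩ := h
  rw [mem_oUnits_iff] at hx
  refine ⟨by rw [Units.val_mul, nrd_mul, norm_mul, hx.2, mul_one, hn], j * bMat m ℓ ℚ_[p] x,
    hj.mul (matInt_bMat_iff.2 hx.1), ?_⟩
  rw [Units.val_mul, bMat_mul, hb, Matrix.mul_assoc]

lemma LRel.congr (h : LRel v u) (h3 : v' 3 = v 3) {c d : ℚ_[p]} (hc : ‖c‖ ≤ 1) (hd : ‖d‖ ≤ 1)
    (h1 : v' 1 = v 1 + v 3 * c) (h2 : v' 2 = v 2 + v 3 * d) : LRel v' u := by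
  obtain ⟨hn, j, hj, hb⟩ := h
  refine ⟨by rw [hn, h3], !![1, ⟨c, d⟩; 0, 1] * j, MatInt.mul ?_ hj, ?_⟩
  · intro i k
    fin_cases i <;> fin_cases k
    · exact one_mem _
    · exact mk_mem_OKp hc hd
    · exact zero_mem _
    · exact one_mem _
  · rw [hb, ← Matrix.mul_assoc]
    congr 1
    rw [Av, Av, Matrix.mul_fin_two]
    ext i k : 1
    fin_cases i <;> fin_cases k <;> simp [h1, h2, h3, QuadraticAlgebra.algebraMap_eq]
    ext <;> simp

lemma matInt_Av (hv : ∀ i, ‖v i‖ ≤ 1) : MatInt (Av v : Matrix (Fin 2) (Fin 2) (KAlg m ℚ_[p])) := by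
  intro i k
  fin_cases i <;> fin_cases k
  · exact zero_mem _
  · exact one_mem _
  · exact neg_mem (algebraMap_mem_OKp (hv 3))
  · exact mk_mem_OKp (hv 1) (hv 2)

lemma LRel.mem_oLoc (h : LRel v u) (hv : ∀ i, ‖v i‖ ≤ 1) : (u : BAlg m ℓ ℚ_[p]) ∈ oLoc m ℓ p := by
  obtain ⟨-, j, hj, hb⟩ := h
  rw [← matInt_bMat_iff, hb]
  exact (matInt_Av hv).mul hj

/-- The entries of `u = A_v j`, in terms of those of `j`. -/
lemma LRel.eqs {j : Matrix (Fin 2) (Fin 2) (KAlg m ℚ_[p])}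
    (hb : bMat m ℓ ℚ_[p] (u : BAlg m ℓ ℚ_[p]) = Av v * j) :
    bMat m ℓ ℚ_[p] (u : BAlg m ℓ ℚ_[p]) 0 0 = j 1 0 ∧
    bMat m ℓ ℚ_[p] (u : BAlg m ℓ ℚ_[p]) 0 1 = j 1 1 ∧
    -(ℓ : KAlg m ℚ_[p]) * star (j 1 1) = -algebraMap _ _ (v 3) * j 0 0 + ⟨v 1, v 2⟩ * j 1 0 ∧
    star (j 1 0) = -algebraMap _ _ (v 3) * j 0 1 + ⟨v 1, v 2⟩ * j 1 1 := by
  have e : ∀ i k, bMat m ℓ ℚ_[p] (u : BAlg m ℓ ℚ_[p]) i k =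
      ((Av v : Matrix (Fin 2) (Fin 2) (KAlg m ℚ_[p])) * j) i k := fun i k => by rw [hb]
  have e00 : bMat m ℓ ℚ_[p] (u : BAlg m ℓ ℚ_[p]) 0 0 = j 1 0 := by
    rw [e]; simp [Av, Matrix.mul_apply]
  have e01 : bMat m ℓ ℚ_[p] (u : BAlg m ℓ ℚ_[p]) 0 1 = j 1 1 := by
    rw [e]; simp [Av, Matrix.mul_apply]
  refine ⟨e00, e01, ?_, ?_⟩
  · rw [← e01, ← (bMat_row_one _).1, e]; simp [Av, Matrix.mul_apply]
  · rw [← e00, ← (bMat_row_one _).2, e]; simp [Av, Matrix.mul_apply]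

/-- The first row of `A_v j` is the second row of the invertible matrix `j`. -/
lemma LRel.unimod (h : LRel v u) (h3 : v 3 ≠ 0) : Unimod u := by
  obtain ⟨j, r, hj, hdet, hr, hb⟩ := h.exists_det h3
  obtain ⟨e00, e01, -, -⟩ := LRel.eqs hb
  have hr0 : r ≠ 0 := by rintro rfl; simp at hr
  have hr' : algebraMap ℚ_[p] (KAlg m ℚ_[p]) r⁻¹ ∈ OKp m p :=
    algebraMap_mem_OKp (by rw [norm_inv, hr, inv_one])
  refine ⟨-(algebraMap _ _ r⁻¹ * j 0 1), neg_mem (mul_mem hr' (hj 0 1)), algebraMap _ _ r⁻¹ * j 0 0,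
    mul_mem hr' (hj 0 0), ?_⟩
  rw [Matrix.det_fin_two] at hdet
  have h1 : algebraMap ℚ_[p] (KAlg m ℚ_[p]) r⁻¹ * algebraMap _ _ r = 1 := by
    rw [← map_mul, inv_mul_cancel₀ hr0, map_one]
  rw [e00, e01, ← h1, ← hdet]
  ring

/-- The quaternion determines `β` modulo `n`. -/
lemma LRel.beta_sub (h : LRel v u) (h' : LRel v' u) (h3 : v 3 ≠ 0) (hv : v' 3 = v 3) :
    ∃ z ∈ OKp m p, (⟨v' 1, v' 2⟩ - ⟨v 1, v 2⟩ : KAlg m ℚ_[p]) = algebraMap _ _ (v 3) * z := by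
  obtain ⟨r, hr, s, hs, hrs⟩ := h.unimod h3
  obtain ⟨-, j, hj, hb⟩ := h
  obtain ⟨-, j', hj', hb'⟩ := h'
  obtain ⟨e00, e01, e10, e11⟩ := LRel.eqs hb
  obtain ⟨e00', e01', e10', e11'⟩ := LRel.eqs hb'
  rw [← e00'.symm.trans e00, ← e01'.symm.trans e01] at e10 e11
  rw [e00', e01'] at hrs
  refine ⟨r * (j' 0 0 - j 0 0) + s * (j' 0 1 - j 0 1),
    add_mem (mul_mem hr (sub_mem (hj' 0 0) (hj 0 0))) (mul_mem hs (sub_mem (hj' 0 1) (hj 0 1))), ?_⟩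
  rw [hv] at e10' e11'
  calc (⟨v' 1, v' 2⟩ - ⟨v 1, v 2⟩ : KAlg m ℚ_[p])
      = (⟨v' 1, v' 2⟩ - ⟨v 1, v 2⟩) * (r * j' 1 0 + s * j' 1 1) := by rw [hrs, mul_one]
    _ = _ := by linear_combination r * (e10 - e10') + s * (e11 - e11')

/-- A quaternion with unimodular first row comes from some vector `v = (k, β, n)` with prescribed
last coordinate. -/
lemma Unimod.exists_LRel (h : Unimod u) (hu : (u : BAlg m ℓ ℚ_[p]) ∈ oLoc m ℓ p) {n : ℚ_[p]}
    (hn : ‖nrd m ℓ ℚ_[p] (u : BAlg m ℓ ℚ_[p])‖ = ‖n‖) :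
    ∃ β ∈ OKp m p, LRel ![0, β.re, β.im, n] u := by
  obtain ⟨r, hr, s, hs, hrs⟩ := h
  have hn0 : n ≠ 0 := by
    rintro rfl
    rw [norm_zero, norm_eq_zero] at hn
    exact nrd_unit_ne_zero u hn
  have hM := matInt_bMat_iff.2 hu
  set a := bMat m ℓ ℚ_[p] (u : BAlg m ℓ ℚ_[p]) 0 0 with ha
  set b := bMat m ℓ ℚ_[p] (u : BAlg m ℓ ℚ_[p]) 0 1 with hb
  set ρ := nrd m ℓ ℚ_[p] (u : BAlg m ℓ ℚ_[p]) / n with hρ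
  have hρ1 : algebraMap ℚ_[p] (KAlg m ℚ_[p]) ρ ∈ OKp m p :=
    algebraMap_mem_OKp (by rw [hρ, norm_div, hn, div_self (norm_ne_zero_iff.2 hn0)])
  have hdet : algebraMap ℚ_[p] (KAlg m ℚ_[p]) n * algebraMap _ _ ρ =
      a * star a + ℓ * b * star b := by
    rw [← map_mul, hρ, mul_div_cancel₀ _ hn0, ← det_bMat, Matrix.det_fin_two, (bMat_row_one _).1,
      (bMat_row_one _).2]
    ring
  have hℓ : (ℓ : KAlg m ℚ_[p]) ∈ OKp m p := natCast_mem _ _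
  -- with `r a + s b = 1`, the second row `(-ℓ b̄, ā)` of `u` is congruent to `β` times the first
  -- row modulo `n` exactly for this `β`
  refine ⟨s * star a - ℓ * r * star b, sub_mem (mul_mem hs (star_mem_OKp (hM 0 0)))
    (mul_mem (mul_mem hℓ hr) (star_mem_OKp (hM 0 1))), hn,
    !![s * algebraMap _ _ ρ, -(r * algebraMap _ _ ρ); a, b], ?_, ?_⟩
  · intro i k
    fin_cases i <;> fin_cases k
    · exact mul_mem hs hρ1
    · exact neg_mem (mul_mem hr hρ1)
    · exact hM 0 0
    · exact hM 0 1
  · ext i k : 1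
    fin_cases i <;> fin_cases k
    · simp [Av, Matrix.mul_apply, ha]
    · simp [Av, Matrix.mul_apply, hb]
    · change bMat m ℓ ℚ_[p] (u : BAlg m ℓ ℚ_[p]) 1 0 = _
      rw [(bMat_row_one _).1, ← hb, Av, Matrix.mul_fin_two]
      change -(ℓ : KAlg m ℚ_[p]) * star b = -algebraMap _ _ n * (s * algebraMap _ _ ρ) +
        (s * star a - ℓ * r * star b) * a
      linear_combination s * hdet + (ℓ * star b) * hrs
    · change bMat m ℓ ℚ_[p] (u : BAlg m ℓ ℚ_[p]) 1 1 = _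
      rw [(bMat_row_one _).2, ← ha, Av, Matrix.mul_fin_two]
      change star a = -algebraMap _ _ n * (-(r * algebraMap _ _ ρ)) +
        (s * star a - ℓ * r * star b) * b
      linear_combination (-r) * hdet - (star a) * hrs

/-- If the form `k b b̄ - Tr(β ȳ b) + n y ȳ` takes a unit value at `(b, y)`, the matrix `A_v j` with
second column of `j` equal to `(y, b)` lies in `B`, and its determinant is `n` times that value. -/
lemma exists_LRel_aux (hv : ∀ i, ‖v i‖ ≤ 1) (hQ : Q0 m ℚ_[p] v = ℓ) (h3 : v 3 ≠ 0)
    {b y : KAlg m ℚ_[p]} (hb : b ∈ OKp m p) (hy : y ∈ OKp m p) {f : ℚ_[p]} (hf : ‖f‖ = 1)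
    (h : algebraMap ℚ_[p] (KAlg m ℚ_[p]) f = algebraMap _ _ (v 0) * (b * star b) -
      (⟨v 1, v 2⟩ * star y * b + star ⟨v 1, v 2⟩ * y * star b) +
      algebraMap _ _ (v 3) * (y * star y)) :
    ∃ u : (BAlg m ℓ ℚ_[p])ˣ, LRel v u := by
  set β : KAlg m ℚ_[p] := ⟨v 1, v 2⟩ with hβ
  have hβO : β ∈ OKp m p := mk_mem_OKp (hv 1) (hv 2)
  have hf0 : f ≠ 0 := by rintro rfl; simp at hf
  -- the first column of `j` is forced by the shape of the matrices of `B`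
  set a : KAlg m ℚ_[p] := star β * star b - algebraMap _ _ (v 3) * star y with ha
  set x : KAlg m ℚ_[p] := algebraMap _ _ (v 0) * star b - β * star y with hx
  set j : Matrix (Fin 2) (Fin 2) (KAlg m ℚ_[p]) := !![x, y; a, b] with hj
  set c : BAlg m ℓ ℚ_[p] := ⟨a.re, a.im, b.re, b.im⟩ with hc
  have hreal : ∀ r : ℚ_[p], star (algebraMap ℚ_[p] (KAlg m ℚ_[p]) r) = algebraMap _ _ r := star_mk0
  have hQ' : algebraMap ℚ_[p] (KAlg m ℚ_[p]) (v 0) * algebraMap _ _ (v 3) - β * star β = ℓ := by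
    rw [mul_star_K, ← map_mul, ← map_sub, ← map_natCast (algebraMap ℚ_[p] (KAlg m ℚ_[p])) ℓ]
    congr 1
    rw [Q0_apply] at hQ
    rw [QuadraticAlgebra.norm_def, ← hQ, hβ]
    ring
  have hbc : bMat m ℓ ℚ_[p] c = Av v * j := by
    ext i k : 1
    fin_cases i <;> fin_cases k
    · simp [Av, Matrix.mul_apply, hj, bMat, hc]
    · simp [Av, Matrix.mul_apply, hj, bMat, hc]
    · rw [Av, hj, Matrix.mul_fin_two]
      change -(ℓ : KAlg m ℚ_[p]) * star b = -algebraMap _ _ (v 3) * x + β * a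
      rw [hx, ha, ← hQ']
      ring
    · rw [Av, hj, Matrix.mul_fin_two]
      change star a = -algebraMap _ _ (v 3) * y + β * b
      rw [ha, star_sub, star_mul, star_mul, star_star, star_star, star_star, hreal]
      ring
  have hnrd : nrd m ℓ ℚ_[p] c = v 3 * f := by
    apply QuadraticAlgebra.algebraMap_injective (a := (cA m : ℚ_[p])) (b := (cB m : ℚ_[p]))
    rw [← det_bMat, hbc, Matrix.det_mul, det_Av, map_mul, h, hj, Matrix.det_fin_two_of, hx, ha]
    ring
  obtain ⟨u, hu⟩ := exists_unit_of_nrd (b := c) (by rw [hnrd]; exact mul_ne_zero h3 hf0)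
  refine ⟨u, by rw [hu, hnrd, norm_mul, hf, mul_one], j, ?_, by rw [hu, hbc]⟩
  intro i k
  fin_cases i <;> fin_cases k
  · exact sub_mem (mul_mem (algebraMap_mem_OKp (hv 0)) (star_mem_OKp hb))
      (mul_mem hβO (star_mem_OKp hy))
  · exact hy
  · exact sub_mem (mul_mem (star_mem_OKp hβO) (star_mem_OKp hb))
      (mul_mem (algebraMap_mem_OKp (hv 3)) (star_mem_OKp hy))
  · exact hb

/-- A vector of norm `ℓ` with a unit among the coordinates `k, n, Tr β, Tr(β ω̄)` comes from a
quaternion: the binary Hermitian form with coefficients `k, -β, n` represents a unit. -/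
lemma exists_LRel {w y : Fin 4 → ℤ} (hQ : QZ m w = ℓ) (h3 : w 3 ≠ 0) (hy : BZ m w y = 1) :
    ∃ u : (BAlg m ℓ ℚ_[p])ˣ, LRel (fun j => (w j : ℚ_[p])) u := by
  have hv : ∀ i, ‖((w i : ℤ) : ℚ_[p])‖ ≤ 1 := fun i => Padic.norm_int_le_one _
  have hQ' : Q0 m ℚ_[p] (fun j => (w j : ℚ_[p])) = ℓ := by rw [Q0_intCast, hQ]; simp
  have h3' : ((w 3 : ℤ) : ℚ_[p]) ≠ 0 := by exact_mod_cast h3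
  have hunit : ∀ f : ℤ, ¬ (p : ℤ) ∣ f → ‖(f : ℚ_[p])‖ = 1 := fun f hf =>
    le_antisymm (Padic.norm_int_le_one _)
      (not_lt.1 fun h => hf (Padic.norm_intCast_lt_one_iff.1 h))
  have hω : (⟨0, 1⟩ : KAlg m ℚ_[p]) ∈ OKp m p := mk_mem_OKp (by simp) (by simp)
  by_cases h0 : (p : ℤ) ∣ w 0
  swap
  · refine exists_LRel_aux hv hQ' h3' (one_mem _) (zero_mem _) (hunit _ h0) ?_
    simp
  by_cases h0' : (p : ℤ) ∣ w 3
  swap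
  · refine exists_LRel_aux hv hQ' h3' (zero_mem _) (one_mem _) (hunit _ h0') ?_
    simp
  by_cases h1 : (p : ℤ) ∣ 2 * w 1 + cB m * w 2
  swap
  · refine exists_LRel_aux hv hQ' h3' (one_mem _) (one_mem _)
      (hunit (w 0 - (2 * w 1 + cB m * w 2) + w 3) fun h => h1 ?_) ?_
    · have := dvd_sub (dvd_add h0 h0') h
      rwa [show w 0 + w 3 - (w 0 - (2 * w 1 + cB m * w 2) + w 3) = 2 * w 1 + cB m * w 2 by ring]
        at this
    · rw [QuadraticAlgebra.algebraMap_eq, QuadraticAlgebra.algebraMap_eq,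
        QuadraticAlgebra.algebraMap_eq]
      ext <;> simp
      ring
  · refine exists_LRel_aux hv hQ' h3' (one_mem _) hω
      (hunit (w 0 - (cB m * w 1 - 2 * cA m * w 2) - cA m * w 3) fun h => ?_) ?_
    · have h2 : (p : ℤ) ∣ cB m * w 1 - 2 * cA m * w 2 := by
        have := dvd_sub (dvd_sub h0 (h0'.mul_left (cA m))) h
        rwa [show w 0 - cA m * w 3 - (w 0 - (cB m * w 1 - 2 * cA m * w 2) - cA m * w 3) =
          cB m * w 1 - 2 * cA m * w 2 by ring] at this
      have h3 : (p : ℤ) ∣ 1 := by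
        rw [← hy, show BZ m w y = w 0 * y 3 + w 3 * y 0 - ((2 * w 1 + cB m * w 2) * y 1 +
          (cB m * w 1 - 2 * cA m * w 2) * y 2) by rw [BZ]; ring]
        exact dvd_sub (dvd_add (h0.mul_right _) (h0'.mul_right _))
          (dvd_add (h1.mul_right _) (h2.mul_right _))
      exact (Nat.prime_iff_prime_int.1 (Fact.out : p.Prime)).not_isUnit (isUnit_of_dvd_one h3)
    · rw [QuadraticAlgebra.algebraMap_eq, QuadraticAlgebra.algebraMap_eq,
        QuadraticAlgebra.algebraMap_eq]
      ext <;> simp <;> ring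

/-- Conversely, a vector which comes from a quaternion is primitive at `p`. -/
lemma LRel.not_dvd {w : Fin 4 → ℤ} (hQ : QZ m w = ℓ) (h3 : w 3 ≠ 0)
    (h : LRel (fun j => (w j : ℚ_[p])) u) (d0 : (p : ℤ) ∣ w 0) (d3 : (p : ℤ) ∣ w 3)
    (d1 : (p : ℤ) ∣ 2 * w 1 + cB m * w 2) (d2 : (p : ℤ) ∣ cB m * w 1 - 2 * cA m * w 2) : False := by
  have h3' : ((w 3 : ℤ) : ℚ_[p]) ≠ 0 := by exact_mod_cast h3
  obtain ⟨j, r, hj, hdet, hr, hb⟩ := h.exists_det h3'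
  obtain ⟨-, -, e10, e11⟩ := LRel.eqs hb
  have hQ' : Q0 m ℚ_[p] (fun j => (w j : ℚ_[p])) = ℓ := by rw [Q0_intCast, hQ]; simp
  set β : KAlg m ℚ_[p] := ⟨(w 1 : ℚ_[p]), (w 2 : ℚ_[p])⟩ with hβ
  have hQ2 : algebraMap ℚ_[p] (KAlg m ℚ_[p]) (w 0) * algebraMap _ _ (w 3 : ℚ_[p]) - β * star β =
      ℓ := by
    rw [mul_star_K, ← map_mul, ← map_sub, ← map_natCast (algebraMap ℚ_[p] (KAlg m ℚ_[p])) ℓ]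
    congr 1
    rw [Q0_apply] at hQ'
    rw [QuadraticAlgebra.norm_def, ← hQ', hβ]
    ring
  have hreal : ∀ r : ℚ_[p], star (algebraMap ℚ_[p] (KAlg m ℚ_[p]) r) = algebraMap _ _ r := star_mk0
  have ha : j 1 0 = star β * star (j 1 1) - algebraMap _ _ (w 3 : ℚ_[p]) * star (j 0 1) := by
    have := congr_arg star e11
    rw [star_star] at this
    rw [this, star_add, star_mul, star_mul, star_neg, hreal]
    ring
  have hx : j 0 0 = algebraMap _ _ (w 0 : ℚ_[p]) * star (j 1 1) - β * star (j 0 1) := by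
    have h4 : algebraMap ℚ_[p] (KAlg m ℚ_[p]) (w 3 : ℚ_[p])⁻¹ *
        algebraMap _ _ (w 3 : ℚ_[p]) = 1 := by
      rw [← map_mul, inv_mul_cancel₀ h3', map_one]
    have h5 : algebraMap ℚ_[p] (KAlg m ℚ_[p]) (w 3 : ℚ_[p]) * (j 0 0) =
        algebraMap _ _ (w 3 : ℚ_[p]) *
          (algebraMap _ _ (w 0 : ℚ_[p]) * star (j 1 1) - β * star (j 0 1)) := by
      rw [ha] at e10
      rw [← hQ2] at e10
      linear_combination e10
    calc j 0 0 = algebraMap ℚ_[p] (KAlg m ℚ_[p]) (w 3 : ℚ_[p])⁻¹ *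
          (algebraMap _ _ (w 3 : ℚ_[p]) * (j 0 0)) := by rw [← mul_assoc, h4, one_mul]
      _ = _ := by rw [h5, ← mul_assoc, h4, one_mul]
  set z := star (j 0 1) * j 1 1 with hz
  have hzO : z ∈ OKp m p := mul_mem (star_mem_OKp (hj 0 1)) (hj 1 1)
  -- `det j` is the value at `(j 1 1, j 0 1)` of the Hermitian form with coefficients `k, -β, n`,
  -- which would be divisible by `p`
  have hrf : r = w 0 * QuadraticAlgebra.norm (j 1 1) - ((2 * w 1 + cB m * w 2) * z.re +
      (cB m * (2 * w 1 + cB m * w 2) - (cB m * w 1 - 2 * cA m * w 2)) * z.im) +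
      w 3 * QuadraticAlgebra.norm (j 0 1) := by
    have htr : β * z + star (β * z) = algebraMap _ _ ((2 * w 1 + cB m * w 2) * z.re +
      (cB m * (2 * w 1 + cB m * w 2) - (cB m * w 1 - 2 * cA m * w 2)) * z.im) := by
      rw [QuadraticAlgebra.algebraMap_eq]
      ext
      · simp [hβ]; ring
      · simp; ring
    apply QuadraticAlgebra.algebraMap_injective (a := (cA m : ℚ_[p])) (b := (cB m : ℚ_[p]))
    rw [← hdet, map_add, map_sub, ← htr, map_mul, map_mul, ← mul_star_K, ← mul_star_K,
      Matrix.det_fin_two, hx, ha, hz]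
    simp only [star_mul, star_star]
    ring
  have hno : ∀ x ∈ OKp m p, QuadraticAlgebra.norm x ∈ PadicInt.subring p := by
    intro x hx
    have h1 : x.re ∈ PadicInt.subring p := (mem_OKp.1 hx).1
    have h2 : x.im ∈ PadicInt.subring p := (mem_OKp.1 hx).2
    have hA : ((cA m : ℤ) : ℚ_[p]) ∈ PadicInt.subring p := intCast_mem _ _
    have hB : ((cB m : ℤ) : ℚ_[p]) ∈ PadicInt.subring p := intCast_mem _ _
    rw [QuadraticAlgebra.norm_def]
    apply_rules [add_mem, sub_mem, mul_mem]
  obtain ⟨c0, hc0⟩ := d0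
  obtain ⟨c3, hc3⟩ := d3
  obtain ⟨c1, hc1⟩ := d1
  obtain ⟨c2, hc2⟩ := d2
  have hc1' : (2 * w 1 + cB m * w 2 : ℚ_[p]) = p * c1 := by
    exact_mod_cast congr_arg (Int.cast : ℤ → ℚ_[p]) hc1
  have hc2' : (cB m * w 1 - 2 * cA m * w 2 : ℚ_[p]) = p * c2 := by
    exact_mod_cast congr_arg (Int.cast : ℤ → ℚ_[p]) hc2
  rw [hc1', hc2', hc0, hc3] at hrf
  push_cast at hrf
  have hfac : r = p * (c0 * QuadraticAlgebra.norm (j 1 1) - (c1 * z.re + (cB m * c1 - c2) * z.im) +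
      c3 * QuadraticAlgebra.norm (j 0 1)) := by rw [hrf]; ring
  have hin : (c0 * QuadraticAlgebra.norm (j 1 1) - (c1 * z.re + (cB m * c1 - c2) * z.im) +
      c3 * QuadraticAlgebra.norm (j 0 1) : ℚ_[p]) ∈ PadicInt.subring p := by
    have h0 : ((c0 : ℤ) : ℚ_[p]) ∈ PadicInt.subring p := intCast_mem _ _
    have h1 : ((c1 : ℤ) : ℚ_[p]) ∈ PadicInt.subring p := intCast_mem _ _
    have h2 : ((c2 : ℤ) : ℚ_[p]) ∈ PadicInt.subring p := intCast_mem _ _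
    have h3 : ((c3 : ℤ) : ℚ_[p]) ∈ PadicInt.subring p := intCast_mem _ _
    have hB : ((cB m : ℤ) : ℚ_[p]) ∈ PadicInt.subring p := intCast_mem _ _
    have h4 := hno _ (hj 1 1)
    have h5 := hno _ (hj 0 1)
    have h6 : z.re ∈ PadicInt.subring p := (mem_OKp.1 hzO).1
    have h7 : z.im ∈ PadicInt.subring p := (mem_OKp.1 hzO).2
    exact add_mem (sub_mem (mul_mem h0 h4) (add_mem (mul_mem h1 h6)
      (mul_mem (sub_mem (mul_mem hB h1) h2) h7))) (mul_mem h3 h5)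
  rw [hfac, norm_mul] at hr
  have h8 : ‖(p : ℚ_[p])‖ < 1 := Padic.norm_p_lt_one
  have h9 := mul_lt_one_of_nonneg_of_lt_one_left (norm_nonneg _) h8 hin
  exact h9.ne hr

end local_rel

/-- A vector whose coordinates in the dual lattice have no common prime divisor is primitive. -/
lemma exists_BZ_eq_one {m : ℕ} {w : Fin 4 → ℤ}
    (h : ∀ p : ℕ, p.Prime → (p : ℤ) ∣ w 0 → (p : ℤ) ∣ w 3 →
    (p : ℤ) ∣ 2 * w 1 + cB m * w 2 → (p : ℤ) ∣ cB m * w 1 - 2 * cA m * w 2 → False) :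
    ∃ y, BZ m w y = 1 := by
  set T := 2 * w 1 + cB m * w 2
  set T' := cB m * w 1 - 2 * cA m * w 2
  have hg : Int.gcd (Int.gcd (w 0) (w 3)) (Int.gcd T T') = 1 := by
    by_contra hne
    obtain ⟨p, hp, hd⟩ := Nat.exists_prime_and_dvd hne
    have h1 : (p : ℤ) ∣ Int.gcd (w 0) (w 3) :=
      (Int.natCast_dvd_natCast.2 hd).trans (Int.gcd_dvd_left _ _)
    have h2 : (p : ℤ) ∣ Int.gcd T T' := (Int.natCast_dvd_natCast.2 hd).trans (Int.gcd_dvd_right _ _)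
    exact h p hp (h1.trans (Int.gcd_dvd_left _ _)) (h1.trans (Int.gcd_dvd_right _ _))
      (h2.trans (Int.gcd_dvd_left _ _)) (h2.trans (Int.gcd_dvd_right _ _))
  have e1 := Int.gcd_eq_gcd_ab (w 0) (w 3)
  have e2 := Int.gcd_eq_gcd_ab T T'
  have e3 := Int.gcd_eq_gcd_ab (Int.gcd (w 0) (w 3)) (Int.gcd T T')
  rw [hg] at e3
  set α := Int.gcdA (Int.gcd (w 0) (w 3)) (Int.gcd T T')
  set β := Int.gcdB (Int.gcd (w 0) (w 3)) (Int.gcd T T')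
  refine ⟨![Int.gcdB (w 0) (w 3) * α, -(Int.gcdA T T' * β), -(Int.gcdB T T' * β),
    Int.gcdA (w 0) (w 3) * α], ?_⟩
  have : BZ m w ![Int.gcdB (w 0) (w 3) * α, -(Int.gcdA T T' * β), -(Int.gcdB T T' * β),
      Int.gcdA (w 0) (w 3) * α] = (w 0 * Int.gcdA (w 0) (w 3) + w 3 * Int.gcdB (w 0) (w 3)) * α +
        (T * Int.gcdA T T' + T' * Int.gcdB T T') * β := by
    simp [BZ, T, T']; ring
  rw [this, ← e1, ← e2]
  exact_mod_cast e3.symm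

/-! ### The ring of integers of `K` -/

section ringOfIntegers
variable {m : ℕ}

/-- `ℤ[ω]`, as a subring of `K`. -/
def OKz (m : ℕ) : Subring (KAlg m ℚ) where
  carrier := {x | ∃ c d : ℤ, x = ⟨(c : ℚ), (d : ℚ)⟩}
  one_mem' := ⟨1, 0, by ext <;> simp [QuadraticAlgebra.re_one, QuadraticAlgebra.im_one]⟩
  zero_mem' := ⟨0, 0, by ext <;> simp⟩
  add_mem' := by
    rintro _ _ ⟨c, d, rfl⟩ ⟨c', d', rfl⟩
    exact ⟨c + c', d + d', by ext <;> simp⟩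
  neg_mem' := by
    rintro _ ⟨c, d, rfl⟩
    exact ⟨-c, -d, by ext <;> simp⟩
  mul_mem' := by
    rintro _ _ ⟨c, d, rfl⟩ ⟨c', d', rfl⟩
    exact ⟨c * c' + cA m * d * d', c * d' + d * c' + cB m * d * d', by ext <;> simp⟩

lemma kMap_mem_OKp {x : KAlg m ℚ} (hx : x ∈ OKz m) (p : ℕ) [Fact p.Prime] :
    kMap m ℚ_[p] x ∈ OKp m p := by
  obtain ⟨c, d, rfl⟩ := hx
  rw [mem_OKp]
  constructor
  · simpa using Padic.norm_int_le_one c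
  · simpa using Padic.norm_int_le_one d

lemma mem_OKz_of_forall {x : KAlg m ℚ} (h : ∀ p : Nat.Primes, kMap m ℚ_[p] x ∈ OKp m p) :
    x ∈ OKz m := by
  obtain ⟨c, hc⟩ := exists_int_of_norm_le_one fun p => (mem_OKp.1 (h p)).1
  obtain ⟨d, hd⟩ := exists_int_of_norm_le_one fun p => (mem_OKp.1 (h p)).2
  exact ⟨c, d, by ext <;> assumption⟩

lemma norm_kMap {R : Type} [Field R] [CharZero R] (x : KAlg m ℚ) :
    QuadraticAlgebra.norm (kMap m R x) = ((QuadraticAlgebra.norm x : ℚ) : R) := by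
  rw [QuadraticAlgebra.norm_def, QuadraticAlgebra.norm_def]
  simp

variable [NeZero m]

lemma exists_nat_norm {x : KAlg m ℚ} (hx : x ∈ OKz m) :
    ∃ n : ℕ, QuadraticAlgebra.norm x = n := by
  have h0 := norm_nonneg_K x
  obtain ⟨c, d, rfl⟩ := hx
  have h : QuadraticAlgebra.norm (⟨(c : ℚ), (d : ℚ)⟩ : KAlg m ℚ) =
      ((c * c + cB m * c * d - cA m * d * d : ℤ) : ℚ) := by
    rw [QuadraticAlgebra.norm_def]; push_cast; rfl
  rw [h] at h0 ⊢
  obtain ⟨n, hn⟩ := Int.eq_ofNat_of_zero_le (by exact_mod_cast h0)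
  exact ⟨n, by rw [hn]; simp⟩

lemma isIntegral_of_mem_OKz {x : KAlg m ℚ} (hx : x ∈ OKz m) : IsIntegral ℤ x := by
  obtain ⟨c, d, rfl⟩ := hx
  obtain ⟨t, ht⟩ : ∃ t : ℤ, t = 2 * c + cB m * d := ⟨_, rfl⟩
  obtain ⟨n, hn⟩ : ∃ n : ℤ, n = c * c + cB m * c * d - cA m * d * d := ⟨_, rfl⟩
  refine ⟨Polynomial.X ^ 2 - Polynomial.C t * Polynomial.X + Polynomial.C n, by monicity!, ?_⟩
  rw [Polynomial.eval₂_add, Polynomial.eval₂_sub, Polynomial.eval₂_mul, Polynomial.eval₂_C,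
    Polynomial.eval₂_C, Polynomial.eval₂_X_pow, Polynomial.eval₂_X]
  have ht' : (t : ℚ) = 2 * c + cB m * d := by rw [ht]; push_cast; rfl
  have hn' : (n : ℚ) = c * c + cB m * c * d - cA m * d * d := by rw [hn]; push_cast; rfl
  simp only [eq_intCast]
  ext <;> simp [pow_two, ht', hn'] <;> ring

/-- `ℤ` is integrally closed. -/
lemma exists_int_of_isIntegral {q : ℚ} (h : IsIntegral ℤ (⟨q, 0⟩ : KAlg m ℚ)) : ∃ z : ℤ, q = z := by
  let f : ℚ →+* KAlg m ℚ := (algebraMap ℚ (QuadraticAlgebra ℚ ((cA m : ℤ) : ℚ) ((cB m : ℤ) : ℚ)))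
  have hf : Function.Injective f := f.injective
  have h1 : IsIntegral ℤ q := by
    have h2 : IsIntegral ℤ (f.toIntAlgHom q) := by
      exact h
    exact (isIntegral_algHom_iff f.toIntAlgHom hf).1 h2
  obtain ⟨z, hz⟩ := IsIntegrallyClosed.isIntegral_iff.1 h1
  exact ⟨z, by simpa using hz.symm⟩

lemma mem_OKz_of_isIntegral (hm : Squarefree m) {x : KAlg m ℚ} (h : IsIntegral ℤ x) :
    x ∈ OKz m := by
  have h' : IsIntegral ℤ (star x) := h.map (starRingEnd (KAlg m ℚ)).toIntAlgHom
  have h1 : x + star x = ⟨2 * x.re + cB m * x.im, 0⟩ := by ext <;> simp; ring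
  have h2 : x * star x = ⟨QuadraticAlgebra.norm x, 0⟩ := mul_star_K x
  obtain ⟨t, ht⟩ := exists_int_of_isIntegral (h1 ▸ h.add h')
  obtain ⟨n, hn⟩ := exists_int_of_isIntegral (h2 ▸ h.mul h')
  refine mem_OKz_of_forall fun p => mem_OKp_of_trace_norm hm ?_ ?_
  · have : (2 * (kMap m ℚ_[p] x).re + cB m * (kMap m ℚ_[p] x).im) = (t : ℚ_[p]) := by
      have := congr_arg (Rat.cast : ℚ → ℚ_[p]) ht
      push_cast at this
      exact this
    rw [this]
    exact Padic.norm_int_le_one _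
  · rw [norm_kMap, hn]
    simpa using Padic.norm_int_le_one n

open NumberField in
lemma exists_ringOfIntegers {x : KAlg m ℚ} (hx : x ∈ OKz m) :
    ∃ y : 𝓞 (KAlg m ℚ), algebraMap (𝓞 (KAlg m ℚ)) (KAlg m ℚ) y = x := by
  have h := isIntegral_of_mem_OKz hx
  exact ⟨⟨x, h⟩, rfl⟩

open NumberField in
lemma coe_mem_OKz (hm : Squarefree m) (y : 𝓞 (KAlg m ℚ)) :
    algebraMap (𝓞 (KAlg m ℚ)) (KAlg m ℚ) y ∈ OKz m := by
  apply mem_OKz_of_isIntegral hm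
  exact y.isIntegral_coe

open NumberField in
/-- The norm of a principal ideal of `𝒪_K` is the norm of its generator. -/
lemma absNorm_span (y : 𝓞 (KAlg m ℚ)) :
    ((Ideal.absNorm (Ideal.span {y}) : ℕ) : ℚ) =
      QuadraticAlgebra.norm (algebraMap (𝓞 (KAlg m ℚ)) (KAlg m ℚ) y) := by
  have h0 := norm_nonneg_K (algebraMap (𝓞 (KAlg m ℚ)) (KAlg m ℚ) y)
  have h1 : ((Algebra.norm ℤ y : ℤ) : ℚ) =
      QuadraticAlgebra.norm (algebraMap (𝓞 (KAlg m ℚ)) (KAlg m ℚ) y) := by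
    rw [Algebra.coe_norm_int, ← QuadraticAlgebra.det_toLinearMap_eq_norm, Algebra.norm_apply]
    congr!
  rw [Ideal.absNorm_span_singleton, Nat.cast_natAbs, ← h1, Int.cast_abs, abs_of_nonneg (h1 ▸ h0)]

end ringOfIntegers

/-! ### Approximation and products of local norms -/

lemma norm_prime_eq_one {p q : Nat.Primes} (h : p ≠ q) : ‖((p : ℕ) : ℚ_[q])‖ = 1 := by
  rw [Padic.norm_natCast_eq_one_iff]
  exact (Nat.coprime_primes q.2 p.2).2 fun h' => h (Subtype.ext h'.symm)

lemma exists_int_approx {p : ℕ} [Fact p.Prime] {x : ℚ_[p]} (hx : ‖x‖ ≤ 1) (k : ℕ) :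
    ∃ (z : ℤ) (e : ℚ_[p]), ‖e‖ ≤ 1 ∧ x = z + p ^ k * e := by
  obtain ⟨z, rfl⟩ : ∃ z : ℤ_[p], (z : ℚ_[p]) = x := ⟨⟨x, hx⟩, rfl⟩
  have h := PadicInt.appr_spec k z
  rw [Ideal.mem_span_singleton] at h
  obtain ⟨e, he⟩ := h
  refine ⟨PadicInt.appr z k, e, e.2, ?_⟩
  have h2 := congr_arg (fun z : ℤ_[p] => (z : ℚ_[p])) he
  push_cast at h2 ⊢
  linear_combination h2

/-- Simultaneous approximation modulo `n` of a family of `p`-adic integers. -/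
lemma exists_int_crt {n : ℕ} (hn : n ≠ 0) {x : ∀ p : Nat.Primes, ℚ_[p]} (hx : ∀ p, ‖x p‖ ≤ 1) :
    ∃ z : ℤ, ∀ p : Nat.Primes, ∃ e : ℚ_[p], ‖e‖ ≤ 1 ∧ (z : ℚ_[p]) = x p + n * e := by
  choose k c hc hnk using fun p : Nat.Primes =>
    Nat.exists_eq_pow_mul_and_not_dvd hn p p.2.one_lt.ne'
  choose g e he hg using fun p : Nat.Primes => exists_int_approx (hx p) (k p)
  have hfin : Finite {p : Nat.Primes // (p : ℕ) ∣ n} := by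
    have := Filter.eventually_cofinite.1 (eventually_not_dvd hn)
    simp only [not_not] at this
    exact this.to_subtype
  -- the Chinese remainder theorem at the primes which divide `n`
  obtain ⟨z, hz⟩ := Ideal.exists_forall_sub_mem_ideal
    (I := fun p : {p : Nat.Primes // (p : ℕ) ∣ n} => Ideal.span {((p.1 : ℕ) : ℤ) ^ k p.1})
    (fun p q hpq => by
      rw [Function.onFun, Ideal.isCoprime_span_singleton_iff]
      refine IsCoprime.pow ?_
      rw [Nat.isCoprime_iff_coprime]
      exact (Nat.coprime_primes p.1.2 q.1.2).2 fun h => hpq (Subtype.ext (Subtype.ext h)))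
    (fun p => g p.1)
  refine ⟨z, fun p => ?_⟩
  have hn0 : (n : ℚ_[p]) ≠ 0 := by exact_mod_cast hn
  refine ⟨(z - x p) / n, ?_, by field_simp; ring⟩
  rw [norm_div, div_le_one (norm_pos_iff.2 hn0)]
  have hc1 : ‖((c p : ℕ) : ℚ_[p])‖ = 1 := by
    rw [Padic.norm_natCast_eq_one_iff]
    exact (Nat.Prime.coprime_iff_not_dvd p.2).2 (hc p)
  have hnn : ‖(n : ℚ_[p])‖ = ‖((p : ℕ) : ℚ_[p]) ^ k p‖ := by
    conv_lhs => rw [hnk p]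
    push_cast
    rw [norm_mul, hc1, mul_one]
  by_cases hp : (p : ℕ) ∣ n
  · obtain ⟨t, ht⟩ := Ideal.mem_span_singleton.1 (hz ⟨p, hp⟩)
    have ht' : (z : ℚ_[p]) - g p = (p : ℕ) ^ k p * t := by
      exact_mod_cast congr_arg (Int.cast : ℤ → ℚ_[p]) ht
    have : (z : ℚ_[p]) - x p = (p : ℕ) ^ k p * (t - e p) := by
      rw [hg p]; linear_combination ht'
    rw [this, norm_mul, hnn]
    refine mul_le_of_le_one_right (norm_nonneg _) ?_
    exact (PadicInt.subring p).sub_mem (Padic.norm_int_le_one t) (he p)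
  · have : ‖(n : ℚ_[p])‖ = 1 := by
      rw [Padic.norm_natCast_eq_one_iff]
      exact (Nat.Prime.coprime_iff_not_dvd p.2).2 hp
    rw [this]
    exact (PadicInt.subring p).sub_mem (Padic.norm_int_le_one z) (hx p)

lemma hasFiniteMulSupport_norm {n : ℕ} (hn : n ≠ 0) :
    Function.HasFiniteMulSupport fun p : Nat.Primes => ‖(n : ℚ_[p])‖⁻¹ := by
  refine Set.Finite.subset (Filter.eventually_cofinite.1 (eventually_not_dvd hn)) ?_
  intro p hp h
  apply hp
  rw [inv_eq_one, Padic.norm_natCast_eq_one_iff]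
  exact (Nat.Prime.coprime_iff_not_dvd p.2).2 h

/-- The product formula for a positive integer. -/
lemma finprod_norm_inv {n : ℕ} (hn : n ≠ 0) : ∏ᶠ p : Nat.Primes, ‖(n : ℚ_[p])‖⁻¹ = n := by
  induction n using induction_on_primes with
  | zero => exact absurd rfl hn
  | one => simp
  | prime_mul p a hp ih =>
    have ha : a ≠ 0 := right_ne_zero_of_mul hn
    have h1 : ∏ᶠ q : Nat.Primes, ‖((p : ℕ) : ℚ_[q])‖⁻¹ = p := by
      have h3 : ∀ q : Nat.Primes, q ≠ (⟨p, hp⟩ : Nat.Primes) → ‖((p : ℕ) : ℚ_[q])‖⁻¹ = 1 := by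
        intro q hq
        have h4 := norm_prime_eq_one (p := (⟨p, hp⟩ : Nat.Primes)) (Ne.symm hq)
        rw [inv_eq_one]
        exact h4
      refine (finprod_eq_single (fun q : Nat.Primes => ‖((p : ℕ) : ℚ_[q])‖⁻¹)
        (⟨p, hp⟩ : Nat.Primes) h3).trans ?_
      have : Fact p.Prime := ⟨hp⟩
      change ‖(p : ℚ_[p])‖⁻¹ = _
      rw [Padic.norm_p, inv_inv]
    have h2 : ∀ q : Nat.Primes, ‖((p * a : ℕ) : ℚ_[q])‖⁻¹ = ‖(p : ℚ_[q])‖⁻¹ * ‖(a : ℚ_[q])‖⁻¹ := by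
      intro q; push_cast; rw [norm_mul, mul_inv]
    rw [finprod_congr h2, finprod_mul_distrib (hasFiniteMulSupport_norm hp.ne_zero)
      (hasFiniteMulSupport_norm ha), h1, ih ha]
    push_cast
    rfl

/-- An integer with prescribed absolute values. -/
lemma exists_nat_of_norms {x : ∀ p : Nat.Primes, ℚ_[p]} (h0 : ∀ p, x p ≠ 0) (h1 : ∀ p, ‖x p‖ ≤ 1)
    (h : ∀ᶠ p in Filter.cofinite, ‖x p‖ = 1) :
    ∃ n : ℕ, n ≠ 0 ∧ ∀ p : Nat.Primes, ‖(n : ℚ_[p])‖ = ‖x p‖ := by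
  set F := (Filter.eventually_cofinite.1 h).toFinset with hF
  have hv : ∀ p, ‖x p‖ = ‖((p : ℕ) : ℚ_[p])‖ ^ (x p).valuation.toNat := by
    intro p
    have h2 := Int.toNat_of_nonneg ((Padic.norm_le_one_iff_val_nonneg _).1 (h1 p))
    rw [Padic.norm_eq_zpow_neg_valuation (h0 p), Padic.norm_p, inv_pow, ← zpow_natCast, h2,
      zpow_neg]
  refine ⟨∏ p ∈ F, (p : ℕ) ^ (x p).valuation.toNat,
    Finset.prod_ne_zero_iff.2 fun p _ => pow_ne_zero _ p.2.ne_zero, fun q => ?_⟩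
  push_cast
  rw [norm_prod]
  have h3 : ∀ p ∈ F, p ≠ q → ‖((p : ℕ) : ℚ_[q]) ^ (x p).valuation.toNat‖ = 1 := by
    intro p _ hpq
    rw [norm_pow, norm_prime_eq_one hpq, one_pow]
  by_cases hq : q ∈ F
  · rw [Finset.prod_eq_single q h3 fun h => absurd hq h, norm_pow, ← hv]
  · have hq1 : ‖x q‖ = 1 := by
      by_contra hne
      exact hq ((Set.Finite.mem_toFinset _).2 hne)
    rw [hq1]
    refine Finset.prod_eq_one fun p hp => h3 p hp ?_
    rintro rfl
    exact hq hp

section global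
variable {m ℓ : ℕ} [NeZero m]

/-- The embedding `K ⊗ R → B ⊗ R`. -/
def kB (m ℓ : ℕ) (R : Type) [Field R] : KAlg m R →+* BAlg m ℓ R where
  toFun x := ⟨x.re, x.im, 0, 0⟩
  map_one' := by ext <;> simp [QuadraticAlgebra.re_one, QuadraticAlgebra.im_one]
  map_zero' := by ext <;> simp
  map_add' := by intro x y; ext <;> simp
  map_mul' := by intro x y; ext <;> simp

section
variable {R : Type} [Field R] [CharZero R]

lemma bMap_kB (x : KAlg m ℚ) : bMap m ℓ R (kB m ℓ ℚ x) = kB m ℓ R (kMap m R x) := by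
  ext <;> simp [bMap, kB]

lemma bMat_kB_mul (x : KAlg m R) (b : BAlg m ℓ R) (k : Fin 2) :
    bMat m ℓ R (kB m ℓ R x * b) 0 k = x * bMat m ℓ R b 0 k := by
  rw [bMat_mul]
  fin_cases k <;> simp [bMat, kB, Matrix.mul_apply] <;> (ext <;> simp)

lemma nrd_kB (x : KAlg m R) : nrd m ℓ R (kB m ℓ R x) = QuadraticAlgebra.norm x := by
  simp [nrd, kB, QuadraticAlgebra.norm_def]
  ring
end

/-- The element of `B_𝔸^×` attached to an element of `K^×`. -/
def tA (m ℓ : ℕ) [NeZero m] : (KAlg m ℚ)ˣ →* BA m ℓ where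
  toFun t := diagB (Units.map (kB m ℓ ℚ : KAlg m ℚ →* BAlg m ℓ ℚ) t)
  map_one' := BA_ext (by simp [diagB]) fun p => by simp [diagB]
  map_mul' s t := BA_ext (by simp [diagB]) fun p => by
    simp only [diagB, map_mul]; rfl

lemma tA_snd (t : (KAlg m ℚ)ˣ) (p : Nat.Primes) :
    (((tA m ℓ t).2 p : (BAlg m ℓ ℚ_[p])ˣ) : BAlg m ℓ ℚ_[p]) =
      kB m ℓ ℚ_[p] (kMap m ℚ_[p] (t : KAlg m ℚ)) := bMap_kB _

lemma BA_mul_snd (x y : BA m ℓ) (p : Nat.Primes) : (x * y).2 p = x.2 p * y.2 p := rfl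

lemma tA_mul_row (t : (KAlg m ℚ)ˣ) (u : BA m ℓ) (p : Nat.Primes) (k : Fin 2) :
    bMat m ℓ ℚ_[p] ((tA m ℓ t * u).2 p : (BAlg m ℓ ℚ_[p])ˣ) 0 k =
      kMap m ℚ_[p] (t : KAlg m ℚ) * bMat m ℓ ℚ_[p] (u.2 p : (BAlg m ℓ ℚ_[p])ˣ) 0 k := by
  rw [BA_mul_snd, Units.val_mul, tA_snd, bMat_kB_mul]

lemma tA_mul_nrd (t : (KAlg m ℚ)ˣ) (u : BA m ℓ) (p : Nat.Primes) :
    nrd m ℓ ℚ_[p] ((tA m ℓ t * u).2 p : (BAlg m ℓ ℚ_[p])ˣ) =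
      ((QuadraticAlgebra.norm (t : KAlg m ℚ) : ℚ) : ℚ_[p]) *
        nrd m ℓ ℚ_[p] (u.2 p : (BAlg m ℓ ℚ_[p])ˣ) := by
  rw [BA_mul_snd, Units.val_mul, tA_snd, nrd_mul, nrd_kB, norm_kMap]

/-- The first row of the matrix of a quaternion consists of its two coordinates in `K`. -/
lemma mem_oLoc_iff_row {p : ℕ} [Fact p.Prime] {b : BAlg m ℓ ℚ_[p]} :
    b ∈ oLoc m ℓ p ↔ ∀ k, bMat m ℓ ℚ_[p] b 0 k ∈ OKp m p := by
  constructor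
  · intro h k
    exact matInt_bMat_iff.2 h 0 k
  · intro h
    exact ⟨(mem_OKp.1 (h 0)).1, (mem_OKp.1 (h 0)).2, (mem_OKp.1 (h 1)).1, (mem_OKp.1 (h 1)).2⟩

end global

/-! ### Decomposition of integral adelic quaternions -/

section global
variable {m ℓ : ℕ} [NeZero m]

/-- The integral vectors `(k, β, n)` of norm `ℓ` with `n > 0` which are primitive in the dual of
`Λ`. -/
def PrimVec (m ℓ : ℕ) (w : Fin 4 → ℤ) : Prop :=
  0 < w 3 ∧ QZ m w = ℓ ∧ ∃ y, BZ m w y = 1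

/-- The relation `LRel` at all primes. -/
def GRel (w : Fin 4 → ℤ) (u : BA m ℓ) : Prop :=
  ∀ p : Nat.Primes, LRel (fun j => (w j : ℚ_[p])) (u.2 p)

/-- At a prime which does not divide `n` the matrix `A_v` is invertible over `𝒪_p`. -/
lemma LRel.one {p : ℕ} [Fact p.Prime] {v : Fin 4 → ℚ_[p]} (hv : ∀ i, ‖v i‖ ≤ 1) (h3 : ‖v 3‖ = 1) :
    LRel v (1 : (BAlg m ℓ ℚ_[p])ˣ) := by
  have h0 : v 3 ≠ 0 := by rintro h; simp [h] at h3
  refine ⟨by rw [Units.val_one, nrd_one, norm_one, h3], (v 3)⁻¹ • (Av v).adjugate,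
    (matInt_Av hv).adjugate.smul (by rw [norm_inv, h3, inv_one]), ?_⟩
  rw [Units.val_one, bMat_one, inv_mul_smul_adjugate h0 (det_Av v)]

/-- A primitive vector comes from an adelic quaternion, which may be taken to be `1` outside `n`. -/
lemma PrimVec.exists_GRel {w : Fin 4 → ℤ} (h : PrimVec m ℓ w) : ∃ u : BA m ℓ, GRel w u := by
  obtain ⟨h3, hQ, y, hy⟩ := h
  have h1 : ∀ p : Nat.Primes, ∃ u : (BAlg m ℓ ℚ_[p])ˣ, LRel (fun j => (w j : ℚ_[p])) u ∧
      (¬ (p : ℕ) ∣ (w 3).natAbs → u = 1) := by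
    intro p
    by_cases hp : (p : ℕ) ∣ (w 3).natAbs
    · obtain ⟨u, hu⟩ := exists_LRel (p := p) hQ h3.ne' hy
      exact ⟨u, hu, fun h => absurd hp h⟩
    · refine ⟨1, LRel.one (fun i => Padic.norm_int_le_one _) ?_, fun _ => rfl⟩
      refine le_antisymm (Padic.norm_int_le_one _) (not_lt.1 fun h => hp ?_)
      exact Int.natCast_dvd.1 (Padic.norm_intCast_lt_one_iff.1 h)
  choose u hu hu1 using h1
  refine ⟨(1, ⟨u, ?_⟩), hu⟩
  filter_upwards [eventually_not_dvd (Int.natAbs_ne_zero.2 h3.ne')] with p hp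
  rw [hu1 p hp]
  exact one_mem _

lemma GRel.mem_oLoc {w : Fin 4 → ℤ} {u : BA m ℓ} (h : GRel w u) (p : Nat.Primes) :
    ((u.2 p : (BAlg m ℓ ℚ_[p])ˣ) : BAlg m ℓ ℚ_[p]) ∈ oLoc m ℓ p :=
  (h p).mem_oLoc fun _ => Padic.norm_int_le_one _

lemma GRel.unimod {w : Fin 4 → ℤ} {u : BA m ℓ} (h : GRel w u) (h3 : 0 < w 3) (p : Nat.Primes) :
    Unimod (u.2 p) :=
  (h p).unimod (by exact_mod_cast h3.ne')

lemma GRel.mul {w : Fin 4 → ℤ} {u x : BA m ℓ} (h : GRel w u) (hx : x ∈ X m ℓ) : GRel w (u * x) :=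
  fun p => (h p).mul (hx p)

lemma GRel.inv_mul_mem {w : Fin 4 → ℤ} {u u' : BA m ℓ} (h : GRel w u) (h' : GRel w u')
    (h3 : 0 < w 3) : u⁻¹ * u' ∈ X m ℓ :=
  fun p => (h p).inv_mul_mem (h' p) (by exact_mod_cast h3.ne')

/-- A natural number is determined by its absolute values. -/
lemma nat_eq_of_norms {a b : ℕ} (ha : a ≠ 0) (hb : b ≠ 0)
    (h : ∀ p : Nat.Primes, ‖(a : ℚ_[p])‖ = ‖(b : ℚ_[p])‖) : a = b := by
  have h1 := finprod_norm_inv ha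
  rw [finprod_congr fun p => by rw [h p], finprod_norm_inv hb] at h1
  exact_mod_cast h1.symm

lemma GRel.congr {w w' : Fin 4 → ℤ} {u : BA m ℓ} (h : GRel w u) (h3 : w' 3 = w 3) {c d : ℤ}
    (h1 : w' 1 = w 1 + w 3 * c) (h2 : w' 2 = w 2 + w 3 * d) : GRel w' u := fun p =>
  (h p).congr (by rw [h3]) (Padic.norm_int_le_one c) (Padic.norm_int_le_one d)
    (by rw [h1]; push_cast; rfl) (by rw [h2]; push_cast; rfl)

/-- The vector `(k, β, n)` is determined by the quaternion up to translations of `β` by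
`n𝒪_K`. -/
lemma GRel.eq_mod {w w' : Fin 4 → ℤ} {u : BA m ℓ} (h : GRel w u) (h' : GRel w' u)
    (h3 : 0 < w 3) (h3' : 0 < w' 3) :
    w' 3 = w 3 ∧ ∃ c d : ℤ, w' 1 = w 1 + w 3 * c ∧ w' 2 = w 2 + w 3 * d := by
  have e3 : w' 3 = w 3 := by
    obtain ⟨a, ha⟩ := Int.eq_ofNat_of_zero_le h3.le
    obtain ⟨b, hb⟩ := Int.eq_ofNat_of_zero_le h3'.le
    rw [ha, hb]
    congr 1
    refine nat_eq_of_norms (by omega) (by omega) fun p => ?_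
    have := (h p).1.symm.trans (h' p).1
    simp only [ha, hb] at this
    simpa using this.symm
  have h30 : (w 3 : ℚ) ≠ 0 := by exact_mod_cast h3.ne'
  have hz : ((w 3 : ℚ)⁻¹ • ⟨w' 1 - w 1, w' 2 - w 2⟩ : KAlg m ℚ) ∈ OKz m := by
    refine mem_OKz_of_forall fun p => ?_
    have h3p : (w 3 : ℚ_[p]) ≠ 0 := by exact_mod_cast h3.ne'
    obtain ⟨z, hz, he⟩ := (h p).beta_sub (h' p) h3p (by rw [e3])
    have e1 := congr_arg QuadraticAlgebra.re he
    have e2 := congr_arg QuadraticAlgebra.im he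
    simp at e1 e2
    convert hz using 1
    ext
    · simp; rw [e1]; field_simp
    · simp; rw [e2]; field_simp
  obtain ⟨c, d, hcd⟩ := hz
  have e1 := congr_arg QuadraticAlgebra.re hcd
  have e2 := congr_arg QuadraticAlgebra.im hcd
  simp at e1 e2
  refine ⟨e3, c, d, ?_, ?_⟩
  · have : (w' 1 : ℚ) = w 1 + w 3 * c := by rw [← e1]; field_simp; ring
    exact_mod_cast this
  · have : (w' 2 : ℚ) = w 2 + w 3 * d := by rw [← e2]; field_simp; ring
    exact_mod_cast this

/-- The scalar in the decomposition `u = t u'`, with `u'` coming from a vector, is determined up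
to units of `𝒪_K`. -/
lemma inv_mul_mem_OKz {t t' : (KAlg m ℚ)ˣ} {u u' : BA m ℓ} (h : tA m ℓ t * u = tA m ℓ t' * u')
    (hu : ∀ p : Nat.Primes, ((u.2 p : (BAlg m ℓ ℚ_[p])ˣ) : BAlg m ℓ ℚ_[p]) ∈ oLoc m ℓ p)
    (hu' : ∀ p : Nat.Primes, Unimod (u'.2 p)) :
    ((t⁻¹ * t' : (KAlg m ℚ)ˣ) : KAlg m ℚ) ∈ OKz m := by
  refine mem_OKz_of_forall fun p => ?_
  have h' : u = tA m ℓ (t⁻¹ * t') * u' := by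
    rw [map_mul, mul_assoc, ← h, map_inv, inv_mul_cancel_left]
  obtain ⟨r, hr, s, hs, hrs⟩ := hu' p
  have h0 := mem_oLoc_iff_row.1 (hu p) 0
  have h1 := mem_oLoc_iff_row.1 (hu p) 1
  rw [h', tA_mul_row] at h0 h1
  have := add_mem (mul_mem hr h0) (mul_mem hs h1)
  convert this using 1
  linear_combination -(kMap m ℚ_[p] ((t⁻¹ * t' : (KAlg m ℚ)ˣ) : KAlg m ℚ)) * hrs

lemma isUnit_one_add_mul {p : ℕ} [Fact p.Prime] {z : KAlg m ℚ_[p]} (hz : z ∈ OKp m p) :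
    ∃ y ∈ OKp m p, (1 + p * z) * y = 1 := by
  set x := 1 + (p : KAlg m ℚ_[p]) * z with hx
  have hxO : x ∈ OKp m p := add_mem (one_mem _) (mul_mem (natCast_mem _ _) hz)
  have hn : ∃ c : ℚ_[p], ‖c‖ ≤ 1 ∧ QuadraticAlgebra.norm x = 1 + p * c := by
    refine ⟨2 * z.re + cB m * z.im + p * QuadraticAlgebra.norm z, ?_, ?_⟩
    · have h1 : z.re ∈ PadicInt.subring p := (mem_OKp.1 hz).1
      have h2 : z.im ∈ PadicInt.subring p := (mem_OKp.1 hz).2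
      have hA : ((cA m : ℤ) : ℚ_[p]) ∈ PadicInt.subring p := intCast_mem _ _
      have hB : ((cB m : ℤ) : ℚ_[p]) ∈ PadicInt.subring p := intCast_mem _ _
      have h3 : (2 : ℚ_[p]) ∈ PadicInt.subring p := ofNat_mem _ 2
      have h4 : (p : ℚ_[p]) ∈ PadicInt.subring p := natCast_mem _ _
      change _ ∈ PadicInt.subring p
      rw [QuadraticAlgebra.norm_def]
      apply_rules [add_mem, sub_mem, mul_mem]
    · rw [QuadraticAlgebra.norm_def, QuadraticAlgebra.norm_def, hx]
      have e1 : (1 + (p : KAlg m ℚ_[p]) * z).re = 1 + p * z.re := by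
        simp [QuadraticAlgebra.re_one]
      have e2 : (1 + (p : KAlg m ℚ_[p]) * z).im = p * z.im := by
        simp [QuadraticAlgebra.im_one]
      rw [e1, e2]
      ring
  obtain ⟨c, hc, hn⟩ := hn
  have hn1 : ‖QuadraticAlgebra.norm x‖ = 1 := by
    rw [hn]
    have : ‖(p : ℚ_[p]) * c‖ < 1 := by
      rw [norm_mul]
      exact mul_lt_one_of_nonneg_of_lt_one_left (norm_nonneg _) Padic.norm_p_lt_one hc
    rw [IsUltrametricDist.norm_add_eq_max_of_norm_ne_norm (by rw [norm_one]; exact this.ne'),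
      norm_one, max_eq_left this.le]
  have hn0 : QuadraticAlgebra.norm x ≠ 0 := by intro h; simp [h] at hn1
  refine ⟨star x * algebraMap _ _ (QuadraticAlgebra.norm x)⁻¹,
    mul_mem (star_mem_OKp hxO) (algebraMap_mem_OKp (by rw [norm_inv, hn1, inv_one])), ?_⟩
  rw [← mul_assoc, mul_star_K, ← map_mul, mul_inv_cancel₀ hn0, map_one]

lemma exists_OKz_approx {p : ℕ} [Fact p.Prime] {x : KAlg m ℚ_[p]} (hx : x ∈ OKp m p) :
    ∃ y ∈ OKz m, ∃ e ∈ OKp m p, x = kMap m ℚ_[p] y + p * e := by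
  obtain ⟨c, e, he, hc⟩ := exists_int_approx (mem_OKp.1 hx).1 1
  obtain ⟨d, f, hf, hd⟩ := exists_int_approx (mem_OKp.1 hx).2 1
  refine ⟨⟨c, d⟩, ⟨c, d, rfl⟩, ⟨e, f⟩, mk_mem_OKp he hf, ?_⟩
  ext
  · simpa using hc
  · simpa using hd

open NumberField in
/-- If the first row of `u` is not unimodular at `p`, then `u` is divisible on the left by a
non-unit of `𝒪_K`, namely a generator of the ideal generated by `p` and approximations of
the entries of this row. -/
lemma exists_divisor (hm : Squarefree m) (hK : NumberField.classNumber (KAlg m ℚ) = 1) {u : BA m ℓ}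
    (hu : ∀ p : Nat.Primes, ((u.2 p : (BAlg m ℓ ℚ_[p])ˣ) : BAlg m ℓ ℚ_[p]) ∈ oLoc m ℓ p)
    {p : Nat.Primes} (hp : ¬ Unimod (u.2 p)) :
    ∃ t : (KAlg m ℚ)ˣ, (t : KAlg m ℚ) ∈ OKz m ∧ QuadraticAlgebra.norm (t : KAlg m ℚ) ≠ 1 ∧
      ∀ q : Nat.Primes, (((tA m ℓ t⁻¹ * u).2 q : (BAlg m ℓ ℚ_[q])ˣ) : BAlg m ℓ ℚ_[q]) ∈
        oLoc m ℓ q := by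
  have hPID := NumberField.classNumber_eq_one_iff.1 hK
  set f := algebraMap (𝓞 (KAlg m ℚ)) (KAlg m ℚ) with hf
  have hrow := mem_oLoc_iff_row.1 (hu p)
  obtain ⟨a, ha, e, he, hae⟩ := exists_OKz_approx (hrow 0)
  obtain ⟨b, hb, e', he', hbe⟩ := exists_OKz_approx (hrow 1)
  obtain ⟨α, hα⟩ := exists_ringOfIntegers ha
  obtain ⟨β, hβ⟩ := exists_ringOfIntegers hb
  -- `π` generates the ideal `(α, β, p)`
  obtain ⟨π, hπ⟩ := (IsPrincipalIdealRing.principal (Ideal.span {α, β, ((p : ℕ) : 𝓞 (KAlg m ℚ))})).1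
  have hmem : ∀ x ∈ ({α, β, ((p : ℕ) : 𝓞 (KAlg m ℚ))} : Set (𝓞 (KAlg m ℚ))), π ∣ x := by
    intro x hx
    rw [← Ideal.mem_span_singleton]
    have := Ideal.subset_span hx
    rwa [hπ] at this
  obtain ⟨α', hα'⟩ := hmem α (by simp)
  obtain ⟨β', hβ'⟩ := hmem β (by simp)
  obtain ⟨γ, hγ⟩ := hmem (p : ℕ) (by simp)
  have hfm := coe_mem_OKz hm (m := m)
  have hp' : f π * f γ = (p : ℕ) := by rw [← map_mul, ← hγ, map_natCast]
  have hpne : ((p : ℕ) : KAlg m ℚ) ≠ 0 := by exact_mod_cast p.2.ne_zero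
  have hπ0 : f π ≠ 0 := left_ne_zero_of_mul (hp'.trans_ne hpne)
  refine ⟨Units.mk0 (f π) hπ0, hfm π, ?_, fun q => ?_⟩
  · intro hn
    apply hp
    have h1 : Ideal.absNorm (Ideal.span {π}) = 1 := by
      have := absNorm_span π
      rw [Units.val_mk0] at hn
      rw [hn] at this
      exact_mod_cast this
    -- if `π` were a unit then `1 = r α + s β + k p`, and the row would be unimodular at `p`
    have h2 : (1 : 𝓞 (KAlg m ℚ)) ∈ Ideal.span {α, β, ((p : ℕ) : 𝓞 (KAlg m ℚ))} := by
      rw [hπ]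
      change 1 ∈ Ideal.span {π}
      rw [Ideal.absNorm_eq_one_iff.1 h1]
      trivial
    rw [Ideal.mem_span_insert] at h2
    obtain ⟨r, z, hz, h2⟩ := h2
    rw [Ideal.mem_span_pair] at hz
    obtain ⟨s, k, hz⟩ := hz
    have h3 : f r * a + f s * b + f k * (p : ℕ) = 1 := by
      rw [← hα, ← hβ, ← map_natCast f, ← map_mul, ← map_mul, ← map_mul, ← map_add, ← map_add,
        ← map_one f, h2, ← hz]
      congr 1; ring
    have h4 := congr_arg (kMap m ℚ_[p]) h3
    simp only [map_add, map_mul, map_one, map_natCast] at h4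
    have hO : ∀ x, kMap m ℚ_[p] (f x) ∈ OKp m p := fun x => kMap_mem_OKp (hfm x) _
    obtain ⟨y, hy, hy1⟩ := isUnit_one_add_mul (p := p)
      (sub_mem (add_mem (mul_mem (hO r) he) (mul_mem (hO s) he')) (hO k))
    refine ⟨kMap m ℚ_[p] (f r) * y, mul_mem (hO r) hy, kMap m ℚ_[p] (f s) * y,
      mul_mem (hO s) hy, ?_⟩
    rw [hae, hbe]
    linear_combination hy1 + y * h4
  · rw [mem_oLoc_iff_row]
    intro k
    rw [tA_mul_row]
    have hu' : (((Units.mk0 (f π) hπ0)⁻¹ : (KAlg m ℚ)ˣ) : KAlg m ℚ) * f π = 1 :=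
      (Units.mk0 (f π) hπ0).inv_mul
    set π' := (((Units.mk0 (f π) hπ0)⁻¹ : (KAlg m ℚ)ˣ) : KAlg m ℚ)
    by_cases hq : p = q
    · subst hq
      have key : ∀ {x : KAlg m ℚ} {y' : 𝓞 (KAlg m ℚ)} {z ε : KAlg m ℚ_[p]}, f (π * y') = x →
          ε ∈ OKp m p → z = kMap m ℚ_[p] x + (p : ℕ) * ε → kMap m ℚ_[p] π' * z ∈ OKp m p := by
        intro x y' z ε hx hε hz
        have h5 : kMap m ℚ_[p] π' * z = kMap m ℚ_[p] (f y') + kMap m ℚ_[p] (f γ) * ε := by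
          have h6 := congr_arg (kMap m ℚ_[p]) hu'
          have h7 := congr_arg (kMap m ℚ_[p]) hp'
          rw [map_mul, map_one] at h6
          rw [map_mul, map_natCast] at h7
          rw [hz, ← hx, map_mul, map_mul, ← h7]
          linear_combination (kMap m ℚ_[p] (f y') + kMap m ℚ_[p] (f γ) * ε) * h6
        rw [h5]
        exact add_mem (kMap_mem_OKp (hfm _) _) (mul_mem (kMap_mem_OKp (hfm _) _) hε)
      fin_cases k
      · exact key (by rw [← hα', hα]) he hae
      · exact key (by rw [← hβ', hβ]) he' hbe
    · refine mul_mem ?_ (mem_oLoc_iff_row.1 (hu q) k)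
      -- away from `p` the divisor `π` of `p` is a unit
      have h8 : kMap m ℚ_[q] π' = kMap m ℚ_[q] (f γ) * algebraMap _ _ ((p : ℕ) : ℚ_[q])⁻¹ := by
        have h6 := congr_arg (kMap m ℚ_[q]) hu'
        have h7 := congr_arg (kMap m ℚ_[q]) hp'
        rw [map_mul, map_one] at h6
        rw [map_mul, map_natCast] at h7
        have h9 : ((p : ℕ) : KAlg m ℚ_[q]) * algebraMap _ _ ((p : ℕ) : ℚ_[q])⁻¹ = 1 := by
          rw [← map_natCast (algebraMap ℚ_[q] (KAlg m ℚ_[q])), ← map_mul, mul_inv_cancel₀,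
            map_one]
          exact_mod_cast p.2.ne_zero
        rw [← h7] at h9
        linear_combination (-kMap m ℚ_[q] π') * h9 +
          (kMap m ℚ_[q] (f γ) * algebraMap _ _ ((p : ℕ) : ℚ_[q])⁻¹) * h6
      rw [h8]
      exact mul_mem (kMap_mem_OKp (hfm _) _)
        (algebraMap_mem_OKp (by rw [norm_inv, norm_prime_eq_one hq, inv_one]))

/-- Division by a maximal left divisor in `𝒪_K`. -/
lemma exists_unimod (hm : Squarefree m) (hK : NumberField.classNumber (KAlg m ℚ) = 1) (M : ℕ) :
    ∀ u : BA m ℓ, (∀ p : Nat.Primes,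
      ((u.2 p : (BAlg m ℓ ℚ_[p])ˣ) : BAlg m ℓ ℚ_[p]) ∈ oLoc m ℓ p ∧
      ‖(M : ℚ_[p])‖ = ‖nrd m ℓ ℚ_[p] ((u.2 p : (BAlg m ℓ ℚ_[p])ˣ) : BAlg m ℓ ℚ_[p])‖) →
    ∃ t : (KAlg m ℚ)ˣ, (t : KAlg m ℚ) ∈ OKz m ∧ ∀ p : Nat.Primes,
      (((tA m ℓ t⁻¹ * u).2 p : (BAlg m ℓ ℚ_[p])ˣ) : BAlg m ℓ ℚ_[p]) ∈ oLoc m ℓ p ∧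
      Unimod ((tA m ℓ t⁻¹ * u).2 p) := by
  induction M using Nat.strong_induction_on with
  | _ M ih =>
    intro u hu
    by_cases hall : ∀ p : Nat.Primes, Unimod (u.2 p)
    · refine ⟨1, one_mem _, fun p => ?_⟩
      rw [inv_one, map_one, one_mul]
      exact ⟨(hu p).1, hall p⟩
    push Not at hall
    obtain ⟨p, hp⟩ := hall
    obtain ⟨t, ht, hN, hint⟩ := exists_divisor hm hK (fun p => (hu p).1) hp
    obtain ⟨N, hNN⟩ := exists_nat_norm ht
    have hM0 : M ≠ 0 := by
      rintro rfl
      have := (hu p).2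
      rw [Nat.cast_zero, norm_zero] at this
      exact nrd_unit_ne_zero _ (norm_eq_zero.1 this.symm)
    have hN0 : N ≠ 0 := by
      rintro rfl
      exact t.ne_zero (eq_zero_of_norm (by simpa using hNN))
    have hN1 : N ≠ 1 := by
      rintro rfl
      exact hN (by simpa using hNN)
    have hmulnorm : ∀ q : Nat.Primes,
        ‖nrd m ℓ ℚ_[q] ((u.2 q : (BAlg m ℓ ℚ_[q])ˣ) : BAlg m ℓ ℚ_[q])‖ =
        ‖(N : ℚ_[q])‖ *
          ‖nrd m ℓ ℚ_[q] (((tA m ℓ t⁻¹ * u).2 q : (BAlg m ℓ ℚ_[q])ˣ) : BAlg m ℓ ℚ_[q])‖ := by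
      intro q
      have h1 : u = tA m ℓ t * (tA m ℓ t⁻¹ * u) := by
        rw [← mul_assoc, ← map_mul, mul_inv_cancel, map_one, one_mul]
      conv_lhs => rw [h1]
      rw [tA_mul_nrd, norm_mul, hNN]
      simp
    -- the norm of `u` drops from `M` to `M' = M / N(t)`
    obtain ⟨M', hM'0, hM'⟩ := exists_nat_of_norms
      (x := fun q : Nat.Primes =>
        nrd m ℓ ℚ_[q] (((tA m ℓ t⁻¹ * u).2 q : (BAlg m ℓ ℚ_[q])ˣ) : BAlg m ℓ ℚ_[q]))
      (fun q => nrd_unit_ne_zero _) (fun q => nrd_norm_le_one (hint q)) (by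
        filter_upwards [(tA m ℓ t⁻¹ * u).2.2] with q hq
        exact (mem_oUnits_iff.1 hq).2)
    have hMM : M = N * M' := by
      refine nat_eq_of_norms hM0 (mul_ne_zero hN0 hM'0) fun q => ?_
      rw [(hu q).2, hmulnorm, Nat.cast_mul, norm_mul, hM']
    have hlt : M' < M := by
      rw [hMM]
      exact lt_mul_of_one_lt_left (Nat.pos_of_ne_zero hM'0) (by omega)
    obtain ⟨t', ht', h'⟩ := ih M' hlt (tA m ℓ t⁻¹ * u) fun q => ⟨hint q, hM' q⟩
    refine ⟨t * t', mul_mem ht ht', ?_⟩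
    rw [mul_inv_rev, map_mul, mul_assoc]
    exact h'

/-- The unimodular integral adelic quaternions come from primitive vectors. -/
lemma exists_primVec {u : BA m ℓ} (hu : ∀ p : Nat.Primes,
      ((u.2 p : (BAlg m ℓ ℚ_[p])ˣ) : BAlg m ℓ ℚ_[p]) ∈ oLoc m ℓ p ∧ Unimod (u.2 p)) :
    ∃ w, PrimVec m ℓ w ∧ GRel w u := by
  obtain ⟨M, hM0, hM⟩ := exists_nat_of_norms
    (x := fun q : Nat.Primes => nrd m ℓ ℚ_[q] ((u.2 q : (BAlg m ℓ ℚ_[q])ˣ) : BAlg m ℓ ℚ_[q]))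
    (fun q => nrd_unit_ne_zero _) (fun q => nrd_norm_le_one (hu q).1) (by
      filter_upwards [u.2.2] with q hq
      exact (mem_oUnits_iff.1 hq).2)
  -- the local `β_p` are glued to a `β = c + d ω ∈ 𝒪_K`, which is only determined modulo `M`
  choose β hβO hβ using fun p : Nat.Primes => (hu p).2.exists_LRel (hu p).1 (hM p).symm
  obtain ⟨c, hc⟩ := exists_int_crt hM0 fun p => (mem_OKp.1 (hβO p)).1
  obtain ⟨d, hd⟩ := exists_int_crt hM0 fun p => (mem_OKp.1 (hβO p)).2
  have hrel : ∀ p : Nat.Primes, LRel (![0, (c : ℚ_[p]), d, M]) (u.2 p) := by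
    intro p
    obtain ⟨e, he, hce⟩ := hc p
    obtain ⟨f, hf, hdf⟩ := hd p
    exact (hβ p).congr rfl he hf (by simpa using hce) (by simpa using hdf)
  have hMq : ∀ q : Nat.Primes, (M : ℚ_[q]) ≠ 0 := fun q => by exact_mod_cast hM0
  -- `k = (ℓ + N(β)) / M` is integral: multiply `ℓ + β β̄` by `1 = r a + s b`
  have hk : ∃ k : ℤ, ((ℓ + (c * c + cB m * c * d - cA m * d * d)) / M : ℚ) = k := by
    refine exists_int_of_norm_le_one fun p => ?_
    obtain ⟨r, hr, s, hs, hrs⟩ := (hu p).2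
    obtain ⟨-, j, hj, hb⟩ := hrel p
    obtain ⟨e00, e01, e10, e11⟩ := LRel.eqs hb
    rw [e00, e01] at hrs
    simp only [Matrix.cons_val] at e10 e11
    set b : KAlg m ℚ_[p] := ⟨(c : ℚ_[p]), (d : ℚ_[p])⟩ with hbdef
    have hreal : ∀ r : ℚ_[p], star (algebraMap ℚ_[p] (KAlg m ℚ_[p]) r) = algebraMap _ _ r :=
      star_mk0
    have hstarℓ : star (ℓ : KAlg m ℚ_[p]) = ℓ := star_natCast _
    have f10 := congr_arg star e10
    have f11 := congr_arg star e11
    simp only [star_add, star_mul, star_neg, star_star, hreal, hstarℓ] at f10 f11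
    set N := algebraMap ℚ_[p] (KAlg m ℚ_[p]) (M : ℚ_[p]) with hN
    have hfac : (ℓ : KAlg m ℚ_[p]) + b * star b = N *
        (r * (star b * j 0 0 - ℓ * star (j 0 1)) + s * (star (j 0 0) + star b * j 0 1)) := by
      calc (ℓ : KAlg m ℚ_[p]) + b * star b =
          (ℓ + b * star b) * (r * j 1 0 + s * j 1 1) := by rw [hrs, mul_one]
        _ = _ := by
          linear_combination (r * ℓ) * f11 + (-s) * f10 - (s * star b) * e11 - (r * star b) * e10
    have hbO : b ∈ OKp m p := mk_mem_OKp (Padic.norm_int_le_one _) (Padic.norm_int_le_one _)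
    have hℓ : (ℓ : KAlg m ℚ_[p]) ∈ OKp m p := natCast_mem _ _
    have hin : (r * (star b * j 0 0 - ℓ * star (j 0 1)) + s * (star (j 0 0) + star b * j 0 1)) ∈
        OKp m p :=
      add_mem (mul_mem hr (sub_mem (mul_mem (star_mem_OKp hbO) (hj 0 0))
        (mul_mem hℓ (star_mem_OKp (hj 0 1)))))
        (mul_mem hs (add_mem (star_mem_OKp (hj 0 0)) (mul_mem (star_mem_OKp hbO) (hj 0 1))))
    set z := (r * (star b * j 0 0 - ℓ * star (j 0 1)) + s * (star (j 0 0) + star b * j 0 1))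
    rw [mul_star_K, hN, QuadraticAlgebra.norm_def] at hfac
    have hre := congr_arg QuadraticAlgebra.re hfac
    simp [QuadraticAlgebra.algebraMap_eq] at hre
    have : (((ℓ + (c * c + cB m * c * d - cA m * d * d)) / M : ℚ) : ℚ_[p]) = z.re := by
      push_cast
      rw [div_eq_iff (hMq p)]
      linear_combination hre
    rw [this]
    exact (mem_OKp.1 hin).1
  obtain ⟨k, hk⟩ := hk
  rw [div_eq_iff (by exact_mod_cast hM0)] at hk
  have hQ : QZ m ![k, c, d, M] = ℓ := by
    have : (QZ m ![k, c, d, (M : ℤ)] : ℚ) = ℓ := by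
      simp [QZ]
      linear_combination -hk
    exact_mod_cast this
  have hG : GRel ![k, c, d, (M : ℤ)] u := fun p =>
    (hrel p).congr (by simp) (c := 0) (d := 0) (by simp) (by simp) (by simp) (by simp)
  have hpos : 0 < (M : ℤ) := by exact_mod_cast Nat.pos_of_ne_zero hM0
  refine ⟨_, ⟨hpos, hQ, exists_BZ_eq_one fun p hp d0 d3 d1 d2 => ?_⟩, hG⟩
  obtain ⟨q, rfl⟩ : ∃ q : Nat.Primes, (q : ℕ) = p := ⟨⟨p, hp⟩, rfl⟩
  exact (hG q).not_dvd hQ hpos.ne' d0 d3 d1 d2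

lemma exists_unimod_of_mem_oLoc (hm : Squarefree m)
    (hK : NumberField.classNumber (KAlg m ℚ) = 1) {u : BA m ℓ}
    (hu : ∀ p : Nat.Primes, ((u.2 p : (BAlg m ℓ ℚ_[p])ˣ) : BAlg m ℓ ℚ_[p]) ∈ oLoc m ℓ p) :
    ∃ t : (KAlg m ℚ)ˣ, (t : KAlg m ℚ) ∈ OKz m ∧ ∀ p : Nat.Primes,
      (((tA m ℓ t⁻¹ * u).2 p : (BAlg m ℓ ℚ_[p])ˣ) : BAlg m ℓ ℚ_[p]) ∈ oLoc m ℓ p ∧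
      Unimod ((tA m ℓ t⁻¹ * u).2 p) := by
  obtain ⟨M, -, hM⟩ := exists_nat_of_norms
    (x := fun q : Nat.Primes => nrd m ℓ ℚ_[q] ((u.2 q : (BAlg m ℓ ℚ_[q])ˣ) : BAlg m ℓ ℚ_[q]))
    (fun q => nrd_unit_ne_zero _) (fun q => nrd_norm_le_one (hu q)) (by
      filter_upwards [u.2.2] with q hq
      exact (mem_oUnits_iff.1 hq).2)
  exact exists_unimod hm hK M u fun p => ⟨hu p, hM p⟩

/-- Multiplication by units of `𝒪_K` preserves unimodularity. -/
lemma unimod_tA_mul {t : (KAlg m ℚ)ˣ} {u : BA m ℓ} {p : Nat.Primes}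
    (ht : (t : KAlg m ℚ) ∈ OKz m) (ht' : ((t⁻¹ : (KAlg m ℚ)ˣ) : KAlg m ℚ) ∈ OKz m)
    (hu : ((u.2 p : (BAlg m ℓ ℚ_[p])ˣ) : BAlg m ℓ ℚ_[p]) ∈ oLoc m ℓ p) (h : Unimod (u.2 p)) :
    (((tA m ℓ t * u).2 p : (BAlg m ℓ ℚ_[p])ˣ) : BAlg m ℓ ℚ_[p]) ∈ oLoc m ℓ p ∧
      Unimod ((tA m ℓ t * u).2 p) := by
  refine ⟨mem_oLoc_iff_row.2 fun k => ?_, ?_⟩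
  · rw [tA_mul_row]
    exact mul_mem (kMap_mem_OKp ht _) (mem_oLoc_iff_row.1 hu k)
  · obtain ⟨r, hr, s, hs, hrs⟩ := h
    have h1 : kMap m ℚ_[p] ((t⁻¹ : (KAlg m ℚ)ˣ) : KAlg m ℚ) * kMap m ℚ_[p] (t : KAlg m ℚ) = 1 := by
      rw [← map_mul, Units.inv_mul, map_one]
    refine ⟨r * kMap m ℚ_[p] ((t⁻¹ : (KAlg m ℚ)ˣ) : KAlg m ℚ), mul_mem hr (kMap_mem_OKp ht' _),
      s * kMap m ℚ_[p] ((t⁻¹ : (KAlg m ℚ)ˣ) : KAlg m ℚ), mul_mem hs (kMap_mem_OKp ht' _), ?_⟩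
    rw [tA_mul_row, tA_mul_row]
    linear_combination (r * bMat m ℓ ℚ_[p] ((u.2 p : (BAlg m ℓ ℚ_[p])ˣ) : BAlg m ℓ ℚ_[p]) 0 0 +
      s * bMat m ℓ ℚ_[p] ((u.2 p : (BAlg m ℓ ℚ_[p])ˣ) : BAlg m ℓ ℚ_[p]) 0 1) * h1 + hrs

end global

/-! ### Classes modulo `d S ℤ²` and primitive vectors -/

section counting
variable {m ℓ : ℕ} [NeZero m]

/-- The set of classes counted by `n(ξ; d)`. -/
def NSet (m ℓ : ℕ) (ξ : Fin 4 → ℚ) (d : ℕ) : Set ((Fin 2 → ℤ) ⧸ dSLattice m d) :=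
  {c | ∃ s : Fin 2 → ℤ, (QuotientAddGroup.mk s : (Fin 2 → ℤ) ⧸ dSLattice m d) = c ∧
      ∃ k : ℤ,
        (1 / 2 : ℚ) * level m * SinvForm m s - (-(ℓ : ℚ) * level m) = (level m : ℚ) * d * k ∧
        ∃ g, InGammaHatPlus m g ∧
          ![(k : ℚ), SinvVec m s 0, SinvVec m s 1, (d : ℚ)] = g.1.mulVec ξ}

lemma nRep_eq (ξ : Fin 4 → ℚ) (d : ℕ) : nRep m ℓ ξ d = Nat.card (NSet m ℓ ξ d) := rfl

/-- The class of `S β` modulo `d S ℤ²` for a vector `(k, β, n)`. -/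
def betaClass (m d : ℕ) (w : Fin 4 → ℤ) : (Fin 2 → ℤ) ⧸ dSLattice m d :=
  QuotientAddGroup.mk ((Smat m).mulVec ![w 1, w 2])

lemma det_Smat_ne_zero : (Smat m).det ≠ 0 := by
  have := disc_lt m
  rw [Smat_eq, Matrix.det_fin_two_of]
  intro h
  nlinarith

lemma Smat_mulVec_injective {x y : Fin 2 → ℤ} (h : (Smat m).mulVec x = (Smat m).mulVec y) :
    x = y := by
  have := Matrix.eq_zero_of_mulVec_eq_zero (det_Smat_ne_zero (m := m)) (v := x - y)
    (by rw [Matrix.mulVec_sub, h, sub_self])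
  exact sub_eq_zero.1 this

/-- The classes modulo `d S ℤ²` of the vectors `S β` are the residue classes of `β` modulo `d`. -/
lemma betaClass_eq_iff {d : ℕ} {w w' : Fin 4 → ℤ} : betaClass m d w = betaClass m d w' ↔
    ∃ c e : ℤ, w' 1 = w 1 + d * c ∧ w' 2 = w 2 + d * e := by
  rw [betaClass, betaClass, QuotientAddGroup.eq]
  constructor
  · rintro ⟨z, hz⟩
    have h1 : (Smat m).mulVec ((d : ℤ) • z) = (Smat m).mulVec (![w' 1, w' 2] - ![w 1, w 2]) := by
      rw [Matrix.mulVec_smul, ← Matrix.smul_mulVec, Matrix.mulVec_sub, sub_eq_neg_add]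
      exact hz
    have h2 := Smat_mulVec_injective h1
    have e0 := congr_fun h2 0
    have e1 := congr_fun h2 1
    simp at e0 e1
    exact ⟨z 0, z 1, by linarith, by linarith⟩
  · rintro ⟨c, e, h1, h2⟩
    refine ⟨![c, e], ?_⟩
    change ((d : ℤ) • Smat m).mulVec ![c, e] = _
    rw [← sub_eq_neg_add, ← Matrix.mulVec_sub, Matrix.smul_mulVec, ← Matrix.mulVec_smul]
    congr 1
    ext i
    fin_cases i
    · simp [h1]
    · simp [h2]

lemma SmatQ_det : IsUnit ((Smat m).map (Int.cast : ℤ → ℚ)).det := by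
  have h := Int.cast_det (R := ℚ) (Smat m)
  rw [isUnit_iff_ne_zero, ← h]
  exact_mod_cast det_Smat_ne_zero

lemma map_mulVec_intCast (x : Fin 2 → ℤ) :
    ((Smat m).map (Int.cast : ℤ → ℚ)).mulVec (fun j => (x j : ℚ)) =
      fun j => (((Smat m).mulVec x j : ℤ) : ℚ) := by
  ext j
  simp [Matrix.mulVec, dotProduct]

lemma SinvVec_mulVec (x : Fin 2 → ℤ) : SinvVec m ((Smat m).mulVec x) = fun j => (x j : ℚ) := by
  rw [SinvVec, ← map_mulVec_intCast, Matrix.mulVec_mulVec, Matrix.nonsing_inv_mul _ SmatQ_det,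
    Matrix.one_mulVec]

lemma eq_mulVec_of_SinvVec {s x : Fin 2 → ℤ} (h : SinvVec m s = fun j => (x j : ℚ)) :
    (Smat m).mulVec x = s := by
  have h1 : ((Smat m).map (Int.cast : ℤ → ℚ)).mulVec (SinvVec m s) = fun j => (s j : ℚ) := by
    rw [SinvVec, Matrix.mulVec_mulVec, Matrix.mul_nonsing_inv _ SmatQ_det, Matrix.one_mulVec]
  rw [h, map_mulVec_intCast] at h1
  ext j
  exact_mod_cast congr_fun h1 j

/-- A class counted by `n(ξ; d)` is the class of `β` for a vector `(k, β, d)` in the orbit of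
`ξ`. -/
lemma exists_primVec_of_mem_NSet (hm : Squarefree m) {ξ : Fin 4 → ℚ} (hξ : ξ ∈ solSet m ℓ) {d : ℕ}
    (hd : d ≠ 0) {c : (Fin 2 → ℤ) ⧸ dSLattice m d} (hc : c ∈ NSet m ℓ ξ d) :
    ∃ w, PrimVec m ℓ w ∧ w 3 = d ∧ (∃ γ, InGammaHat m γ ∧ (fun j => (w j : ℚ)) = γ.1.mulVec ξ) ∧
      betaClass m d w = c := by
  obtain ⟨s, rfl, k, -, g, hg, hx⟩ := hc
  have h1 := hg.1.mem_solSet hm hξ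
  obtain ⟨w, hw, hQ, hy⟩ := (mem_solSet_iff hm).1 h1
  have hw' := hx.trans hw
  have e1 := congr_fun hw' 1
  have e2 := congr_fun hw' 2
  have e3 := congr_fun hw' 3
  simp only [Matrix.cons_val] at e1 e2 e3
  have e3' : w 3 = d := by exact_mod_cast e3.symm
  refine ⟨w, ⟨by rw [e3']; exact_mod_cast Nat.pos_of_ne_zero hd, hQ, hy⟩, e3',
    ⟨g, hg.1, hw.symm⟩, ?_⟩
  rw [betaClass, eq_mulVec_of_SinvVec (s := s)]
  ext j
  fin_cases j
  · exact e1
  · exact e2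

/-- The converse of `exists_primVec_of_mem_NSet`. -/
lemma betaClass_mem_NSet {ξ : Fin 4 → ℚ} (h0 : 0 < ξ 0) (hQ : 0 < phi0 m ℚ ξ ξ)
    {w : Fin 4 → ℤ} (hw : PrimVec m ℓ w) {d : ℕ} (hd : w 3 = d)
    {γ : Matrix.SpecialLinearGroup (Fin 4) ℚ} (hγ : InGammaHat m γ)
    (hwγ : (fun j => (w j : ℚ)) = γ.1.mulVec ξ) : betaClass m d w ∈ NSet m ℓ ξ d := by
  have hQ' : 0 < Q0 m ℚ ξ := hQ
  have hℓ : (ℓ : ℚ) = Q0 m ℚ ξ := by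
    rw [← SO0_Q0 hγ.1 ξ, ← hwγ, Q0_intCast, hw.2.1]; simp
  have hQZ := hw.2.1
  rw [QZ] at hQZ
  -- `w` stays in the cone, because `w 0 * w 3 = ℓ + N(β)` is positive
  have hw0 : 0 < w 0 := by
    have h1 : (0 : ℤ) ≤ w 1 ^ 2 + cB m * w 1 * w 2 - cA m * w 2 ^ 2 := by
      have := disc_lt m
      nlinarith [sq_nonneg (2 * w 1 + cB m * w 2), sq_nonneg (w 2)]
    have h2 : (0 : ℤ) < ℓ := by
      rw [← hℓ] at hQ'; exact_mod_cast hQ'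
    have h3 : 0 < w 0 * w 3 := by linarith
    exact pos_of_mul_pos_left h3 hw.1.le
  refine ⟨_, rfl, w 0, ?_, γ, hγ.plus h0 hQ' ?_, ?_⟩
  · rw [SinvForm, SinvVec_mulVec]
    have h1 : (fun j => (((Smat m).mulVec ![w 1, w 2] j : ℤ) : ℚ)) ⬝ᵥ
        (fun j => ((![w 1, w 2] j : ℤ) : ℚ)) =
        2 * (w 1 ^ 2 + cB m * w 1 * w 2 - cA m * w 2 ^ 2) := by
      rw [Smat_eq]
      simp [Matrix.mulVec, dotProduct, Fin.sum_univ_two]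
      ring
    rw [h1]
    have h2 : (w 0 : ℚ) * w 3 - (w 1 ^ 2 + cB m * w 1 * w 2 - cA m * w 2 ^ 2) = ℓ := by
      exact_mod_cast hQZ
    have h3 : (w 3 : ℚ) = d := by exact_mod_cast hd
    rw [h3] at h2
    linear_combination (-(level m : ℚ)) * h2
  · rw [← hwγ]
    change (0 : ℚ) < (w 0 : ℚ)
    exact_mod_cast hw0
  · rw [← hwγ, SinvVec_mulVec]
    ext j
    fin_cases j
    · rfl
    · rfl
    · rfl
    · simp [hd]

/-- The integers `0 ≤ x, y < d` with `d ∣ N(x + y ω) + ℓ`. -/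
def boxSet (m ℓ d : ℕ) : Finset (ℕ × ℕ) :=
  (Finset.range d ×ˢ Finset.range d).filter fun z =>
    (d : ℤ) ∣ (z.1 : ℤ) ^ 2 + cB m * z.1 * z.2 - cA m * (z.2 : ℤ) ^ 2 + ℓ

/-- A class is determined by the residues of `β` modulo `d`, and `ℓ + N(β) = k d`. -/
lemma exists_injective_NSet (hm : Squarefree m) {ξ : Fin 4 → ℚ} (hξ : ξ ∈ solSet m ℓ) {d : ℕ}
    (hd : d ≠ 0) : ∃ f : NSet m ℓ ξ d → boxSet m ℓ d, Function.Injective f := by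
  choose w hw h3 _ hc using fun c : NSet m ℓ ξ d => exists_primVec_of_mem_NSet hm hξ hd c.2
  have hd0 : (d : ℤ) ≠ 0 := by exact_mod_cast hd
  have hmod : ∀ x : ℤ, (((x % d).toNat : ℕ) : ℤ) = x - d * (x / d) := fun x => by
    rw [Int.toNat_of_nonneg (Int.emod_nonneg _ hd0)]
    have := Int.emod_add_mul_ediv x d
    linarith
  have hlt : ∀ x : ℤ, (x % d).toNat < d := fun x => by
    have h1 := Int.emod_lt_of_pos x (by positivity : (0 : ℤ) < d)
    have h2 := Int.emod_nonneg x hd0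
    omega
  refine ⟨fun c => ⟨((w c 1 % d).toNat, (w c 2 % d).toNat), ?_⟩, fun c c' h => ?_⟩
  · rw [boxSet, Finset.mem_filter, Finset.mem_product, Finset.mem_range, Finset.mem_range]
    refine ⟨⟨hlt _, hlt _⟩, ?_⟩
    have h1 := (hw c).2.1
    rw [QZ, h3] at h1
    rw [hmod, hmod, ← h1]
    set p := w c 1 / d
    set q := w c 2 / d
    refine ⟨w c 0 - 2 * w c 1 * p + d * p ^ 2 + cB m * (-w c 1 * q - p * w c 2 + d * p * q)
      - cA m * (-2 * w c 2 * q + d * q ^ 2), ?_⟩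
    ring
  · rw [Subtype.mk.injEq, Prod.mk.injEq] at h
    have e1 := congr_arg (Nat.cast : ℕ → ℤ) h.1
    have e2 := congr_arg (Nat.cast : ℕ → ℤ) h.2
    rw [hmod, hmod] at e1 e2
    apply Subtype.ext
    rw [← hc c, ← hc c', betaClass_eq_iff]
    exact ⟨w c' 1 / d - w c 1 / d, w c' 2 / d - w c 2 / d, by linarith, by linarith⟩

lemma finite_NSet (hm : Squarefree m) {ξ : Fin 4 → ℚ} (hξ : ξ ∈ solSet m ℓ) {d : ℕ}
    (hd : d ≠ 0) : Finite (NSet m ℓ ξ d) :=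
  let ⟨_, hf⟩ := exists_injective_NSet hm hξ hd
  Finite.of_injective _ hf

lemma nRep_le_card_boxSet (hm : Squarefree m) {ξ : Fin 4 → ℚ} (hξ : ξ ∈ solSet m ℓ) {d : ℕ}
    (hd : d ≠ 0) : nRep m ℓ ξ d ≤ (boxSet m ℓ d).card := by
  obtain ⟨f, hf⟩ := exists_injective_NSet hm hξ hd
  rw [nRep_eq]
  simpa using Nat.card_le_card_of_injective f hf

end counting

/-! ### Convergence -/

/-- The divisor bound `d(n) = O(n^ε)`. -/
lemma exists_card_divisors_le {ε : ℝ} (hε : 0 < ε) :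
    ∃ A : ℝ, 0 < A ∧ ∀ n : ℕ, n ≠ 0 → (n.divisors.card : ℝ) ≤ A * (n : ℝ) ^ ε := by
  -- `v + 1 ≤ K p^(ε v)` for all primes `p`, and `K` is only needed for `p < B`,
  -- where `2^(1/ε) ≤ B`
  obtain ⟨B, hB⟩ := exists_nat_ge ((2 : ℝ) ^ (1 / ε))
  have hlog : 0 < Real.log 2 := Real.log_pos one_lt_two
  set K : ℝ := 1 + 1 / (ε * Real.log 2) with hK
  have hK1 : 1 ≤ K := le_add_of_nonneg_right (by positivity)
  -- if `p ≥ B` then `p^ε ≥ 2`; for small `p` the Bernoulli inequality gives `K`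
  have hbound : ∀ p v : ℕ, p.Prime →
      ((v + 1 : ℕ) : ℝ) ≤ (if p < B then K else 1) * ((p : ℝ) ^ v) ^ ε := by
    intro p v hp
    have hp2 : (2 : ℝ) ≤ p := by exact_mod_cast hp.two_le
    have hpow : ((p : ℝ) ^ v) ^ ε = ((p : ℝ) ^ ε) ^ v := by
      rw [← Real.rpow_natCast, ← Real.rpow_natCast, ← Real.rpow_mul (by linarith),
        ← Real.rpow_mul (by linarith), mul_comm]
    rw [hpow]
    split_ifs with h
    · have h1 : 1 + v * (ε * Real.log 2) ≤ ((p : ℝ) ^ ε) ^ v := by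
        have h2 : ((2 : ℝ) ^ ε) ^ v ≤ ((p : ℝ) ^ ε) ^ v := by gcongr
        refine le_trans ?_ h2
        have h3 := one_add_mul_le_pow (a := (2 : ℝ) ^ ε - 1)
          (by have : (0 : ℝ) < (2 : ℝ) ^ ε := by positivity
              linarith) v
        rw [add_sub_cancel] at h3
        refine le_trans ?_ h3
        have h4 : ε * Real.log 2 ≤ (2 : ℝ) ^ ε - 1 := by
          rw [Real.rpow_def_of_pos two_pos, mul_comm]
          linarith [Real.add_one_le_exp (Real.log 2 * ε)]
        gcongr
      have h5 : (1 : ℝ) + v ≤ K * (1 + v * (ε * Real.log 2)) := by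
        rw [hK]
        have h6 : (1 / (ε * Real.log 2)) * (v * (ε * Real.log 2)) = v := by field_simp
        have h7 : 0 ≤ v * (ε * Real.log 2) := by positivity
        have h8 : 0 ≤ 1 / (ε * Real.log 2) := by positivity
        nlinarith
      push_cast
      calc (v : ℝ) + 1 = 1 + v := add_comm _ _
        _ ≤ _ := h5
        _ ≤ _ := by gcongr
    · have h1 : (2 : ℝ) ≤ (p : ℝ) ^ ε := by
        have h2 : ((2 : ℝ) ^ (1 / ε)) ^ ε ≤ (p : ℝ) ^ ε := by
          have h3 : (2 : ℝ) ^ (1 / ε) ≤ p := hB.trans (by exact_mod_cast not_lt.1 h)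
          gcongr
        rwa [← Real.rpow_mul two_pos.le, one_div_mul_cancel hε.ne', Real.rpow_one] at h2
      rw [one_mul]
      calc ((v + 1 : ℕ) : ℝ) ≤ ((2 ^ v : ℕ) : ℝ) := by exact_mod_cast Nat.lt_two_pow_self
        _ = (2 : ℝ) ^ v := by push_cast; rfl
        _ ≤ _ := by gcongr
  refine ⟨K ^ B, by positivity, fun n hn => ?_⟩
  rw [Nat.card_divisors hn]
  push_cast
  have hn' : (n : ℝ) ^ ε = ∏ p ∈ n.primeFactors, ((p : ℝ) ^ n.factorization p) ^ ε := by
    rw [Real.finsetProd_rpow _ _ fun p _ => by positivity]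
    congr 1
    have := Nat.prod_factorization_pow_eq_self hn
    conv_lhs => rw [← this]
    rw [Finsupp.prod, Nat.support_factorization]
    push_cast
    rfl
  calc ∏ p ∈ n.primeFactors, ((n.factorization p : ℝ) + 1)
      ≤ ∏ p ∈ n.primeFactors, ((if p < B then K else 1) * ((p : ℝ) ^ n.factorization p) ^ ε) :=
        Finset.prod_le_prod (fun p _ => by positivity) fun p hp => by
          have := hbound p (n.factorization p) (Nat.prime_of_mem_primeFactors hp)
          push_cast at this
          exact this
    _ = (∏ p ∈ n.primeFactors, if p < B then K else 1) * (n : ℝ) ^ ε := by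
        rw [Finset.prod_mul_distrib, hn']
    _ ≤ K ^ B * (n : ℝ) ^ ε := by
        gcongr
        rw [Finset.prod_ite, Finset.prod_const, Finset.prod_const_one, mul_one]
        refine pow_le_pow_right₀ hK1 ?_
        calc _ ≤ (Finset.range B).card := Finset.card_le_card fun p hp => by
              simpa using (Finset.mem_filter.1 hp).2
          _ = B := Finset.card_range B

section series
variable {m ℓ : ℕ} [NeZero m]

/-- The pairs counted by `boxSet` for `d ≤ n` are divisors `d` of the positive integers
`N(x + y ω) + ℓ = O(n²)` with `0 ≤ x, y < n`, so the divisor bound applies. -/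
lemma sum_card_boxSet_le (hℓ : 0 < ℓ) {ε : ℝ} (hε : 0 < ε) :
    ∃ A : ℝ, 0 < A ∧ ∀ n : ℕ, n ≠ 0 →
      ∑ d ∈ Finset.Icc 1 n, ((boxSet m ℓ d).card : ℝ) ≤ A * (n : ℝ) ^ (2 + 2 * ε) := by
  obtain ⟨A, hA, hdiv⟩ := exists_card_divisors_le hε
  set F : ℕ × ℕ → ℤ := fun z =>
    (z.1 : ℤ) ^ 2 + cB m * z.1 * z.2 - cA m * (z.2 : ℤ) ^ 2 + ℓ with hF
  set M : ℕ := 1 + (cB m).natAbs + (cA m).natAbs + ℓ with hM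
  have hFpos : ∀ z, 0 < F z := by
    intro z
    have := disc_lt m
    have h2 : (0 : ℤ) < ℓ := by exact_mod_cast hℓ
    simp only [hF]
    nlinarith [sq_nonneg (2 * (z.1 : ℤ) + cB m * z.2), sq_nonneg (z.2 : ℤ)]
  have hFle : ∀ n : ℕ, n ≠ 0 → ∀ z ∈ Finset.range n ×ˢ Finset.range n,
      F z ≤ (M : ℤ) * n ^ 2 := by
    intro n hn z hz
    rw [Finset.mem_product, Finset.mem_range, Finset.mem_range] at hz
    obtain ⟨x, y⟩ := z
    have hx : (x : ℤ) ≤ n := by exact_mod_cast hz.1.le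
    have hy : (y : ℤ) ≤ n := by exact_mod_cast hz.2.le
    have hx0 : (0 : ℤ) ≤ x := by positivity
    have hy0 : (0 : ℤ) ≤ y := by positivity
    have hn1 : (1 : ℤ) ≤ n := by exact_mod_cast Nat.one_le_iff_ne_zero.2 hn
    have hxx : (x : ℤ) ^ 2 ≤ n ^ 2 := by gcongr
    have hyy : (y : ℤ) ^ 2 ≤ n ^ 2 := by gcongr
    have hxy : (x : ℤ) * y ≤ n ^ 2 := by rw [pow_two]; gcongr
    have hb : cB m * x * y ≤ |cB m| * n ^ 2 := by
      rw [mul_assoc]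
      exact mul_le_mul (le_abs_self _) hxy (by positivity) (abs_nonneg _)
    have ha : -cA m * (y : ℤ) ^ 2 ≤ |cA m| * n ^ 2 :=
      mul_le_mul (neg_le_abs _) hyy (by positivity) (abs_nonneg _)
    have hl : (ℓ : ℤ) ≤ ℓ * n ^ 2 := le_mul_of_one_le_right (by positivity) (one_le_pow₀ hn1)
    simp only [hF, hM]
    push_cast
    linarith
  refine ⟨A * (M : ℝ) ^ ε, by positivity, fun n hn => ?_⟩
  have hnat : ∑ d ∈ Finset.Icc 1 n, (boxSet m ℓ d).card ≤
      ∑ z ∈ Finset.range n ×ˢ Finset.range n, (F z).natAbs.divisors.card := by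
    calc ∑ d ∈ Finset.Icc 1 n, (boxSet m ℓ d).card
        ≤ ∑ d ∈ Finset.Icc 1 n, ∑ z ∈ Finset.range n ×ˢ Finset.range n,
            if (d : ℤ) ∣ F z then 1 else 0 := by
          refine Finset.sum_le_sum fun d hd => ?_
          rw [← Finset.card_filter]
          refine Finset.card_le_card fun z hz => ?_
          rw [boxSet, Finset.mem_filter, Finset.mem_product, Finset.mem_range,
            Finset.mem_range] at hz
          rw [Finset.mem_filter, Finset.mem_product, Finset.mem_range, Finset.mem_range]
          have := (Finset.mem_Icc.1 hd).2
          exact ⟨⟨hz.1.1.trans_le this, hz.1.2.trans_le this⟩, hz.2⟩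
      _ = ∑ z ∈ Finset.range n ×ˢ Finset.range n, ∑ d ∈ Finset.Icc 1 n,
            if (d : ℤ) ∣ F z then 1 else 0 := Finset.sum_comm
      _ ≤ _ := by
          refine Finset.sum_le_sum fun z _ => ?_
          rw [← Finset.card_filter]
          refine Finset.card_le_card fun d hd => ?_
          rw [Nat.mem_divisors]
          exact ⟨Int.natCast_dvd.1 (Finset.mem_filter.1 hd).2,
            Int.natAbs_ne_zero.2 (hFpos z).ne'⟩
  calc ∑ d ∈ Finset.Icc 1 n, ((boxSet m ℓ d).card : ℝ)
      ≤ ∑ z ∈ Finset.range n ×ˢ Finset.range n, ((F z).natAbs.divisors.card : ℝ) := by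
        exact_mod_cast hnat
    _ ≤ ∑ z ∈ Finset.range n ×ˢ Finset.range n, A * ((M : ℝ) * (n : ℝ) ^ 2) ^ ε := by
        refine Finset.sum_le_sum fun z hz => ?_
        refine (hdiv _ (Int.natAbs_ne_zero.2 (hFpos z).ne')).trans ?_
        have h1 : ((F z).natAbs : ℝ) ≤ (M : ℝ) * (n : ℝ) ^ 2 := by
          have h2 : ((F z).natAbs : ℤ) ≤ (M : ℤ) * n ^ 2 := by
            rw [Int.natAbs_of_nonneg (hFpos z).le]
            exact hFle n hn z hz
          exact_mod_cast h2
        gcongr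
    _ = A * (M : ℝ) ^ ε * (n : ℝ) ^ (2 + 2 * ε) := by
        rw [Finset.sum_const, Finset.card_product, Finset.card_range, nsmul_eq_mul,
          Real.mul_rpow (by positivity) (by positivity),
          Real.rpow_add (by positivity), Real.rpow_mul (by positivity)]
        push_cast
        rw [show (n : ℝ) ^ (2 : ℝ) = (n : ℝ) ^ 2 by exact_mod_cast Real.rpow_natCast (n : ℝ) 2]
        ring

lemma lSeriesSummable_coeffXi (hm : Squarefree m) (hℓ : 0 < ℓ) (P : Finset ℕ) {ξ : Fin 4 → ℚ}
    (hξ : ξ ∈ solSet m ℓ) {s : ℂ} (hs : 2 < s.re) : LSeriesSummable (coeffXi m ℓ P ξ) s := by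
  set ε := (s.re - 2) / 4 with hε
  have hε0 : 0 < ε := by rw [hε]; linarith
  obtain ⟨A, hA, h⟩ := sum_card_boxSet_le (m := m) hℓ hε0
  refine LSeriesSummable_of_sum_norm_bigO (r := 2 + 2 * ε) ?_ (by positivity)
    (by rw [hε]; linarith)
  refine Asymptotics.IsBigO.of_bound A ?_
  filter_upwards [Filter.eventually_ne_atTop 0] with n hn
  rw [Real.norm_of_nonneg (Finset.sum_nonneg fun _ _ => norm_nonneg _),
    Real.norm_of_nonneg (by positivity)]
  refine le_trans (Finset.sum_le_sum fun d hd => ?_) (h n hn)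
  have hd0 : d ≠ 0 := by have := (Finset.mem_Icc.1 hd).1; omega
  rw [coeffXi]
  split_ifs
  · rw [Complex.norm_natCast]
    exact_mod_cast nRep_le_card_boxSet hm hξ hd0
  · rw [norm_zero]; positivity

open NumberField in
lemma lSeriesSummable_coeffK (P : Finset ℕ) {s : ℂ} (hs : 1 < s.re) :
    LSeriesSummable (coeffK m P) s := by
  refine LSeriesSummable_of_sum_norm_bigO (r := 1) ?_ zero_le_one hs
  have h1 : (fun n : ℕ => ∑ k ∈ Finset.Icc 1 n,
      (Nat.card {I : Ideal (𝓞 (KAlg m ℚ)) // Ideal.absNorm I = k} : ℝ)) =O[Filter.atTop]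
        fun n : ℕ => (n : ℝ) ^ (1 : ℝ) := by
    simp only [Real.rpow_one]
    refine Asymptotics.isBigO_of_div_tendsto_nhds ?_ _
      (((NumberField.Ideal.tendsto_norm_le_div_atTop₀ (KAlg m ℚ)).comp
        tendsto_natCast_atTop_atTop).congr fun n ↦ ?_)
    · filter_upwards [Filter.eventually_ne_atTop 0] with n hn h
      exact absurd (by exact_mod_cast h) hn
    · simp only [Function.comp_apply, Nat.cast_le, ← Nat.cast_sum, Pi.div_apply]
      congr
      rw [← add_left_inj 1, ← Ideal.card_norm_le_eq_card_norm_le_add_one,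
        show Finset.Icc 1 n = Finset.Ioc 0 n from Finset.Icc_succ_left_eq_Ioc _ _,
        show 1 = Nat.card {I : Ideal (𝓞 (KAlg m ℚ)) // Ideal.absNorm I = 0} by
          simp [Ideal.absNorm_eq_zero_iff],
        Finset.sum_Ioc_add_eq_sum_Icc (n.zero_le),
        ← Finset.card_preimage_eq_sum_card_image_eq
          (fun k _ ↦ Ideal.finite_setOfPred_absNorm_eq k)]
      simp [Set.coe_eq_subtype]
  refine (Asymptotics.IsBigO.of_norm_le fun n => ?_).trans h1
  rw [Real.norm_of_nonneg (Finset.sum_nonneg fun _ _ => norm_nonneg _)]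
  refine Finset.sum_le_sum fun d _ => ?_
  rw [coeffK]
  split_ifs
  · rw [Complex.norm_natCast]
  · rw [norm_zero]; positivity

end series

/-- A Dirichlet series whose coefficients count finite sets, as a sum over their disjoint union. -/
lemma hasSum_sigma_of_lSeriesSummable {D : ℕ → Prop} {F : ℕ → Type*}
    (hF : ∀ n, n ≠ 0 → Finite (F n))
    {f : ℕ → ℂ} (hf : ∀ n, D n → f n = Nat.card (F n)) (hf0 : ∀ n, ¬ D n → f n = 0) {s : ℂ}
    (h : LSeriesSummable f s) :
    Summable (fun x : Σ n : {n : ℕ // n ≠ 0 ∧ D n}, F n => ‖((x.1 : ℕ) : ℂ) ^ (-s)‖) ∧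
    HasSum (fun x : Σ n : {n : ℕ // n ≠ 0 ∧ D n}, F n => ((x.1 : ℕ) : ℂ) ^ (-s)) (LSeries f s) := by
  have hfin : ∀ n : {n : ℕ // n ≠ 0 ∧ D n}, Finite (F n) := fun n => hF n n.2.1
  have hterm : ∀ n : {n : ℕ // n ≠ 0 ∧ D n},
      LSeries.term f s n = Nat.card (F n) * ((n : ℕ) : ℂ) ^ (-s) := by
    intro n
    rw [LSeries.term_of_ne_zero n.2.1, hf _ n.2.2, Complex.cpow_neg, div_eq_mul_inv]
  have hsum : HasSum (fun n : {n : ℕ // n ≠ 0 ∧ D n} => LSeries.term f s n) (LSeries f s) := by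
    refine (hasSum_subtype_iff_of_support_subset (s := {n : ℕ | n ≠ 0 ∧ D n}) ?_).2 h.hasSum
    intro n hn
    rw [Function.mem_support] at hn
    by_contra hc
    rw [Set.mem_ofPred_eq, not_and_or, not_not] at hc
    rcases hc with rfl | hD
    · exact hn (LSeries.term_zero f s)
    · refine hn ?_
      by_cases h0 : n = 0
      · rw [h0, LSeries.term_zero]
      · rw [LSeries.term_of_ne_zero h0, hf0 n hD, zero_div]
  have hnorm : Summable (fun x : Σ n : {n : ℕ // n ≠ 0 ∧ D n}, F n =>
      ‖((x.1 : ℕ) : ℂ) ^ (-s)‖) := by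
    rw [summable_sigma_of_nonneg fun _ => norm_nonneg _]
    refine ⟨fun n => Summable.of_finite, ?_⟩
    refine hsum.summable.norm.congr fun n => ?_
    have := Fintype.ofFinite (F n)
    rw [hterm, norm_mul, Complex.norm_natCast, tsum_fintype, Nat.card_eq_fintype_card]
    simp
  refine ⟨hnorm, HasSum.sigma_of_hasSum hsum (fun n => ?_) (Summable.of_norm hnorm)⟩
  have := Fintype.ofFinite (F n)
  have h2 := hasSum_fintype (fun _ : F n => ((n : ℕ) : ℂ) ^ (-s))
  rw [Finset.sum_const, nsmul_eq_mul, Finset.card_univ, ← Nat.card_eq_fintype_card, ← hterm] at h2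
  exact h2

/-! ### Parametrisation of the integral classes -/

section param
variable {m ℓ : ℕ} [NeZero m]

/-- The adelic quaternions which are integral, and units at the primes in `𝒫`. -/
def intSet (m ℓ : ℕ) (P : Finset ℕ) : Set (BA m ℓ) :=
  {y | ∀ p : Nat.Primes,
    ((p : ℕ) ∉ P → (y.2 p : BAlg m ℓ ℚ_[p]) ∈ oLoc m ℓ p) ∧
    ((p : ℕ) ∈ P → y.2 p ∈ oUnits m ℓ p)}

/-- The norm `∏_p |nrd(y_p)|_p⁻¹`. -/
def nrdNorm (y : BA m ℓ) : ℝ :=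
  ∏ᶠ p : Nat.Primes, ‖nrd m ℓ ℚ_[p] ((y.2 p : (BAlg m ℓ ℚ_[p])ˣ) : BAlg m ℓ ℚ_[p])‖⁻¹

lemma intSet_oLoc {P : Finset ℕ} {y : BA m ℓ} (h : y ∈ intSet m ℓ P) (p : Nat.Primes) :
    (y.2 p : BAlg m ℓ ℚ_[p]) ∈ oLoc m ℓ p := by
  by_cases hp : (p : ℕ) ∈ P
  · exact (mem_oUnits_iff.1 ((h p).2 hp)).1
  · exact (h p).1 hp

/-- The integers prime to `𝒫`. -/
def PrimeTo (P : Finset ℕ) (n : ℕ) : Prop := ∀ p ∈ P, n.Coprime p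

/-- The nonzero ideals of `𝒪_K` with norm prime to `𝒫`, together with their norms. -/
abbrev IdealIdx (m : ℕ) [NeZero m] (P : Finset ℕ) : Type :=
  Σ n : {n : ℕ // n ≠ 0 ∧ PrimeTo P n},
    {I : Ideal (NumberField.RingOfIntegers (KAlg m ℚ)) // Ideal.absNorm I = n}

/-- The pairs of an integer `d ≥ 1` prime to `𝒫` and of a class counted by `n(ξ; d)`. -/
abbrev RepIdx (m ℓ : ℕ) (P : Finset ℕ) (ξ : Fin 4 → ℚ) : Type :=
  Σ d : {d : ℕ // d ≠ 0 ∧ PrimeTo P d}, NSet m ℓ ξ d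

lemma GRel.norm_nrd {w : Fin 4 → ℤ} {u : BA m ℓ} (h : GRel w u) (p : Nat.Primes) :
    ‖nrd m ℓ ℚ_[p] ((u.2 p : (BAlg m ℓ ℚ_[p])ˣ) : BAlg m ℓ ℚ_[p])‖ = ‖(w 3 : ℚ_[p])‖ :=
  (h p).1

lemma idx_ext {P : Finset ℕ} {h₁ : ℕ} {ξ : Fin h₁ → Fin 4 → ℚ}
    {x x' : Σ i : Fin h₁, IdealIdx m P × RepIdx m ℓ P (ξ i)} {v v' : Fin 4 → ℤ}
    (hi : x.1 = x'.1) (hII : x.2.1.2.1 = x'.2.1.2.1) (hd : (x.2.2.1 : ℕ) = x'.2.2.1)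
    (hv : betaClass m x.2.2.1 v = x.2.2.2) (hv' : betaClass m x'.2.2.1 v' = x'.2.2.2)
    (hvv : betaClass m x.2.2.1 v = betaClass m x.2.2.1 v') : x = x' := by
  obtain ⟨i, ⟨⟨n, hn⟩, ⟨I, hI⟩⟩, ⟨⟨d, hd0⟩, ⟨k, hk⟩⟩⟩ := x
  obtain ⟨i', ⟨⟨n', hn'⟩, ⟨I', hI'⟩⟩, ⟨⟨d', hd0'⟩, ⟨k', hk'⟩⟩⟩ := x'
  dsimp only at *
  subst hi
  subst hII
  subst hd
  subst hv
  have hnn : n = n' := hI.symm.trans hI'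
  subst hnn
  have hkk : k' = betaClass m d v := by rw [hvv, hv']
  subst hkk
  rfl

open NumberField in
/-- A choice of generators of the nonzero ideals of `𝒪_K`. -/
lemma exists_generator (hK : NumberField.classNumber (KAlg m ℚ) = 1) :
    ∃ gen : Ideal (𝓞 (KAlg m ℚ)) → (KAlg m ℚ)ˣ, ∀ I, Ideal.absNorm I ≠ 0 →
      ∃ y : 𝓞 (KAlg m ℚ), algebraMap (𝓞 (KAlg m ℚ)) (KAlg m ℚ) y = gen I ∧ I = Ideal.span {y} := by
  have hPID := NumberField.classNumber_eq_one_iff.1 hK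
  have h : ∀ I : Ideal (𝓞 (KAlg m ℚ)), ∃ t : (KAlg m ℚ)ˣ, Ideal.absNorm I ≠ 0 →
      ∃ y : 𝓞 (KAlg m ℚ), algebraMap (𝓞 (KAlg m ℚ)) (KAlg m ℚ) y = t ∧ I = Ideal.span {y} := by
    intro I
    by_cases hI : Ideal.absNorm I = 0
    · exact ⟨1, fun h => absurd hI h⟩
    obtain ⟨y, hy⟩ := (IsPrincipalIdealRing.principal I).1
    have hy' : I = Ideal.span {y} := hy
    have hy0 : algebraMap (𝓞 (KAlg m ℚ)) (KAlg m ℚ) y ≠ 0 := by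
      intro h
      have h1 := absNorm_span y
      rw [h, QuadraticAlgebra.norm_zero, ← hy'] at h1
      exact hI (by exact_mod_cast h1)
    exact ⟨Units.mk0 _ hy0, fun _ => ⟨y, rfl, hy'⟩⟩
  choose gen hgen using h
  exact ⟨gen, hgen⟩

lemma norm_eq_one_iff_coprime {p : ℕ} [hp : Fact p.Prime] {n : ℕ} :
    ‖(n : ℚ_[p])‖ = 1 ↔ n.Coprime p := by
  rw [Padic.norm_natCast_eq_one_iff, Nat.coprime_comm]

lemma norm_mul_eq_one {a b : ℝ} (ha : 0 ≤ a) (hb : 0 ≤ b) (ha1 : a ≤ 1) (hb1 : b ≤ 1)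
    (h : a * b = 1) : a = 1 ∧ b = 1 := by
  constructor <;> nlinarith

open NumberField in
/-- The cosets `yX` of integral elements correspond to triples consisting of an ideal of `𝒪_K`, an
index `i`, and a class counted by `n(ξ_i; d)`. -/
lemma exists_parametrization (hm : Squarefree m)
    (hK : NumberField.classNumber (KAlg m ℚ) = 1)
    (P : Finset ℕ) (hP : ∀ p ∈ P, p.Prime)
    {h₁ : ℕ} {ξ : Fin h₁ → Fin 4 → ℚ} (hξ : IsRepSystem m ℓ ξ)
    {ζ : Fin h₁ → GWA m ℓ} (hζ : ∀ i, IsKappa m ℓ (ζ i) (ξ i)) :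
    ∃ F : (Σ i : Fin h₁, IdealIdx m P × RepIdx m ℓ P (ξ i)) → BA m ℓ,
      (∀ x, F x ∈ intSet m ℓ P) ∧
      (∀ x x', (F x)⁻¹ * F x' ∈ X m ℓ → x = x') ∧
      (∀ y ∈ intSet m ℓ P, ∃ x, (F x)⁻¹ * y ∈ X m ℓ) ∧
      (∀ x, nrdNorm (F x) = ((x.2.1.1 * x.2.2.1 : ℕ) : ℝ)) ∧
      ∀ x, TauEquiv m ℓ (HC m ℓ) (ζ x.1) (psiA hm (F x)) := by
  obtain ⟨gen, hgen⟩ := exists_generator hK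
  have hdata : ∀ i, ∀ z : RepIdx m ℓ P (ξ i), ∃ w, PrimVec m ℓ w ∧ w 3 = z.1 ∧
      (∃ γ, InGammaHat m γ ∧ (fun j => (w j : ℚ)) = γ.1.mulVec (ξ i)) ∧
      betaClass m z.1 w = z.2 ∧ ∃ u : BA m ℓ, GRel w u := by
    intro i z
    obtain ⟨w, hw, h3, hγ, hc⟩ := exists_primVec_of_mem_NSet hm (hξ.1 i).1 z.1.2.1 z.2.2
    exact ⟨w, hw, h3, hγ, hc, hw.exists_GRel⟩
  -- each class counted by `n(ξ_i; d)` gives a vector `w`, and `w` gives a quaternion `u`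
  choose w hw hw3 hwγ hwc u hu using hdata
  have hfOK := coe_mem_OKz hm (m := m)
  have hgen0 : ∀ z : IdealIdx m P, Ideal.absNorm z.2.1 ≠ 0 := fun z => by
    rw [z.2.2]; exact z.1.2.1
  have hgenO : ∀ z : IdealIdx m P, (gen z.2.1 : KAlg m ℚ) ∈ OKz m := fun z => by
    obtain ⟨y, hy, -⟩ := hgen _ (hgen0 z)
    rw [← hy]; exact hfOK y
  have hgenN : ∀ z : IdealIdx m P, QuadraticAlgebra.norm (gen z.2.1 : KAlg m ℚ) = (z.1 : ℕ) := by
    intro z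
    obtain ⟨y, hy, hI⟩ := hgen _ (hgen0 z)
    rw [← hy, ← absNorm_span, ← hI, z.2.2]
  set F : (Σ i : Fin h₁, IdealIdx m P × RepIdx m ℓ P (ξ i)) → BA m ℓ :=
    fun x => tA m ℓ (gen x.2.1.2.1) * u x.1 x.2.2 with hF
  have hFO : ∀ x, ∀ p : Nat.Primes, ((F x).2 p : BAlg m ℓ ℚ_[p]) ∈ oLoc m ℓ p := by
    intro x p
    rw [mem_oLoc_iff_row]
    intro k
    rw [hF, tA_mul_row]
    exact mul_mem (kMap_mem_OKp (hgenO _) _) (mem_oLoc_iff_row.1 ((hu x.1 x.2.2).mem_oLoc p) k)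
  have hFN : ∀ x, ∀ p : Nat.Primes, ‖nrd m ℓ ℚ_[p] ((F x).2 p : BAlg m ℓ ℚ_[p])‖ =
      ‖((x.2.1.1 * x.2.2.1 : ℕ) : ℚ_[p])‖ := by
    intro x p
    rw [hF, tA_mul_nrd, norm_mul, hgenN, (hu x.1 x.2.2).norm_nrd, hw3]
    push_cast
    rw [norm_mul]
  refine ⟨F, fun x p => ⟨fun _ => hFO x p, fun hp => ?_⟩, fun x x' h => ?_, fun y hy => ?_,
    fun x => ?_, fun x => ?_⟩
  · rw [mem_oUnits_iff, hFN, norm_eq_one_iff_coprime]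
    exact ⟨hFO x p, Nat.Coprime.mul_left (x.2.1.1.2.2 p hp) (x.2.2.1.2.2 p hp)⟩
  -- two triples with the same coset: the scalars generate the same ideal
  · set χ := (F x)⁻¹ * F x' with hχ
    have h1 : tA m ℓ (gen x.2.1.2.1) * (u x.1 x.2.2 * χ) =
        tA m ℓ (gen x'.2.1.2.1) * u x'.1 x'.2.2 := by
      rw [← mul_assoc]
      exact mul_inv_cancel_left (F x) (F x')
    have hG : GRel (w x.1 x.2.2) (u x.1 x.2.2 * χ) := (hu _ _).mul h
    have hG' := hu x'.1 x'.2.2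
    have hpos := (hw x.1 x.2.2).1
    have hpos' := (hw x'.1 x'.2.2).1
    have i1 := inv_mul_mem_OKz h1 hG.mem_oLoc (hG'.unimod hpos')
    have i2 := inv_mul_mem_OKz h1.symm hG'.mem_oLoc (hG.unimod hpos)
    have hII : x.2.1.2.1 = x'.2.1.2.1 := by
      obtain ⟨y, hy, hI⟩ := hgen _ (hgen0 x.2.1)
      obtain ⟨y', hy', hI'⟩ := hgen _ (hgen0 x'.2.1)
      obtain ⟨a, ha⟩ := exists_ringOfIntegers i1
      obtain ⟨b, hb⟩ := exists_ringOfIntegers i2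
      have e1 : y' = y * a := by
        apply RingOfIntegers.coe_injective
        rw [map_mul, ha, hy, hy', ← Units.val_mul, mul_inv_cancel_left]
      have e2 : y = y' * b := by
        apply RingOfIntegers.coe_injective
        rw [map_mul, hb, hy, hy', ← Units.val_mul, mul_inv_cancel_left]
      rw [hI, hI']
      exact le_antisymm (Ideal.span_singleton_le_span_singleton.2 ⟨b, e2⟩)
        (Ideal.span_singleton_le_span_singleton.2 ⟨a, e1⟩)
    rw [hII] at h1
    -- now the vectors differ by a translation, which lies in `Γ̂`
    rw [mul_left_cancel h1] at hG
    obtain ⟨e3, c, e, hc, he⟩ := hG.eq_mod hG' hpos hpos'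
    obtain ⟨g, hg, hgw⟩ := exists_inGammaHat_translation e3 hpos.ne' hc he
      ((hw x'.1 x'.2.2).2.1.trans (hw x.1 x.2.2).2.1.symm)
    obtain ⟨γ, hγ, hwγ1⟩ := hwγ x.1 x.2.2
    obtain ⟨γ', hγ', hwγ2⟩ := hwγ x'.1 x'.2.2
    have hi : x.1 = x'.1 := by
      have hsol : (fun j => (w x'.1 x'.2.2 j : ℚ)) ∈ solSet m ℓ :=
        (mem_solSet_iff hm).2 ⟨_, rfl, (hw x'.1 x'.2.2).2⟩
      refine (hξ.2 _ hsol).unique ⟨g * γ, hg.mul hγ, ?_⟩ ⟨γ', hγ', hwγ2⟩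
      rw [Matrix.SpecialLinearGroup.coe_mul, ← Matrix.mulVec_mulVec, ← hwγ1, hgw]
    have hd : ((x'.2.2.1 : ℕ) : ℤ) = x.2.2.1 := by rw [← hw3, ← hw3, e3]
    have hd' : (x.2.2.1 : ℕ) = x'.2.2.1 := by exact_mod_cast hd.symm
    rw [hw3] at hc he
    have hcc : betaClass m x.2.2.1 (w x.1 x.2.2) = betaClass m x.2.2.1 (w x'.1 x'.2.2) :=
      betaClass_eq_iff.2 ⟨c, e, hc, he⟩
    exact idx_ext hi hII hd' (hwc _ _) (hwc _ _) hcc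
  -- an integral `y` is `t` times a unimodular element; `t` may be changed by a unit to `gen I`
  · obtain ⟨t, ht, htu⟩ := exists_unimod_of_mem_oLoc hm hK (intSet_oLoc hy)
    obtain ⟨a, ha⟩ := exists_ringOfIntegers ht
    set I : Ideal (𝓞 (KAlg m ℚ)) := Ideal.span {a} with hIdef
    have hIN : ((Ideal.absNorm I : ℕ) : ℚ) = QuadraticAlgebra.norm (t : KAlg m ℚ) := by
      rw [hIdef, absNorm_span, ha]
    have hI0 : Ideal.absNorm I ≠ 0 := by
      intro h0
      rw [h0, Nat.cast_zero] at hIN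
      exact t.ne_zero (eq_zero_of_norm hIN.symm)
    obtain ⟨b, hb, hIb⟩ := hgen I hI0
    have hspan : Ideal.span {a} = Ideal.span {b} := hIb
    obtain ⟨e, he⟩ := Ideal.span_singleton_le_span_singleton.1 hspan.le
    obtain ⟨e', he'⟩ := Ideal.span_singleton_le_span_singleton.1 hspan.ge
    have o1 : (((gen I)⁻¹ * t : (KAlg m ℚ)ˣ) : KAlg m ℚ) ∈ OKz m := by
      have : (((gen I)⁻¹ * t : (KAlg m ℚ)ˣ) : KAlg m ℚ) = algebraMap (𝓞 (KAlg m ℚ)) _ e := by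
        rw [Units.val_mul, ← ha, he, map_mul, hb, Units.inv_mul_cancel_left]
      rw [this]; exact hfOK e
    have o2 : ((((gen I)⁻¹ * t)⁻¹ : (KAlg m ℚ)ˣ) : KAlg m ℚ) ∈ OKz m := by
      have : ((((gen I)⁻¹ * t)⁻¹ : (KAlg m ℚ)ˣ) : KAlg m ℚ) = algebraMap (𝓞 (KAlg m ℚ)) _ e' := by
        rw [mul_inv_rev, inv_inv, Units.val_mul, ← hb, he', map_mul, ha, Units.inv_mul_cancel_left]
      rw [this]; exact hfOK e'
    have hy' : tA m ℓ ((gen I)⁻¹ * t) * (tA m ℓ t⁻¹ * y) = tA m ℓ (gen I)⁻¹ * y := by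
      rw [← mul_assoc, ← map_mul, mul_inv_cancel_right]
    have hv := fun p => unimod_tA_mul o1 o2 (htu p).1 (htu p).2
    rw [hy'] at hv
    obtain ⟨v, hvp, hvG⟩ := exists_primVec hv
    obtain ⟨i, ⟨γ, hγ, hvγ⟩, -⟩ := hξ.2 (fun j => (v j : ℚ)) ((mem_solSet_iff hm).2 ⟨v, rfl, hvp.2⟩)
    obtain ⟨d, hd⟩ := Int.eq_ofNat_of_zero_le hvp.1.le
    have hd' : v 3 = d := hd
    have hd0 : d ≠ 0 := by
      rintro rfl
      exact hvp.1.ne' hd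
    have hnorm : ∀ p : Nat.Primes, ‖nrd m ℓ ℚ_[p] (y.2 p : BAlg m ℓ ℚ_[p])‖ =
        ‖((Ideal.absNorm I : ℕ) : ℚ_[p])‖ * ‖(d : ℚ_[p])‖ := by
      intro p
      have h1 : y = tA m ℓ (gen I) * (tA m ℓ (gen I)⁻¹ * y) := by
        rw [← mul_assoc, ← map_mul, mul_inv_cancel, map_one, one_mul]
      conv_lhs => rw [h1]
      rw [tA_mul_nrd, norm_mul, hvG.norm_nrd, hd', ← hb, ← absNorm_span, ← hIb]
      simp
    -- the local norms of `y` are units at the primes of `𝒫`, and both factors are integral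
    have hcop : PrimeTo P (Ideal.absNorm I) ∧ PrimeTo P d := by
      have h1 : ∀ p ∈ P, (Ideal.absNorm I).Coprime p ∧ d.Coprime p := by
        intro p hp
        obtain ⟨q, rfl⟩ : ∃ q : Nat.Primes, (q : ℕ) = p := ⟨⟨p, hP p hp⟩, rfl⟩
        have h2 := (mem_oUnits_iff.1 ((hy q).2 hp)).2
        rw [hnorm] at h2
        have h3 := norm_mul_eq_one (norm_nonneg _) (norm_nonneg _)
          (by simpa using Padic.norm_int_le_one (p := q) (Ideal.absNorm I : ℕ))
          (by simpa using Padic.norm_int_le_one (p := q) (d : ℕ)) h2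
        exact ⟨norm_eq_one_iff_coprime.1 h3.1, norm_eq_one_iff_coprime.1 h3.2⟩
      exact ⟨fun p hp => (h1 p hp).1, fun p hp => (h1 p hp).2⟩
    have hcl := betaClass_mem_NSet (hξ.1 i).2.1 (hξ.1 i).2.2 hvp hd' hγ hvγ
    set z : RepIdx m ℓ P (ξ i) := ⟨⟨d, hd0, hcop.2⟩, ⟨betaClass m d v, hcl⟩⟩ with hz
    refine ⟨⟨i, ⟨⟨Ideal.absNorm I, hI0, hcop.1⟩, ⟨I, rfl⟩⟩, z⟩, ?_⟩
    obtain ⟨c, e, hc, he⟩ := betaClass_eq_iff.1 (hwc i z).symm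
    have hG : GRel (w i z) (tA m ℓ (gen I)⁻¹ * y) :=
      hvG.congr (by rw [hw3, hd']) (by rw [hc, hd']) (by rw [he, hd'])
    have h5 := (hu i z).inv_mul_mem hG (hw i z).1
    rw [hF]
    simp only
    rw [mul_inv_rev, mul_assoc, ← map_inv]
    exact h5
  · rw [nrdNorm, finprod_congr fun p => by rw [hFN x p]]
    exact finprod_norm_inv (mul_ne_zero x.2.1.1.2.1 x.2.2.1.2.1)
  · obtain ⟨γ, hγ, hwγ1⟩ := hwγ x.1 x.2.2
    have h3 : w x.1 x.2.2 3 ≠ 0 := (hw x.1 x.2.2).1.ne'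
    refine tauEquiv_of_isKappa hm (by rw [Q0_intCast, (hw x.1 x.2.2).2.1]; simp)
      (by exact_mod_cast h3) hγ hwγ1 (hζ x.1)
      (Units.map (kB m ℓ ℚ : KAlg m ℚ →* BAlg m ℓ ℚ) (gen x.2.1.2.1)) fun p => ?_
    obtain ⟨j, r, hj, hdet, hr, hb⟩ := (hu x.1 x.2.2 p).exists_det (by exact_mod_cast h3)
    refine ⟨j, r, hj, hdet, hr, ?_⟩
    rw [hF]
    simp only
    rw [BA_mul_snd, Units.val_mul, bMat_mul, hb, ← Matrix.mul_assoc]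
    simp only [Rat.cast_intCast]
    rfl

end param

/-! ### Summation over the classes -/

/-- Reindexing of a sum over the image of a set in `G ⧸ E` along a family of representatives. -/
lemma hasSum_image_mk {G ι : Type*} [Group G] (E : Subgroup G) {F : ι → G} {S : Set G}
    {f : G → ℂ} (hf : ∀ g, ∀ e ∈ E, f (g * e) = f g)
    (hinj : ∀ x x', (F x)⁻¹ * F x' ∈ E → x = x') (hmem : ∀ x, F x ∈ S)
    (hsurj : ∀ y ∈ S, ∃ x, (F x)⁻¹ * y ∈ E) {A : ℂ} (h : HasSum (fun x => f (F x)) A) :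
    HasSum (fun c : ((fun y => (QuotientGroup.mk y : G ⧸ E)) '' S : Set (G ⧸ E)) =>
      f (c : G ⧸ E).out) A := by
  set e : ι → ((fun y => (QuotientGroup.mk y : G ⧸ E)) '' S : Set (G ⧸ E)) :=
    fun x => ⟨QuotientGroup.mk (F x), F x, hmem x, rfl⟩ with he
  have hbij : Function.Bijective e := by
    constructor
    · intro x x' hx
      exact hinj x x' (QuotientGroup.eq.1 (Subtype.ext_iff.1 hx))
    · rintro ⟨_, y, hy, rfl⟩
      obtain ⟨x, hx⟩ := hsurj y hy
      exact ⟨x, Subtype.ext (QuotientGroup.eq.2 hx)⟩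
  rw [← (Equiv.ofBijective e hbij).hasSum_iff]
  refine h.congr_fun ?_
  intro x
  obtain ⟨a, ha⟩ := QuotientGroup.mk_out_eq_mul E (F x)
  change f (QuotientGroup.mk (F x) : G ⧸ E).out = f (F x)
  rw [ha, hf _ _ a.2]

lemma hasSum_mul_of_summable_norm {ι κ : Type*} {f : ι → ℂ} {g : κ → ℂ} {a b : ℂ}
    (hf : Summable fun x => ‖f x‖) (hg : Summable fun x => ‖g x‖) (ha : HasSum f a)
    (hb : HasSum g b) : HasSum (fun x : ι × κ => f x.1 * g x.2) (a * b) :=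
  ha.mul hb (summable_mul_of_summable_norm hf hg)

section main
variable {m ℓ : ℕ} [NeZero m]

lemma nrdNorm_mul {y x : BA m ℓ} (hx : x ∈ X m ℓ) : nrdNorm (y * x) = nrdNorm y := by
  refine finprod_congr fun p => ?_
  rw [BA_mul_snd, Units.val_mul, nrd_mul, norm_mul, (mem_oUnits_iff.1 (hx p)).2, mul_one]

lemma normNu_psiA (hm : Squarefree m) (y : BA m ℓ) : normNu m ℓ (psiA hm y) = nrdNorm y := by
  refine finprod_congr fun p => ?_
  rw [psiA_snd, (isRep_PsiU (y.2 p)).nu (det_bMat _)]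

lemma psiA_mem_Yset_iff (hm : Squarefree m) {P : Finset ℕ} {y : BA m ℓ} :
    psiA hm y ∈ Yset m ℓ P ↔ y ∈ intSet m ℓ P := by
  refine forall_congr' fun p => and_congr ?_ ?_
  · rw [psiA_snd, PsiU_coe, Psi_mem_Sloc_iff]
  · rw [psiA_snd, PsiU_mem_J_iff hm]

lemma tauEquiv_mul_of_mem_X (hm : Squarefree m) {y x : BA m ℓ} (hx : x ∈ X m ℓ) :
    TauEquiv m ℓ (HC m ℓ) (psiA hm y) (psiA hm (y * x)) := by
  rw [tauEquiv_psiA_iff]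
  exact ⟨1, one_mem _, tauA hm x, fun p => tauB_mem_C_of_mem_oUnits hm (hx p),
    by rw [tauA_mul, one_mul]⟩

/-- The sum of the products `ζ̂_{ξ_i, 𝒫}(s)` over the indices in `I`, as a sum over ideals, indices
and classes. -/
lemma hasSum_zetaHat (hm : Squarefree m) (hℓ : 0 < ℓ) (P : Finset ℕ) {h₁ : ℕ}
    {ξ : Fin h₁ → Fin 4 → ℚ} (hξ : ∀ i, ξ i ∈ solSet m ℓ) {s : ℂ} (hs : 2 < s.re)
    (I : Fin h₁ → Prop) :
    HasSum (fun x : Σ i : {i // I i}, IdealIdx m P × RepIdx m ℓ P (ξ i) =>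
      ((((x.2.1.1 * x.2.2.1 : ℕ) : ℝ) : ℂ)) ^ (-s))
      (∑ᶠ (i : Fin h₁) (_ : I i), zetaHat m ℓ P (ξ i) s) := by
  classical
  have hKK : Summable (fun x : IdealIdx m P => ‖((x.1 : ℕ) : ℂ) ^ (-s)‖) ∧
      HasSum (fun x : IdealIdx m P => ((x.1 : ℕ) : ℂ) ^ (-s)) (LSeries (coeffK m P) s) :=
    hasSum_sigma_of_lSeriesSummable
      (fun n _ => (Ideal.finite_setOfPred_absNorm_eq n).to_subtype)
      (fun n hn => if_pos hn) (fun n hn => if_neg hn) (lSeriesSummable_coeffK P (by linarith))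
  have hX : ∀ i, Summable (fun x : RepIdx m ℓ P (ξ i) => ‖((x.1 : ℕ) : ℂ) ^ (-s)‖) ∧
      HasSum (fun x : RepIdx m ℓ P (ξ i) => ((x.1 : ℕ) : ℂ) ^ (-s))
        (LSeries (coeffXi m ℓ P (ξ i)) s) := fun i =>
    hasSum_sigma_of_lSeriesSummable (fun n hn => finite_NSet hm (hξ i) hn)
      (fun n hn => if_pos hn) (fun n hn => if_neg hn) (lSeriesSummable_coeffXi hm hℓ P (hξ i) hs)
  have hterm : ∀ (i : Fin h₁) (x : IdealIdx m P × RepIdx m ℓ P (ξ i)),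
      ((((x.1.1 * x.2.1 : ℕ) : ℝ) : ℂ)) ^ (-s) =
        (((x.1.1 : ℕ) : ℂ)) ^ (-s) * (((x.2.1 : ℕ) : ℂ)) ^ (-s) := by
    intro i x
    rw [← Complex.natCast_mul_natCast_cpow]
    push_cast
    rfl
  have hi : ∀ i : Fin h₁, HasSum (fun x : IdealIdx m P × RepIdx m ℓ P (ξ i) =>
      ((((x.1.1 * x.2.1 : ℕ) : ℝ) : ℂ)) ^ (-s)) (zetaHat m ℓ P (ξ i) s) := by
    intro i
    have h1 := hasSum_mul_of_summable_norm hKK.1 (hX i).1 hKK.2 (hX i).2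
    have h2 : (fun x : IdealIdx m P × RepIdx m ℓ P (ξ i) =>
        ((((x.1.1 * x.2.1 : ℕ) : ℝ) : ℂ)) ^ (-s)) = fun x =>
        (((x.1.1 : ℕ) : ℂ)) ^ (-s) * (((x.2.1 : ℕ) : ℂ)) ^ (-s) := funext (hterm i)
    rw [h2]
    exact h1
  have hn : ∀ i : Fin h₁, Summable (fun x : IdealIdx m P × RepIdx m ℓ P (ξ i) =>
      ‖((((x.1.1 * x.2.1 : ℕ) : ℝ) : ℂ)) ^ (-s)‖) := fun i => (hi i).summable.norm
  have hsum : (∑ᶠ (i : Fin h₁) (_ : I i), zetaHat m ℓ P (ξ i) s) =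
      ∑ i : {i // I i}, zetaHat m ℓ P (ξ i) s := by
    rw [← finsum_eq_sum_of_fintype, ← finsum_subtype_eq_finsum_cond]
  rw [hsum]
  refine HasSum.sigma_of_hasSum (hasSum_fintype _) (fun i => hi i) (Summable.of_norm ?_)
  rw [summable_sigma_of_nonneg fun _ => norm_nonneg _]
  exact ⟨fun i => hn i, Summable.of_finite⟩

/-- The sum over the classes `τ(y) ∈ H(ξ)_ℚ τ(a) E`. -/
lemma hasSum_modJ_Ya (hm : Squarefree m) (hℓ : 0 < ℓ)
    (hK : NumberField.classNumber (KAlg m ℚ) = 1)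
    (P : Finset ℕ) (hP : ∀ p ∈ P, p.Prime)
    {h₁ : ℕ} {ξ : Fin h₁ → Fin 4 → ℚ} (hξ : IsRepSystem m ℓ ξ)
    {ζ : Fin h₁ → GWA m ℓ} (hζ : ∀ i, IsKappa m ℓ (ζ i) (ξ i)) {s : ℂ} (hs : 2 < s.re)
    {E : Subgroup (HA m ℓ)} (hE : HC m ℓ ≤ E) (a : GWA m ℓ) :
    HasSum (fun c : modJ m ℓ (Ya m ℓ P E a) => termY m ℓ s c)
      (∑ᶠ (i : Fin h₁) (_ : TauEquiv m ℓ E a (ζ i)), zetaHat m ℓ P (ξ i) s) ∧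
    HasSum (fun c : modX m ℓ {y | psiA hm y ∈ Ya m ℓ P E a} => termB m ℓ s c)
      (∑ᶠ (i : Fin h₁) (_ : TauEquiv m ℓ E a (ζ i)), zetaHat m ℓ P (ξ i) s) := by
  obtain ⟨F, hF, hinj, hsurj, hN, hτ⟩ := exists_parametrization hm hK P hP hξ hζ
  have hsum := hasSum_zetaHat hm hℓ P (fun i => (hξ.1 i).1) hs fun i => TauEquiv m ℓ E a (ζ i)
  set F' : (Σ i : {i // TauEquiv m ℓ E a (ζ i)}, IdealIdx m P × RepIdx m ℓ P (ξ i)) → BA m ℓ :=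
    fun x => F ⟨x.1, x.2⟩ with hF'
  have hinj' : ∀ x x', (F' x)⁻¹ * F' x' ∈ X m ℓ → x = x' := by
    rintro ⟨⟨i, hi⟩, x⟩ ⟨⟨i', hi'⟩, x'⟩ h
    have h1 := hinj _ _ h
    rw [Sigma.mk.injEq] at h1
    obtain ⟨rfl, h2⟩ := h1
    obtain rfl := eq_of_heq h2
    rfl
  have hmem : ∀ x, psiA hm (F' x) ∈ Ya m ℓ P E a := fun x =>
    ⟨(psiA_mem_Yset_iff hm).2 (hF _), x.1.2.trans hm ((hτ ⟨x.1, x.2⟩).mono hE)⟩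
  have hsurj' : ∀ y, psiA hm y ∈ Ya m ℓ P E a → ∃ x, (F' x)⁻¹ * y ∈ X m ℓ := by
    rintro y ⟨hy, hya⟩
    obtain ⟨⟨i, x⟩, hx⟩ := hsurj y ((psiA_mem_Yset_iff hm).1 hy)
    refine ⟨⟨⟨i, hya.trans hm ?_⟩, x⟩, hx⟩
    have h1 := tauEquiv_mul_of_mem_X hm hx (y := F ⟨i, x⟩)
    rw [mul_inv_cancel_left] at h1
    exact (((hτ ⟨i, x⟩).trans hm h1).mono hE).symm
  constructor
  · refine hasSum_image_mk (calJ m ℓ) (F := fun x => psiA hm (F' x))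
      (f := fun y => ((normNu m ℓ y : ℝ) : ℂ) ^ (-s)) ?_ ?_ hmem ?_ ?_
    · intro g e he
      obtain ⟨g, rfl⟩ := (psiA hm).surjective g
      obtain ⟨e, rfl⟩ := (psiA hm).surjective e
      rw [← map_mul, normNu_psiA, normNu_psiA, nrdNorm_mul ((psiA_mem_calJ_iff hm).1 he)]
    · intro x x' h
      rw [← map_inv, ← map_mul, psiA_mem_calJ_iff] at h
      exact hinj' x x' h
    · intro y hy
      obtain ⟨y, rfl⟩ := (psiA hm).surjective y
      obtain ⟨x, hx⟩ := hsurj' y hy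
      exact ⟨x, by rwa [← map_inv, ← map_mul, psiA_mem_calJ_iff]⟩
    · refine hsum.congr_fun fun x => ?_
      rw [normNu_psiA, hN]
  · refine hasSum_image_mk (X m ℓ) (F := F') (f := fun y => ((nrdNorm y : ℝ) : ℂ) ^ (-s)) ?_
      hinj' hmem hsurj' ?_
    · intro g e he
      rw [nrdNorm_mul he]
    · refine hsum.congr_fun fun x => ?_
      rw [hN]

end main

end HermZeta

end

theorem mainTheorem4 (m ℓ : ℕ) [NeZero m] (hm : Squarefree m) (hℓ : 0 < ℓ)
    (hK : NumberField.classNumber (HermZeta.KAlg m ℚ) = 1)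
    (P : Finset ℕ) (hP : ∀ p ∈ P, p.Prime)
    (h₁ : ℕ) (ξ : Fin h₁ → Fin 4 → ℚ) (hξ : HermZeta.IsRepSystem m ℓ ξ)
    (ζ : Fin h₁ → HermZeta.GWA m ℓ) (hζ : ∀ i, HermZeta.IsKappa m ℓ (ζ i) (ξ i))
    (u : Fin h₁ → HermZeta.BA m ℓ) (hu : ∀ i, HermZeta.IsXi m ℓ (ζ i) (u i))
    (s : ℂ) (hs : 2 < s.re) :
    LSeriesSummable (HermZeta.coeffK m P) s ∧
    (∀ i, LSeriesSummable (HermZeta.coeffXi m ℓ P (ξ i)) s) ∧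
    (∀ (w : HermZeta.TypeSet m ℓ) (a : HermZeta.GWA m ℓ) (b : HermZeta.BA m ℓ),
      HermZeta.IsXi m ℓ a b → HermZeta.rho m ℓ b = w →
      HasSum
        (fun c : HermZeta.modJ m ℓ (HermZeta.Ya m ℓ P (HermZeta.HD m ℓ) a) =>
          HermZeta.termY m ℓ s c)
        (∑ᶠ (i : Fin h₁) (_ : HermZeta.rho m ℓ (u i) = w), HermZeta.zetaHat m ℓ P (ξ i) s) ∧
      HasSum
        (fun c : HermZeta.modX m ℓ (HermZeta.YB m ℓ P w) => HermZeta.termB m ℓ s c)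
        (∑ᶠ (i : Fin h₁) (_ : HermZeta.rho m ℓ (u i) = w), HermZeta.zetaHat m ℓ P (ξ i) s)) ∧
    (∀ a : HermZeta.GWA m ℓ,
      HasSum
        (fun c : HermZeta.modJ m ℓ (HermZeta.Ya m ℓ P (HermZeta.HC m ℓ) a) =>
          HermZeta.termY m ℓ s c)
        (∑ᶠ (i : Fin h₁) (_ : HermZeta.TauEquiv m ℓ (HermZeta.HC m ℓ) a (ζ i)),
          HermZeta.zetaHat m ℓ P (ξ i) s)) := by
  open HermZeta in
  refine ⟨lSeriesSummable_coeffK P (by linarith),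
    fun i => lSeriesSummable_coeffXi hm hℓ P (hξ.1 i).1 hs, ?_,
    fun a => (hasSum_modJ_Ya hm hℓ hK P hP hξ hζ hs le_rfl a).1⟩
  rintro w a b hab rfl
  obtain rfl := (isXi_iff hm).1 hab
  have hcond : ∀ i, TauEquiv m ℓ (HD m ℓ) (psiA hm b) (ζ i) ↔ rho m ℓ (u i) = rho m ℓ b := by
    intro i
    rw [← (isXi_iff hm).1 (hu i), ← rho_eq_iff_tauEquiv hm hℓ exists_tauB_of_mem_H, eq_comm]
  have hset : {y | psiA hm y ∈ Ya m ℓ P (HD m ℓ) (psiA hm b)} = YB m ℓ P (rho m ℓ b) := by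
    ext y
    change psiA hm y ∈ Yset m ℓ P ∧ TauEquiv m ℓ (HD m ℓ) (psiA hm b) (psiA hm y) ↔
      rho m ℓ y = rho m ℓ b ∧ y ∈ intSet m ℓ P
    rw [psiA_mem_Yset_iff, ← rho_eq_iff_tauEquiv hm hℓ exists_tauB_of_mem_H, and_comm, eq_comm]
  have h := hasSum_modJ_Ya hm hℓ hK P hP hξ hζ hs HC_le_HD (psiA hm b)
  simp only [hcond] at h
  exact ⟨h.1, hset ▸ h.2⟩
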